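/- Let $n\ge 1$, let $p$ be a point of the round unit sphere $\mathbb S^n$, and let $\Omega\subset\mathbb S^n$ be a domain with smooth boundary that contains $p$, is star-shaped with respect to $p$ (with every point it contains the geodesic segment joining $p$ to it), and is contained in the open hemisphere $B(p,\pi/2)$, where $B(p,r)$ denotes the open geodesic ball of radius $r$ about $p$. Let $\nu$ be the outward unit normal to $\partial\Omega$, let $\partial_r$ be the radial unit vector field centred at $p$, and let $\theta(q)\in[0,\pi]$ be the angle between $\nu(q)$ and $\partial_r(q)$ for $q\in\partial\Omega$. Suppose that $\theta(q)\le\alpha<\pi/2$ for all $q\in\partial\Omega$. For a unit vector $u\in T_p\mathbb S^n$ put $R_u=\sup\{t\in[0,\pi):\exp_p(tu)\in\Omega\}$, and let $$R_m=\min_u R_u,\qquad R_M=\max_u R_u,\qquad a=\max_u\frac{\|\overline\nabla R_u\|^2}{\sin^2 R_u},$$ where $\overline\nabla$ is the gradient on the unit sphere of $T_p\mathbb S^n$. For a domain $D$ with smooth boundary, let $\mu_1(D)$ be the smallest non-zero $\mu$ for which the Steklov problem $\Delta f=0$ in $D$, $\partial f/\partial\nu=\mu f$ on $\partial D$ has a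 non-zero solution $f$ that is smooth up to the boundary. Then $$\mu_1(\Omega)\ \ge\ \frac{R_m}{R_M}\cdot\frac{(2+a)-\sqrt{a^2+4a}}{2}\cdot\frac{\sin^{n-1}(R_m)}{\sec\alpha\,\sin^{n-1}(R_M)}\cdot\mu_1\big(B(p,R_m)\big).$$ Moreover, if $\alpha=\max_{q\in\partial\Omega}\theta(q)$, then equality holds if and only if $\Omega$ is a geodesic ball centred at $p$. -/

import Mathlib

open scoped ContDiff

noncomputable section

namespace Steklov

/-- The Euclidean space `ℝⁿ⁺¹` in which the round sphere `Sⁿ` sits. -/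
abbrev Amb (n : ℕ) : Type := EuclideanSpace ℝ (Fin (n + 1))

/-- The round unit sphere `Sⁿ ⊂ ℝⁿ⁺¹`. Its geodesic distance is the angle between unit vectors. -/
abbrev Sph (n : ℕ) : Type := Metric.sphere (0 : Amb n) 1

variable {n : ℕ}

/-! ### Differential calculus on the sphere

A function on (an open part of) the sphere is given as a function `f` on (an open part of) the
ambient space, of which only the values on the sphere matter. -/

/-- The extension of `f` restricted to the sphere that is constant along rays from the origin. -/
def homExt (f : Amb n → ℝ) : Amb n → ℝ := fun y => f (‖y‖⁻¹ • y)

/-- The Riemannian gradient on the round sphere at the unit vector `x`: the Euclidean gradient of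
the extension that is constant along rays. It is a tangent vector at `x`, viewed in `ℝⁿ⁺¹`. -/
def sphGrad (f : Amb n → ℝ) (x : Amb n) : Amb n := gradient (homExt f) x

/-- The Laplace-Beltrami operator of the round sphere at the unit vector `x`: the Euclidean
Laplacian of the extension that is constant along rays. -/
def sphLaplacian (f : Amb n → ℝ) (x : Amb n) : ℝ := Laplacian.laplacian (homExt f) x

/-! ### Domains with smooth boundary -/

/-- `ρ`, on the open set `U`, is a smooth local defining function of `Ω` at the boundary
point `q`. -/
structure IsLocalDefiningFunction (Ω : Set (Sph n)) (q : Sph n) (U : Set (Amb n))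
    (ρ : Amb n → ℝ) : Prop where
  isOpen : IsOpen U
  mem : (q : Amb n) ∈ U
  smooth : ContDiffOn ℝ ∞ ρ U
  neg_iff : ∀ x : Sph n, (x : Amb n) ∈ U → (x ∈ Ω ↔ ρ x < 0)
  zero_iff : ∀ x : Sph n, (x : Amb n) ∈ U → (x ∈ frontier Ω ↔ ρ x = 0)
  grad_ne : sphGrad ρ q ≠ 0

/-- `Ω` lies locally on one side of its boundary, which is a smooth hypersurface of `Sⁿ`. -/
def HasSmoothBoundary (Ω : Set (Sph n)) : Prop :=
  ∀ q ∈ frontier Ω, ∃ U ρ, IsLocalDefiningFunction Ω q U ρ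

/-- `ν` is the outward unit normal to `∂Ω` at `q`. -/
def IsOutwardNormal (Ω : Set (Sph n)) (q : Sph n) (ν : Amb n) : Prop :=
  ∃ U ρ, IsLocalDefiningFunction Ω q U ρ ∧ ν = ‖sphGrad ρ q‖⁻¹ • sphGrad ρ q

/-! ### The Steklov problem -/

/-- `μ` is an eigenvalue of the Steklov problem on `Ω`: some nonzero `f`, smooth up to the boundary,
satisfies `Δ f = 0` in `Ω` and `∂f/∂ν = μ f` on `∂Ω`. -/
def IsSteklovEigenvalue (Ω : Set (Sph n)) (μ : ℝ) : Prop :=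
  ∃ (f : Amb n → ℝ) (U : Set (Amb n)),
    IsOpen U ∧ (∀ x ∈ closure Ω, (x : Amb n) ∈ U) ∧ ContDiffOn ℝ ∞ f U ∧
    (∃ x ∈ Ω, f x ≠ 0) ∧
    (∀ x ∈ Ω, sphLaplacian f x = 0) ∧
    (∀ q ∈ frontier Ω, ∃ ν, IsOutwardNormal Ω q ν ∧ inner ℝ (sphGrad f q) ν = μ * f q)

/-- `μ` is the first (smallest) nonzero Steklov eigenvalue `μ₁(Ω)`. -/
def IsFirstSteklovEigenvalue (Ω : Set (Sph n)) (μ : ℝ) : Prop :=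
  IsLeast {t : ℝ | t ≠ 0 ∧ IsSteklovEigenvalue Ω t} μ

/-! ### Geodesic polar coordinates about `p` -/

/-- The open geodesic ball of radius `r` about `p`. -/
def geodesicBall (p : Sph n) (r : ℝ) : Set (Sph n) :=
  {x | InnerProductGeometry.angle (p : Amb n) x < r}

/-- The unit sphere of the tangent space `T_p Sⁿ`. -/
def unitTangent (p : Sph n) : Set (Amb n) := {u | ‖u‖ = 1 ∧ inner ℝ (p : Amb n) u = 0}

/-- The point `exp_p (t u)`, for `u` a unit tangent vector at `p`. -/
def expPt (p : Sph n) (u : Amb n) (t : ℝ) : Amb n := Real.cos t • (p : Amb n) + Real.sin t • u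

/-- `Ω` is star-shaped with respect to `p ∈ Ω`: with a point it contains the geodesic segment that
joins `p` to it. -/
def StarShapedAt (Ω : Set (Sph n)) (p : Sph n) : Prop :=
  p ∈ Ω ∧ ∀ u ∈ unitTangent p, ∀ s t : ℝ, 0 ≤ s → s ≤ t → t < Real.pi →
    expPt p u t ∈ ((↑) '' Ω : Set (Amb n)) → expPt p u s ∈ ((↑) '' Ω : Set (Amb n))

/-- The radial function `R_u` of `Ω` about `p`: the parameter at which the geodesic with initial
velocity `u` leaves `Ω`. -/
def radius (Ω : Set (Sph n)) (p : Sph n) (u : Amb n) : ℝ :=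
  sSup {t : ℝ | 0 ≤ t ∧ t < Real.pi ∧ expPt p u t ∈ ((↑) '' Ω : Set (Amb n))}

/-- `R_m = min R_u`. -/
def minRadius (Ω : Set (Sph n)) (p : Sph n) : ℝ := sInf (radius Ω p '' unitTangent p)

/-- `R_M = max R_u`. -/
def maxRadius (Ω : Set (Sph n)) (p : Sph n) : ℝ := sSup (radius Ω p '' unitTangent p)

/-- The projection of an ambient vector to `T_p Sⁿ`, the orthogonal complement of `p`. -/
def tangentProj (p : Sph n) (v : Amb n) : Amb n := v - inner ℝ (p : Amb n) v • (p : Amb n)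

/-- The gradient `∇̄ R_u` of the radial function on the unit sphere of `T_p Sⁿ` at `u`, with its
standard metric: `R` is extended to be constant along `p` and along the rays from the origin of
`T_p Sⁿ`, so that the Euclidean gradient at `u` is orthogonal to `p` and to `u`. -/
def radiusGrad (Ω : Set (Sph n)) (p : Sph n) (u : Amb n) : Amb n :=
  gradient (fun v => radius Ω p (‖tangentProj p v‖⁻¹ • tangentProj p v)) u

/-- `a = max ‖∇̄ R_u‖² / sin² R_u`. -/
def slope (Ω : Set (Sph n)) (p : Sph n) : ℝ :=
  sSup ((fun u => ‖radiusGrad Ω p u‖ ^ 2 / Real.sin (radius Ω p u) ^ 2) '' unitTangent p)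

/-- The radial unit vector field `∂_r` centred at `p`, at a point `x ≠ ±p` of the sphere. -/
def radialField (p : Sph n) (x : Amb n) : Amb n :=
  ‖inner ℝ (p : Amb n) x • x - (p : Amb n)‖⁻¹ • (inner ℝ (p : Amb n) x • x - (p : Amb n))

/-- `∂_r` is the velocity of the unit speed geodesics issuing from `p`. -/
theorem radialField_expPt (p : Sph n) {u : Amb n} (hu : u ∈ unitTangent p) {t : ℝ}
    (h0 : 0 < t) (h1 : t < Real.pi) :
    radialField p (expPt p u t) = -Real.sin t • (p : Amb n) + Real.cos t • u := by
  have hs : 0 < Real.sin t := Real.sin_pos_of_pos_of_lt_pi h0 h1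
  have hp : ‖(p : Amb n)‖ = 1 := by simp
  have hpp : inner ℝ (p : Amb n) (p : Amb n) = (1 : ℝ) := by
    rw [real_inner_self_eq_norm_sq, hp]; norm_num
  have huu : inner ℝ u u = (1 : ℝ) := by
    rw [real_inner_self_eq_norm_sq, hu.1]; norm_num
  have hup : inner ℝ u (p : Amb n) = (0 : ℝ) := by rw [real_inner_comm]; exact hu.2
  have hi : inner ℝ (p : Amb n) (expPt p u t) = Real.cos t := by
    simp [expPt, inner_add_right, inner_smul_right, hu.2]
  have hv : inner ℝ (p : Amb n) (expPt p u t) • expPt p u t - (p : Amb n)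
      = Real.sin t • (-Real.sin t • (p : Amb n) + Real.cos t • u) := by
    rw [hi, expPt]
    have h2 : (Real.cos t * Real.cos t - 1) = -(Real.sin t * Real.sin t) := by
      nlinarith [Real.sin_sq_add_cos_sq t]
    calc _ = (Real.cos t * Real.cos t - 1) • (p : Amb n) + (Real.cos t * Real.sin t) • u := by
          module
      _ = _ := by rw [h2]; module
  have hn : ‖-Real.sin t • (p : Amb n) + Real.cos t • u‖ = 1 := by
    have : ‖-Real.sin t • (p : Amb n) + Real.cos t • u‖ ^ 2 = 1 := by
      rw [← real_inner_self_eq_norm_sq]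
      simp only [inner_add_left, inner_add_right, inner_smul_left, inner_smul_right, hu.2, hup,
        hpp, huu]
      simp
      nlinarith [Real.sin_sq_add_cos_sq t]
    nlinarith [norm_nonneg (-Real.sin t • (p : Amb n) + Real.cos t • u)]
  rw [radialField, hv, norm_smul, hn, Real.norm_of_nonneg hs.le, mul_one, smul_smul,
    inv_mul_cancel₀ hs.ne', one_smul]

/-- The set of all angles `θ(q)`, `q ∈ ∂Ω`, between the outward unit normal `ν` and `∂_r`. -/
def normalAngles (Ω : Set (Sph n)) (p : Sph n) : Set ℝ :=
  {θ | ∃ q ∈ frontier Ω, ∃ ν, IsOutwardNormal Ω q ν ∧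
    θ = InnerProductGeometry.angle ν (radialField p q)}

/-- The right-hand side of the estimate, as a function of the dimension `n`, of `R_m`, `R_M`, `a`,
`α` and of the first nonzero Steklov eigenvalue of the ball of radius `R_m`. -/
def lowerBound (n : ℕ) (Rm RM a α μB : ℝ) : ℝ :=
  Rm / RM * (((2 + a) - Real.sqrt (a ^ 2 + 4 * a)) / 2) *
    (Real.sin Rm ^ (n - 1) / ((Real.cos α)⁻¹ * Real.sin RM ^ (n - 1))) * μB

end Steklov

end

/-! Put n = m + 1 and use geodesic polar coordinates about p, rescaled so that (s, u) with 0 ≤ s ≤ 1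
stands for exp_p(s R_u u). The bound on θ makes every ray transversal to ∂Ω, so R is smooth by the
implicit function theorem. The outward normal satisfies sec θ · ν = ∂_r − ∇R / sin R, where sec θ =
√(1 + |∇R|² / sin² R), and ∂Ω has area density J = sin^m R · sec θ ≤ sec α · sin^m R_M over the unit
tangent sphere.

Let f be an eigenfunction for μ = μ₁(Ω). Green's identity (`integral_dirichletSlice_eq`), tested
with f and with 1, gives ∫_Ω |∇f|² = μ ∫ J f² and ∫ J f = 0. Transplant f along rays to B(p, R_m):
the value at fraction s of the ray u is placed at distance s R_m in the direction u. By
`integrand_comparison` the energy density of f is at least q · R_m / R_M times that of the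
transplanted function, where q = ((2 + a) − √(a² + 4a)) / 2. The ratio of radii comes from the
concavity of the sine. The factor q appears because the hypersurfaces s = const are not geodesic
spheres, so that the angular derivative of the transplanted function picks up part of the radial
derivative of f.

On the ball of radius ρ, `ball_spectral_gap` bounds the energy from below by κ sin^m ρ times the
variance of the boundary values, where W(r) = ∫₀^r sin^m and κ = W'/W − m cot is the logarithmic
derivative of φ = W / sin^m, the radial part of the first eigenfunctions (`ballEigenvalue`). The
proof looks at differences h(s, u) − h(s, v) on pairs of rays. The Poincaré inequality on the unit
tangent sphere, with constant m, replaces the angular energy by m times a variance, and the Riccati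
equation of κ completes the square in the radial direction. The Poincaré inequality itself is
Wirtinger's inequality on a circle, averaged over the planes spanned by Gaussian pairs of vectors.

Since ∫ J f = 0, subtracting a constant from f can only increase ∫ J f², whence ∫ J f² ≤ sec α sin^m
R_M · Var f. This yields the estimate with κ(R_m) in place of μ₁(B(p, R_m)). As κ(R_m) is an
eigenvalue of the ball, with an explicit eigenfunction, μ₁(B(p, R_m)) ≤ κ(R_m). This inequality
suffices, and the first eigenvalue of the ball is never computed.

For the equality case the loss in the comparison of densities is kept as a remainder, `defect`.
Equality forces it to vanish. If R_m < R_M, then f is constant along all rays (m ≥ 1), or f vanishes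
at the boundary point nearer to p (m = 0). Either way f cannot change sign on ∂Ω, contrary to ∫ J f
= 0. Conversely, for a ball a = 0 and α = 0, and the bound reduces to the eigenvalue itself. -/

set_option linter.unusedSectionVars false

noncomputable section

namespace Steklov

open MeasureTheory Set Filter Topology

/-! ### Wirtinger's inequality -/

/-- Wirtinger's inequality for functions that vanish at the end points of an interval. -/
theorem wirtinger_of_zero {T : ℝ} (hT : 0 < T) {c c' : ℝ → ℝ}
    (hc : ∀ x, HasDerivAt c (c' x) x) (hc' : Continuous c') (h0 : c 0 = 0) (h1 : c T = 0) :
    (Real.pi / T) ^ 2 * ∫ x in (0:ℝ)..T, c x ^ 2 ≤ ∫ x in (0:ℝ)..T, c' x ^ 2 := by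
  have hcc : Continuous c := continuous_iff_continuousAt.2 fun x => (hc x).continuousAt
  set a := Real.pi / T with ha
  have hapos : 0 < a := div_pos Real.pi_pos hT
  have haT : a * T = Real.pi := by rw [ha]; field_simp
  set I : ℝ → ℝ := fun x => c' x ^ 2 - a ^ 2 * c x ^ 2 with hI
  have hIc : Continuous I := by fun_prop
  -- Jacobi's trick: c'² − a² c² − w' is the square (c' − a cot(ax) c)², so the integral of c'² − a²
  -- c² is at least the difference of the boundary values of w.
  set w : ℝ → ℝ := fun x => a * (Real.cos (a * x) / Real.sin (a * x)) * c x ^ 2 with hw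
  have hsin : ∀ x, 0 < x → x < T → 0 < Real.sin (a * x) := fun x hx0 hxT =>
    Real.sin_pos_of_pos_of_lt_pi (by positivity) (by rw [← haT]; gcongr)
  have hwd : ∀ x, 0 < x → x < T → HasDerivAt w
      (a * ((-(Real.sin (a * x) * a) * Real.sin (a * x) - Real.cos (a * x) *
        (Real.cos (a * x) * a)) / Real.sin (a * x) ^ 2) * c x ^ 2
        + a * (Real.cos (a * x) / Real.sin (a * x)) * (2 * c x * c' x)) x := by
    intro x hx0 hxT
    have hlin : HasDerivAt (fun x : ℝ => a * x) a x := by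
      simpa using (hasDerivAt_id x).const_mul a
    have := (((hlin.cos.div hlin.sin (hsin x hx0 hxT).ne').const_mul a).mul ((hc x).pow 2))
    refine this.congr_deriv ?_
    simp
  have key : ∀ ε, 0 < ε → ε < T / 2 → w (T - ε) - w ε ≤ ∫ x in ε..(T - ε), I x := by
    intro ε he heT
    refine intervalIntegral.sub_le_integral_of_hasDeriv_right_of_le (by linarith)
      (fun x hx => (hwd x (by linarith [hx.1]) (by linarith [hx.2])).continuousAt.continuousWithinAt)
      (fun x hx => (hwd x (by linarith [hx.1]) (by linarith [hx.2])).hasDerivWithinAt)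
      hIc.continuousOn.integrableOn_Icc (fun x hx => ?_)
    have hs := hsin x (by linarith [hx.1]) (by linarith [hx.2])
    rw [hI]
    have : c' x ^ 2 - a ^ 2 * c x ^ 2 - (a * ((-(Real.sin (a * x) * a) * Real.sin (a * x)
        - Real.cos (a * x) * (Real.cos (a * x) * a)) / Real.sin (a * x) ^ 2) * c x ^ 2
        + a * (Real.cos (a * x) / Real.sin (a * x)) * (2 * c x * c' x))
        = (c' x - a * (Real.cos (a * x) / Real.sin (a * x)) * c x) ^ 2 := by
      field_simp
      ring
    nlinarith [sq_nonneg (c' x - a * (Real.cos (a * x) / Real.sin (a * x)) * c x)]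
  -- At both ends the cotangent grows like 1/ε while c² is O(ε²), because c vanishes there and c' is
  -- bounded. Hence the boundary values of w are O(ε).
  have hlow : ∃ C, ∀ ε, 0 < ε → ε < T / 2 → -(C * ε) ≤ w (T - ε) - w ε := by
    obtain ⟨K, hK⟩ := isCompact_Icc.exists_bound_of_continuousOn
      (s := Icc 0 T) (f := c') hc'.continuousOn
    have hb : ∀ x ∈ Icc 0 T, ∀ y ∈ Icc 0 T, |c y - c x| ≤ K * |y - x| := by
      intro x hx y hy
      simpa using (convex_Icc (0:ℝ) T).norm_image_sub_le_of_norm_hasDerivWithin_le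
        (fun z hz => (hc z).hasDerivWithinAt) hK hx hy
    refine ⟨2 * (a * (K ^ 2 / (2 / Real.pi * a))), fun ε he heT => ?_⟩
    have hse : 2 / Real.pi * (a * ε) ≤ Real.sin (a * ε) := by
      apply Real.mul_le_sin (by positivity)
      have : a * ε ≤ a * (T / 2) := by gcongr
      linarith
    have hse0 : 0 < Real.sin (a * ε) := hsin _ he (by linarith)
    have e1 : c ε ^ 2 ≤ (K * ε) ^ 2 := by
      have := hb 0 ⟨le_rfl, hT.le⟩ ε ⟨he.le, by linarith⟩
      rw [h0, sub_zero, sub_zero, abs_of_pos he] at this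
      exact sq_le_sq' (by linarith [neg_abs_le (c ε)]) (le_trans (le_abs_self _) this)
    have e2 : c (T - ε) ^ 2 ≤ (K * ε) ^ 2 := by
      have := hb T ⟨hT.le, le_rfl⟩ (T - ε) ⟨by linarith, by linarith⟩
      rw [h1, sub_zero, show T - ε - T = -ε by ring, abs_neg, abs_of_pos he] at this
      exact sq_le_sq' (by linarith [neg_abs_le (c (T - ε))]) (le_trans (le_abs_self _) this)
    have e3 : Real.sin (a * (T - ε)) = Real.sin (a * ε) := by
      rw [mul_sub, haT, Real.sin_pi_sub]
    have e4 : Real.cos (a * (T - ε)) = -Real.cos (a * ε) := by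
      rw [mul_sub, haT, Real.cos_pi_sub]
    have e5 : Real.cos (a * ε) / Real.sin (a * ε) ≤ 1 / (2 / Real.pi * (a * ε)) := by
      gcongr
      exact Real.cos_le_one _
    have e6 : a * (Real.cos (a * ε) / Real.sin (a * ε)) * (c (T - ε) ^ 2 + c ε ^ 2)
        ≤ a * (1 / (2 / Real.pi * (a * ε))) * ((K * ε) ^ 2 + (K * ε) ^ 2) := by
      gcongr
    have e7 : a * (1 / (2 / Real.pi * (a * ε))) * ((K * ε) ^ 2 + (K * ε) ^ 2)
       = 2 * (a * (K ^ 2 / (2 / Real.pi * a))) * ε := by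
      field_simp
      ring
    rw [hw]
    simp only
    rw [e3, e4]
    rw [e7] at e6
    have : a * (-Real.cos (a * ε) / Real.sin (a * ε)) * c (T - ε) ^ 2
      = - (a * (Real.cos (a * ε) / Real.sin (a * ε)) * c (T - ε) ^ 2) := by ring
    linarith
  obtain ⟨C, hC⟩ := hlow
  have hlim : Tendsto (fun ε => ∫ x in ε..(T - ε), I x) (𝓝[>] 0) (𝓝 (∫ x in (0:ℝ)..T, I x)) := by
    have hcont : Continuous fun ε : ℝ => ∫ x in ε..(T - ε), I x := by
      have h1 : Continuous fun ε : ℝ => ∫ x in (0:ℝ)..ε, I x :=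
        intervalIntegral.continuous_primitive (fun _ _ => hIc.intervalIntegrable _ _) 0
      have h2 : (fun ε : ℝ => ∫ x in ε..(T - ε), I x)
          = fun ε => (∫ x in (0:ℝ)..(T - ε), I x) - ∫ x in (0:ℝ)..ε, I x := by
        ext ε
        rw [intervalIntegral.integral_interval_sub_left] <;> exact hIc.intervalIntegrable _ _
      rw [h2]
      exact (h1.comp (by fun_prop)).sub h1
    have := (hcont.tendsto 0).mono_left (nhdsWithin_le_nhds (s := Ioi (0:ℝ)))
    simpa using this
  have hlim2 : Tendsto (fun ε : ℝ => -(C * ε)) (𝓝[>] 0) (𝓝 0) := by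
    have : Continuous fun ε : ℝ => -(C * ε) := by fun_prop
    simpa using (this.tendsto 0).mono_left (nhdsWithin_le_nhds (s := Ioi (0:ℝ)))
  have h := le_of_tendsto_of_tendsto hlim2 hlim (by
    filter_upwards [Ioo_mem_nhdsGT (show (0:ℝ) < T / 2 by linarith)] with ε hε
    exact (hC ε hε.1 hε.2).trans (key ε hε.1 hε.2))
  rw [hI, intervalIntegral.integral_sub, intervalIntegral.integral_const_mul] at h
  · linarith
  · exact (Continuous.intervalIntegrable (by fun_prop) _ _)
  · exact (Continuous.intervalIntegrable (by fun_prop) _ _)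

/-- Wirtinger's inequality for functions with `c (x + T) = -c x`. -/
theorem wirtinger_of_antiperiodic {T : ℝ} (hT : 0 < T) {c c' : ℝ → ℝ}
    (hc : ∀ x, HasDerivAt c (c' x) x) (hc' : Continuous c') (hanti : ∀ x, c (x + T) = -c x) :
    (Real.pi / T) ^ 2 * ∫ x in (0:ℝ)..T, c x ^ 2 ≤ ∫ x in (0:ℝ)..T, c' x ^ 2 := by
  have hcc : Continuous c := continuous_iff_continuousAt.2 fun x => (hc x).continuousAt
  have hanti' : ∀ x, c' (x + T) = -c' x := fun x => by
    have h1 : HasDerivAt (fun y => c (y + T)) (c' (x + T)) x := (hc (x + T)).comp_add_const x T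
    have h2 : HasDerivAt (fun y => c (y + T)) (-c' x) x := by
      rw [funext hanti]; exact (hc x).fun_neg
    exact h1.unique h2
  -- The values c 0 and c T = −c 0 have opposite signs. Since c² and c'² are T-periodic, the window
  -- of integration may start at a zero of c, which reduces to the previous case.
  obtain ⟨z, hz⟩ : ∃ z, c z = 0 := by
    have h0 := hanti 0
    rw [zero_add] at h0
    rcases le_total (c 0) 0 with h | h
    · obtain ⟨z, -, hz⟩ := intermediate_value_Icc hT.le hcc.continuousOn
        (show (0:ℝ) ∈ Icc (c 0) (c T) from ⟨h, by linarith⟩)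
      exact ⟨z, hz⟩
    · obtain ⟨z, -, hz⟩ := intermediate_value_Icc' hT.le hcc.continuousOn
        (show (0:ℝ) ∈ Icc (c T) (c 0) from ⟨by linarith, h⟩)
      exact ⟨z, hz⟩
  have hshift : ∀ f : ℝ → ℝ, (∀ x, f (x + T) = -f x) →
      ∫ x in (0:ℝ)..T, f (x + z) ^ 2 = ∫ x in (0:ℝ)..T, f x ^ 2 := by
    intro f hf
    rw [intervalIntegral.integral_comp_add_right (fun x => f x ^ 2) z, zero_add, add_comm T z]
    have hper : Function.Periodic (fun x => f x ^ 2) T := fun x => by simp [hf]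
    simpa using hper.intervalIntegral_add_eq z 0
  have := wirtinger_of_zero hT (c := fun x => c (x + z)) (c' := fun x => c' (x + z))
    (fun x => (hc (x + z)).comp_add_const x z) (by fun_prop) (by simpa using hz)
    (by rw [add_comm, hanti, hz, neg_zero])
  rwa [hshift c hanti, hshift c' hanti'] at this

end Steklov

end

noncomputable section

namespace Steklov

open MeasureTheory Set Filter Topology

/-! ### Gaussian averages over planes through the origin -/

section Gaussian

variable {E : Type*} [NormedAddCommGroup E] [InnerProductSpace ℝ E] [FiniteDimensional ℝ E]
  [MeasurableSpace E] [BorelSpace E]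

/-- The rotation by `θ` of a pair of vectors. -/
def rotPair (θ : ℝ) (z : E × E) : E × E :=
  (Real.cos θ • z.1 + Real.sin θ • z.2, -Real.sin θ • z.1 + Real.cos θ • z.2)

theorem norm_sq_rotPair (θ : ℝ) (z : E × E) :
    ‖(rotPair θ z).1‖ ^ 2 + ‖(rotPair θ z).2‖ ^ 2 = ‖z.1‖ ^ 2 + ‖z.2‖ ^ 2 := by
  simp only [rotPair, ← real_inner_self_eq_norm_sq, inner_add_left, inner_add_right,
    real_inner_smul_left, real_inner_smul_right]
  rw [real_inner_comm z.1 z.2]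
  linear_combination (inner ℝ z.1 z.1 + inner ℝ z.2 z.2) * Real.sin_sq_add_cos_sq θ

theorem rotPair_rotPair (θ η : ℝ) (z : E × E) :
    rotPair θ (rotPair η z) = rotPair (θ + η) z := by
  simp only [rotPair, Real.cos_add, Real.sin_add, Prod.mk.injEq]
  constructor <;> module

/-- The rotation of pairs as a linear isometry of the Hilbert sum. -/
def rotPairIso (θ : ℝ) : WithLp 2 (E × E) ≃ₗᵢ[ℝ] WithLp 2 (E × E) where
  toFun z := WithLp.toLp 2 (rotPair θ (WithLp.ofLp z))
  invFun z := WithLp.toLp 2 (rotPair (-θ) (WithLp.ofLp z))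
  left_inv z := by simp [rotPair_rotPair]; simp [rotPair]; rfl
  right_inv z := by simp [rotPair_rotPair]; simp [rotPair]; rfl
  map_add' x y := by
    apply (WithLp.equiv 2 (E × E)).injective
    simp [rotPair]
    constructor <;> module
  map_smul' r x := by
    apply (WithLp.equiv 2 (E × E)).injective
    simp [rotPair]
    constructor <;> module
  norm_map' z := by
    have h := norm_sq_rotPair θ (WithLp.ofLp z)
    have h1 := WithLp.prod_norm_sq_eq_of_L2 z
    have h2 := WithLp.prod_norm_sq_eq_of_L2 (WithLp.toLp 2 (rotPair θ (WithLp.ofLp z)))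
    simp only [WithLp.fst, WithLp.snd] at h1 h2
    change ‖WithLp.toLp 2 (rotPair θ (WithLp.ofLp z))‖ = ‖z‖
    rw [← sq_eq_sq₀ (norm_nonneg _) (norm_nonneg _)]
    linarith

theorem continuous_rotPair (θ : ℝ) : Continuous (rotPair (E := E) θ) := by
  unfold rotPair; fun_prop

/-- The rotation is an isometry for the Hilbert norm of E × E, and the volume of that norm is the
product volume. -/
theorem measurePreserving_rotPair (θ : ℝ) :
    MeasurePreserving (rotPair (E := E) θ) (volume.prod volume) (volume.prod volume) :=
  (WithLp.volume_preserving_ofLp E E).comp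
    ((rotPairIso θ).measurePreserving.comp (WithLp.volume_preserving_toLp E E))

/-- The (unnormalised) Gaussian measure. -/
def gauss (E : Type*) [NormedAddCommGroup E] [InnerProductSpace ℝ E] [FiniteDimensional ℝ E]
    [MeasurableSpace E] [BorelSpace E] : Measure E :=
  volume.withDensity fun x => ENNReal.ofReal (Real.exp (-‖x‖ ^ 2 / 2))

theorem gauss_prod_gauss : (gauss E).prod (gauss E) = (volume.prod volume).withDensity
    fun z : E × E => ENNReal.ofReal (Real.exp (-(‖z.1‖ ^ 2 + ‖z.2‖ ^ 2) / 2)) := by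
  rw [gauss, prod_withDensity (by fun_prop) (by fun_prop)]
  congr 1
  ext z
  rw [← ENNReal.ofReal_mul (Real.exp_nonneg _), ← Real.exp_add]
  congr 2
  ring

/-- The product Gaussian density depends only on ‖x‖² + ‖y‖², which rotations of pairs preserve
along with volume. -/
theorem lintegral_comp_rotPair (θ : ℝ) {f : E × E → ENNReal} (hf : Measurable f) :
    ∫⁻ z, f (rotPair θ z) ∂(gauss E).prod (gauss E) = ∫⁻ z, f z ∂(gauss E).prod (gauss E) := by
  have hw : Measurable fun z : E × E =>
      ENNReal.ofReal (Real.exp (-(‖z.1‖ ^ 2 + ‖z.2‖ ^ 2) / 2)) := by fun_prop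
  rw [gauss_prod_gauss, lintegral_withDensity_eq_lintegral_mul _ hw hf,
    lintegral_withDensity_eq_lintegral_mul _ hw
      (g := fun z => f (rotPair θ z)) (hf.comp (continuous_rotPair θ).measurable),
    ← (measurePreserving_rotPair (E := E) θ).lintegral_comp (hw.mul hf)]
  simp only [Pi.mul_apply, norm_sq_rotPair]

instance sigmaFinite_gauss : SigmaFinite (gauss E) := by
  unfold gauss
  exact SigmaFinite.withDensity_of_ne_top (by simp)

theorem lintegral_Ioc_sq {T : ℝ} (hT : 0 < T) {g : ℝ → ℝ} (hg : Continuous g) :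
    ∫⁻ θ in Ioc 0 T, ENNReal.ofReal (g θ ^ 2) = ENNReal.ofReal (∫ θ in (0:ℝ)..T, g θ ^ 2) := by
  rw [intervalIntegral.integral_of_le hT.le]
  have hi : IntegrableOn (fun θ => g θ ^ 2) (Ioc 0 T) :=
    (hg.pow 2).continuousOn.integrableOn_Icc.mono_set Ioc_subset_Icc_self
  exact (ofReal_integral_eq_lintegral_ofReal hi (ae_of_all _ fun x => sq_nonneg _)).symm

/-- Averaging Wirtinger's inequality over all planes. -/
theorem gauss_wirtinger {T : ℝ} (hT : 0 < T) {Φ Ψ : E × E → ℝ}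
    (hΦ : Measurable Φ) (hΨ : Measurable Ψ)
    (h : ∀ᵐ z ∂(gauss E).prod (gauss E),
      (∀ θ, HasDerivAt (fun θ => Φ (rotPair θ z)) (Ψ (rotPair θ z)) θ) ∧
      (Continuous fun θ => Ψ (rotPair θ z)) ∧
      ∀ θ, Φ (rotPair (θ + T) z) = -Φ (rotPair θ z)) :
    ENNReal.ofReal ((Real.pi / T) ^ 2) * ∫⁻ z, ENNReal.ofReal (Φ z ^ 2) ∂(gauss E).prod (gauss E)
      ≤ ∫⁻ z, ENNReal.ofReal (Ψ z ^ 2) ∂(gauss E).prod (gauss E) := by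
  have hrot : Measurable fun q : (E × E) × ℝ => rotPair q.2 q.1 := by
    unfold rotPair
    exact Continuous.measurable (by fun_prop)
  -- After exchanging the integrals the inner one no longer depends on θ, by rotation invariance, so
  -- averaging over the circle only contributes the length T. Working with lower integrals avoids
  -- any integrability hypothesis.
  have avg : ∀ {F : E × E → ℝ}, Measurable F →
      ∫⁻ z, (∫⁻ θ in Ioc 0 T, ENNReal.ofReal (F (rotPair θ z) ^ 2)) ∂(gauss E).prod (gauss E)
        = ENNReal.ofReal T * ∫⁻ z, ENNReal.ofReal (F z ^ 2) ∂(gauss E).prod (gauss E) := by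
    intro F hF
    rw [lintegral_lintegral_swap]
    · have : ∀ θ, ∫⁻ z, ENNReal.ofReal (F (rotPair θ z) ^ 2) ∂(gauss E).prod (gauss E)
          = ∫⁻ z, ENNReal.ofReal (F z ^ 2) ∂(gauss E).prod (gauss E) := fun θ =>
        lintegral_comp_rotPair θ (f := fun z => ENNReal.ofReal (F z ^ 2)) (by fun_prop)
      simp only [this]
      simp [mul_comm]
    · apply Measurable.aemeasurable
      have h1 : Measurable fun q : (E × E) × ℝ => F (rotPair q.2 q.1) := hF.comp hrot
      have h2 : Measurable fun q : (E × E) × ℝ => ENNReal.ofReal (F (rotPair q.2 q.1) ^ 2) :=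
        (h1.pow_const 2).ennreal_ofReal
      exact h2
  have main : ENNReal.ofReal ((Real.pi / T) ^ 2) *
      ∫⁻ z, (∫⁻ θ in Ioc 0 T, ENNReal.ofReal (Φ (rotPair θ z) ^ 2)) ∂(gauss E).prod (gauss E)
      ≤ ∫⁻ z, (∫⁻ θ in Ioc 0 T, ENNReal.ofReal (Ψ (rotPair θ z) ^ 2)) ∂(gauss E).prod (gauss E) := by
    rw [← lintegral_const_mul' _ _ ENNReal.ofReal_ne_top]
    refine lintegral_mono_ae ?_
    filter_upwards [h] with z hz
    have hc : Continuous fun θ => Φ (rotPair θ z) :=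
      continuous_iff_continuousAt.2 fun x => (hz.1 x).continuousAt
    rw [lintegral_Ioc_sq hT hc, lintegral_Ioc_sq hT hz.2.1, ← ENNReal.ofReal_mul (by positivity)]
    exact ENNReal.ofReal_le_ofReal (wirtinger_of_antiperiodic hT hz.1 hz.2.1 hz.2.2)
  rw [avg hΦ, avg hΨ, mul_left_comm] at main
  exact (ENNReal.mul_le_mul_iff_right (by simpa using hT) ENNReal.ofReal_ne_top).1 main

/-- Almost every pair of vectors spans a plane, if the dimension is at least two. -/
theorem ae_rotPair_ne_zero (hd : 2 ≤ Module.finrank ℝ E) :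
    ∀ᵐ z ∂(gauss E).prod (gauss E), ∀ θ, (rotPair θ z).1 ≠ 0 ∧ (rotPair θ z).2 ≠ 0 := by
  have hac : (gauss E).prod (gauss E) ≪ (volume.prod volume : Measure (E × E)) := by
    rw [gauss_prod_gauss]; exact withDensity_absolutelyContinuous _ _
  refine hac.ae_le ?_
  have : Nontrivial E := Module.nontrivial_of_finrank_pos (R := ℝ) (by omega)
  -- Linear dependence of a pair is equality in the Cauchy–Schwarz inequality. For fixed x ≠ 0 the y
  -- that satisfy it lie on the line through x, which is null in dimension at least two.
  have hcl : IsClosed {z : E × E | inner ℝ z.1 z.2 ^ 2 = ‖z.1‖ ^ 2 * ‖z.2‖ ^ 2} :=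
    isClosed_eq (by fun_prop) (by fun_prop)
  have hnull : ∀ᵐ z ∂(volume.prod volume : Measure (E × E)),
      ¬ inner ℝ z.1 z.2 ^ 2 = ‖z.1‖ ^ 2 * ‖z.2‖ ^ 2 := by
    rw [ae_iff]
    simp only [not_not]
    rw [Measure.measure_prod_null hcl.measurableSet]
    have h0 : ∀ᵐ x : E, x ≠ 0 := by simp [ae_iff]
    filter_upwards [h0] with x hx
    refine measure_mono_null (t := ((Submodule.span ℝ {x} : Submodule ℝ E) : Set E)) ?_ ?_
    · intro y hy
      change inner ℝ x y ^ 2 = ‖x‖ ^ 2 * ‖y‖ ^ 2 at hy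
      rw [SetLike.mem_coe, Submodule.mem_span_singleton]
      refine ⟨inner ℝ x y / ‖x‖ ^ 2, ?_⟩
      have hxx : ‖x‖ ^ 2 ≠ 0 := by simpa using hx
      have : ‖y - (inner ℝ x y / ‖x‖ ^ 2) • x‖ ^ 2 = 0 := by
        rw [norm_sub_sq_real, real_inner_smul_right, norm_smul, real_inner_comm y x, mul_pow,
          Real.norm_eq_abs, sq_abs]
        field_simp
        rw [real_inner_comm x y]
        linarith
      rw [sq_eq_zero_iff, norm_eq_zero, sub_eq_zero] at this
      exact this.symm
    · apply Measure.addHaar_submodule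
      intro htop
      have h1 := finrank_span_singleton (K := ℝ) hx
      rw [htop, finrank_top] at h1
      omega
  filter_upwards [hnull] with z hz θ
  have aux : ∀ a b : ℝ, a ^ 2 + b ^ 2 = 1 → a • z.1 + b • z.2 ≠ 0 := by
    intro a b hab h
    apply hz
    have ha : a ≠ 0 ∨ b ≠ 0 := by
      by_contra! hcon
      rw [hcon.1, hcon.2] at hab
      norm_num at hab
    have e1 : a * ‖z.1‖ ^ 2 + b * inner ℝ z.1 z.2 = 0 := by
      have := congrArg (fun w => inner ℝ z.1 w) h
      simpa [inner_add_right, real_inner_smul_right] using this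
    have e2 : a * inner ℝ z.1 z.2 + b * ‖z.2‖ ^ 2 = 0 := by
      have := congrArg (fun w => inner ℝ z.2 w) h
      simpa [inner_add_right, real_inner_smul_right, real_inner_comm] using this
    have e3 : a * (inner ℝ z.1 z.2 ^ 2 - ‖z.1‖ ^ 2 * ‖z.2‖ ^ 2) = 0 := by
      linear_combination inner ℝ z.1 z.2 * e2 - ‖z.2‖ ^ 2 * e1
    have e4 : b * (inner ℝ z.1 z.2 ^ 2 - ‖z.1‖ ^ 2 * ‖z.2‖ ^ 2) = 0 := by
      linear_combination inner ℝ z.1 z.2 * e1 - ‖z.1‖ ^ 2 * e2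
    rcases ha with ha | ha
    · exact sub_eq_zero.1 ((mul_eq_zero.1 e3).resolve_left ha)
    · exact sub_eq_zero.1 ((mul_eq_zero.1 e4).resolve_left ha)
  exact ⟨aux _ _ (by linarith [Real.sin_sq_add_cos_sq θ]),
    aux _ _ (by linarith [Real.sin_sq_add_cos_sq θ])⟩

end Gaussian

end Steklov

end

/-! ### Gaussian integrals of homogeneous functions in polar coordinates -/

noncomputable section

namespace Steklov

open MeasureTheory Set Filter Topology

section Poincare

variable {E : Type*} [NormedAddCommGroup E] [InnerProductSpace ℝ E] [FiniteDimensional ℝ E]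
  [MeasurableSpace E] [BorelSpace E]

/-- The moments of the Gaussian weight on the half line. -/
def halfMoment (j : ℕ) : ℝ := ∫ r in Ioi (0:ℝ), r ^ j * Real.exp (-r ^ 2 / 2)

theorem integrableOn_halfMoment (j : ℕ) :
    IntegrableOn (fun r : ℝ => r ^ j * Real.exp (-r ^ 2 / 2)) (Ioi 0) := by
  have h := integrableOn_rpow_mul_exp_neg_mul_sq (b := 1 / 2) (by norm_num) (s := (j : ℝ))
    (by linarith [(Nat.cast_nonneg j : (0:ℝ) ≤ j)])
  refine h.congr_fun (fun x hx => ?_) measurableSet_Ioi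
  simp only [Real.rpow_natCast]
  congr 2
  ring

theorem halfMoment_eq (j : ℕ) :
    halfMoment j = (1 / 2 : ℝ) ^ (-((j : ℝ) + 1) / 2) * (1 / 2) * Real.Gamma (((j : ℝ) + 1) / 2) := by
  rw [← integral_rpow_mul_exp_neg_mul_rpow (by norm_num)
    (by linarith [(Nat.cast_nonneg j : (0:ℝ) ≤ j)]) (by norm_num)]
  refine setIntegral_congr_fun measurableSet_Ioi fun x hx => ?_
  simp only [Real.rpow_natCast, Real.rpow_two]
  congr 2
  ring

theorem halfMoment_pos (j : ℕ) : 0 < halfMoment j := by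
  rw [halfMoment_eq]
  have : 0 < Real.Gamma (((j : ℝ) + 1) / 2) := Real.Gamma_pos_of_pos (by positivity)
  positivity

/-- This is Γ(z + 1) = z Γ(z). With j + 1 equal to the dimension it is the source of the dimension
in the Poincaré constant. -/
theorem halfMoment_add_two (j : ℕ) : halfMoment (j + 2) = (j + 1) * halfMoment j := by
  rw [halfMoment_eq, halfMoment_eq]
  push_cast
  rw [show ((j : ℝ) + 2 + 1) / 2 = ((j : ℝ) + 1) / 2 + 1 by ring,
    Real.Gamma_add_one (by positivity),
    show -((j : ℝ) + 2 + 1) / 2 = -((j : ℝ) + 1) / 2 - 1 by ring,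
    Real.rpow_sub (by norm_num), Real.rpow_one]
  ring

/-- Integration in polar coordinates of functions in product form. -/
theorem integral_polar [Nontrivial E] {Φ : E → ℝ} {a : ℝ → ℝ} {b : Metric.sphere (0 : E) 1 → ℝ}
    (h : ∀ r : ℝ, 0 < r → ∀ u : Metric.sphere (0 : E) 1, Φ (r • (u : E)) = a r * b u)
    (ha : IntegrableOn (fun r => r ^ (Module.finrank ℝ E - 1) * a r) (Ioi 0))
    (hb : Integrable b (volume : Measure E).toSphere) :
    Integrable Φ ∧ ∫ x, Φ x = (∫ r in Ioi (0:ℝ), r ^ (Module.finrank ℝ E - 1) * a r) *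
      ∫ u, b u ∂(volume : Measure E).toSphere := by
  have hmp := (volume : Measure E).measurePreserving_homeomorphUnitSphereProd
  have hme := (homeomorphUnitSphereProd E).measurableEmbedding
  have hcomp : ∀ x : ({0}ᶜ : Set E), Φ x = a ((homeomorphUnitSphereProd E x).2 : ℝ) *
      b (homeomorphUnitSphereProd E x).1 := by
    intro x
    rw [← h _ (homeomorphUnitSphereProd E x).2.2]
    congr 1
    have hx : ‖(x : E)‖ ≠ 0 := norm_ne_zero_iff.2 x.2
    simp [smul_smul, mul_inv_cancel₀ hx]
  have hIoi : Integrable (fun r : Ioi (0:ℝ) => a r)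
      (Measure.volumeIoiPow (Module.finrank ℝ E - 1)) ∧
      ∫ r : Ioi (0:ℝ), a r ∂Measure.volumeIoiPow (Module.finrank ℝ E - 1)
        = ∫ r in Ioi (0:ℝ), r ^ (Module.finrank ℝ E - 1) * a r := by
    have hm : Measurable fun r : Ioi (0:ℝ) => (r : ℝ) ^ (Module.finrank ℝ E - 1) := by fun_prop
    have hnn : ∀ r : Ioi (0:ℝ), 0 ≤ (r : ℝ) ^ (Module.finrank ℝ E - 1) :=
      fun r => pow_nonneg (le_of_lt r.2) _
    unfold Measure.volumeIoiPow
    constructor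
    · rw [integrable_withDensity_iff_integrable_smul₀' hm.ennreal_ofReal.aemeasurable
        (ae_of_all _ fun _ => ENNReal.ofReal_lt_top)]
      simp only [ENNReal.toReal_ofReal (hnn _), smul_eq_mul]
      exact (integrableOn_iff_comap_subtypeVal measurableSet_Ioi).1 ha
    · rw [integral_withDensity_eq_integral_toReal_smul₀ hm.ennreal_ofReal.aemeasurable
        (ae_of_all _ fun _ => ENNReal.ofReal_lt_top)]
      simp only [ENNReal.toReal_ofReal (hnn _), smul_eq_mul]
      exact integral_subtype_comap measurableSet_Ioi
        (fun r : ℝ => r ^ (Module.finrank ℝ E - 1) * a r)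
  have hprod := hb.mul_prod hIoi.1
  have hae : ({0}ᶜ : Set E) =ᵐ[volume] (univ : Set E) := by
    rw [ae_eq_univ, compl_compl]; exact measure_singleton _
  have hms : MeasurableSet ({0}ᶜ : Set E) := (measurableSet_singleton _).compl
  constructor
  · rw [← integrableOn_univ, ← integrableOn_congr_set_ae hae,
      integrableOn_iff_comap_subtypeVal hms]
    have := (hmp.integrable_comp_emb hme).2 hprod
    refine this.congr (ae_of_all _ fun x => ?_)
    simp only [Function.comp, hcomp]
    ring
  · rw [← setIntegral_univ, ← setIntegral_congr_set hae, ← integral_subtype_comap hms]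
    simp only [hcomp]
    rw [hmp.integral_comp hme (fun q : Metric.sphere (0 : E) 1 × Ioi (0:ℝ) => a q.2 * b q.1)]
    simp only [mul_comm (a _) (b _)]
    rw [integral_prod_mul (fun u => b u) (fun r : Ioi (0:ℝ) => a r), hIoi.2, mul_comm]

/-- The Gaussian weight converts integrals of homogeneous functions into integrals over the unit
sphere and back, up to a positive moment. Symmetries of the Gaussian measure thereby become
statements about the sphere. -/
theorem gauss_polar [Nontrivial E] {Φ : E → ℝ} {b : Metric.sphere (0 : E) 1 → ℝ}
    (hb : Continuous b) {j : ℕ}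
    (h : ∀ r : ℝ, 0 < r → ∀ u : Metric.sphere (0 : E) 1, Φ (r • (u : E)) = r ^ j * b u) :
    Integrable Φ (gauss E) ∧ ∫ x, Φ x ∂gauss E = halfMoment (Module.finrank ℝ E - 1 + j) *
      ∫ u, b u ∂(volume : Measure E).toSphere := by
  have hm : Measurable fun x : E => ENNReal.ofReal (Real.exp (-‖x‖ ^ 2 / 2)) := by fun_prop
  have hfun : (fun r : ℝ => r ^ (Module.finrank ℝ E - 1) * (Real.exp (-r ^ 2 / 2) * r ^ j))
      = fun r => r ^ (Module.finrank ℝ E - 1 + j) * Real.exp (-r ^ 2 / 2) := by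
    ext r; ring
  have key := integral_polar (E := E) (Φ := fun x => Real.exp (-‖x‖ ^ 2 / 2) * Φ x)
    (a := fun r => Real.exp (-r ^ 2 / 2) * r ^ j) (b := b)
    (fun r hr u => by
      simp only [h r hr u, norm_smul, Real.norm_of_nonneg hr.le, norm_eq_of_mem_sphere, mul_one]
      ring)
    (by rw [hfun]; exact integrableOn_halfMoment _)
    (hb.integrable_of_hasCompactSupport (HasCompactSupport.of_compactSpace _))
  rw [hfun] at key
  unfold gauss
  constructor
  · rw [integrable_withDensity_iff_integrable_smul₀' hm.aemeasurable
        (ae_of_all _ fun _ => ENNReal.ofReal_lt_top)]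
    simpa only [ENNReal.toReal_ofReal (Real.exp_nonneg _), smul_eq_mul] using key.1
  · rw [integral_withDensity_eq_integral_toReal_smul₀ hm.aemeasurable
        (ae_of_all _ fun _ => ENNReal.ofReal_lt_top)]
    simp only [ENNReal.toReal_ofReal (Real.exp_nonneg _), smul_eq_mul]
    exact key.2

instance isFiniteMeasure_gauss [Nontrivial E] : IsFiniteMeasure (gauss E) := by
  have := (gauss_polar (E := E) (Φ := fun _ => 1) (b := fun _ => 1) continuous_const (j := 0)
    (by simp)).1
  rcases integrable_const_iff.1 this with h | h
  · exact absurd h one_ne_zero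
  · exact h

theorem gauss_real_univ [Nontrivial E] : (gauss E).real univ =
    halfMoment (Module.finrank ℝ E - 1) * (volume : Measure E).toSphere.real univ := by
  have := (gauss_polar (E := E) (Φ := fun _ => 1) (b := fun _ => 1) continuous_const (j := 0)
    (by simp)).2
  simpa using this

theorem measurePreserving_gauss (L : E ≃ₗᵢ[ℝ] E) : MeasurePreserving L (gauss E) (gauss E) := by
  refine ⟨L.continuous.measurable, ?_⟩
  have hw : Measurable fun x : E => ENNReal.ofReal (Real.exp (-‖x‖ ^ 2 / 2)) := by fun_prop
  refine Measure.ext_of_lintegral _ fun f hf => ?_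
  rw [lintegral_map hf L.continuous.measurable, gauss,
    lintegral_withDensity_eq_lintegral_mul _ hw hf,
    lintegral_withDensity_eq_lintegral_mul _ hw (g := fun x => f (L x))
      (hf.comp L.continuous.measurable),
    ← (L.measurePreserving).lintegral_comp (hw.mul hf)]
  simp

/-- The covariance of the Gaussian measure. -/
theorem gauss_inner_sq [Nontrivial E] (a : E) :
    Integrable (fun y => inner ℝ a y ^ 2) (gauss E) ∧
    ∫ y, inner ℝ a y ^ 2 ∂gauss E = ‖a‖ ^ 2 * (gauss E).real univ := by
  have hint : ∀ a : E, Integrable (fun y => inner ℝ a y ^ 2) (gauss E) := fun a =>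
    (gauss_polar (b := fun u : Metric.sphere (0 : E) 1 => inner ℝ a (u : E) ^ 2) (by fun_prop)
      (j := 2) (fun r hr u => by rw [real_inner_smul_right]; ring)).1
  refine ⟨hint a, ?_⟩
  -- A reflection takes a to b when their norms agree, and it preserves the Gaussian measure.
  have heq : ∀ a b : E, ‖a‖ = ‖b‖ →
      ∫ y, inner ℝ a y ^ 2 ∂gauss E = ∫ y, inner ℝ b y ^ 2 ∂gauss E := by
    intro a b hab
    have hL := Submodule.reflection_sub hab
    set L := Submodule.reflection (ℝ ∙ (a - b))ᗮ
    rw [← (measurePreserving_gauss L).integral_comp L.toHomeomorph.measurableEmbedding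
      (fun y => inner ℝ b y ^ 2), ← hL]
    simp
  have hdim : (Module.finrank ℝ E - 1 + 1 : ℕ) = Module.finrank ℝ E :=
    Nat.sub_add_cancel Module.finrank_pos
  have hone : ∀ b : E, ‖b‖ = 1 → ∫ y, inner ℝ b y ^ 2 ∂gauss E = (gauss E).real univ := by
    intro b hb
    -- The integral of ‖y‖² is computed twice: as the dimension times one directional moment, by
    -- summing over an orthonormal basis, and as the dimension times the total mass, by the
    -- recursion for the moments.
    have hsum : ∫ y, ‖y‖ ^ 2 ∂gauss E = Module.finrank ℝ E * ∫ y, inner ℝ b y ^ 2 ∂gauss E := by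
      have h1 : (fun y : E => ‖y‖ ^ 2) = fun y => ∑ i, inner ℝ (stdOrthonormalBasis ℝ E i) y ^ 2 := by
        ext y
        rw [← (stdOrthonormalBasis ℝ E).sum_sq_norm_inner_right y]
        simp
      rw [h1, integral_finsetSum _ fun i _ => hint _]
      rw [Finset.sum_congr rfl fun i _ => heq _ b (by rw [hb]; simp)]
      simp
    have hpol := (gauss_polar (E := E) (Φ := fun y => ‖y‖ ^ 2) (b := fun _ => 1)
      continuous_const (j := 2) (fun r hr u => by simp [norm_smul])).2
    rw [halfMoment_add_two, hsum, mul_assoc] at hpol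
    have hc : ((Module.finrank ℝ E - 1 : ℕ) : ℝ) + 1 = Module.finrank ℝ E := by
      exact_mod_cast hdim
    rw [hc] at hpol
    have hpos : (0 : ℝ) < Module.finrank ℝ E := by exact_mod_cast Module.finrank_pos
    have := mul_left_cancel₀ hpos.ne' hpol
    rw [this, gauss_real_univ]
    simp
  rcases eq_or_ne a 0 with rfl | ha
  · simp
  have hb : ‖‖a‖⁻¹ • a‖ = 1 := by rw [norm_smul, norm_inv, norm_norm, inv_mul_cancel₀]; simpa
  have h1 := hone _ hb
  have h2 : (fun y => inner ℝ a y ^ 2) = fun y => ‖a‖ ^ 2 * inner ℝ (‖a‖⁻¹ • a) y ^ 2 := by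
    ext y
    rw [real_inner_smul_left]
    have := norm_ne_zero_iff.2 ha
    field_simp
  rw [h2, integral_const_mul, h1]

end Poincare

end Steklov

end

/-! ### The Poincaré inequality for odd and for even functions -/

noncomputable section

namespace Steklov

open MeasureTheory Set Filter Topology

section Poincare2

variable {E : Type*} [NormedAddCommGroup E] [InnerProductSpace ℝ E] [FiniteDimensional ℝ E]
  [MeasurableSpace E] [BorelSpace E]

/-- `k` is continuously differentiable away from the origin and constant along rays. -/
structure IsHomogeneousC1 (k : E → ℝ) : Prop where
  contDiffAt : ∀ x, x ≠ 0 → ContDiffAt ℝ 1 k x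
  smul_eq : ∀ (r : ℝ) (x : E), 0 < r → k (r • x) = k x

theorem gradient_smul_of_homogeneous {k : E → ℝ} (hk : ∀ (r : ℝ) (x : E), 0 < r → k (r • x) = k x)
    {r : ℝ} (hr : 0 < r) (x : E) : gradient k (r • x) = r⁻¹ • gradient k x := by
  have h2 : fderiv ℝ (fun y => k (r • y)) x = r • fderiv ℝ k (r • x) := fderiv_comp_smul ..
  have h3 : (fun y => k (r • y)) = k := funext fun y => hk r y hr
  rw [h3] at h2
  rw [gradient, gradient, h2, map_smul, smul_smul, inv_mul_cancel₀ hr.ne', one_smul]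

/-- Euler's relation: k is constant along the ray through x. Where k is not differentiable the
gradient is zero by default. -/
theorem inner_gradient_self_of_homogeneous {k : E → ℝ}
    (hk : ∀ (r : ℝ) (x : E), 0 < r → k (r • x) = k x) (x : E) : inner ℝ (gradient k x) x = 0 := by
  by_cases hd : DifferentiableAt ℝ k x
  · have h1 : HasDerivAt (fun t : ℝ => k (x + t • x)) (inner ℝ (gradient k x) x) 0 := by
      have hl : HasDerivAt (fun t : ℝ => x + t • x) x 0 := by
        simpa using ((hasDerivAt_id (0:ℝ)).smul_const x).const_add x
      have hf : HasFDerivAt k (fderiv ℝ k x) (x + (0:ℝ) • x) := by simpa using hd.hasFDerivAt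
      have := hf.comp_hasDerivAt (0:ℝ) hl
      refine this.congr_deriv ?_
      rw [gradient, InnerProductSpace.toDual_symm_apply]
    have h2 : HasDerivAt (fun t : ℝ => k (x + t • x)) 0 0 := by
      refine (hasDerivAt_const (0:ℝ) (k x)).congr_of_eventuallyEq ?_
      filter_upwards [Ioi_mem_nhds (show (-1:ℝ) < 0 by norm_num)] with t ht
      rw [show x + t • x = (1 + t) • x by module]
      exact hk _ _ (by linarith [show (-1:ℝ) < t from ht])
    exact h1.unique h2
  · rw [gradient, fderiv_zero_of_not_differentiableAt hd]; simp

theorem IsHomogeneousC1.continuousAt_gradient {k : E → ℝ} (hk : IsHomogeneousC1 k) {x : E}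
    (hx : x ≠ 0) : ContinuousAt (gradient k) x := by
  have := (hk.contDiffAt x hx).continuousAt_fderiv one_ne_zero
  exact (InnerProductSpace.toDual ℝ E).symm.continuous.continuousAt.comp this

theorem IsHomogeneousC1.continuous_sphere {k : E → ℝ} (hk : IsHomogeneousC1 k) :
    Continuous fun u : Metric.sphere (0 : E) 1 => k u :=
  continuous_iff_continuousAt.2 fun u =>
    (hk.contDiffAt u (ne_zero_of_mem_unit_sphere u)).continuousAt.comp
      continuous_subtype_val.continuousAt

theorem IsHomogeneousC1.continuous_gradient_sphere {k : E → ℝ} (hk : IsHomogeneousC1 k) :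
    Continuous fun u : Metric.sphere (0 : E) 1 => gradient k (u : E) :=
  continuous_iff_continuousAt.2 fun u =>
    (hk.continuousAt_gradient (ne_zero_of_mem_unit_sphere u)).comp (f := fun u : Metric.sphere (0 : E) 1 => (u : E))
      continuous_subtype_val.continuousAt

theorem toSphere_real_univ_pos [Nontrivial E] :
    0 < (volume : Measure E).toSphere.real univ := by
  rw [Measure.toSphere_real_apply_univ]
  have h1 : (0:ℝ) < Module.finrank ℝ E := by exact_mod_cast Module.finrank_pos
  have h2 : 0 < (volume : Measure E).real (Metric.ball 0 1) :=
    ENNReal.toReal_pos (Metric.measure_ball_pos _ _ one_pos).ne' measure_ball_lt_top.ne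
  positivity

theorem gauss_real_univ_pos [Nontrivial E] : 0 < (gauss E).real univ := by
  rw [gauss_real_univ]
  exact mul_pos (halfMoment_pos _) toSphere_real_univ_pos

/-- The extension of `k` that is positively homogeneous of degree one. -/
def coneExt (k : E → ℝ) (x : E) : ℝ := ‖x‖ * k x

/-- The gradient of `coneExt k`. -/
def coneGrad (k : E → ℝ) (x : E) : E := (k x * ‖x‖⁻¹) • x + ‖x‖ • gradient k x

namespace IsHomogeneousC1

variable {k : E → ℝ}

theorem hasGradientAt_coneExt (hk : IsHomogeneousC1 k) {x : E} (hx : x ≠ 0) :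
    HasGradientAt (coneExt k) (coneGrad k x) x := by
  have hn : HasGradientAt (fun x : E => ‖x‖) (‖x‖⁻¹ • x) x := by
    have h1 : HasFDerivAt (fun x : E => ‖x‖ ^ 2) (2 • innerSL ℝ x) x :=
      (hasStrictFDerivAt_norm_sq x).hasFDerivAt
    have h2 := h1.sqrt (pow_ne_zero 2 (norm_ne_zero_iff.2 hx))
    simp only [Real.sqrt_sq (norm_nonneg _)] at h2
    rw [hasGradientAt_iff_hasFDerivAt]
    convert! h2 using 1
    ext y
    have := norm_ne_zero_iff.2 hx
    simp
    field_simp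
  have hg := ((hk.contDiffAt x hx).differentiableAt one_ne_zero).hasGradientAt
  rw [hasGradientAt_iff_hasFDerivAt] at hn hg ⊢
  have := hn.mul hg
  convert! this using 1
  ext y
  simp [coneGrad]
  ring

theorem continuousAt_coneExt (hk : IsHomogeneousC1 k) {x : E} (hx : x ≠ 0) : ContinuousAt (coneExt k) x :=
  continuous_norm.continuousAt.mul (hk.contDiffAt x hx).continuousAt

theorem continuousAt_coneGrad (hk : IsHomogeneousC1 k) {x : E} (hx : x ≠ 0) : ContinuousAt (coneGrad k) x := by
  have h1 := (hk.contDiffAt x hx).continuousAt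
  have h2 := hk.continuousAt_gradient hx
  unfold coneGrad
  exact (((h1.mul (continuousAt_id.norm.inv₀ (by simpa)))).smul continuousAt_id).add
    (continuousAt_id.norm.smul h2)

theorem measurable_coneExt (hk : IsHomogeneousC1 k) : Measurable (coneExt k) :=
  measurable_of_continuousOn_compl_singleton 0 fun _ hx =>
    (hk.continuousAt_coneExt hx).continuousWithinAt

theorem measurable_coneGrad (hk : IsHomogeneousC1 k) : Measurable (coneGrad k) :=
  measurable_of_continuousOn_compl_singleton 0 fun _ hx =>
    (hk.continuousAt_coneGrad hx).continuousWithinAt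

/-- The two summands of `coneGrad` are orthogonal by Euler's relation, and their sum is homogeneous
of degree zero, so the radius drops out. -/
theorem norm_sq_coneGrad_smul (hk : IsHomogeneousC1 k) {r : ℝ} (hr : 0 < r) (u : Metric.sphere (0 : E) 1) :
    ‖coneGrad k (r • (u : E))‖ ^ 2 = k u ^ 2 + ‖gradient k (u : E)‖ ^ 2 := by
  have hu : ‖(u : E)‖ = 1 := norm_eq_of_mem_sphere u
  have h0 := inner_gradient_self_of_homogeneous hk.smul_eq (u : E)
  rw [coneGrad, hk.smul_eq _ _ hr, gradient_smul_of_homogeneous hk.smul_eq hr, norm_smul, hu,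
    Real.norm_of_nonneg hr.le, mul_one, smul_smul, smul_smul, mul_inv_cancel₀ hr.ne', one_smul,
    mul_assoc, inv_mul_cancel₀ hr.ne', mul_one, norm_add_sq_real, norm_smul, hu,
    real_inner_smul_left, real_inner_comm, h0]
  simp

theorem gauss_coneExt (hk : IsHomogeneousC1 k) [Nontrivial E] : Integrable (coneExt k) (gauss E) ∧
    ∫ x, coneExt k x ∂gauss E = halfMoment (Module.finrank ℝ E - 1 + 1) *
      ∫ u : Metric.sphere (0 : E) 1, k u ∂(volume : Measure E).toSphere :=
  gauss_polar hk.continuous_sphere fun r hr u => by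
    simp [coneExt, hk.smul_eq _ _ hr, norm_smul, abs_of_pos hr]

theorem gauss_coneExt_sq (hk : IsHomogeneousC1 k) [Nontrivial E] : Integrable (fun x => coneExt k x ^ 2) (gauss E) ∧
    ∫ x, coneExt k x ^ 2 ∂gauss E = Module.finrank ℝ E * halfMoment (Module.finrank ℝ E - 1) *
      ∫ u : Metric.sphere (0 : E) 1, k u ^ 2 ∂(volume : Measure E).toSphere := by
  have := gauss_polar (E := E) (Φ := fun x => coneExt k x ^ 2) (hk.continuous_sphere.pow 2) (j := 2)
    fun r hr u => by simp [coneExt, hk.smul_eq _ _ hr, norm_smul, abs_of_pos hr, mul_pow]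
  rw [halfMoment_add_two] at this
  have hdim : ((Module.finrank ℝ E - 1 : ℕ) : ℝ) + 1 = Module.finrank ℝ E := by
    exact_mod_cast Nat.sub_add_cancel (Module.finrank_pos (R := ℝ) (M := E))
  rwa [hdim] at this

theorem gauss_coneGrad_sq (hk : IsHomogeneousC1 k) [Nontrivial E] : Integrable (fun x => ‖coneGrad k x‖ ^ 2) (gauss E) ∧
    ∫ x, ‖coneGrad k x‖ ^ 2 ∂gauss E = halfMoment (Module.finrank ℝ E - 1) *
      ((∫ u : Metric.sphere (0 : E) 1, k u ^ 2 ∂(volume : Measure E).toSphere) +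
      ∫ u : Metric.sphere (0 : E) 1, ‖gradient k (u : E)‖ ^ 2 ∂(volume : Measure E).toSphere) := by
  have hc1 : Continuous fun u : Metric.sphere (0 : E) 1 => k u ^ 2 := hk.continuous_sphere.pow 2
  have hc2 : Continuous fun u : Metric.sphere (0 : E) 1 => ‖gradient k (u : E)‖ ^ 2 :=
    hk.continuous_gradient_sphere.norm.pow 2
  have := gauss_polar (E := E) (Φ := fun x => ‖coneGrad k x‖ ^ 2) (hc1.add hc2) (j := 0)
    fun r hr u => by rw [hk.norm_sq_coneGrad_smul hr]; simp
  rw [← integral_add (hc1.integrable_of_hasCompactSupport (HasCompactSupport.of_compactSpace _))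
    (hc2.integrable_of_hasCompactSupport (HasCompactSupport.of_compactSpace _))]
  exact this

/-- For fixed x the function y ↦ ⟨∇K(x), y⟩ is linear, so its Gaussian second moment is ‖∇K(x)‖²
times the total mass. -/
theorem lintegral_inner_coneGrad (hk : IsHomogeneousC1 k) [Nontrivial E] :
    ∫⁻ z, ENNReal.ofReal (inner ℝ (coneGrad k z.1) z.2 ^ 2) ∂(gauss E).prod (gauss E)
      = ENNReal.ofReal ((gauss E).real univ * ∫ x, ‖coneGrad k x‖ ^ 2 ∂gauss E) := by
  have hm : Measurable fun z : E × E => inner ℝ (coneGrad k z.1) z.2 :=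
    (hk.measurable_coneGrad.comp measurable_fst).inner measurable_snd
  rw [lintegral_prod _ (hm.pow_const 2).ennreal_ofReal.aemeasurable]
  have : ∀ x, ∫⁻ y, ENNReal.ofReal (inner ℝ (coneGrad k x) y ^ 2) ∂gauss E
      = ENNReal.ofReal ((gauss E).real univ * ‖coneGrad k x‖ ^ 2) := by
    intro x
    rw [← ofReal_integral_eq_lintegral_ofReal (gauss_inner_sq _).1
      (ae_of_all _ fun _ => sq_nonneg _), (gauss_inner_sq _).2, mul_comm]
  simp only [this]
  rw [← ofReal_integral_eq_lintegral_ofReal (hk.gauss_coneGrad_sq.1.const_mul _)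
    (ae_of_all _ fun _ => by positivity), integral_const_mul]

theorem hasDerivAt_coneExt_rotPair (hk : IsHomogeneousC1 k) (z : E × E) (θ : ℝ) (h : (rotPair θ z).1 ≠ 0) :
    HasDerivAt (fun θ => coneExt k (rotPair θ z).1)
      (inner ℝ (coneGrad k (rotPair θ z).1) (rotPair θ z).2) θ := by
  have hp : HasDerivAt (fun θ => (rotPair θ z).1) (rotPair θ z).2 θ := by
    unfold rotPair
    exact ((Real.hasDerivAt_cos θ).smul_const z.1).add ((Real.hasDerivAt_sin θ).smul_const z.2)
  refine (((hk.hasGradientAt_coneExt h).hasFDerivAt).comp_hasDerivAt θ hp).congr_deriv ?_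
  simp

/-- Let K = `coneExt k`. Along the ellipse θ ↦ cos θ · x + sin θ · y the function K changes sign
after half a turn, so Wirtinger applies with T = π and constant 1. The Gaussian average compares ∫
K² = d · M ∫ k² with ∫ |∇K|² = M (∫ k² + ∫ |∇k|²), where d is the dimension and M > 0 a moment. The
excess d − 1 is the constant. -/
theorem poincare_of_odd (hk : IsHomogeneousC1 k) (hd : 2 ≤ Module.finrank ℝ E) (hodd : ∀ x, k (-x) = -k x) :
    ((Module.finrank ℝ E : ℝ) - 1) *
      ∫ u : Metric.sphere (0 : E) 1, k u ^ 2 ∂(volume : Measure E).toSphere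
      ≤ ∫ u : Metric.sphere (0 : E) 1, ‖gradient k (u : E)‖ ^ 2 ∂(volume : Measure E).toSphere := by
  have : Nontrivial E := Module.nontrivial_of_finrank_pos (R := ℝ) (by omega)
  have hΦ : Measurable fun z : E × E => coneExt k z.1 ^ 2 :=
    (hk.measurable_coneExt.comp measurable_fst).pow_const 2
  have h := gauss_wirtinger Real.pi_pos (E := E) (Φ := fun z => coneExt k z.1)
    (Ψ := fun z => inner ℝ (coneGrad k z.1) z.2) (hk.measurable_coneExt.comp measurable_fst)
    ((hk.measurable_coneGrad.comp measurable_fst).inner measurable_snd) (by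
      filter_upwards [ae_rotPair_ne_zero hd] with z hz
      refine ⟨fun θ => hk.hasDerivAt_coneExt_rotPair z θ (hz θ).1, ?_, fun θ => ?_⟩
      · refine continuous_iff_continuousAt.2 fun θ => ContinuousAt.inner (𝕜 := ℝ) ?_ ?_
        · exact (hk.continuousAt_coneGrad (hz θ).1).comp (f := fun θ => (rotPair θ z).1)
            (by unfold rotPair; fun_prop)
        · unfold rotPair; fun_prop
      · have : (rotPair (θ + Real.pi) z).1 = -(rotPair θ z).1 := by
          simp [rotPair]; module
        simp [coneExt, this, hodd])
  rw [div_self Real.pi_ne_zero, one_pow, ENNReal.ofReal_one, one_mul, hk.lintegral_inner_coneGrad,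
    lintegral_prod _ hΦ.ennreal_ofReal.aemeasurable] at h
  simp only [lintegral_const] at h
  rw [lintegral_mul_const' _ _ (measure_ne_top _ _),
    ← ofReal_integral_eq_lintegral_ofReal hk.gauss_coneExt_sq.1 (ae_of_all _ fun _ => sq_nonneg _),
    ← ofReal_measureReal, ← ENNReal.ofReal_mul (integral_nonneg fun _ => sq_nonneg _),
    ENNReal.ofReal_le_ofReal_iff (by positivity), mul_comm] at h
  have hZ := gauss_real_univ_pos (E := E)
  have h' := le_of_mul_le_mul_left h hZ
  rw [hk.gauss_coneExt_sq.2, hk.gauss_coneGrad_sq.2] at h'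
  have hm := halfMoment_pos (Module.finrank ℝ E - 1)
  rw [mul_comm (Module.finrank ℝ E : ℝ), mul_assoc] at h'
  linarith [le_of_mul_le_mul_left h' hm]

/-- For even k the function K(x) − K(y) changes sign after a quarter turn, which takes (x, y) to (y,
−x). Wirtinger with T = π/2 has constant 4. The mean zero condition removes the product K(x) K(y)
when the square is integrated. -/
theorem poincare_of_even (hk : IsHomogeneousC1 k) (hd : 2 ≤ Module.finrank ℝ E)
    (heven : ∀ x, k (-x) = k x)
    (hmean : ∫ u : Metric.sphere (0 : E) 1, k u ∂(volume : Measure E).toSphere = 0) :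
    ((Module.finrank ℝ E : ℝ) - 1) *
      ∫ u : Metric.sphere (0 : E) 1, k u ^ 2 ∂(volume : Measure E).toSphere
      ≤ ∫ u : Metric.sphere (0 : E) 1, ‖gradient k (u : E)‖ ^ 2 ∂(volume : Measure E).toSphere := by
  have : Nontrivial E := Module.nontrivial_of_finrank_pos (R := ℝ) (by omega)
  have hm1 : Measurable fun z : E × E => coneExt k z.1 := hk.measurable_coneExt.comp measurable_fst
  have hm2 : Measurable fun z : E × E => coneExt k z.2 := hk.measurable_coneExt.comp measurable_snd
  have hg1 : Measurable fun z : E × E => inner ℝ (coneGrad k z.1) z.2 :=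
    (hk.measurable_coneGrad.comp measurable_fst).inner measurable_snd
  have hg2 : Measurable fun z : E × E => inner ℝ (coneGrad k z.2) z.1 :=
    (hk.measurable_coneGrad.comp measurable_snd).inner measurable_fst
  have hrot : ∀ θ (z : E × E), rotPair (θ + Real.pi / 2) z
      = ((rotPair θ z).2, -(rotPair θ z).1) := by
    intro θ z
    simp only [rotPair, Real.cos_add_pi_div_two, Real.sin_add_pi_div_two, Prod.mk.injEq, true_and]
    module
  have hd2 : ∀ z : E × E, (∀ θ, (rotPair θ z).1 ≠ 0 ∧ (rotPair θ z).2 ≠ 0) → ∀ θ,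
      HasDerivAt (fun θ => coneExt k (rotPair θ z).2)
        (inner ℝ (coneGrad k (rotPair θ z).2) (-(rotPair θ z).1)) θ := by
    intro z hz θ
    have h1 := (hk.hasDerivAt_coneExt_rotPair z (θ + Real.pi / 2) (hz _).1).comp_add_const θ
      (Real.pi / 2)
    simpa only [hrot] using h1
  have h := gauss_wirtinger (by positivity : 0 < Real.pi / 2) (E := E)
    (Φ := fun z => coneExt k z.1 - coneExt k z.2)
    (Ψ := fun z => inner ℝ (coneGrad k z.1) z.2 + inner ℝ (coneGrad k z.2) z.1)
    (hm1.sub hm2) (hg1.add hg2) (by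
      filter_upwards [ae_rotPair_ne_zero hd] with z hz
      refine ⟨fun θ => ?_, ?_, fun θ => ?_⟩
      · refine ((hk.hasDerivAt_coneExt_rotPair z θ (hz θ).1).sub (hd2 z hz θ)).congr_deriv ?_
        rw [inner_neg_right, sub_neg_eq_add]
      · refine continuous_iff_continuousAt.2 fun θ => ContinuousAt.add
          (ContinuousAt.inner (𝕜 := ℝ) ?_ ?_) (ContinuousAt.inner (𝕜 := ℝ) ?_ ?_)
        · exact (hk.continuousAt_coneGrad (hz θ).1).comp (f := fun θ => (rotPair θ z).1)
            (by unfold rotPair; fun_prop)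
        · unfold rotPair; fun_prop
        · exact (hk.continuousAt_coneGrad (hz θ).2).comp (f := fun θ => (rotPair θ z).2)
            (by unfold rotPair; fun_prop)
        · unfold rotPair; fun_prop
      · simp only [hrot, coneExt, heven, norm_neg]
        ring)
  have h4 : (Real.pi / (Real.pi / 2)) ^ 2 = 4 := by
    have := Real.pi_ne_zero
    field_simp
    norm_num
  obtain ⟨hi1, hv1⟩ := hk.gauss_coneExt
  obtain ⟨hi2, hv2⟩ := hk.gauss_coneExt_sq
  rw [hmean, mul_zero] at hv1
  -- By (A + B)² ≤ 2A² + 2B², where the two squares have the same integral because x and y may be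
  -- exchanged.
  have hΨ : ∫⁻ z, ENNReal.ofReal ((inner ℝ (coneGrad k z.1) z.2 + inner ℝ (coneGrad k z.2) z.1) ^ 2)
      ∂(gauss E).prod (gauss E)
      ≤ ENNReal.ofReal (4 * ((gauss E).real univ * ∫ x, ‖coneGrad k x‖ ^ 2 ∂gauss E)) := by
    have hswap : ∫⁻ z, ENNReal.ofReal (inner ℝ (coneGrad k z.2) z.1 ^ 2)
        ∂(gauss E).prod (gauss E)
        = ENNReal.ofReal ((gauss E).real univ * ∫ x, ‖coneGrad k x‖ ^ 2 ∂gauss E) := by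
      rw [← hk.lintegral_inner_coneGrad, ← Measure.measurePreserving_swap.lintegral_comp
        ((hg1.pow_const 2).ennreal_ofReal)]
      rfl
    calc _ ≤ ∫⁻ z, (ENNReal.ofReal 2 * ENNReal.ofReal (inner ℝ (coneGrad k z.1) z.2 ^ 2)
          + ENNReal.ofReal 2 * ENNReal.ofReal (inner ℝ (coneGrad k z.2) z.1 ^ 2))
          ∂(gauss E).prod (gauss E) := by
          refine lintegral_mono fun z => ?_
          rw [← ENNReal.ofReal_mul (by norm_num), ← ENNReal.ofReal_mul (by norm_num),
            ← ENNReal.ofReal_add (by positivity) (by positivity)]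
          refine ENNReal.ofReal_le_ofReal ?_
          nlinarith [sq_nonneg (inner ℝ (coneGrad k z.1) z.2 - inner ℝ (coneGrad k z.2) z.1)]
      _ = _ := by
          have hZ := gauss_real_univ_pos (E := E)
          have hI : 0 ≤ ∫ x, ‖coneGrad k x‖ ^ 2 ∂gauss E := integral_nonneg fun _ => sq_nonneg _
          rw [lintegral_add_left ((hg1.pow_const 2).ennreal_ofReal.const_mul _),
            lintegral_const_mul _ (hg1.pow_const 2).ennreal_ofReal,
            lintegral_const_mul _ (hg2.pow_const 2).ennreal_ofReal,
            hswap, hk.lintegral_inner_coneGrad, ← ENNReal.ofReal_mul (by norm_num),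
            ← ENNReal.ofReal_add (by positivity) (by positivity)]
          congr 1
          ring
  have hΦ : ∫⁻ z, ENNReal.ofReal ((coneExt k z.1 - coneExt k z.2) ^ 2) ∂(gauss E).prod (gauss E)
      = ENNReal.ofReal (2 * ((gauss E).real univ * ∫ x, coneExt k x ^ 2 ∂gauss E)) := by
    have e : (fun z : E × E => (coneExt k z.1 - coneExt k z.2) ^ 2) = fun z =>
        (coneExt k z.1 ^ 2 * 1 - 2 * (coneExt k z.1 * coneExt k z.2)) + 1 * coneExt k z.2 ^ 2 := by
      ext z; ring
    have j1 : Integrable (fun z : E × E => coneExt k z.1 ^ 2 * (1:ℝ)) ((gauss E).prod (gauss E)) :=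
      hi2.mul_prod (integrable_const 1)
    have j2 : Integrable (fun z : E × E => 2 * (coneExt k z.1 * coneExt k z.2))
      ((gauss E).prod (gauss E)) := (hi1.mul_prod hi1).const_mul 2
    have j3 : Integrable (fun z : E × E => (1:ℝ) * coneExt k z.2 ^ 2) ((gauss E).prod (gauss E)) :=
      (integrable_const 1).mul_prod hi2
    have j12 : Integrable (fun z : E × E => coneExt k z.1 ^ 2 * (1:ℝ) -
      2 * (coneExt k z.1 * coneExt k z.2)) ((gauss E).prod (gauss E)) := j1.sub j2
    rw [← ofReal_integral_eq_lintegral_ofReal (by rw [e]; exact j12.add j3)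
      (ae_of_all _ fun _ => sq_nonneg _), e, integral_add j12 j3, integral_sub j1 j2,
      integral_const_mul, integral_prod_mul (fun x => coneExt k x ^ 2) (fun _ : E => (1:ℝ)),
      integral_prod_mul (fun _ : E => (1:ℝ)) (fun x => coneExt k x ^ 2),
      integral_prod_mul (coneExt k) (coneExt k), hv1]
    congr 1
    simp
    ring
  have hZ := gauss_real_univ_pos (E := E)
  have hI2 : 0 ≤ ∫ x, coneExt k x ^ 2 ∂gauss E := integral_nonneg fun _ => sq_nonneg _
  have hI : 0 ≤ ∫ x, ‖coneGrad k x‖ ^ 2 ∂gauss E := integral_nonneg fun _ => sq_nonneg _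
  have hfin := (h.trans hΨ)
  rw [hΦ, h4, ← ENNReal.ofReal_mul (by norm_num), ENNReal.ofReal_le_ofReal_iff (by positivity)]
    at hfin
  have h' : 2 * ∫ x, coneExt k x ^ 2 ∂gauss E ≤ ∫ x, ‖coneGrad k x‖ ^ 2 ∂gauss E := by
    refine le_of_mul_le_mul_left (a := (gauss E).real univ) ?_ hZ
    linarith
  rw [hv2, hk.gauss_coneGrad_sq.2] at h'
  have hm := halfMoment_pos (Module.finrank ℝ E - 1)
  have h'' : halfMoment (Module.finrank ℝ E - 1) * (2 * Module.finrank ℝ E *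
      ∫ u : Metric.sphere (0 : E) 1, k u ^ 2 ∂(volume : Measure E).toSphere) ≤
      halfMoment (Module.finrank ℝ E - 1) *
      ((∫ u : Metric.sphere (0 : E) 1, k u ^ 2 ∂(volume : Measure E).toSphere) +
      ∫ u : Metric.sphere (0 : E) 1, ‖gradient k (u : E)‖ ^ 2 ∂(volume : Measure E).toSphere) := by
    linarith
  have h3 := le_of_mul_le_mul_left h'' hm
  have hA : 0 ≤ ∫ u : Metric.sphere (0 : E) 1, k u ^ 2 ∂(volume : Measure E).toSphere :=
    integral_nonneg fun _ => sq_nonneg _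
  -- The average gives 2d ∫ k² ≤ ∫ k² + ∫ |∇k|², that is, the constant 2d − 1, which is more than d
  -- − 1. Even functions are not the extremal ones.
  nlinarith [mul_nonneg (Nat.cast_nonneg (Module.finrank ℝ E) : (0:ℝ) ≤ _) hA]

end IsHomogeneousC1

end Poincare2

end Steklov

end

/-! ### The sharp Poincaré inequality on the unit sphere -/

noncomputable section

namespace Steklov

open MeasureTheory Set Filter Topology

section Poincare3

variable {E : Type*} [NormedAddCommGroup E] [InnerProductSpace ℝ E] [FiniteDimensional ℝ E]
  [MeasurableSpace E] [BorelSpace E]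

theorem integrable_toSphere {F : Type*} [NormedAddCommGroup F]
    {b : Metric.sphere (0 : E) 1 → F} (hb : Continuous b) :
    Integrable b (volume : Measure E).toSphere :=
  hb.integrable_of_hasCompactSupport (HasCompactSupport.of_compactSpace _)

/-- Extending b to be constant along rays turns the claim into the invariance of the Gaussian
measure under x ↦ −x. -/
theorem integral_toSphere_neg [Nontrivial E] {b : E → ℝ}
    (hb : Continuous fun u : Metric.sphere (0 : E) 1 => b u) :
    ∫ u : Metric.sphere (0 : E) 1, b (-(u : E)) ∂(volume : Measure E).toSphere
      = ∫ u : Metric.sphere (0 : E) 1, b u ∂(volume : Measure E).toSphere := by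
  have hb' : Continuous fun u : Metric.sphere (0 : E) 1 => b (-(u : E)) :=
    hb.comp (continuous_neg (G := Metric.sphere (0 : E) 1))
  have h : ∀ (r : ℝ), 0 < r → ∀ u : Metric.sphere (0 : E) 1, ‖r • (u : E)‖⁻¹ • r • (u : E) = u := by
    intro r hr u
    rw [norm_smul, Real.norm_of_nonneg hr.le, norm_eq_of_mem_sphere, mul_one, smul_smul,
      inv_mul_cancel₀ hr.ne', one_smul]
  have h1 := (gauss_polar (Φ := fun x : E => b (‖x‖⁻¹ • x)) hb (j := 0)
    (fun r hr u => by simp only [h r hr u, pow_zero, one_mul])).2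
  have h2 := (gauss_polar (Φ := fun x : E => b (-(‖x‖⁻¹ • x))) hb' (j := 0)
    (fun r hr u => by simp only [h r hr u, pow_zero, one_mul])).2
  have h3 := (measurePreserving_gauss (LinearIsometryEquiv.neg ℝ (E := E))).integral_comp
    (LinearIsometryEquiv.neg ℝ (E := E)).toHomeomorph.measurableEmbedding
    (fun x : E => b (‖x‖⁻¹ • x))
  simp only [LinearIsometryEquiv.coe_neg, norm_neg, smul_neg] at h3
  rw [h1, h2] at h3
  exact mul_left_cancel₀ (halfMoment_pos _).ne' h3

theorem gradient_comp_neg (k : E → ℝ) (x : E) :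
    gradient (fun y => k (-y)) x = -gradient k (-x) := by
  have h : fderiv ℝ (fun y => k (-y)) x = -fderiv ℝ k (-x) := by
    simpa using fderiv_comp_smul (𝕜 := ℝ) (f := k) (-1) (x := x)
  rw [gradient, gradient, h, map_neg]

namespace IsHomogeneousC1

variable {k : E → ℝ}

theorem integrable_sq (hk : IsHomogeneousC1 k) :
    Integrable (fun u : Metric.sphere (0 : E) 1 => k u ^ 2) (volume : Measure E).toSphere :=
  integrable_toSphere (hk.continuous_sphere.pow 2)

theorem integrable_norm_gradient_sq (hk : IsHomogeneousC1 k) :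
    Integrable (fun u : Metric.sphere (0 : E) 1 => ‖gradient k (u : E)‖ ^ 2)
      (volume : Measure E).toSphere :=
  integrable_toSphere (hk.continuous_gradient_sphere.norm.pow 2)

theorem comp_neg (hk : IsHomogeneousC1 k) : IsHomogeneousC1 fun x => k (-x) where
  contDiffAt x hx := (hk.contDiffAt (-x) (neg_ne_zero.2 hx)).comp x contDiff_neg.contDiffAt
  smul_eq r x hr := by rw [← smul_neg]; exact hk.smul_eq r _ hr

theorem lin_comb (hk : IsHomogeneousC1 k) {l : E → ℝ} (hl : IsHomogeneousC1 l) (a b : ℝ) :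
    IsHomogeneousC1 fun x => a * k x + b * l x where
  contDiffAt x hx := (contDiffAt_const.mul (hk.contDiffAt x hx)).add
    (contDiffAt_const.mul (hl.contDiffAt x hx))
  smul_eq r x hr := by rw [hk.smul_eq r x hr, hl.smul_eq r x hr]

theorem gradient_lin_comb (hk : IsHomogeneousC1 k) {l : E → ℝ} (hl : IsHomogeneousC1 l) (a b : ℝ)
    {x : E} (hx : x ≠ 0) :
    gradient (fun x => a * k x + b * l x) x = a • gradient k x + b • gradient l x := by
  have h1 := ((hk.contDiffAt x hx).differentiableAt one_ne_zero)
  have h2 := ((hl.contDiffAt x hx).differentiableAt one_ne_zero)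
  rw [gradient, fderiv_fun_add (h1.const_mul a) (h2.const_mul b), fderiv_const_mul h1,
    fderiv_const_mul h2, map_add, map_smulₛₗ, map_smulₛₗ]
  rfl

/-- Split k into its odd and even parts. By the parallelogram identity and the antipodal symmetry of
the surface measure, both the squares and the squared gradients of the two parts add up to those of
k. -/
theorem poincare_of_mean_zero (hk : IsHomogeneousC1 k) (hd : 2 ≤ Module.finrank ℝ E)
    (hmean : ∫ u : Metric.sphere (0 : E) 1, k u ∂(volume : Measure E).toSphere = 0) :
    ((Module.finrank ℝ E : ℝ) - 1) *
      ∫ u : Metric.sphere (0 : E) 1, k u ^ 2 ∂(volume : Measure E).toSphere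
      ≤ ∫ u : Metric.sphere (0 : E) 1, ‖gradient k (u : E)‖ ^ 2 ∂(volume : Measure E).toSphere := by
  have : Nontrivial E := Module.nontrivial_of_finrank_pos (R := ℝ) (by omega)
  have hn := hk.comp_neg
  have ho := hk.lin_comb hn (1 / 2) (-(1 / 2))
  have he := hk.lin_comb hn (1 / 2) (1 / 2)
  have i1 := integrable_toSphere (hk.continuous_sphere)
  have i2 := integrable_toSphere (hn.continuous_sphere)
  have ho' := ho.poincare_of_odd hd (fun x => by rw [neg_neg]; ring)
  have he' := he.poincare_of_even hd (fun x => by rw [neg_neg]; ring) (by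
    rw [integral_add (i1.const_mul _) (i2.const_mul _), integral_const_mul, integral_const_mul,
      integral_toSphere_neg hk.continuous_sphere, hmean]
    simp)
  have hsq : (∫ u : Metric.sphere (0 : E) 1, (1 / 2 * k u + -(1 / 2) * k (-(u : E))) ^ 2
        ∂(volume : Measure E).toSphere) +
      ∫ u : Metric.sphere (0 : E) 1, (1 / 2 * k u + 1 / 2 * k (-(u : E))) ^ 2
        ∂(volume : Measure E).toSphere
      = ∫ u : Metric.sphere (0 : E) 1, k u ^ 2 ∂(volume : Measure E).toSphere := by
    rw [← integral_add ho.integrable_sq he.integrable_sq]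
    have h1 : ∀ u : Metric.sphere (0 : E) 1, (1 / 2 * k u + -(1 / 2) * k (-(u : E))) ^ 2 +
        (1 / 2 * k u + 1 / 2 * k (-(u : E))) ^ 2 = 1 / 2 * k u ^ 2 + 1 / 2 * k (-(u : E)) ^ 2 := by
      intro u; ring
    simp only [h1]
    rw [integral_add (hk.integrable_sq.const_mul _) (hn.integrable_sq.const_mul _), integral_const_mul,
      integral_const_mul, integral_toSphere_neg (b := fun x => k x ^ 2) (hk.continuous_sphere.pow 2)]
    ring
  have hgr : (∫ u : Metric.sphere (0 : E) 1,
        ‖gradient (fun x => 1 / 2 * k x + -(1 / 2) * k (-x)) (u : E)‖ ^ 2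
        ∂(volume : Measure E).toSphere) +
      ∫ u : Metric.sphere (0 : E) 1,
        ‖gradient (fun x => 1 / 2 * k x + 1 / 2 * k (-x)) (u : E)‖ ^ 2
        ∂(volume : Measure E).toSphere
      = ∫ u : Metric.sphere (0 : E) 1, ‖gradient k (u : E)‖ ^ 2 ∂(volume : Measure E).toSphere := by
    rw [← integral_add ho.integrable_norm_gradient_sq he.integrable_norm_gradient_sq]
    have h1 : ∀ u : Metric.sphere (0 : E) 1,
        ‖gradient (fun x => 1 / 2 * k x + -(1 / 2) * k (-x)) (u : E)‖ ^ 2 +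
        ‖gradient (fun x => 1 / 2 * k x + 1 / 2 * k (-x)) (u : E)‖ ^ 2
        = 1 / 2 * ‖gradient k (u : E)‖ ^ 2 + 1 / 2 * ‖gradient k (-(u : E))‖ ^ 2 := by
      intro u
      have hu := ne_zero_of_mem_unit_sphere u
      rw [hk.gradient_lin_comb hn _ _ hu, hk.gradient_lin_comb hn _ _ hu, gradient_comp_neg]
      simp only [← real_inner_self_eq_norm_sq, inner_add_left, inner_add_right,
        real_inner_smul_left, real_inner_smul_right, inner_neg_left, inner_neg_right,
        real_inner_comm (gradient k (u : E)) (gradient k (-(u : E)))]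
      ring
    simp only [h1]
    have hc : Continuous fun u : Metric.sphere (0 : E) 1 => ‖gradient k (u : E)‖ ^ 2 :=
      hk.continuous_gradient_sphere.norm.pow 2
    have hc' : Continuous fun u : Metric.sphere (0 : E) 1 => ‖gradient k (-(u : E))‖ ^ 2 :=
      hc.comp (continuous_neg (G := Metric.sphere (0 : E) 1))
    rw [integral_add ((integrable_toSphere hc).const_mul _)
      ((integrable_toSphere hc').const_mul _), integral_const_mul,
      integral_const_mul, integral_toSphere_neg (b := fun x => ‖gradient k x‖ ^ 2) hc]
    ring
  rw [← hsq, ← hgr, mul_add]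
  exact add_le_add ho' he'

/-- The Poincaré inequality on the unit sphere, with the sharp constant. -/
theorem poincare (hk : IsHomogeneousC1 k) (hd : 1 ≤ Module.finrank ℝ E) :
    ((Module.finrank ℝ E : ℝ) - 1) *
      ((volume : Measure E).toSphere.real univ *
        ∫ u : Metric.sphere (0 : E) 1, k u ^ 2 ∂(volume : Measure E).toSphere -
        (∫ u : Metric.sphere (0 : E) 1, k u ∂(volume : Measure E).toSphere) ^ 2)
      ≤ (volume : Measure E).toSphere.real univ *
        ∫ u : Metric.sphere (0 : E) 1, ‖gradient k (u : E)‖ ^ 2 ∂(volume : Measure E).toSphere := by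
  have : Nontrivial E := Module.nontrivial_of_finrank_pos (R := ℝ) (by omega)
  have hS := toSphere_real_univ_pos (E := E)
  -- In dimension one the sphere consists of two points and the constant is zero, so there is
  -- nothing to prove. This is the case m = 0 of the main theorem.
  rcases hd.eq_or_lt with hd | hd
  · rw [← hd]
    have : 0 ≤ ∫ u : Metric.sphere (0 : E) 1, ‖gradient k (u : E)‖ ^ 2
      ∂(volume : Measure E).toSphere := integral_nonneg fun _ => sq_nonneg _
    simp only [Nat.cast_one, sub_self, zero_mul]
    positivity
  set S := (volume : Measure E).toSphere.real univ with hSdef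
  set m := ∫ u : Metric.sphere (0 : E) 1, k u ∂(volume : Measure E).toSphere with hm
  have h1 : IsHomogeneousC1 fun _ : E => (1 : ℝ) := ⟨fun _ _ => contDiffAt_const, fun _ _ _ => rfl⟩
  -- Subtracting the mean m / S reduces to mean zero and does not change the gradient.
  have hl := hk.lin_comb h1 1 (-(m / S))
  have i1 := integrable_toSphere (hk.continuous_sphere)
  have i2 := hk.integrable_sq
  have hp := hl.poincare_of_mean_zero hd (by
    rw [integral_add (i1.const_mul _) (integrable_const _), integral_const_mul, ← hm]
    simp only [mul_one, one_mul, integral_const, smul_eq_mul]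
    rw [← hSdef]
    field_simp
    ring)
  have e1 : ∀ u : Metric.sphere (0 : E) 1, gradient (fun x => 1 * k x + -(m / S) * 1) (u : E)
      = gradient k (u : E) := by
    intro u
    have : gradient (fun _ : E => (1:ℝ)) (u : E) = 0 := by simp [gradient]
    rw [hk.gradient_lin_comb h1 _ _ (ne_zero_of_mem_unit_sphere u), this]
    simp
  have e2 : ∀ u : Metric.sphere (0 : E) 1, (1 * k u + -(m / S) * 1) ^ 2 =
      k u ^ 2 + (-(2 * (m / S)) * k u + (m / S) ^ 2) := by intro u; ring
  have i3 : Integrable (fun u : Metric.sphere (0 : E) 1 => -(2 * (m / S)) * k u + (m / S) ^ 2)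
      (volume : Measure E).toSphere := (i1.const_mul _).add (integrable_const _)
  simp only [e1, e2] at hp
  rw [integral_add i2 i3, integral_add (i1.const_mul _) (integrable_const _), integral_const_mul,
    ← hm, integral_const, smul_eq_mul, ← hSdef] at hp
  have hp2 := mul_le_mul_of_nonneg_left hp hS.le
  refine le_trans (le_of_eq ?_) hp2
  field_simp
  ring

end IsHomogeneousC1

end Poincare3

end Steklov

end

noncomputable section

namespace Steklov

open MeasureTheory Set Filter Topology

/-! ### The radial part of the spectral gap of a geodesic ball -/

/-- `∫₀ʳ sinᵐ`. -/
def sinVol (m : ℕ) (r : ℝ) : ℝ := ∫ x in (0:ℝ)..r, Real.sin x ^ m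

/-- The first nonzero Steklov eigenvalue of a geodesic ball of radius `r` in `Sᵐ⁺¹`. -/
def ballEigenvalue (m : ℕ) (r : ℝ) : ℝ :=
  Real.sin r ^ m / sinVol m r - m * (Real.cos r / Real.sin r)

theorem hasDerivAt_sinVol (m : ℕ) (r : ℝ) : HasDerivAt (sinVol m) (Real.sin r ^ m) r := by
  have hc : Continuous fun x : ℝ => Real.sin x ^ m := by fun_prop
  exact intervalIntegral.integral_hasDerivAt_right (hc.intervalIntegrable _ _)
    (hc.stronglyMeasurableAtFilter _ _) hc.continuousAt

/-- Jordan's inequality sin x ≥ 2x/π under the integral. It serves to show that κ(r) is O(1/r) at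
the centre. -/
theorem sinVol_ge (m : ℕ) {r : ℝ} (h0 : 0 ≤ r) (h1 : r ≤ Real.pi / 2) :
    (2 / Real.pi) ^ m * (r ^ (m + 1) / (m + 1)) ≤ sinVol m r := by
  have : ∫ x in (0:ℝ)..r, (2 / Real.pi * x) ^ m = (2 / Real.pi) ^ m * (r ^ (m + 1) / (m + 1)) := by
    simp only [mul_pow]
    rw [intervalIntegral.integral_const_mul, integral_pow]
    simp
  rw [← this, sinVol]
  refine intervalIntegral.integral_mono_on h0 (Continuous.intervalIntegrable (by fun_prop) _ _)
    (Continuous.intervalIntegrable (by fun_prop) _ _) fun x hx => ?_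
  have := Real.mul_le_sin hx.1 (hx.2.trans h1)
  have hx0 := hx.1
  gcongr

theorem sinVol_pos (m : ℕ) {r : ℝ} (h0 : 0 < r) (h1 : r ≤ Real.pi / 2) : 0 < sinVol m r :=
  lt_of_lt_of_le (by positivity) (sinVol_ge m h0.le h1)

theorem sin_pos_of_le_pi_div_two {r : ℝ} (h0 : 0 < r) (h1 : r ≤ Real.pi / 2) : 0 < Real.sin r :=
  Real.sin_pos_of_pos_of_lt_pi h0 (by linarith [Real.pi_pos])

theorem cos_nonneg_of_le_pi_div_two {r : ℝ} (h0 : 0 ≤ r) (h1 : r ≤ Real.pi / 2) :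
    0 ≤ Real.cos r :=
  Real.cos_nonneg_of_neg_pi_div_two_le_of_le (by linarith) h1

theorem hasDerivAt_sin_pow {m : ℕ} {r : ℝ} (hs : Real.sin r ≠ 0) :
    HasDerivAt (fun r => Real.sin r ^ m) (m * Real.sin r ^ m * (Real.cos r / Real.sin r)) r := by
  refine ((Real.hasDerivAt_sin r).pow m).congr_deriv ?_
  rcases m with _ | m
  · simp
  · simp only [Nat.add_sub_cancel, pow_succ]
    field_simp

/-- Riccati form of the radial equation φ'' + m cot · φ' − (m / sin²) φ = 0 for φ = W / sin^m, whose
logarithmic derivative is κ. The factor sin^m absorbs the first order term. -/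
theorem hasDerivAt_ballEigenvalue_mul (m : ℕ) {r : ℝ} (h0 : 0 < r) (h1 : r ≤ Real.pi / 2) :
    HasDerivAt (fun r => ballEigenvalue m r * Real.sin r ^ m)
      (Real.sin r ^ m * (m / Real.sin r ^ 2 - ballEigenvalue m r ^ 2)) r := by
  have hs := sin_pos_of_le_pi_div_two h0 h1
  have hW := sinVol_pos m h0 h1
  have hp := hasDerivAt_sin_pow (m := m) hs.ne'
  have h := (((hp.div (hasDerivAt_sinVol m r) hW.ne').sub
    (((Real.hasDerivAt_cos r).div (Real.hasDerivAt_sin r) hs.ne').const_mul (m:ℝ))).mul hp)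
  refine h.congr_deriv ?_
  simp only [ballEigenvalue, Pi.sub_apply, Pi.div_apply]
  have hsc : Real.cos r ^ 2 = 1 - Real.sin r ^ 2 := by linarith [Real.sin_sq_add_cos_sq r]
  field_simp
  ring_nf
  simp only [hsc]
  ring

/-- After clearing denominators the numerator is sin^{m+1} − m cos · W. It vanishes at 0, and its
derivative cos · sin^m + m sin · W is positive before π/2. -/
theorem ballEigenvalue_pos (m : ℕ) {r : ℝ} (h0 : 0 < r) (h1 : r ≤ Real.pi / 2) :
    0 < ballEigenvalue m r := by
  have hs := sin_pos_of_le_pi_div_two h0 h1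
  have hW := sinVol_pos m h0 h1
  have key : 0 < Real.sin r ^ (m + 1) - m * Real.cos r * sinVol m r := by
    set g : ℝ → ℝ := fun x => Real.sin x ^ (m + 1) - m * Real.cos x * sinVol m x with hg
    have hd : ∀ x, HasDerivAt g (Real.cos x * Real.sin x ^ m + m * Real.sin x * sinVol m x) x := by
      intro x
      refine (((Real.hasDerivAt_sin x).pow (m + 1)).sub
        (((Real.hasDerivAt_cos x).const_mul (m:ℝ)).mul (hasDerivAt_sinVol m x))).congr_deriv ?_
      push_cast
      ring
    have hmono : StrictMonoOn g (Icc 0 r) := by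
      refine strictMonoOn_of_deriv_pos (convex_Icc 0 r)
        (continuous_iff_continuousAt.2 fun x => (hd x).continuousAt).continuousOn fun x hx => ?_
      rw [interior_Icc] at hx
      rw [(hd x).deriv]
      have hx2 : x < Real.pi / 2 := hx.2.trans_le h1
      have h3 := sin_pos_of_le_pi_div_two hx.1 hx2.le
      have h4 := sinVol_pos m hx.1 hx2.le
      have h5 : 0 < Real.cos x := Real.cos_pos_of_mem_Ioo ⟨by linarith [hx.1, Real.pi_pos], hx2⟩
      positivity
    have := hmono ⟨le_rfl, h0.le⟩ ⟨h0.le, le_rfl⟩ h0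
    simpa [hg, sinVol] using this
  have : ballEigenvalue m r = (Real.sin r ^ (m + 1) - m * Real.cos r * sinVol m r) /
      (Real.sin r * sinVol m r) := by
    rw [ballEigenvalue]
    field_simp
    ring
  rw [this]
  positivity

/-- A bound near the origin for the boundary term of the radial inequality. -/
theorem exists_ballEigenvalue_mul_le (m : ℕ) : ∃ C, 0 ≤ C ∧ ∀ r, 0 < r → r ≤ Real.pi / 2 →
    ballEigenvalue m r * Real.sin r ^ m * r ^ 2 ≤ C * r := by
  refine ⟨(Real.pi / 2) ^ m * (m + 1) * (Real.pi / 2) ^ m, by positivity, fun r h0 h1 => ?_⟩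
  have hs := sin_pos_of_le_pi_div_two h0 h1
  have hW := sinVol_pos m h0 h1
  have hc := cos_nonneg_of_le_pi_div_two h0.le h1
  have e1 : ballEigenvalue m r ≤ Real.sin r ^ m / sinVol m r := by
    have : 0 ≤ m * (Real.cos r / Real.sin r) := by positivity
    rw [ballEigenvalue]; linarith
  have e2 : Real.sin r ^ m / sinVol m r ≤
      r ^ m / ((2 / Real.pi) ^ m * (r ^ (m + 1) / (m + 1))) := by
    gcongr
    · exact (Real.sin_lt h0).le
    · exact sinVol_ge m h0.le h1
  have e3 : Real.sin r ^ m ≤ r ^ m := by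
    have := (Real.sin_lt h0).le
    gcongr
  have e4 : 0 ≤ r ^ m / ((2 / Real.pi) ^ m * (r ^ (m + 1) / (m + 1))) := by positivity
  calc ballEigenvalue m r * Real.sin r ^ m * r ^ 2
      ≤ r ^ m / ((2 / Real.pi) ^ m * (r ^ (m + 1) / (m + 1))) * r ^ m * r ^ 2 := by
        have := e1.trans e2
        gcongr
    _ = (Real.pi / 2) ^ m * (m + 1) * r ^ m * r := by
        rw [div_pow, div_pow, pow_succ]
        field_simp
    _ ≤ _ := by gcongr

/-- The radial inequality: completing the square with the logarithmic derivative of the radial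
part of the first eigenfunctions of the ball. -/
theorem radial_inequality (m : ℕ) {ρ : ℝ} (hρ : 0 < ρ) (hρ2 : ρ ≤ Real.pi / 2) {D D' : ℝ → ℝ}
    {ε : ℝ} (hε : 0 < ε) (hε1 : ε < 1) (hD : ∀ s ∈ Icc ε 1, HasDerivAt D (D' s) s)
    (hD' : ContinuousOn D' (Icc ε 1)) :
    ballEigenvalue m ρ * Real.sin ρ ^ m * D 1 ^ 2 -
      ballEigenvalue m (ε * ρ) * Real.sin (ε * ρ) ^ m * D ε ^ 2 ≤
    ∫ s in ε..1, (D' s ^ 2 / ρ ^ 2 + m * D s ^ 2 / Real.sin (s * ρ) ^ 2) *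
      (Real.sin (s * ρ) ^ m * ρ) := by
  have hr : ∀ s ∈ Icc ε 1, 0 < s * ρ ∧ s * ρ ≤ Real.pi / 2 := fun s hs => by
    have hs0 : 0 < s := hε.trans_le hs.1
    exact ⟨by positivity, le_trans (mul_le_of_le_one_left hρ.le hs.2) hρ2⟩
  have hDc : ContinuousOn D (Icc ε 1) := fun s hs => (hD s hs).continuousAt.continuousWithinAt
  -- By the Riccati equation, the integrand minus the derivative of κ sin^m D² is sin^m · ρ (D'/ρ −
  -- κD)², which is nonnegative.
  have hw : ∀ s ∈ Icc ε 1, HasDerivAt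
      (fun s => ballEigenvalue m (s * ρ) * Real.sin (s * ρ) ^ m * D s ^ 2)
      (Real.sin (s * ρ) ^ m * (m / Real.sin (s * ρ) ^ 2 - ballEigenvalue m (s * ρ) ^ 2) * ρ
        * D s ^ 2 + ballEigenvalue m (s * ρ) * Real.sin (s * ρ) ^ m * (2 * D s * D' s)) s := by
    intro s hs
    have h1 := hasDerivAt_ballEigenvalue_mul m (hr s hs).1 (hr s hs).2
    have h2 : HasDerivAt (fun s : ℝ => s * ρ) ρ s := by
      simpa using (hasDerivAt_id s).mul_const ρ
    refine ((h1.comp s h2).mul ((hD s hs).pow 2)).congr_deriv ?_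
    simp [Function.comp]
  have hint : ContinuousOn (fun s => (D' s ^ 2 / ρ ^ 2 + m * D s ^ 2 / Real.sin (s * ρ) ^ 2) *
      (Real.sin (s * ρ) ^ m * ρ)) (Icc ε 1) := by
    refine ContinuousOn.mul (ContinuousOn.add ((hD'.pow 2).div_const _) (ContinuousOn.div
      (continuousOn_const.mul (hDc.pow 2)) (by fun_prop) fun s hs => ?_)) (by fun_prop)
    exact pow_ne_zero 2 (sin_pos_of_le_pi_div_two (hr s hs).1 (hr s hs).2).ne'
  have := intervalIntegral.sub_le_integral_of_hasDeriv_right_of_le hε1.le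
    (fun s hs => (hw s hs).continuousAt.continuousWithinAt)
    (fun s hs => (hw s ⟨hs.1.le, hs.2.le⟩).hasDerivWithinAt)
    hint.integrableOn_Icc (fun s hs => ?_)
  · simpa using this
  · have hs' : s ∈ Icc ε 1 := ⟨hs.1.le, hs.2.le⟩
    have hsin := sin_pos_of_le_pi_div_two (hr s hs').1 (hr s hs').2
    have key : (D' s ^ 2 / ρ ^ 2 + m * D s ^ 2 / Real.sin (s * ρ) ^ 2) * (Real.sin (s * ρ) ^ m * ρ)
        - (Real.sin (s * ρ) ^ m * (m / Real.sin (s * ρ) ^ 2 - ballEigenvalue m (s * ρ) ^ 2) * ρ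
        * D s ^ 2 + ballEigenvalue m (s * ρ) * Real.sin (s * ρ) ^ m * (2 * D s * D' s))
        = Real.sin (s * ρ) ^ m * ρ * (D' s / ρ - ballEigenvalue m (s * ρ) * D s) ^ 2 := by
      field_simp
      ring
    have : 0 ≤ Real.sin (s * ρ) ^ m * ρ * (D' s / ρ - ballEigenvalue m (s * ρ) * D s) ^ 2 := by
      positivity
    linarith

end Steklov

end

/-! ### The spectral gap of a geodesic ball -/

noncomputable section

namespace Steklov

open MeasureTheory Set Filter Topology

section Ball

theorem integrable_prod_of_continuousOn {Z F : Type*} [TopologicalSpace Z] [CompactSpace Z]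
    [SecondCountableTopology Z] [MeasurableSpace Z] [BorelSpace Z] [NormedAddCommGroup F]
    [T2Space Z]
    {ν : Measure Z} [IsFiniteMeasure ν] {a b : ℝ} {f : ℝ × Z → F}
    (hf : ContinuousOn f (Icc a b ×ˢ univ)) :
    Integrable f ((volume.restrict (Icc a b)).prod ν) := by
  have h : (volume.restrict (Icc a b)).prod ν = (volume.prod ν).restrict (Icc a b ×ˢ univ) := by
    rw [← Measure.prod_restrict, Measure.restrict_univ]
  rw [h]
  have : ContinuousOn f (Icc a b ×ˢ univ) → IntegrableOn f (Icc a b ×ˢ univ) (volume.prod ν) :=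
    fun hf => hf.integrableOn_compact (isCompact_Icc.prod isCompact_univ)
  exact this hf

variable {E : Type*} [NormedAddCommGroup E] [InnerProductSpace ℝ E] [FiniteDimensional ℝ E]
  [MeasurableSpace E] [BorelSpace E]

/-- Averaging over pairs of points of the sphere. -/
theorem integral_sub_sq_prod {b : Metric.sphere (0 : E) 1 → ℝ} (hb : Continuous b) :
    ∫ z, (b z.1 - b z.2) ^ 2 ∂((volume : Measure E).toSphere.prod (volume : Measure E).toSphere)
      = 2 * ((volume : Measure E).toSphere.real univ * ∫ u, b u ^ 2 ∂(volume : Measure E).toSphere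
        - (∫ u, b u ∂(volume : Measure E).toSphere) ^ 2) := by
  set σ := (volume : Measure E).toSphere
  have i1 : Integrable b σ := integrable_toSphere hb
  have i2 : Integrable (fun u => b u ^ 2) σ := integrable_toSphere (hb.pow 2)
  have e : ∀ z : Metric.sphere (0 : E) 1 × Metric.sphere (0 : E) 1, (b z.1 - b z.2) ^ 2 =
      (b z.1 ^ 2 * 1 - 2 * (b z.1 * b z.2)) + 1 * b z.2 ^ 2 := fun z => by ring
  have j1 : Integrable (fun z : Metric.sphere (0 : E) 1 × Metric.sphere (0 : E) 1 =>
    b z.1 ^ 2 * (1:ℝ)) (σ.prod σ) := i2.mul_prod (integrable_const 1)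
  have j2 : Integrable (fun z : Metric.sphere (0 : E) 1 × Metric.sphere (0 : E) 1 =>
    2 * (b z.1 * b z.2)) (σ.prod σ) := (i1.mul_prod i1).const_mul 2
  have j3 : Integrable (fun z : Metric.sphere (0 : E) 1 × Metric.sphere (0 : E) 1 =>
    (1:ℝ) * b z.2 ^ 2) (σ.prod σ) := (integrable_const 1).mul_prod i2
  have j12 : Integrable (fun z : Metric.sphere (0 : E) 1 × Metric.sphere (0 : E) 1 =>
    b z.1 ^ 2 * (1:ℝ) - 2 * (b z.1 * b z.2)) (σ.prod σ) := j1.sub j2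
  simp only [e]
  rw [integral_add j12 j3, integral_sub j1 j2,
      integral_const_mul, integral_prod_mul (fun x => b x ^ 2) (fun _ => (1:ℝ)),
      integral_prod_mul (fun _ => (1:ℝ)) (fun x => b x ^ 2),
      integral_prod_mul b b]
  simp
  ring

/-- The spectral gap of the geodesic ball of radius `ρ` in `Sᵐ⁺¹`, in geodesic polar coordinates
rescaled to `0 < s ≤ 1`, up to an error that vanishes at the centre. -/
theorem ball_spectral_gap {m : ℕ} (hdim : Module.finrank ℝ E = m + 1) {ρ : ℝ} (hρ : 0 < ρ)
    (hρ2 : ρ ≤ Real.pi / 2) {h h' : ℝ → E → ℝ}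
    (hhom : ∀ s ∈ Ioc (0:ℝ) 1, IsHomogeneousC1 (h s))
    (hderiv : ∀ s ∈ Icc (0:ℝ) 1, ∀ u : Metric.sphere (0 : E) 1,
      HasDerivAt (fun s => h s u) (h' s u) s)
    (hcont : ContinuousOn (fun q : ℝ × Metric.sphere (0 : E) 1 => h q.1 q.2) (Icc 0 1 ×ˢ univ))
    (hcont' : ContinuousOn (fun q : ℝ × Metric.sphere (0 : E) 1 => h' q.1 q.2) (Icc 0 1 ×ˢ univ))
    (hgrad : ContinuousOn (fun q : ℝ × Metric.sphere (0 : E) 1 => gradient (h q.1) (q.2 : E))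
      (Ioc 0 1 ×ˢ univ))
    (h0 : ∀ u v : Metric.sphere (0 : E) 1, h 0 u = h 0 v) :
    ∃ C, ∀ ε ∈ Ioo (0:ℝ) 1,
      ballEigenvalue m ρ * Real.sin ρ ^ m *
        ((volume : Measure E).toSphere.real univ *
            ∫ u : Metric.sphere (0 : E) 1, h 1 u ^ 2 ∂(volume : Measure E).toSphere
          - (∫ u : Metric.sphere (0 : E) 1, h 1 u ∂(volume : Measure E).toSphere) ^ 2) - C * ε ≤
      (volume : Measure E).toSphere.real univ *
        ∫ s in Icc ε 1, ∫ u : Metric.sphere (0 : E) 1,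
          (h' s u ^ 2 / ρ ^ 2 + ‖gradient (h s) (u : E)‖ ^ 2 / Real.sin (s * ρ) ^ 2) *
            (Real.sin (s * ρ) ^ m * ρ) ∂(volume : Measure E).toSphere := by
  set σ := (volume : Measure E).toSphere with hσ
  set S := σ.real univ with hS
  have hS0 : 0 ≤ S := measureReal_nonneg
  have hslice : ∀ {f : ℝ × Metric.sphere (0 : E) 1 → ℝ} {A : Set ℝ}, ContinuousOn f (A ×ˢ univ) →
      ∀ s ∈ A, Continuous fun u => f (s, u) := by
    intro f A hf s hs
    rw [← continuousOn_univ]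
    exact hf.comp (by fun_prop) fun u _ => ⟨hs, mem_univ _⟩
  -- the difference of the values at two points of the sphere
  obtain ⟨K, hK⟩ := (isCompact_Icc.prod isCompact_univ).exists_bound_of_continuousOn hcont'
  have hK0 : ∀ s ∈ Icc (0:ℝ) 1, ∀ u : Metric.sphere (0 : E) 1, |h' s u| ≤ K := fun s hs u =>
    hK (s, u) ⟨hs, mem_univ _⟩
  -- All rays start at one point, so the difference of the values on two rays vanishes at s = 0 and
  -- is O(s). This compensates the growth of κ at the centre.
  have hD0 : ∀ s ∈ Icc (0:ℝ) 1, ∀ u v : Metric.sphere (0 : E) 1,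
      |h s u - h s v| ≤ 2 * K * s := by
    intro s hs u v
    have := (convex_Icc (0:ℝ) 1).norm_image_sub_le_of_norm_hasDerivWithin_le
      (f := fun s => h s u - h s v) (f' := fun s => h' s u - h' s v) (C := 2 * K)
      (fun x hx => ((hderiv x hx u).sub (hderiv x hx v)).hasDerivWithinAt)
      (fun x hx => by
        have := abs_sub (h' x u) (h' x v)
        rw [Real.norm_eq_abs]
        linarith [hK0 x hx u, hK0 x hx v]) ⟨le_rfl, zero_le_one⟩ hs
    simpa [h0 u v, abs_of_nonneg hs.1] using this
  obtain ⟨C, hC0, hC⟩ := exists_ballEigenvalue_mul_le m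
  -- Each pair of rays contributes an inner boundary term of at most Cρ(2K/ρ)² ε. The set of pairs
  -- has mass S², and the factor 1/2 is there because the variance is half of the double integral of
  -- squared differences.
  refine ⟨1 / 2 * (C * ρ * (2 * K / ρ) ^ 2 * (S * S)), fun ε hε => ?_⟩
  have hsub : Icc ε 1 ⊆ Ioc (0:ℝ) 1 := fun s hs => ⟨hε.1.trans_le hs.1, hs.2⟩
  have hsub' : Icc ε 1 ⊆ Icc (0:ℝ) 1 := fun s hs => ⟨hε.1.le.trans hs.1, hs.2⟩
  have hsin : ∀ s ∈ Icc ε 1, 0 < Real.sin (s * ρ) := fun s hs =>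
    sin_pos_of_le_pi_div_two (mul_pos (hsub hs).1 hρ)
      ((mul_le_of_le_one_left hρ.le hs.2).trans hρ2)
  -- the two densities
  set F : ℝ × Metric.sphere (0 : E) 1 → ℝ := fun q =>
    (h' q.1 q.2 ^ 2 / ρ ^ 2 + ‖gradient (h q.1) (q.2 : E)‖ ^ 2 / Real.sin (q.1 * ρ) ^ 2) *
            (Real.sin (q.1 * ρ) ^ m * ρ) with hF
  set G : ℝ × (Metric.sphere (0 : E) 1 × Metric.sphere (0 : E) 1) → ℝ := fun q =>
    ((h' q.1 q.2.1 - h' q.1 q.2.2) ^ 2 / ρ ^ 2 +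
      m * (h q.1 q.2.1 - h q.1 q.2.2) ^ 2 / Real.sin (q.1 * ρ) ^ 2) *
            (Real.sin (q.1 * ρ) ^ m * ρ) with hG
  have hFc : ContinuousOn F (Icc ε 1 ×ˢ univ) := by
    refine ContinuousOn.mul (ContinuousOn.add (((hcont'.mono (prod_mono hsub' Subset.rfl)).pow
      2).div_const _) (ContinuousOn.div (((hgrad.mono (prod_mono hsub Subset.rfl)).norm).pow 2)
      (by fun_prop) fun q hq => pow_ne_zero 2 (hsin q.1 hq.1).ne')) (by fun_prop)
  have hproj : ∀ {f : ℝ × Metric.sphere (0 : E) 1 → ℝ},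
      ContinuousOn f (Icc 0 1 ×ˢ univ) → ContinuousOn (fun q : ℝ × (Metric.sphere (0 : E) 1 ×
        Metric.sphere (0 : E) 1) => f (q.1, q.2.1) - f (q.1, q.2.2)) (Icc ε 1 ×ˢ univ) := by
    intro f hf
    exact (hf.comp (by fun_prop) fun q hq => ⟨hsub' hq.1, mem_univ _⟩).sub
      (hf.comp (by fun_prop) fun q hq => ⟨hsub' hq.1, mem_univ _⟩)
  have hGc : ContinuousOn G (Icc ε 1 ×ˢ univ) := by
    refine ContinuousOn.mul (ContinuousOn.add (((hproj hcont').pow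
      2).div_const _) (ContinuousOn.div (continuousOn_const.mul ((hproj hcont).pow 2))
      (by fun_prop) fun q hq => pow_ne_zero 2 (hsin q.1 hq.1).ne')) (by fun_prop)
  have hFi : Integrable F ((volume.restrict (Icc ε 1)).prod σ) :=
    integrable_prod_of_continuousOn hFc
  have hGi : Integrable G ((volume.restrict (Icc ε 1)).prod (σ.prod σ)) :=
    integrable_prod_of_continuousOn hGc
  -- the Poincaré inequality on each sphere
  have hstep : ∀ s ∈ Icc ε 1, ∫ z, G (s, z) ∂(σ.prod σ) ≤ 2 * S * ∫ u, F (s, u) ∂σ := by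
    intro s hs
    have c1 := hslice hcont s (hsub' hs)
    have c2 := hslice hcont' s (hsub' hs)
    have c3 := ((hhom s (hsub hs)).continuous_gradient_sphere)
    have c3' : Continuous fun u : Metric.sphere (0 : E) 1 => ‖gradient (h s) (u : E)‖ ^ 2 :=
      c3.norm.pow 2
    have c2' : Continuous fun u : Metric.sphere (0 : E) 1 => h' s u ^ 2 := c2.pow 2
    have hP := (hhom s (hsub hs)).poincare (by omega)
    rw [hdim] at hP
    push_cast at hP
    rw [add_sub_cancel_right] at hP
    have e1 := integral_sub_sq_prod c1
    have e2 := integral_sub_sq_prod c2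
    simp only at e1 e2
    have cz : ∀ {b : Metric.sphere (0 : E) 1 → ℝ}, Continuous b →
        Integrable (fun z : Metric.sphere (0 : E) 1 × Metric.sphere (0 : E) 1 =>
          (b z.1 - b z.2) ^ 2) (σ.prod σ) := by
      intro b hb
      have : Continuous fun z : Metric.sphere (0 : E) 1 × Metric.sphere (0 : E) 1 =>
          (b z.1 - b z.2) ^ 2 := by fun_prop
      exact this.integrable_of_hasCompactSupport (HasCompactSupport.of_compactSpace _)
    have eG : ∫ z, G (s, z) ∂(σ.prod σ) = (2 * (S * ∫ u : Metric.sphere (0 : E) 1, h' s u ^ 2 ∂σ -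
        (∫ u : Metric.sphere (0 : E) 1, h' s u ∂σ) ^ 2) / ρ ^ 2 + m * (2 * (S *
          ∫ u : Metric.sphere (0 : E) 1, h s u ^ 2 ∂σ -
        (∫ u : Metric.sphere (0 : E) 1, h s u ∂σ) ^ 2)) / Real.sin (s * ρ) ^ 2) *
            (Real.sin (s * ρ) ^ m * ρ) := by
      rw [← e1, ← e2]
      simp only [hG]
      rw [integral_mul_const, integral_add ((cz c2).div_const _)
        (((cz c1).const_mul _).div_const _), integral_div, integral_div, integral_const_mul]
    have eF : ∫ u, F (s, u) ∂σ = ((∫ u : Metric.sphere (0 : E) 1, h' s u ^ 2 ∂σ) / ρ ^ 2 +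
        (∫ u : Metric.sphere (0 : E) 1, ‖gradient (h s) (u : E)‖ ^ 2 ∂σ) / Real.sin (s * ρ) ^ 2) *
            (Real.sin (s * ρ) ^ m * ρ) := by
      simp only [hF]
      rw [integral_mul_const, integral_add ((integrable_toSphere c2').div_const _)
        ((integrable_toSphere c3').div_const _), integral_div, integral_div]
    rw [eG, eF, ← mul_assoc (2 * S)]
    have hs0 := hsin s hs
    refine mul_le_mul_of_nonneg_right ?_ (show (0:ℝ) ≤ Real.sin (s * ρ) ^ m * ρ by positivity)
    rw [mul_add]
    refine add_le_add ?_ ?_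
    -- In the radial term the square of the mean of h' is simply dropped. The angular term is the
    -- Poincaré inequality.
    · rw [mul_div_assoc', div_le_div_iff_of_pos_right (show 0 < ρ ^ 2 by positivity)]
      nlinarith [sq_nonneg (∫ u : Metric.sphere (0 : E) 1, h' s u ∂σ)]
    · rw [mul_div_assoc', div_le_div_iff_of_pos_right (show 0 < Real.sin (s * ρ) ^ 2 by positivity)]
      linarith
  have hmono : ∫ s in Icc ε 1, ∫ z, G (s, z) ∂(σ.prod σ) ≤
      2 * S * ∫ s in Icc ε 1, ∫ u, F (s, u) ∂σ := by
    rw [← integral_const_mul]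
    exact setIntegral_mono_on hGi.integral_prod_left (hFi.integral_prod_left.const_mul _)
      measurableSet_Icc hstep
  have hswap : ∫ s in Icc ε 1, ∫ z, G (s, z) ∂(σ.prod σ)
      = ∫ z, (∫ s in Icc ε 1, G (s, z)) ∂(σ.prod σ) := integral_integral_swap hGi
  -- The one-dimensional inequality is applied to s ↦ h(s, u) − h(s, v) for every pair, so that no
  -- separate treatment of the spherical mean is needed.
  have hrad : ∀ z : Metric.sphere (0 : E) 1 × Metric.sphere (0 : E) 1,
      ballEigenvalue m ρ * Real.sin ρ ^ m * (h 1 z.1 - h 1 z.2) ^ 2 - C * ρ * (2 * K / ρ) ^ 2 * ε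
        ≤ ∫ s in Icc ε 1, G (s, z) := by
    intro z
    have hd' : ContinuousOn (fun s => h' s z.1 - h' s z.2) (Icc ε 1) :=
      (hproj hcont').comp (f := fun s : ℝ => (s, z)) (by fun_prop) fun s hs => ⟨hs, mem_univ _⟩
    have := radial_inequality m hρ hρ2 hε.1 hε.2 (D := fun s => h s z.1 - h s z.2)
      (D' := fun s => h' s z.1 - h' s z.2)
      (fun s hs => (hderiv s (hsub' hs) z.1).sub (hderiv s (hsub' hs) z.2)) hd'
    rw [intervalIntegral.integral_of_le hε.2.le, ← integral_Icc_eq_integral_Ioc] at this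
    refine le_trans ?_ this
    have hερ : ε * ρ ≤ Real.pi / 2 := (mul_le_of_le_one_left hρ.le hε.2.le).trans hρ2
    have b1 := hC (ε * ρ) (mul_pos hε.1 hρ) hερ
    have b2 : (h ε z.1 - h ε z.2) ^ 2 ≤ (2 * K * ε) ^ 2 := by
      have := hD0 ε ⟨hε.1.le, hε.2.le⟩ z.1 z.2
      exact sq_le_sq' (by linarith [neg_abs_le (h ε z.1 - h ε z.2)])
        (le_trans (le_abs_self _) this)
    have b3 : 0 ≤ ballEigenvalue m (ε * ρ) * Real.sin (ε * ρ) ^ m :=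
      mul_nonneg (ballEigenvalue_pos m (mul_pos hε.1 hρ) hερ).le
        (pow_nonneg (hsin ε ⟨le_rfl, hε.2.le⟩).le _)
    have b4 : ballEigenvalue m (ε * ρ) * Real.sin (ε * ρ) ^ m * (h ε z.1 - h ε z.2) ^ 2
        ≤ C * ρ * (2 * K / ρ) ^ 2 * ε := by
      calc _ ≤ ballEigenvalue m (ε * ρ) * Real.sin (ε * ρ) ^ m * (2 * K * ε) ^ 2 := by gcongr
        _ = (ballEigenvalue m (ε * ρ) * Real.sin (ε * ρ) ^ m * (ε * ρ) ^ 2) * (2 * K / ρ) ^ 2 := by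
          field_simp
        _ ≤ C * (ε * ρ) * (2 * K / ρ) ^ 2 := by gcongr
        _ = _ := by ring
    linarith
  have c11 := hslice hcont 1 ⟨zero_le_one, le_rfl⟩
  have hi1 : Integrable (fun z : Metric.sphere (0 : E) 1 × Metric.sphere (0 : E) 1 =>
      (h 1 z.1 - h 1 z.2) ^ 2) (σ.prod σ) := by
    have : Continuous fun z : Metric.sphere (0 : E) 1 × Metric.sphere (0 : E) 1 =>
        (h 1 z.1 - h 1 z.2) ^ 2 := ((c11.comp continuous_fst).sub (c11.comp continuous_snd)).pow 2
    exact this.integrable_of_hasCompactSupport (HasCompactSupport.of_compactSpace _)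
  have hi2 : Integrable (fun z : Metric.sphere (0 : E) 1 × Metric.sphere (0 : E) 1 =>
      ballEigenvalue m ρ * Real.sin ρ ^ m * (h 1 z.1 - h 1 z.2) ^ 2
        - C * ρ * (2 * K / ρ) ^ 2 * ε) (σ.prod σ) := (hi1.const_mul _).sub (integrable_const _)
  have hfin := integral_mono hi2 hGi.integral_prod_right hrad
  have e3 := integral_sub_sq_prod c11
  simp only at e3
  rw [integral_sub (hi1.const_mul _) (integrable_const _), integral_const_mul, e3, ← hswap] at hfin
  have hSS : (σ.prod σ).real univ = S * S := by
    rw [hS, ← univ_prod_univ, measureReal_prod_prod]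
  rw [integral_const, hSS, smul_eq_mul] at hfin
  have := hfin.trans hmono
  change _ ≤ S * ∫ s in Icc ε 1, ∫ u, F (s, u) ∂σ
  linarith

end Ball

end Steklov

end

/-! ### Derivatives of extensions that are constant along rays -/

noncomputable section

namespace Steklov

open MeasureTheory Set Filter Topology

section Calculus

variable {E : Type*} [NormedAddCommGroup E] [InnerProductSpace ℝ E]

theorem contDiffAt_normalize {x : E} (hx : x ≠ 0) {k : ℕ∞ω} :
    ContDiffAt ℝ k (fun y : E => ‖y‖⁻¹ • y) x :=
  ((contDiffAt_norm ℝ hx).inv (norm_ne_zero_iff.2 hx)).smul contDiffAt_id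

/-- The inverse norm along a line. -/
theorem hasDerivAt_inv_norm_line {x e : E} (τ : ℝ) (h : x + τ • e ≠ 0) :
    HasDerivAt (fun τ : ℝ => ‖x + τ • e‖⁻¹)
      (-(inner ℝ (x + τ • e) e) * (‖x + τ • e‖⁻¹) ^ 3) τ := by
  have hl : HasDerivAt (fun τ : ℝ => x + τ • e) e τ := by
    simpa using ((hasDerivAt_id τ).smul_const e).const_add x
  have h1 := hl.norm_sq
  have hn : ‖x + τ • e‖ ≠ 0 := norm_ne_zero_iff.2 h
  have h2 := (h1.sqrt (pow_ne_zero 2 hn)).inv (by rwa [Real.sqrt_sq (norm_nonneg _)])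
  simp only [Real.sqrt_sq (norm_nonneg _)] at h2
  refine h2.congr_deriv ?_
  field_simp

theorem hasFDerivAt_normalize {x : E} (hx : ‖x‖ = 1) :
    HasFDerivAt (fun y : E => ‖y‖⁻¹ • y)
      (ContinuousLinearMap.id ℝ E - (innerSL ℝ x).smulRight x) x := by
  have hx0 : x ≠ 0 := fun h => by simp [h] at hx
  have hd := (contDiffAt_normalize hx0 (k := 1)).differentiableAt one_ne_zero
  convert! hd.hasFDerivAt using 1
  ext v
  have hl : HasDerivAt (fun τ : ℝ => x + τ • v) v 0 := by
    simpa using ((hasDerivAt_id (0:ℝ)).smul_const v).const_add x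
  have h0 : x + (0:ℝ) • v ≠ 0 := by simpa
  have h1 : HasDerivAt (fun τ : ℝ => ‖x + τ • v‖⁻¹ • (x + τ • v)) (v - inner ℝ x v • x) 0 := by
    refine ((hasDerivAt_inv_norm_line 0 h0).smul hl).congr_deriv ?_
    simp [hx, sub_eq_add_neg]
  have h2 : HasDerivAt (fun τ : ℝ => ‖x + τ • v‖⁻¹ • (x + τ • v))
      (fderiv ℝ (fun y : E => ‖y‖⁻¹ • y) x v) 0 := by
    have : HasFDerivAt (fun y : E => ‖y‖⁻¹ • y) (fderiv ℝ (fun y : E => ‖y‖⁻¹ • y) x)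
      (x + (0:ℝ) • v) := by simpa using hd.hasFDerivAt
    exact this.comp_hasDerivAt (0:ℝ) hl
  simpa using h1.unique h2

/-- The second derivative in a direction can be computed along a line. -/
theorem iteratedFDeriv_two_eq_of_line {F : E → ℝ} {x e : E} (hF : ContDiffAt ℝ 2 F x)
    {g : ℝ → ℝ} {g2 : ℝ} (h1 : ∀ᶠ τ in 𝓝 (0:ℝ), HasDerivAt (fun τ : ℝ => F (x + τ • e)) (g τ) τ)
    (h2 : HasDerivAt g g2 0) : iteratedFDeriv ℝ 2 F x ![e, e] = g2 := by
  rw [iteratedFDeriv_two_apply]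
  simp only [Matrix.cons_val_zero, Matrix.cons_val_one]
  have hl : ∀ τ, HasDerivAt (fun τ : ℝ => x + τ • e) e τ := fun τ => by
    simpa using ((hasDerivAt_id τ).smul_const e).const_add x
  have hl0 : Tendsto (fun τ : ℝ => x + τ • e) (𝓝 0) (𝓝 x) := by
    simpa using (hl 0).continuousAt.tendsto
  have hd : ∀ᶠ y in 𝓝 x, DifferentiableAt ℝ F y := by
    filter_upwards [hF.eventually (by simp)] with y hy
    exact hy.differentiableAt two_ne_zero
  have heq : (fun τ : ℝ => fderiv ℝ F (x + τ • e) e) =ᶠ[𝓝 0] g := by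
    filter_upwards [hl0.eventually hd, h1] with τ ha hb
    exact (ha.hasFDerivAt.comp_hasDerivAt τ (hl τ)).unique hb
  have hdd : DifferentiableAt ℝ (fderiv ℝ F) x :=
    (hF.fderiv_right (m := 1) (by norm_num)).differentiableAt one_ne_zero
  have h3 : HasDerivAt (fun τ : ℝ => fderiv ℝ F (x + τ • e) e) (fderiv ℝ (fderiv ℝ F) x e e) 0 := by
    have h4 : HasFDerivAt (fderiv ℝ F) (fderiv ℝ (fderiv ℝ F) x) (x + (0:ℝ) • e) := by
      simpa using hdd.hasFDerivAt
    exact (ContinuousLinearMap.apply ℝ ℝ e).hasFDerivAt.comp_hasDerivAt (0:ℝ)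
      (h4.comp_hasDerivAt (0:ℝ) (hl 0))
  exact h3.unique (h2.congr_of_eventuallyEq heq)

end Calculus

variable {n : ℕ}

theorem contDiffAt_homExt {f : Amb n → ℝ} {k : ℕ∞ω} {y : Amb n} (hy : y ≠ 0)
    (hf : ContDiffAt ℝ k f (‖y‖⁻¹ • y)) : ContDiffAt ℝ k (homExt f) y :=
  ContDiffAt.comp (f := fun y : Amb n => ‖y‖⁻¹ • y) y hf (contDiffAt_normalize hy)

/-- The spherical gradient is the tangential part of the Euclidean gradient. -/
theorem hasGradientAt_homExt {f : Amb n → ℝ} {g x : Amb n} (hx : ‖x‖ = 1)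
    (hf : HasGradientAt f g x) : HasGradientAt (homExt f) (g - inner ℝ g x • x) x := by
  have hx' : ‖x‖⁻¹ • x = x := by simp [hx]
  rw [hasGradientAt_iff_hasFDerivAt] at hf ⊢
  have hf' : HasFDerivAt f (InnerProductSpace.toDual ℝ _ g) (‖x‖⁻¹ • x) := by rwa [hx']
  have := HasFDerivAt.comp (f := fun y : Amb n => ‖y‖⁻¹ • y) x hf' (hasFDerivAt_normalize hx)
  refine this.congr_fderiv ?_
  ext v
  simp
  ring

theorem sphGrad_eq {f : Amb n → ℝ} {g x : Amb n} (hx : ‖x‖ = 1)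
    (hf : HasGradientAt f g x) : sphGrad f x = g - inner ℝ g x • x :=
  (hasGradientAt_homExt hx hf).gradient

theorem homExt_smul (f : Amb n → ℝ) (r : ℝ) (y : Amb n) (hr : 0 < r) :
    homExt f (r • y) = homExt f y := by
  unfold homExt
  rw [norm_smul, Real.norm_of_nonneg hr.le, smul_smul, mul_inv, mul_comm r⁻¹, mul_assoc,
    inv_mul_cancel₀ hr.ne', mul_one]

end Steklov

end

/-! ### The radial profile of the first eigenfunctions of a ball -/

noncomputable section

namespace Steklov

open MeasureTheory Set Filter Topology

theorem hasDerivAt_intervalIntegral_of_continuousOn {F F' : ℝ → ℝ → ℝ} {x₀ δ : ℝ} (hδ : 0 < δ)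
    (hF : ∀ x ∈ Icc (x₀ - δ) (x₀ + δ), ContinuousOn (F x) (Icc 0 1))
    (hF' : ContinuousOn (fun q : ℝ × ℝ => F' q.1 q.2) (Icc (x₀ - δ) (x₀ + δ) ×ˢ Icc 0 1))
    (hd : ∀ x ∈ Icc (x₀ - δ) (x₀ + δ), ∀ t ∈ Icc (0:ℝ) 1, HasDerivAt (fun x => F x t) (F' x t) x) :
    HasDerivAt (fun x => ∫ t in (0:ℝ)..1, F x t) (∫ t in (0:ℝ)..1, F' x₀ t) x₀ := by
  obtain ⟨K, hK⟩ := (isCompact_Icc.prod isCompact_Icc).exists_bound_of_continuousOn hF'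
  have hI : Set.uIoc (0:ℝ) 1 ⊆ Icc 0 1 := by
    rw [uIoc_of_le zero_le_one]; exact Ioc_subset_Icc_self
  have hx₀ : x₀ ∈ Icc (x₀ - δ) (x₀ + δ) := ⟨by linarith, by linarith⟩
  have hms : ∀ {g : ℝ → ℝ}, ContinuousOn g (Icc 0 1) →
      AEStronglyMeasurable g (volume.restrict (Set.uIoc 0 1)) := fun hg =>
    (hg.mono hI).aestronglyMeasurable measurableSet_uIoc
  refine (intervalIntegral.hasDerivAt_integral_of_dominated_loc_of_deriv_le (μ := volume)
    (F := F) (F' := F') (bound := fun _ => K) (s := Icc (x₀ - δ) (x₀ + δ))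
    (Icc_mem_nhds (by linarith) (by linarith)) ?_ ?_ ?_ ?_ ?_ ?_).2
  · filter_upwards [Icc_mem_nhds (show x₀ - δ < x₀ by linarith) (show x₀ < x₀ + δ by linarith)]
      with x hx
    exact hms (hF x hx)
  · exact ContinuousOn.intervalIntegrable (by rw [uIcc_of_le zero_le_one]; exact hF x₀ hx₀)
  · exact hms (hF'.comp (f := fun t : ℝ => (x₀, t)) (by fun_prop) fun t ht => ⟨hx₀, ht⟩)
  · exact ae_of_all _ fun t ht x hx => hK (x, t) ⟨hx, hI ht⟩
  · exact intervalIntegrable_const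
  · exact ae_of_all _ fun t ht x hx => hd x hx t (hI ht)

/-- An auxiliary family of functions, smooth on `(-1, ∞)`. -/
def radialInt (a : ℕ) (b c : ℝ) : ℝ := ∫ t in (0:ℝ)..1, t ^ a * (2 - (1 - c) * t ^ 2) ^ b

theorem radialInt_base_pos {c : ℝ} (hc : -1 < c) {t : ℝ} (ht : t ∈ Icc (0:ℝ) 1) :
    0 < 2 - (1 - c) * t ^ 2 := by
  have h1 : t ^ 2 ≤ 1 := by nlinarith [ht.1, ht.2]
  rcases (sq_nonneg t).eq_or_lt with h | h
  · rw [← h]; norm_num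
  · nlinarith [mul_pos (show 0 < 1 + c by linarith) h]

theorem hasDerivAt_radialInt (a : ℕ) (b : ℝ) {c : ℝ} (hc : -1 < c) :
    HasDerivAt (radialInt a b) (b * radialInt (a + 2) (b - 1) c) c := by
  have hδ : 0 < (c + 1) / 2 := by linarith
  have hsub : ∀ x ∈ Icc (c - (c + 1) / 2) (c + (c + 1) / 2), -1 < x := fun x hx => by
    linarith [hx.1]
  have := hasDerivAt_intervalIntegral_of_continuousOn hδ
    (F := fun c t => t ^ a * (2 - (1 - c) * t ^ 2) ^ b)
    (F' := fun c t => b * (t ^ (a + 2) * (2 - (1 - c) * t ^ 2) ^ (b - 1))) (x₀ := c) ?_ ?_ ?_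
  · rw [intervalIntegral.integral_const_mul] at this
    exact this
  · intro x hx
    exact ContinuousOn.mul (by fun_prop) (ContinuousOn.rpow_const (by fun_prop) fun t ht =>
      Or.inl (radialInt_base_pos (hsub x hx) ht).ne')
  · exact continuousOn_const.mul (ContinuousOn.mul (by fun_prop)
      (ContinuousOn.rpow_const (by fun_prop) fun q hq =>
      Or.inl (radialInt_base_pos (hsub q.1 hq.1) hq.2).ne'))
  · intro x hx t ht
    have h1 : HasDerivAt (fun x : ℝ => 2 - (1 - x) * t ^ 2) (t ^ 2) x := by
      have := (((hasDerivAt_id x).const_sub 1).mul_const (t ^ 2)).const_sub 2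
      simpa using this
    refine ((h1.rpow_const (p := b) (Or.inl (radialInt_base_pos (hsub x hx) ht).ne')).const_mul
      (t ^ a)).congr_deriv ?_
    ring

/-- Differentiation in c only shifts the exponents, so induction on the order works for all
exponents simultaneously. -/
theorem contDiffOn_radialInt (a : ℕ) (b : ℝ) : ContDiffOn ℝ ∞ (radialInt a b) (Ioi (-1)) := by
  rw [contDiffOn_infty]
  intro k
  induction k generalizing a b with
  | zero =>
    exact contDiffOn_zero.2 fun c hc =>
      (hasDerivAt_radialInt a b hc).continuousAt.continuousWithinAt
  | succ k ih =>
    push_cast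
    rw [contDiffOn_succ_iff_deriv_of_isOpen isOpen_Ioi]
    refine ⟨fun c hc => (hasDerivAt_radialInt a b hc).differentiableAt.differentiableWithinAt,
      by simp, ?_⟩
    refine ((contDiffOn_const (c := b)).mul (ih (a + 2) (b - 1))).congr fun c hc => ?_
    exact (hasDerivAt_radialInt a b hc).deriv

/-- The radial factor of the first Steklov eigenfunctions of the balls in `Sᵐ⁺¹`, divided by
`sin r`, as a function of `cos r`. -/
def radialFactor (m : ℕ) (c : ℝ) : ℝ :=
  2 * radialInt m (((m : ℝ) - 1) / 2) c * (1 + c) ^ (-((m : ℝ) + 1) / 2)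

/-- The substitution 1 − cos x = (1 − c) t² in W(r) = ∫₀^r sin^m x dx, with c = cos r, extracts the
factor (1 − c)^{(m+1)/2}, which cancels against sin^{m+1} r. In this form the quotient W / sin^{m+1}
is smooth in c across c = 1, that is, at the centre of the ball. -/
theorem contDiffOn_radialFactor (m : ℕ) : ContDiffOn ℝ ∞ (radialFactor m) (Ioi (-1)) := by
  refine (contDiffOn_const.mul (contDiffOn_radialInt _ _)).mul fun c hc => ?_
  have : 1 + c ≠ 0 := by linarith [show -1 < c from hc]
  exact ((contDiffAt_const.add contDiffAt_id).rpow_const_of_ne this).contDiffWithinAt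

/-- The left side is the integral over [0, 1] of the derivative of t^{m+1} (2 − (1 − c)
t²)^{(m−1)/2}. -/
theorem radialInt_parts (m : ℕ) {c : ℝ} (hc : -1 < c) :
    ((m : ℝ) + 1) * radialInt m (((m : ℝ) - 1) / 2) c -
      ((m : ℝ) - 1) * (1 - c) * radialInt (m + 2) (((m : ℝ) - 1) / 2 - 1) c
      = (1 + c) ^ (((m : ℝ) - 1) / 2) := by
  set b : ℝ := ((m : ℝ) - 1) / 2 with hb
  have hco : ∀ (a' : ℕ) (b' : ℝ), ContinuousOn (fun t : ℝ => t ^ a' * (2 - (1 - c) * t ^ 2) ^ b')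
      (uIcc 0 1) := fun a' b' => by
    rw [uIcc_of_le zero_le_one]
    exact ContinuousOn.mul (by fun_prop) (ContinuousOn.rpow_const (by fun_prop) fun t ht =>
      Or.inl (radialInt_base_pos hc ht).ne')
  have hi1 := (hco m b).intervalIntegrable (μ := volume)
  have hi2 := (hco (m + 2) (b - 1)).intervalIntegrable (μ := volume)
  rw [radialInt, radialInt, ← intervalIntegral.integral_const_mul,
    ← intervalIntegral.integral_const_mul, ← intervalIntegral.integral_sub (hi1.const_mul _)
      (hi2.const_mul _)]
  rw [intervalIntegral.integral_eq_sub_of_hasDerivAt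
    (f := fun t : ℝ => t ^ (m + 1) * (2 - (1 - c) * t ^ 2) ^ b) (fun t ht => ?_)
    ((hi1.const_mul _).sub (hi2.const_mul _))]
  · norm_num
    congr 1
    ring
  · rw [uIcc_of_le zero_le_one] at ht
    have h1 : HasDerivAt (fun t : ℝ => 2 - (1 - c) * t ^ 2) (-((1 - c) * (2 * t))) t := by
      have := ((hasDerivAt_pow 2 t).const_mul (1 - c)).const_sub 2
      simpa using this
    refine ((hasDerivAt_pow (m + 1) t).mul (h1.rpow_const (p := b)
      (Or.inl (radialInt_base_pos hc ht).ne'))).congr_deriv ?_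
    push_cast
    rw [hb]
    ring

/-- The first order differential equation of the radial factor. -/
theorem exists_deriv_radialFactor (m : ℕ) {c : ℝ} (hc : -1 < c) :
    ∃ d, HasDerivAt (radialFactor m) d c ∧
      (1 - c ^ 2) * d = ((m : ℝ) + 1) * c * radialFactor m c - 1 := by
  have hc1 : 0 < 1 + c := by linarith
  have h1 : HasDerivAt (fun c : ℝ => 1 + c) 1 c := (hasDerivAt_id c).const_add 1
  refine ⟨_, ((hasDerivAt_radialInt m (((m : ℝ) - 1) / 2) hc).const_mul 2).mul
    (h1.rpow_const (p := -((m : ℝ) + 1) / 2) (Or.inl hc1.ne')), ?_⟩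
  have hp := radialInt_parts m hc
  rw [radialFactor]
  set A := radialInt m (((m : ℝ) - 1) / 2) c
  set B := radialInt (m + 2) (((m : ℝ) - 1) / 2 - 1) c
  set P := (1 + c) ^ (-((m : ℝ) + 1) / 2) with hP
  have e1 : (1 + c) ^ (-((m : ℝ) + 1) / 2 - 1) = P / (1 + c) := by
    rw [Real.rpow_sub hc1, Real.rpow_one]
  have e2 : (1 + c) ^ (((m : ℝ) - 1) / 2) * ((1 + c) * P) = 1 := by
    have e3 : (1 + c) * P = (1 + c) ^ (1 + -((m : ℝ) + 1) / 2) := by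
      rw [Real.rpow_add hc1, Real.rpow_one]
    rw [e3, ← Real.rpow_add hc1, show ((m : ℝ) - 1) / 2 + (1 + -((m : ℝ) + 1) / 2) = 0 by ring,
      Real.rpow_zero]
  rw [e1]
  rw [← hp] at e2
  field_simp
  linear_combination (-(1 + c)) * e2

/-- The second order differential equation of the radial factor. -/
theorem deriv_deriv_radialFactor (m : ℕ) {c : ℝ} (hc : -1 < c) :
    (1 - c ^ 2) * deriv (deriv (radialFactor m)) c - ((m : ℝ) + 3) * c * deriv (radialFactor m) c
      - ((m : ℝ) + 1) * radialFactor m c = 0 := by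
  have hQ := (contDiffOn_radialFactor m).contDiffAt (Ioi_mem_nhds hc)
  have hd1 : HasDerivAt (radialFactor m) (deriv (radialFactor m) c) c :=
    (hQ.differentiableAt (by simp)).hasDerivAt
  have hd2 : HasDerivAt (deriv (radialFactor m)) (deriv (deriv (radialFactor m)) c) c := by
    have h2 : ContDiffOn ℝ 1 (deriv (radialFactor m)) (Ioi (-1)) :=
      (contDiffOn_radialFactor m).deriv_of_isOpen isOpen_Ioi (by norm_cast)
    exact ((h2.contDiffAt (Ioi_mem_nhds hc)).differentiableAt one_ne_zero).hasDerivAt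
  -- The second order equation is the derivative of the first order one, which holds in a
  -- neighbourhood of c.
  have heq : (fun c => (1 - c ^ 2) * deriv (radialFactor m) c) =ᶠ[𝓝 c]
      fun c => ((m : ℝ) + 1) * c * radialFactor m c - 1 := by
    filter_upwards [Ioi_mem_nhds hc] with y hy
    obtain ⟨d, hd, h⟩ := exists_deriv_radialFactor m hy
    rw [hd.deriv, h]
  have h1 : HasDerivAt (fun c => (1 - c ^ 2) * deriv (radialFactor m) c) _ c :=
    ((hasDerivAt_pow 2 c).const_sub 1).mul hd2
  have h2 : HasDerivAt (fun c => ((m : ℝ) + 1) * c * radialFactor m c - 1) _ c :=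
    (((hasDerivAt_id c).const_mul ((m : ℝ) + 1)).mul hd1).sub_const 1
  have := h1.unique (h2.congr_of_eventuallyEq heq)
  simp only [id] at this
  push_cast at this
  linear_combination this

/-- The radial part of the first eigenfunctions. -/
theorem sin_mul_radialFactor (m : ℕ) {r : ℝ} (h0 : 0 ≤ r) (h1 : r ≤ Real.pi / 2) :
    Real.sin r ^ (m + 1) * radialFactor m (Real.cos r) = sinVol m r := by
  set g : ℝ → ℝ := fun r => Real.sin r ^ (m + 1) * radialFactor m (Real.cos r) - sinVol m r with hg
  have hd : ∀ x ∈ Icc 0 r, HasDerivAt g 0 x := by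
    intro x hx
    have hc : -1 < Real.cos x := by
      linarith [cos_nonneg_of_le_pi_div_two hx.1 (hx.2.trans h1)]
    obtain ⟨d, hd, h⟩ := exists_deriv_radialFactor m hc
    refine ((((Real.hasDerivAt_sin x).pow (m + 1)).mul (hd.comp x (Real.hasDerivAt_cos x))).sub
      (hasDerivAt_sinVol m x)).congr_deriv ?_
    have hs : 1 - Real.cos x ^ 2 = Real.sin x ^ 2 := by linarith [Real.sin_sq_add_cos_sq x]
    rw [hs] at h
    push_cast
    simp only [Function.comp, Pi.pow_apply]
    linear_combination (-Real.sin x ^ m) * h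
  have := constant_of_has_deriv_right_zero (f := g)
    (fun x hx => (hd x hx).continuousAt.continuousWithinAt)
    (fun x hx => (hd x ⟨hx.1, hx.2.le⟩).hasDerivWithinAt) r ⟨h0, le_rfl⟩
  simp [hg, sinVol] at this
  rw [sinVol]
  linarith

end Steklov

end

/-! ### The spherical Laplacian of first-degree harmonics times radial functions -/

noncomputable section

namespace Steklov

open MeasureTheory Set Filter Topology

variable {n : ℕ}

/-- A spherical harmonic of degree one times a function of the distance from `p`. -/
def linearRadial (p a : Amb n) (Q : ℝ → ℝ) (y : Amb n) : ℝ := inner ℝ a y * Q (inner ℝ p y)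

theorem hasGradientAt_linearRadial (p a : Amb n) {Q : ℝ → ℝ} {d : ℝ} {x : Amb n}
    (hQ : HasDerivAt Q d (inner ℝ p x)) :
    HasGradientAt (linearRadial p a Q) (Q (inner ℝ p x) • a + (inner ℝ a x * d) • p) x := by
  rw [hasGradientAt_iff_hasFDerivAt]
  have h1 : HasFDerivAt (fun y : Amb n => inner ℝ p y) (innerSL ℝ p) x := (innerSL ℝ p).hasFDerivAt
  have h2 : HasFDerivAt (fun y : Amb n => inner ℝ a y) (innerSL ℝ a) x := (innerSL ℝ a).hasFDerivAt
  refine (h2.mul (hQ.comp_hasFDerivAt x h1)).congr_fderiv ?_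
  ext v
  simp
  ring

/-- The spherical Laplacian of a spherical harmonic of degree one times a function of the distance
from `p`. -/
theorem sphLaplacian_linearRadial {p a x : Amb n} (hp : ‖p‖ = 1) (ha : inner ℝ a p = (0:ℝ))
    (hx : ‖x‖ = 1) {Q : ℝ → ℝ} (hQ : ContDiffAt ℝ 2 Q (inner ℝ p x)) :
    sphLaplacian (linearRadial p a Q) x = inner ℝ a x *
      ((1 - inner ℝ p x ^ 2) * deriv (deriv Q) (inner ℝ p x)
        - (n + 2) * inner ℝ p x * deriv Q (inner ℝ p x) - n * Q (inner ℝ p x)) := by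
  have hx0 : x ≠ 0 := fun h => by simp [h] at hx
  have hx' : ‖x‖⁻¹ • x = x := by simp [hx]
  set c : ℝ := inner ℝ p x with hc
  set b : ℝ := inner ℝ a x with hb
  have hF : ContDiffAt ℝ 2 (homExt (linearRadial p a Q)) x := by
    refine contDiffAt_homExt hx0 ?_
    rw [hx']
    have h1 : ContDiffAt ℝ 2 (fun y : Amb n => inner ℝ a y) x := (innerSL ℝ a).contDiff.contDiffAt
    have h2 : ContDiffAt ℝ 2 (fun y : Amb n => inner ℝ p y) x := (innerSL ℝ p).contDiff.contDiffAt
    exact h1.mul (hQ.comp x h2)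
  -- Along τ ↦ x + τe the extension is ⟨a, x + τe⟩ M Q(K) with M the inverse norm and K = ⟨p, x +
  -- τe⟩ M. Its second derivative at 0 is a quadratic form in the products of e with a, p, x and e,
  -- so Parseval's identity sums it over an orthonormal basis.
  have hline : ∀ e : Amb n, iteratedFDeriv ℝ 2 (homExt (linearRadial p a Q)) x ![e, e] =
      b * Q c * (3 * inner ℝ x e ^ 2 - inner ℝ e e) - 2 * Q c * (inner ℝ a e * inner ℝ x e)
      + 2 * deriv Q c * (inner ℝ a e * inner ℝ p e)
      - 2 * deriv Q c * c * (inner ℝ a e * inner ℝ x e)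
      - 2 * b * deriv Q c * (inner ℝ p e * inner ℝ x e)
      + 2 * b * c * deriv Q c * inner ℝ x e ^ 2
      + b * deriv (deriv Q) c * (inner ℝ p e ^ 2 - 2 * c * (inner ℝ p e * inner ℝ x e)
        + c ^ 2 * inner ℝ x e ^ 2)
      + b * deriv Q c * (3 * c * inner ℝ x e ^ 2 - c * inner ℝ e e
        - 2 * (inner ℝ p e * inner ℝ x e)) := by
    intro e
    set M : ℝ → ℝ := fun τ => ‖x + τ • e‖⁻¹ with hM
    set M' : ℝ → ℝ := fun τ => -(inner ℝ (x + τ • e) e) * M τ ^ 3 with hM'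
    have hl : ∀ τ, HasDerivAt (fun τ : ℝ => x + τ • e) e τ := fun τ => by
      simpa using ((hasDerivAt_id τ).smul_const e).const_add x
    have hB : ∀ (w : Amb n) τ, HasDerivAt (fun τ : ℝ => inner ℝ w (x + τ • e)) (inner ℝ w e) τ :=
      fun w τ => (innerSL ℝ w).hasFDerivAt.comp_hasDerivAt τ (hl τ)
    have hM1 : ∀ τ, x + τ • e ≠ 0 → HasDerivAt M (M' τ) τ := fun τ h => hasDerivAt_inv_norm_line τ h
    have hM0 : M 0 = 1 := by simp [hM, hx]
    have hM'0 : M' 0 = -inner ℝ x e := by simp [hM', hM0]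
    have h00 : x + (0:ℝ) • e ≠ 0 := by simpa
    have hM2 : HasDerivAt M' (3 * inner ℝ x e ^ 2 - inner ℝ e e) 0 := by
      have h1 : HasDerivAt (fun τ : ℝ => inner ℝ (x + τ • e) e) (inner ℝ e e) 0 := by
        simpa only [real_inner_comm] using hB e 0
      refine (h1.neg.mul ((hM1 0 h00).pow 3)).congr_deriv ?_
      simp [hM0, hM'0]
      ring
    set K : ℝ → ℝ := fun τ => inner ℝ p (x + τ • e) * M τ with hK
    set K' : ℝ → ℝ := fun τ => inner ℝ p e * M τ + inner ℝ p (x + τ • e) * M' τ with hK'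
    have hK1 : ∀ τ, x + τ • e ≠ 0 → HasDerivAt K (K' τ) τ := fun τ h => (hB p τ).mul (hM1 τ h)
    have hK0 : K 0 = c := by simp [hK, hM0, hc]
    have hK2 := ((hM1 0 h00).const_mul (inner ℝ p e)).add ((hB p 0).mul hM2)
    have hK2' : HasDerivAt K' _ 0 := hK2
    have hne : ∀ᶠ τ in 𝓝 (0:ℝ), x + τ • e ≠ 0 :=
      ((hl 0).continuousAt).eventually_ne h00
    have hQ1 : ∀ᶠ τ in 𝓝 (0:ℝ), HasDerivAt Q (deriv Q (K τ)) (K τ) := by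
      have h1 : ∀ᶠ y in 𝓝 c, ContDiffAt ℝ 2 Q y := hQ.eventually (by simp)
      have h2 : Tendsto K (𝓝 0) (𝓝 c) := by
        rw [← hK0]; exact (hK1 0 h00).continuousAt.tendsto
      filter_upwards [h2.eventually h1] with τ hτ
      exact (hτ.differentiableAt two_ne_zero).hasDerivAt
    have hQ2 : HasDerivAt (deriv Q) (deriv (deriv Q) c) (K 0) := by
      rw [hK0]
      obtain ⟨u, hu, hQu⟩ := hQ.contDiffOn (m := 2) le_rfl (by simp)
      have hD : ContDiffAt ℝ 1 (deriv Q) c := by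
        have h1 : ContDiffAt ℝ 1 (fderiv ℝ Q) c := hQ.fderiv_right (m := 1) (by norm_num)
        have h2 : deriv Q = fun y => fderiv ℝ Q y 1 := by ext y; exact fderiv_apply_one_eq_deriv.symm
        rw [h2]
        exact h1.clm_apply contDiffAt_const
      exact (hD.differentiableAt one_ne_zero).hasDerivAt
    have hg1 : ∀ᶠ τ in 𝓝 (0:ℝ), HasDerivAt
        (fun τ : ℝ => homExt (linearRadial p a Q) (x + τ • e))
        ((inner ℝ a e * M τ + inner ℝ a (x + τ • e) * M' τ) * Q (K τ) +
          inner ℝ a (x + τ • e) * M τ * (deriv Q (K τ) * K' τ)) τ := by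
      filter_upwards [hne, hQ1] with τ h1 h2
      have h3 := ((hB a τ).mul (hM1 τ h1)).mul (h2.comp τ (hK1 τ h1))
      refine h3.congr_of_eventuallyEq (Eventually.of_forall fun t => ?_)
      simp only [homExt, linearRadial, hK, hM, inner_smul_right, Pi.mul_apply, Function.comp]
      rw [mul_comm (‖x + t • e‖⁻¹) (inner ℝ a _), mul_comm (‖x + t • e‖⁻¹) (inner ℝ p _)]
    have hg2 := (((((hM1 0 h00).const_mul (inner ℝ a e)).add ((hB a 0).mul hM2)).mul
      ((hQ1.self_of_nhds).comp 0 (hK1 0 h00))).add (((hB a 0).mul (hM1 0 h00)).mul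
        ((hQ2.comp 0 (hK1 0 h00)).mul hK2')))
    rw [iteratedFDeriv_two_eq_of_line hF hg1 hg2]
    simp only [Pi.mul_apply, Pi.add_apply, Function.comp, hK0, hM0, hM'0, hK', zero_smul, add_zero]
    simp only [← hc, ← hb]
    ring
  rw [sphLaplacian, InnerProductSpace.laplacian_eq_iteratedFDeriv_orthonormalBasis _
    (EuclideanSpace.basisFun (Fin (n + 1)) ℝ)]
  simp only [hline]
  set B := EuclideanSpace.basisFun (Fin (n + 1)) ℝ
  have hs : ∀ v w : Amb n, ∑ i, inner ℝ v (B i) * inner ℝ w (B i) = inner ℝ v w := fun v w => by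
    rw [← B.sum_inner_mul_inner v w]
    simp only [real_inner_comm w]
  have hs2 : ∀ v : Amb n, ∑ i, inner ℝ v (B i) ^ 2 = inner ℝ v v := fun v => by
    simp only [sq]; exact hs v v
  have hcard : ∑ i, inner ℝ (B i) (B i) = (n : ℝ) + 1 := by simp
  have hpp : inner ℝ p p = (1:ℝ) := by rw [real_inner_self_eq_norm_sq, hp]; norm_num
  have hxx : inner ℝ x x = (1:ℝ) := by rw [real_inner_self_eq_norm_sq, hx]; norm_num
  simp only [Finset.sum_add_distrib, Finset.sum_sub_distrib, ← Finset.mul_sum, hs, hs2, hcard,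
    hpp, hxx, ha]
  simp only [← hc, ← hb]
  ring

end Steklov

end

noncomputable section

namespace Steklov

open MeasureTheory Set Filter Topology

variable {n : ℕ}

/-! ### Geodesic polar coordinates -/

theorem norm_coe_sph (p : Sph n) : ‖(p : Amb n)‖ = 1 := norm_eq_of_mem_sphere p

theorem inner_coe_sph (p : Sph n) : inner ℝ (p : Amb n) (p : Amb n) = (1 : ℝ) := by
  rw [real_inner_self_eq_norm_sq, norm_coe_sph]; norm_num

theorem inner_expPt_left (p : Sph n) {u : Amb n} (hu : u ∈ unitTangent p) (t : ℝ) :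
    inner ℝ (p : Amb n) (expPt p u t) = Real.cos t := by
  simp [expPt, inner_add_right, inner_smul_right, hu.2]

theorem norm_expPt (p : Sph n) {u : Amb n} (hu : u ∈ unitTangent p) (t : ℝ) :
    ‖expPt p u t‖ = 1 := by
  have h : ‖expPt p u t‖ ^ 2 = 1 := by
    rw [expPt, norm_add_sq_real, norm_smul, norm_smul, norm_coe_sph, hu.1, real_inner_smul_left,
      real_inner_smul_right, hu.2]
    simp
  nlinarith [norm_nonneg (expPt p u t)]

/-- The point `exp_p (t u)` as a point of the sphere. -/
def expSph (p : Sph n) {u : Amb n} (hu : u ∈ unitTangent p) (t : ℝ) : Sph n :=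
  ⟨expPt p u t, by simp [norm_expPt p hu t]⟩

theorem expPt_mem_image_iff {Ω : Set (Sph n)} {p : Sph n} {u : Amb n} (hu : u ∈ unitTangent p)
    (t : ℝ) : expPt p u t ∈ ((↑) '' Ω : Set (Amb n)) ↔ expSph p hu t ∈ Ω := by
  constructor
  · rintro ⟨x, hx, h⟩
    have : x = expSph p hu t := Subtype.ext h
    rwa [← this]
  · exact fun h => ⟨_, h, rfl⟩

theorem continuous_expSph (p : Sph n) {u : Amb n} (hu : u ∈ unitTangent p) :
    Continuous (expSph p hu) :=
  Continuous.subtype_mk (by unfold expPt; fun_prop) _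

theorem exists_unitTangent (hn : 1 ≤ n) (p : Sph n) : ∃ u, u ∈ unitTangent p := by
  have hfin : 0 < Module.finrank ℝ (ℝ ∙ (p : Amb n))ᗮ := by
    have h1 := Submodule.finrank_add_finrank_orthogonal (ℝ ∙ (p : Amb n))
    have hp : (p : Amb n) ≠ 0 := ne_zero_of_mem_unit_sphere p
    rw [finrank_span_singleton hp, finrank_euclideanSpace_fin] at h1
    omega
  have : Nontrivial (ℝ ∙ (p : Amb n))ᗮ := Module.nontrivial_of_finrank_pos hfin
  obtain ⟨v, hv⟩ := exists_ne (0 : (ℝ ∙ (p : Amb n))ᗮ)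
  have hv0 : ‖(v : Amb n)‖ ≠ 0 := by simpa using hv
  refine ⟨‖(v : Amb n)‖⁻¹ • (v : Amb n), ?_, ?_⟩
  · rw [norm_smul, norm_inv, norm_norm, inv_mul_cancel₀ hv0]
  · rw [inner_smul_right, Submodule.mem_orthogonal_singleton_iff_inner_right.1 v.2, mul_zero]

theorem exists_eq_expPt (hn : 1 ≤ n) (p x : Sph n) {t : ℝ}
    (h : inner ℝ (p : Amb n) x = Real.cos t) (ht0 : 0 ≤ t) (htpi : t ≤ Real.pi) :
    ∃ u ∈ unitTangent p, (x : Amb n) = expPt p u t := by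
  have hnorm : ‖(x : Amb n) - Real.cos t • (p : Amb n)‖ ^ 2 = Real.sin t ^ 2 := by
    rw [norm_sub_sq_real, norm_smul, norm_coe_sph, norm_coe_sph, real_inner_smul_right,
      real_inner_comm, h, Real.norm_eq_abs, mul_one, sq_abs]
    linarith [Real.sin_sq_add_cos_sq t]
  have hs0 := Real.sin_nonneg_of_nonneg_of_le_pi ht0 htpi
  -- If sin t = 0 then x is ±p and any unit tangent vector will do.
  rcases hs0.eq_or_lt with hs | hs
  · obtain ⟨u, hu⟩ := exists_unitTangent hn p
    refine ⟨u, hu, ?_⟩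
    rw [← hs] at hnorm
    have : (x : Amb n) - Real.cos t • (p : Amb n) = 0 := by simpa using hnorm
    rw [expPt, ← hs, zero_smul, add_zero]
    exact sub_eq_zero.1 this
  · refine ⟨(Real.sin t)⁻¹ • ((x : Amb n) - Real.cos t • (p : Amb n)), ⟨?_, ?_⟩, ?_⟩
    · rw [sq_eq_sq₀ (norm_nonneg _) hs.le] at hnorm
      rw [norm_smul, hnorm, norm_inv, Real.norm_of_nonneg hs.le, inv_mul_cancel₀ hs.ne']
    · rw [inner_smul_right, inner_sub_right, inner_smul_right, inner_coe_sph, h]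
      simp
    · rw [expPt, smul_smul, mul_inv_cancel₀ hs.ne', one_smul]
      abel

theorem angle_eq_arccos (p x : Sph n) :
    InnerProductGeometry.angle (p : Amb n) x = Real.arccos (inner ℝ (p : Amb n) x) := by
  simp [InnerProductGeometry.angle]

theorem abs_inner_le_one (p x : Sph n) : |inner ℝ (p : Amb n) (x : Amb n)| ≤ 1 := by
  have := abs_real_inner_le_norm (p : Amb n) x
  simpa using this

theorem mem_geodesicBall_iff {p x : Sph n} {r : ℝ} (h0 : 0 ≤ r) (h1 : r ≤ Real.pi) :
    x ∈ geodesicBall p r ↔ Real.cos r < inner ℝ (p : Amb n) x := by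
  have hx := abs_le.1 (abs_inner_le_one p x)
  rw [geodesicBall, mem_ofPred_eq, angle_eq_arccos]
  constructor
  · intro h
    have := Real.cos_lt_cos_of_nonneg_of_le_pi (Real.arccos_nonneg _) h1 h
    rwa [Real.cos_arccos hx.1 hx.2] at this
  · intro h
    have := Real.arccos_lt_arccos (by linarith [Real.neg_one_le_cos r]) h hx.2
    rwa [Real.arccos_cos h0 h1] at this

theorem isOpen_geodesicBall (p : Sph n) {r : ℝ} (h0 : 0 ≤ r) (h1 : r ≤ Real.pi) :
    IsOpen (geodesicBall p r) := by
  have : geodesicBall p r = {x : Sph n | Real.cos r < inner ℝ (p : Amb n) (x : Amb n)} := by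
    ext x; exact mem_geodesicBall_iff h0 h1
  rw [this]
  exact isOpen_lt continuous_const (by fun_prop)

theorem expSph_mem_geodesicBall {p : Sph n} {u : Amb n} (hu : u ∈ unitTangent p) {r t : ℝ}
    (ht : 0 ≤ t) (htr : t < r) (hr : r ≤ Real.pi) : expSph p hu t ∈ geodesicBall p r := by
  rw [mem_geodesicBall_iff (ht.trans htr.le) hr]
  change _ < inner ℝ (p : Amb n) (expPt p u t)
  rw [inner_expPt_left p hu]
  exact Real.cos_lt_cos_of_nonneg_of_le_pi ht hr htr

theorem cos_le_of_mem_closure_geodesicBall {p x : Sph n} {r : ℝ} (h0 : 0 ≤ r) (h1 : r ≤ Real.pi)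
    (hx : x ∈ closure (geodesicBall p r)) : Real.cos r ≤ inner ℝ (p : Amb n) x := by
  have hc : IsClosed {x : Sph n | Real.cos r ≤ inner ℝ (p : Amb n) (x : Amb n)} :=
    isClosed_le continuous_const (by fun_prop)
  exact closure_minimal (fun y hy => ((mem_geodesicBall_iff h0 h1).1 hy).le) hc hx

/-- A point at distance exactly r is the limit of the interior points of its own ray. The other
inclusion holds because the inner product with p is continuous. -/
theorem mem_frontier_geodesicBall_iff (hn : 1 ≤ n) {p x : Sph n} {r : ℝ} (h0 : 0 < r)
    (h1 : r ≤ Real.pi / 2) :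
    x ∈ frontier (geodesicBall p r) ↔ inner ℝ (p : Amb n) x = Real.cos r := by
  have hpi : r ≤ Real.pi := by linarith [Real.pi_pos]
  rw [(isOpen_geodesicBall p h0.le hpi).frontier_eq, Set.mem_sdiff, mem_geodesicBall_iff h0.le hpi]
  constructor
  · rintro ⟨hx1, hx2⟩
    exact le_antisymm (not_lt.1 hx2) (cos_le_of_mem_closure_geodesicBall h0.le hpi hx1)
  · intro hx
    refine ⟨?_, hx.not_gt⟩
    obtain ⟨u, hu, hxu⟩ := exists_eq_expPt hn p x hx h0.le hpi
    have hxs : x = expSph p hu r := Subtype.ext hxu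
    rw [hxs]
    have ht : Tendsto (expSph p hu) (𝓝[<] r) (𝓝 (expSph p hu r)) :=
      ((continuous_expSph p hu).tendsto r).mono_left nhdsWithin_le_nhds
    refine mem_closure_of_tendsto ht ?_
    filter_upwards [Ioo_mem_nhdsLT h0] with t ht
    exact expSph_mem_geodesicBall hu ht.1.le ht.2 hpi

/-! ### The first eigenvalue of a geodesic ball -/

theorem hasGradientAt_const_sub_inner (p : Amb n) (c : ℝ) (x : Amb n) :
    HasGradientAt (fun y : Amb n => c - inner ℝ p y) (-p) x := by
  rw [hasGradientAt_iff_hasFDerivAt]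
  refine (((innerSL ℝ p).hasFDerivAt).const_sub c).congr_fderiv ?_
  ext v
  simp

theorem isOutwardNormal_geodesicBall (hn : 1 ≤ n) {p q : Sph n} {r : ℝ} (h0 : 0 < r)
    (h1 : r ≤ Real.pi / 2) (hq : q ∈ frontier (geodesicBall p r)) :
    IsOutwardNormal (geodesicBall p r) q
      ((Real.sin r)⁻¹ • (Real.cos r • (q : Amb n) - (p : Amb n))) := by
  have hpi : r ≤ Real.pi := by linarith [Real.pi_pos]
  have hs := sin_pos_of_le_pi_div_two h0 h1
  have hq' := (mem_frontier_geodesicBall_iff hn h0 h1).1 hq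
  have hgrad : sphGrad (fun y : Amb n => Real.cos r - inner ℝ (p : Amb n) y) q
      = Real.cos r • (q : Amb n) - (p : Amb n) := by
    rw [sphGrad_eq (norm_coe_sph q) (hasGradientAt_const_sub_inner (p : Amb n) _ _),
      inner_neg_left, hq']
    module
  have hnorm : ‖Real.cos r • (q : Amb n) - (p : Amb n)‖ = Real.sin r := by
    have : ‖Real.cos r • (q : Amb n) - (p : Amb n)‖ ^ 2 = Real.sin r ^ 2 := by
      rw [norm_sub_sq_real, norm_smul, norm_coe_sph, norm_coe_sph, real_inner_smul_left,
        real_inner_comm, hq', Real.norm_eq_abs, mul_one, sq_abs]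
      linarith [Real.sin_sq_add_cos_sq r]
    rwa [sq_eq_sq₀ (norm_nonneg _) hs.le] at this
  -- The affine function cos r − ⟨p, y⟩ is a global defining function of the ball.
  refine ⟨univ, fun y => Real.cos r - inner ℝ (p : Amb n) y, ⟨isOpen_univ, mem_univ _,
    ?_, ?_, ?_, ?_⟩, ?_⟩
  · exact (contDiff_const.sub (innerSL ℝ (p : Amb n)).contDiff).contDiffOn
  · intro x _
    rw [mem_geodesicBall_iff h0.le hpi, sub_neg]
  · intro x _
    rw [mem_frontier_geodesicBall_iff hn h0 h1, sub_eq_zero, eq_comm]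
  · rw [hgrad, ← norm_ne_zero_iff, hnorm]
    exact hs.ne'
  · rw [hgrad, hnorm]

/-- `ballEigenvalue` is a Steklov eigenvalue of the geodesic ball. -/
theorem isSteklovEigenvalue_geodesicBall {m : ℕ} (p : Sph (m + 1)) {r : ℝ} (h0 : 0 < r)
    (h1 : r ≤ Real.pi / 2) : IsSteklovEigenvalue (geodesicBall p r) (ballEigenvalue m r) := by
  have hpi : r ≤ Real.pi := by linarith [Real.pi_pos]
  have hs := sin_pos_of_le_pi_div_two h0 h1
  have hW := sinVol_pos m h0 h1
  have hcr := cos_nonneg_of_le_pi_div_two h0.le h1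
  obtain ⟨a, ha⟩ := exists_unitTangent (by omega : 1 ≤ m + 1) p
  have hap : inner ℝ a (p : Amb (m + 1)) = (0:ℝ) := by rw [real_inner_comm]; exact ha.2
  have haa : inner ℝ a a = (1:ℝ) := by rw [real_inner_self_eq_norm_sq, ha.1]; norm_num
  -- At distance t in the direction u one has ⟨a, x⟩ = sin t ⟨a, u⟩, since a is orthogonal to p. So
  -- this function is φ(t) ⟨a, u⟩, and its normal derivative at radius r is κ(r) times itself. It is
  -- smooth for ⟨p, y⟩ > −1, which covers the closed ball because cos r ≥ 0.
  refine ⟨linearRadial (p : Amb (m + 1)) a (radialFactor m), {y | -1 < inner ℝ (p : Amb (m + 1)) y},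
    isOpen_lt continuous_const (by fun_prop), ?_, ?_, ?_, ?_, ?_⟩
  · intro x hx
    have := cos_le_of_mem_closure_geodesicBall h0.le hpi hx
    exact lt_of_lt_of_le (by linarith) this
  · exact (innerSL ℝ a).contDiff.contDiffOn.mul ((contDiffOn_radialFactor m).comp
      (innerSL ℝ (p : Amb (m + 1))).contDiff.contDiffOn fun y hy => hy)
  · refine ⟨expSph p ha (r / 2), expSph_mem_geodesicBall ha (by linarith) (by linarith) hpi, ?_⟩
    have h2 := sin_mul_radialFactor m (r := r / 2) (by linarith) (by linarith)
    have h3 := sinVol_pos m (r := r / 2) (by linarith) (by linarith)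
    have h4 := sin_pos_of_le_pi_div_two (r := r / 2) (by linarith) (by linarith)
    change linearRadial (p : Amb (m + 1)) a (radialFactor m) (expPt p a (r / 2)) ≠ 0
    rw [linearRadial, inner_expPt_left p ha]
    have h5 : inner ℝ a (expPt p a (r / 2)) = Real.sin (r / 2) := by
      simp [expPt, inner_add_right, inner_smul_right, hap, ha.1]
    rw [h5]
    intro h6
    rw [pow_succ, mul_assoc, h6, mul_zero] at h2
    exact h3.ne h2
  · intro x hx
    have hc : -1 < inner ℝ (p : Amb (m + 1)) (x : Amb (m + 1)) := by
      have := (mem_geodesicBall_iff h0.le hpi).1 hx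
      linarith
    rw [sphLaplacian_linearRadial (norm_coe_sph p) hap (norm_coe_sph x)
      (((contDiffOn_radialFactor m).contDiffAt (Ioi_mem_nhds hc)).of_le (by norm_cast))]
    have := deriv_deriv_radialFactor m hc
    push_cast
    rw [show ((m : ℝ) + 1 + 2) = m + 3 by ring, this, mul_zero]
  · intro q hq
    refine ⟨_, isOutwardNormal_geodesicBall (by omega) h0 h1 hq, ?_⟩
    have hq' := (mem_frontier_geodesicBall_iff (by omega) h0 h1).1 hq
    obtain ⟨d, hd, hode⟩ := exists_deriv_radialFactor m (c := Real.cos r) (by linarith)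
    have hd' : HasDerivAt (radialFactor m) d (inner ℝ (p : Amb (m + 1)) (q : Amb (m + 1))) := by
      rwa [hq']
    rw [sphGrad_eq (norm_coe_sph q) (hasGradientAt_linearRadial _ _ hd'), linearRadial]
    have hφ := sin_mul_radialFactor m h0.le h1
    set Q := radialFactor m (Real.cos r) with hQ
    have hqp : inner ℝ (q : Amb (m + 1)) (p : Amb (m + 1)) = Real.cos r := by
      rw [real_inner_comm]; exact hq'
    simp only [inner_sub_left, inner_sub_right, inner_add_left, real_inner_smul_left,
      real_inner_smul_right, hq', hap, inner_coe_sph, hqp, ← hQ]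
    rw [ballEigenvalue, ← hφ]
    have hsc : Real.cos r ^ 2 = 1 - Real.sin r ^ 2 := by linarith [Real.sin_sq_add_cos_sq r]
    have hQ0 : Q ≠ 0 := fun h => by rw [h, mul_zero] at hφ; exact hW.ne hφ
    set b := inner ℝ a (q : Amb (m + 1))
    field_simp
    rw [hsc] at hode
    ring_nf
    ring_nf at hode
    rw [hsc]
    linear_combination (-b * Real.sin r * Real.sin r ^ m) * hode

/-- Only this direction is needed: a smaller eigenvalue of the ball makes the claimed lower bound
smaller. -/
theorem firstEigenvalue_geodesicBall_le {m : ℕ} {p : Sph (m + 1)} {r μ : ℝ} (h0 : 0 < r)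
    (h1 : r ≤ Real.pi / 2) (hμ : IsFirstSteklovEigenvalue (geodesicBall p r) μ) :
    μ ≤ ballEigenvalue m r :=
  hμ.2 ⟨(ballEigenvalue_pos m h0 h1).ne', isSteklovEigenvalue_geodesicBall p h0 h1⟩

end Steklov

end

noncomputable section

namespace Steklov

open MeasureTheory Set Filter Topology

variable {n : ℕ}

/-! ### Orthonormal frames of the tangent space at the centre -/

/-- An isometric splitting `ℝⁿ⁺¹ = ℝ p ⊕ T_p Sⁿ`, the tangent space being identified with `ℝⁿ`. -/
structure PolarFrame (p : Sph n) where
  toEquiv : WithLp 2 (ℝ × EuclideanSpace ℝ (Fin n)) ≃ₗᵢ[ℝ] Amb n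
  map_one : toEquiv (WithLp.toLp 2 ((1 : ℝ), (0 : EuclideanSpace ℝ (Fin n)))) = (p : Amb n)

/-- Any isometry between the two spaces can be corrected by the reflection that moves the image of
the first unit vector to p. -/
theorem exists_polarFrame (p : Sph n) : Nonempty (PolarFrame p) := by
  have hfr : Module.finrank ℝ (WithLp 2 (ℝ × EuclideanSpace ℝ (Fin n)))
      = Module.finrank ℝ (Amb n) := by
    rw [LinearEquiv.finrank_eq (WithLp.linearEquiv 2 ℝ (ℝ × EuclideanSpace ℝ (Fin n)))]
    simp [Module.finrank_prod, add_comm]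
  let L : WithLp 2 (ℝ × EuclideanSpace ℝ (Fin n)) ≃ₗᵢ[ℝ] Amb n :=
    (stdOrthonormalBasis ℝ _).equiv (stdOrthonormalBasis ℝ (Amb n)) (finCongr hfr)
  set e : WithLp 2 (ℝ × EuclideanSpace ℝ (Fin n)) :=
    WithLp.toLp 2 ((1 : ℝ), (0 : EuclideanSpace ℝ (Fin n)))
  have he : ‖e‖ = 1 := by
    rw [WithLp.prod_norm_eq_of_L2]; simp [e]
  have hn : ‖L e‖ = ‖(p : Amb n)‖ := by
    rw [LinearIsometryEquiv.norm_map, he, norm_coe_sph]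
  exact ⟨⟨L.trans (Submodule.reflection (ℝ ∙ (L e - (p : Amb n)))ᗮ), by
    simpa using Submodule.reflection_sub hn⟩⟩

namespace PolarFrame

variable {p : Sph n} (F : PolarFrame p)

/-- The inclusion of the tangent space. -/
def incl : EuclideanSpace ℝ (Fin n) →ₗᵢ[ℝ] Amb n where
  toFun v := F.toEquiv (WithLp.toLp 2 ((0 : ℝ), v))
  map_add' v w := by
    rw [← map_add]; congr 1; apply WithLp.ofLp_injective; ext <;> simp
  map_smul' c v := by
    rw [RingHom.id_apply, ← map_smul]; congr 1; apply WithLp.ofLp_injective; ext <;> simp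
  norm_map' v := by
    change ‖F.toEquiv (WithLp.toLp 2 ((0 : ℝ), v))‖ = _
    rw [LinearIsometryEquiv.norm_map, WithLp.prod_norm_eq_of_L2]; simp

theorem toEquiv_toLp (a : ℝ) (v : EuclideanSpace ℝ (Fin n)) :
    F.toEquiv (WithLp.toLp 2 (a, v)) = a • (p : Amb n) + F.incl v := by
  rw [← F.map_one, ← map_smul]
  change _ = _ + F.toEquiv (WithLp.toLp 2 ((0 : ℝ), v))
  rw [← map_add]; congr 1; apply WithLp.ofLp_injective; ext <;> simp

theorem inner_incl (v : EuclideanSpace ℝ (Fin n)) : inner ℝ (p : Amb n) (F.incl v) = (0 : ℝ) := by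
  rw [← F.map_one]
  change inner ℝ _ (F.toEquiv (WithLp.toLp 2 ((0 : ℝ), v))) = _
  rw [LinearIsometryEquiv.inner_map_map, WithLp.prod_inner_apply]; simp

theorem incl_inner (v : EuclideanSpace ℝ (Fin n)) : inner ℝ (F.incl v) (p : Amb n) = (0 : ℝ) := by
  rw [real_inner_comm, F.inner_incl]

theorem inner_incl_incl (v w : EuclideanSpace ℝ (Fin n)) :
    inner ℝ (F.incl v) (F.incl w) = inner ℝ v w := F.incl.inner_map_map v w

/-- The orthogonal projection to the tangent space. -/
def proj : Amb n →L[ℝ] EuclideanSpace ℝ (Fin n) :=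
  ContinuousLinearMap.adjoint F.incl.toContinuousLinearMap

theorem inner_proj (x : Amb n) (v : EuclideanSpace ℝ (Fin n)) :
    inner ℝ (F.proj x) v = inner ℝ x (F.incl v) := by
  rw [proj, ContinuousLinearMap.adjoint_inner_left]; rfl

theorem exists_eq (x : Amb n) : ∃ (a : ℝ) (v : EuclideanSpace ℝ (Fin n)),
    x = a • (p : Amb n) + F.incl v := by
  obtain ⟨y, rfl⟩ := F.toEquiv.surjective x
  exact ⟨y.fst, y.snd, F.toEquiv_toLp _ _⟩

theorem proj_incl (v : EuclideanSpace ℝ (Fin n)) : F.proj (F.incl v) = v := by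
  refine ext_inner_right ℝ fun w => ?_
  rw [inner_proj, inner_incl_incl]

theorem proj_center : F.proj (p : Amb n) = 0 := by
  refine ext_inner_right ℝ fun w => ?_
  rw [inner_proj, inner_incl, inner_zero_left]

theorem incl_proj (x : Amb n) : F.incl (F.proj x) = tangentProj p x := by
  obtain ⟨a, v, rfl⟩ := F.exists_eq x
  rw [map_add, map_smul, proj_center, smul_zero, zero_add, proj_incl, tangentProj, inner_add_right,
    inner_smul_right, inner_coe_sph, inner_incl]
  simp

/-- A vector is determined by its components along `p` and along the tangent space. -/
theorem incl_mem_unitTangent {v : EuclideanSpace ℝ (Fin n)} (hv : ‖v‖ = 1) :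
    F.incl v ∈ unitTangent p := ⟨by rw [F.incl.norm_map, hv], F.inner_incl v⟩

theorem unitTangent_eq : unitTangent p = F.incl '' Metric.sphere 0 1 := by
  ext u
  constructor
  · rintro ⟨hu, hpu⟩
    have h : F.incl (F.proj u) = u := by rw [incl_proj, tangentProj, hpu, zero_smul, sub_zero]
    refine ⟨F.proj u, ?_, h⟩
    rw [mem_sphere_zero_iff_norm, ← F.incl.norm_map, h, hu]
  · rintro ⟨v, hv, rfl⟩
    exact F.incl_mem_unitTangent (by simpa using hv)

/-- The radial function as a function on `ℝⁿ`, constant along rays. -/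
def rad (Ω : Set (Sph n)) (v : EuclideanSpace ℝ (Fin n)) : ℝ := radius Ω p (‖v‖⁻¹ • F.incl v)

theorem rad_of_norm_eq_one (Ω : Set (Sph n)) {v : EuclideanSpace ℝ (Fin n)} (hv : ‖v‖ = 1) :
    F.rad Ω v = radius Ω p (F.incl v) := by rw [rad, hv, inv_one, one_smul]

theorem rad_smul (Ω : Set (Sph n)) {r : ℝ} (hr : 0 < r) (v : EuclideanSpace ℝ (Fin n)) :
    F.rad Ω (r • v) = F.rad Ω v := by
  rw [rad, rad, norm_smul, Real.norm_of_nonneg hr.le, map_smul, smul_smul, mul_inv_rev, mul_assoc,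
    inv_mul_cancel₀ hr.ne', mul_one]

/-- The geodesic polar parametrisation, constant along rays in the direction variable. -/
def pt (t : ℝ) (v : EuclideanSpace ℝ (Fin n)) : Amb n := expPt p (‖v‖⁻¹ • F.incl v) t

theorem pt_of_norm_eq_one {v : EuclideanSpace ℝ (Fin n)} (hv : ‖v‖ = 1) (t : ℝ) :
    F.pt t v = Real.cos t • (p : Amb n) + Real.sin t • F.incl v := by
  rw [pt, hv, inv_one, one_smul, expPt]

theorem normalize_mem_unitTangent {v : EuclideanSpace ℝ (Fin n)} (hv : v ≠ 0) :
    ‖v‖⁻¹ • F.incl v ∈ unitTangent p := by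
  rw [← map_smul]
  exact F.incl_mem_unitTangent (by
    rw [norm_smul, norm_inv, norm_norm, inv_mul_cancel₀ (norm_ne_zero_iff.2 hv)])

theorem norm_pt {v : EuclideanSpace ℝ (Fin n)} (hv : v ≠ 0) (t : ℝ) : ‖F.pt t v‖ = 1 :=
  norm_expPt p (F.normalize_mem_unitTangent hv) t

theorem contDiffAt_pt {v : EuclideanSpace ℝ (Fin n)} (hv : v ≠ 0) (t : ℝ) {k : ℕ∞} :
    ContDiffAt ℝ k (fun z : EuclideanSpace ℝ (Fin n) × ℝ => F.pt z.2 z.1) (v, t) := by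
  have h1 : ContDiffAt ℝ k (fun z : EuclideanSpace ℝ (Fin n) × ℝ => ‖z.1‖⁻¹) (v, t) :=
    (contDiffAt_fst.norm ℝ hv).inv (norm_ne_zero_iff.2 hv)
  have h2 : ContDiffAt ℝ k (fun z : EuclideanSpace ℝ (Fin n) × ℝ => F.incl z.1) (v, t) :=
    F.incl.toContinuousLinearMap.contDiff.contDiffAt.comp _ contDiffAt_fst
  exact ((Real.contDiff_cos.contDiffAt.comp _ contDiffAt_snd).smul contDiffAt_const).add
    ((Real.contDiff_sin.contDiffAt.comp _ contDiffAt_snd).smul (h1.smul h2))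

end PolarFrame

/-! ### The radial function of a star-shaped domain -/

section Star

variable {Ω : Set (Sph n)} {p : Sph n} (hopen : IsOpen Ω) (hstar : StarShapedAt Ω p)
  (hball : Ω ⊆ geodesicBall p (Real.pi / 2))

theorem lt_pi_div_two_of_expSph_mem (hball : Ω ⊆ geodesicBall p (Real.pi / 2)) {u : Amb n}
    (hu : u ∈ unitTangent p) {t : ℝ} (ht : t < Real.pi)
    (h : expSph p hu t ∈ Ω) : t < Real.pi / 2 := by
  have h1 := (mem_geodesicBall_iff (by positivity) (by linarith [Real.pi_pos])).1 (hball h)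
  change _ < inner ℝ (p : Amb n) (expPt p u t) at h1
  rw [inner_expPt_left p hu, Real.cos_pi_div_two] at h1
  by_contra h2
  exact h1.not_ge (Real.cos_nonpos_of_pi_div_two_le_of_le (not_lt.1 h2) (by linarith))

theorem bddAbove_radius_set (Ω : Set (Sph n)) (p : Sph n) (u : Amb n) :
    BddAbove {t : ℝ | 0 ≤ t ∧ t < Real.pi ∧ expPt p u t ∈ ((↑) '' Ω : Set (Amb n))} :=
  ⟨Real.pi, fun _ ht => ht.2.1.le⟩

theorem expSph_zero (p : Sph n) {u : Amb n} (hu : u ∈ unitTangent p) : expSph p hu 0 = p :=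
  Subtype.ext (by simp [expSph, expPt])

theorem radius_pos (hopen : IsOpen Ω) (hstar : StarShapedAt Ω p) {u : Amb n}
    (hu : u ∈ unitTangent p) : 0 < radius Ω p u := by
  have h0 : expSph p hu 0 ∈ Ω := by rw [expSph_zero]; exact hstar.1
  have h1 : ∀ᶠ t in 𝓝 (0:ℝ), expSph p hu t ∈ Ω :=
    (continuous_expSph p hu).tendsto 0 (hopen.mem_nhds h0)
  obtain ⟨t, ⟨ht, htpi⟩, ht0⟩ := (((h1.and (eventually_lt_nhds Real.pi_pos)).filter_mono
    nhdsWithin_le_nhds).and (self_mem_nhdsWithin (s := Ioi (0:ℝ)))).exists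
  exact lt_of_lt_of_le ht0 (le_csSup (bddAbove_radius_set Ω p u)
    ⟨ht0.le, htpi, (expPt_mem_image_iff hu t).2 ht⟩)

theorem radius_le (hstar : StarShapedAt Ω p) (hball : Ω ⊆ geodesicBall p (Real.pi / 2)) {u : Amb n}
    (hu : u ∈ unitTangent p) : radius Ω p u ≤ Real.pi / 2 := by
  refine csSup_le ⟨0, le_rfl, Real.pi_pos, ?_⟩ ?_
  · rw [expPt_mem_image_iff hu, expSph_zero]; exact hstar.1
  · rintro t ⟨ht0, htpi, ht⟩
    exact (lt_pi_div_two_of_expSph_mem hball hu htpi ((expPt_mem_image_iff hu t).1 ht)).le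

/-- Openness gives the strict inequality, since a point of Ω can be moved slightly outwards.
Star-shapedness gives the converse, since the supremum is approached by points of Ω farther out on
the ray. -/
theorem expSph_mem_iff_lt_radius (hopen : IsOpen Ω) (hstar : StarShapedAt Ω p) {u : Amb n}
    (hu : u ∈ unitTangent p) {t : ℝ} (h0 : 0 ≤ t) (h1 : t < Real.pi) :
    expSph p hu t ∈ Ω ↔ t < radius Ω p u := by
  constructor
  · intro h
    have h2 : ∀ᶠ s in 𝓝 t, expSph p hu s ∈ Ω :=
      (continuous_expSph p hu).tendsto t (hopen.mem_nhds h)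
    obtain ⟨s, ⟨hs, hspi⟩, hst⟩ := (((h2.and (eventually_lt_nhds h1)).filter_mono
      nhdsWithin_le_nhds).and (self_mem_nhdsWithin (s := Ioi t))).exists
    exact lt_of_lt_of_le hst (le_csSup (bddAbove_radius_set Ω p u)
      ⟨h0.trans (le_of_lt hst), hspi, (expPt_mem_image_iff hu s).2 hs⟩)
  · intro h
    obtain ⟨s, ⟨hs0, hspi, hs⟩, hts⟩ := exists_lt_of_lt_csSup (by
      refine ⟨0, le_rfl, Real.pi_pos, ?_⟩
      rw [expPt_mem_image_iff hu, expSph_zero]; exact hstar.1) h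
    exact (expPt_mem_image_iff hu t).1 (hstar.2 u hu t s h0 hts.le hspi hs)

theorem expSph_radius_mem_frontier (hopen : IsOpen Ω) (hstar : StarShapedAt Ω p)
    (hball : Ω ⊆ geodesicBall p (Real.pi / 2)) {u : Amb n}
    (hu : u ∈ unitTangent p) : expSph p hu (radius Ω p u) ∈ frontier Ω := by
  have hR := radius_pos hopen hstar hu
  have hR' := radius_le hstar hball hu
  have hpi := Real.pi_pos
  rw [hopen.frontier_eq]
  refine ⟨?_, ?_⟩
  · refine mem_closure_of_tendsto (((continuous_expSph p hu).tendsto _).mono_left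
      (nhdsWithin_le_nhds (s := Iio (radius Ω p u)))) ?_
    filter_upwards [Ioo_mem_nhdsLT hR] with t ht
    exact (expSph_mem_iff_lt_radius hopen hstar hu ht.1.le (by linarith [ht.2])).2 ht.2
  · rw [expSph_mem_iff_lt_radius hopen hstar hu hR.le (by linarith)]
    exact lt_irrefl _

end Star

end Steklov

end

/-! ### Regularity of the radial function -/

noncomputable section

namespace Steklov

open MeasureTheory Set Filter Topology

variable {n : ℕ}

theorem hasGradientAt_homExt_sphGrad {f : Amb n → ℝ} {x : Amb n} (hx : ‖x‖ = 1)
    (hf : DifferentiableAt ℝ f x) : HasGradientAt (homExt f) (sphGrad f x) x := by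
  have h := hasGradientAt_homExt hx hf.hasGradientAt
  rwa [sphGrad, h.gradient]

theorem inner_sphGrad_self {f : Amb n → ℝ} {x : Amb n} (hx : ‖x‖ = 1)
    (hf : DifferentiableAt ℝ f x) : inner ℝ (sphGrad f x) x = (0 : ℝ) := by
  rw [sphGrad_eq hx hf.hasGradientAt, inner_sub_left, inner_smul_left,
    real_inner_self_eq_norm_sq, hx]
  simp

/-- The chain rule along a curve on the sphere. -/
theorem hasDerivAt_comp_curve {f : Amb n → ℝ} {γ : ℝ → Amb n} {γ' : Amb n} {t : ℝ}
    (hγ : HasDerivAt γ γ' t) (hn : ∀ᶠ s in 𝓝 t, ‖γ s‖ = 1) (hf : DifferentiableAt ℝ f (γ t)) :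
    HasDerivAt (fun s => f (γ s)) (inner ℝ (sphGrad f (γ t)) γ') t := by
  have h := (hasGradientAt_homExt_sphGrad hn.self_of_nhds hf).hasFDerivAt.comp_hasDerivAt t hγ
  rw [InnerProductSpace.toDual_apply_apply] at h
  refine h.congr_of_eventuallyEq ?_
  filter_upwards [hn] with s hs
  simp [homExt, hs]

/-- The standing assumptions on the domain. -/
structure IsStarDomain (Ω : Set (Sph n)) (p : Sph n) (α : ℝ) : Prop where
  isOpen : IsOpen Ω
  smooth : HasSmoothBoundary Ω
  star : StarShapedAt Ω p
  subset_ball : Ω ⊆ geodesicBall p (Real.pi / 2)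
  lt : α < Real.pi / 2
  angle_le : ∀ θ ∈ normalAngles Ω p, θ ≤ α

namespace IsStarDomain

variable {Ω : Set (Sph n)} {p : Sph n} {α : ℝ}

theorem radius_pos (h : IsStarDomain Ω p α) {u : Amb n} (hu : u ∈ unitTangent p) : 0 < radius Ω p u :=
  Steklov.radius_pos h.isOpen h.star hu

theorem radius_le (h : IsStarDomain Ω p α) {u : Amb n} (hu : u ∈ unitTangent p) : radius Ω p u ≤ Real.pi / 2 :=
  Steklov.radius_le h.star h.subset_ball hu

theorem mem_frontier (h : IsStarDomain Ω p α) {u : Amb n} (hu : u ∈ unitTangent p) :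
    expSph p hu (radius Ω p u) ∈ frontier Ω :=
  expSph_radius_mem_frontier h.isOpen h.star h.subset_ball hu

/-- The normalised gradient of any defining function is an admissible normal, so its angle with ∂_r
is at most α. That angle is nonnegative, hence so is α, and cos α > 0 follows. -/
theorem cos_mul_norm_le (h : IsStarDomain Ω p α) {u : Amb n} (hu : u ∈ unitTangent p) {U : Set (Amb n)} {ρ : Amb n → ℝ}
    (hρ : IsLocalDefiningFunction Ω (expSph p hu (radius Ω p u)) U ρ) :
    0 < Real.cos α ∧ Real.cos α * ‖sphGrad ρ (expPt p u (radius Ω p u))‖ ≤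
      inner ℝ (sphGrad ρ (expPt p u (radius Ω p u)))
        (-Real.sin (radius Ω p u) • (p : Amb n) + Real.cos (radius Ω p u) • u) := by
  have hR := h.radius_pos hu
  have hR' := h.radius_le hu
  have hpi := Real.pi_pos
  have hG : 0 < ‖sphGrad ρ (expPt p u (radius Ω p u))‖ := norm_pos_iff.2 hρ.grad_ne
  have hang := h.angle_le _ ⟨_, h.mem_frontier hu, _, ⟨U, ρ, hρ, rfl⟩, rfl⟩
  change InnerProductGeometry.angle (‖sphGrad ρ (expPt p u (radius Ω p u))‖⁻¹ •
    sphGrad ρ (expPt p u (radius Ω p u))) (radialField p (expPt p u (radius Ω p u))) ≤ α at hang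
  rw [radialField_expPt p hu hR (by linarith),
    InnerProductGeometry.angle_smul_left_of_pos _ _ (inv_pos.2 hG)] at hang
  set G := sphGrad ρ (expPt p u (radius Ω p u))
  set d := -Real.sin (radius Ω p u) • (p : Amb n) + Real.cos (radius Ω p u) • u with hd
  have hdn : ‖d‖ = 1 := by
    have h1 : ‖d‖ ^ 2 = 1 := by
      rw [hd, norm_add_sq_real, norm_smul, norm_smul, norm_coe_sph, hu.1, real_inner_smul_left,
        real_inner_smul_right, hu.2]
      simp
    nlinarith [norm_nonneg d]
  have h0 := InnerProductGeometry.angle_nonneg G d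
  have hα := h.lt
  refine ⟨Real.cos_pos_of_mem_Ioo ⟨by linarith, hα⟩, ?_⟩
  have hcos := Real.cos_le_cos_of_nonneg_of_le_pi h0 (by linarith) hang
  have := InnerProductGeometry.cos_angle_mul_norm_mul_norm G d
  rw [hdn, mul_one] at this
  rw [← this]
  exact mul_le_mul_of_nonneg_right hcos hG.le

theorem differentiableAt (_h : IsStarDomain Ω p α) {u : Amb n} (hu : u ∈ unitTangent p) {U : Set (Amb n)} {ρ : Amb n → ℝ}
    (hρ : IsLocalDefiningFunction Ω (expSph p hu (radius Ω p u)) U ρ) :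
    DifferentiableAt ℝ ρ (expPt p u (radius Ω p u)) :=
  ((hρ.smooth.contDiffAt (hρ.isOpen.mem_nhds hρ.mem))).differentiableAt (by simp)

theorem hasDerivAt_expPt (u : Amb n) (t : ℝ) :
    HasDerivAt (expPt p u) (-Real.sin t • (p : Amb n) + Real.cos t • u) t :=
  ((Real.hasDerivAt_cos t).smul_const _).add ((Real.hasDerivAt_sin t).smul_const _)

/-- Transversality: ρ increases strictly along the ray at the boundary. This is the role of θ ≤ α <
π/2 in the regularity of R. -/
theorem hasDerivAt_radial (h : IsStarDomain Ω p α) {u : Amb n} (hu : u ∈ unitTangent p) {U : Set (Amb n)} {ρ : Amb n → ℝ}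
    (hρ : IsLocalDefiningFunction Ω (expSph p hu (radius Ω p u)) U ρ) :
    ∃ c > 0, HasDerivAt (fun t => ρ (expPt p u t)) c (radius Ω p u) := by
  refine ⟨_, ?_, hasDerivAt_comp_curve (hasDerivAt_expPt u _)
    (Eventually.of_forall fun t => norm_expPt p hu t) (h.differentiableAt hu hρ)⟩
  have h1 := h.cos_mul_norm_le hu hρ
  exact lt_of_lt_of_le (mul_pos h1.1 (norm_pos_iff.2 hρ.grad_ne)) h1.2

/-- Lower semicontinuity comes from the openness of Ω. For upper semicontinuity, transversality
makes ρ positive at parameters slightly above R. This persists for nearby directions, and there a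
point outside Ω bounds the radius. -/
theorem tendsto_rad (h : IsStarDomain Ω p α) (F : PolarFrame p) {v : EuclideanSpace ℝ (Fin n)} (hv : v ≠ 0) :
    Tendsto (F.rad Ω) (𝓝 v) (𝓝 (F.rad Ω v)) := by
  have hu := F.normalize_mem_unitTangent hv
  have hR := h.radius_pos hu
  have hR' := h.radius_le hu
  have hpi := Real.pi_pos
  have hptc : ∀ t, ContinuousAt (fun w => F.pt t w) v := fun t =>
    (F.contDiffAt_pt hv t (k := 0)).continuousAt.comp (f := fun w => (w, t)) (by fun_prop)
  have hne : ∀ᶠ w in 𝓝 v, w ≠ 0 := eventually_ne_nhds hv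
  rw [tendsto_order]
  constructor
  · intro b hb
    -- The maximum keeps the parameter positive even when b is not.
    set t := max b (F.rad Ω v / 2)
    have ht0 : 0 < t := lt_max_of_lt_right (by change 0 < radius Ω p _ / 2; linarith)
    have htR : t < F.rad Ω v := max_lt hb (by change radius Ω p _ / 2 < radius Ω p _; linarith)
    have htpi : t < Real.pi := by change t < radius Ω p _ at htR; linarith
    obtain ⟨W, hW, hWΩ⟩ := isOpen_induced_iff.1 h.isOpen
    have hmem : F.pt t v ∈ W := by
      have := (expSph_mem_iff_lt_radius h.isOpen h.star hu ht0.le htpi).2 htR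
      rw [← hWΩ] at this
      exact this
    filter_upwards [hne, (hptc t).preimage_mem_nhds (hW.mem_nhds hmem)] with w hw hwW
    have hw' := F.normalize_mem_unitTangent hw
    have : expSph p hw' t ∈ Ω := by rw [← hWΩ]; exact hwW
    exact lt_of_le_of_lt (le_max_left _ _)
      ((expSph_mem_iff_lt_radius h.isOpen h.star hw' ht0.le htpi).1 this)
  · intro b hb
    obtain ⟨U, ρ, hρ⟩ := h.smooth _ (h.mem_frontier hu)
    obtain ⟨c, hc, hd⟩ := h.hasDerivAt_radial hu hρ
    have hz : ρ (expPt p (‖v‖⁻¹ • F.incl v) (radius Ω p (‖v‖⁻¹ • F.incl v))) = 0 :=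
      (hρ.zero_iff _ hρ.mem).1 (h.mem_frontier hu)
    have hs := (hasDerivAt_iff_tendsto_slope.1 hd).eventually (eventually_gt_nhds hc)
    have hs' : ∀ᶠ t in 𝓝[>] (radius Ω p (‖v‖⁻¹ • F.incl v)), 0 < ρ (F.pt t v) := by
      filter_upwards [hs.filter_mono (nhdsWithin_mono _ fun x (hx : _ < x) => ne_of_gt hx),
        self_mem_nhdsWithin] with t ht ht'
      rw [slope_def_field, hz, sub_zero] at ht
      exact (div_pos_iff_of_pos_right (sub_pos.2 ht')).1 ht
    have hU : ∀ᶠ t in 𝓝[>] (radius Ω p (‖v‖⁻¹ • F.incl v)), F.pt t v ∈ U :=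
      nhdsWithin_le_nhds ((hasDerivAt_expPt _ _).continuousAt.preimage_mem_nhds
        (hρ.isOpen.mem_nhds hρ.mem))
    obtain ⟨t, ⟨ht1, ht2⟩, ht3⟩ := ((hs'.and hU).and (Ioo_mem_nhdsGT
      (lt_min hb (by linarith : radius Ω p (‖v‖⁻¹ • F.incl v) < Real.pi)))).exists
    have hρc : ContinuousAt ρ (F.pt t v) :=
      (hρ.smooth.contDiffAt (hρ.isOpen.mem_nhds ht2)).continuousAt
    filter_upwards [hne, (hptc t).preimage_mem_nhds (hρ.isOpen.mem_nhds ht2),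
      (hρc.comp (hptc t)).preimage_mem_nhds (Ioi_mem_nhds ht1)] with w hw hwU hwρ
    have hw' := F.normalize_mem_unitTangent hw
    have h1 : expSph p hw' t ∉ Ω := fun hh =>
      lt_asymm (α := ℝ) hwρ ((hρ.neg_iff (expSph p hw' t) hwU).1 hh)
    rw [expSph_mem_iff_lt_radius h.isOpen h.star hw' (hR.le.trans ht3.1.le)
      (ht3.2.trans_le (min_le_right _ _)), not_lt] at h1
    exact lt_of_le_of_lt h1 (ht3.2.trans_le (min_le_left _ _))

/-- Implicit function theorem for ρ(exp_p(t u)) = 0, whose t-derivative does not vanish by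
transversality. The continuity of R, proved beforehand, ensures that R is the branch that the
theorem provides. -/
theorem contDiffAt_rad (h : IsStarDomain Ω p α) (F : PolarFrame p) {v : EuclideanSpace ℝ (Fin n)} (hv : v ≠ 0) :
    ContDiffAt ℝ ∞ (F.rad Ω) v := by
  have hu := F.normalize_mem_unitTangent hv
  obtain ⟨U, ρ, hρ⟩ := h.smooth _ (h.mem_frontier hu)
  obtain ⟨c, hc, hd⟩ := h.hasDerivAt_radial hu hρ
  have hpt := F.contDiffAt_pt hv (F.rad Ω v) (k := ⊤)
  have hcd : ContDiffAt ℝ ∞ (fun z : EuclideanSpace ℝ (Fin n) × ℝ => ρ (F.pt z.2 z.1))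
      (v, F.rad Ω v) :=
    ContDiffAt.comp (v, F.rad Ω v) (hρ.smooth.contDiffAt (hρ.isOpen.mem_nhds hρ.mem)) hpt
  have hone : fderiv ℝ (fun z : EuclideanSpace ℝ (Fin n) × ℝ => ρ (F.pt z.2 z.1)) (v, F.rad Ω v)
      (0, 1) = c := by
    have h1 := (hcd.differentiableAt (by simp)).hasFDerivAt.comp_hasDerivAt (F.rad Ω v)
      ((hasDerivAt_const (F.rad Ω v) v).prodMk (hasDerivAt_id (F.rad Ω v)))
    exact h1.unique hd
  have hinv : (fderiv ℝ (fun z : EuclideanSpace ℝ (Fin n) × ℝ => ρ (F.pt z.2 z.1))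
      (v, F.rad Ω v) ∘L .inr ℝ (EuclideanSpace ℝ (Fin n)) ℝ).IsInvertible := by
    refine ⟨ContinuousLinearEquiv.unitsEquivAut ℝ (Units.mk0 c hc.ne'), ?_⟩
    ext
    simp [hone]
  have hev := hcd.eventually_apply_eq_iff_implicitFunction (by simp) hinv
  have ht := h.tendsto_rad F hv
  have hpair : Tendsto (fun w => (w, F.rad Ω w)) (𝓝 v) (𝓝 (v, F.rad Ω v)) :=
    tendsto_id.prodMk_nhds ht
  have hz : ρ (F.pt (F.rad Ω v) v) = 0 := (hρ.zero_iff _ hρ.mem).1 (h.mem_frontier hu)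
  have hU : ∀ᶠ w in 𝓝 v, F.pt (F.rad Ω w) w ∈ U :=
    (hpt.continuousAt.tendsto.comp hpair).eventually (hρ.isOpen.mem_nhds hρ.mem)
  refine (hcd.contDiffAt_implicitFunction (by simp) hinv).congr_of_eventuallyEq ?_
  filter_upwards [hpair.eventually hev, hU, eventually_ne_nhds hv] with w hw hwU hw0
  have hw' := F.normalize_mem_unitTangent hw0
  have hzw : ρ (F.pt (F.rad Ω w) w) = 0 :=
    (hρ.zero_iff (expSph p hw' (F.rad Ω w)) hwU).1 (h.mem_frontier hw')
  exact (hw.1 (hzw.trans hz.symm)).symm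

theorem isHomogeneousC1_rad (h : IsStarDomain Ω p α) (F : PolarFrame p) : IsHomogeneousC1 (F.rad Ω) where
  contDiffAt v hv := (h.contDiffAt_rad F hv).of_le (by norm_cast)
  smul_eq r v hr := F.rad_smul Ω hr v

theorem rad_pos (h : IsStarDomain Ω p α) (F : PolarFrame p) {v : EuclideanSpace ℝ (Fin n)} (hv : v ≠ 0) : 0 < F.rad Ω v :=
  h.radius_pos (F.normalize_mem_unitTangent hv)

theorem rad_le (h : IsStarDomain Ω p α) (F : PolarFrame p) {v : EuclideanSpace ℝ (Fin n)} (hv : v ≠ 0) :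
    F.rad Ω v ≤ Real.pi / 2 :=
  h.radius_le (F.normalize_mem_unitTangent hv)

theorem sin_rad_pos (h : IsStarDomain Ω p α) (F : PolarFrame p) {v : EuclideanSpace ℝ (Fin n)} (hv : v ≠ 0) :
    0 < Real.sin (F.rad Ω v) := sin_pos_of_le_pi_div_two (h.rad_pos F hv) (h.rad_le F hv)

end IsStarDomain

end Steklov

end

/-! ### Gradients and normals in polar coordinates -/

noncomputable section

namespace Steklov

open MeasureTheory Set Filter Topology

variable {n : ℕ}

namespace PolarFrame

variable {p : Sph n} (F : PolarFrame p)

/-- The radial unit vector at `F.pt t u`. -/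
def dr (t : ℝ) (u : EuclideanSpace ℝ (Fin n)) : Amb n :=
  -Real.sin t • (p : Amb n) + Real.cos t • F.incl u

/-- The component of an ambient vector tangent to the unit sphere of the tangent space at `u`. -/
def tang (u : EuclideanSpace ℝ (Fin n)) (x : Amb n) : EuclideanSpace ℝ (Fin n) :=
  F.proj x - inner ℝ u (F.proj x) • u

theorem inner_tang {u : EuclideanSpace ℝ (Fin n)} (hu : ‖u‖ = 1) (x : Amb n) :
    inner ℝ u (F.tang u x) = (0 : ℝ) := by
  rw [tang, inner_sub_right, inner_smul_right, real_inner_self_eq_norm_sq, hu]; simp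

theorem eq_polar {u : EuclideanSpace ℝ (Fin n)} (hu : ‖u‖ = 1) (t : ℝ) (x : Amb n) :
    x = inner ℝ x (F.pt t u) • F.pt t u + inner ℝ x (F.dr t u) • F.dr t u
      + F.incl (F.tang u x) := by
  obtain ⟨a, v, rfl⟩ := F.exists_eq x
  rw [F.pt_of_norm_eq_one hu, dr, tang, map_add, map_smul, F.proj_center, smul_zero, zero_add,
    F.proj_incl, map_sub, map_smul]
  simp only [inner_add_left, inner_add_right, inner_smul_left, inner_smul_right, F.inner_incl,
    F.incl_inner, inner_coe_sph, F.inner_incl_incl, real_inner_comm v u]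
  simp only [conj_trivial]
  set b : ℝ := inner ℝ v u
  have h := Real.sin_sq_add_cos_sq t
  have e1 : a • (p : Amb n) + F.incl v = (a * (Real.sin t ^ 2 + Real.cos t ^ 2)) • (p : Amb n)
      + (b * (Real.sin t ^ 2 + Real.cos t ^ 2) - b) • F.incl u + F.incl v := by
    rw [h]; module
  rw [e1]
  module

theorem norm_dr {u : EuclideanSpace ℝ (Fin n)} (hu : ‖u‖ = 1) (t : ℝ) : ‖F.dr t u‖ = 1 := by
  have h1 : ‖F.dr t u‖ ^ 2 = 1 := by
    rw [dr, norm_add_sq_real, norm_smul, norm_smul, norm_coe_sph, F.incl.norm_map, hu,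
      real_inner_smul_left, real_inner_smul_right, F.inner_incl]
    simp
  nlinarith [norm_nonneg (F.dr t u)]

theorem inner_dr_incl {u w : EuclideanSpace ℝ (Fin n)} (h : inner ℝ u w = (0 : ℝ)) (t : ℝ) :
    inner ℝ (F.dr t u) (F.incl w) = (0 : ℝ) := by
  rw [dr, inner_add_left, inner_smul_left, inner_smul_left, F.inner_incl, F.inner_incl_incl, h]
  simp

theorem norm_smul_dr_add {u w : EuclideanSpace ℝ (Fin n)} (hu : ‖u‖ = 1)
    (h : inner ℝ u w = (0 : ℝ)) (t c : ℝ) :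
    ‖c • F.dr t u + F.incl w‖ ^ 2 = c ^ 2 + ‖w‖ ^ 2 := by
  rw [norm_add_sq_real, norm_smul, F.norm_dr hu, inner_smul_left, F.inner_dr_incl h,
    F.incl.norm_map, Real.norm_eq_abs, mul_one, sq_abs]
  simp

theorem eq_polar_of_inner_eq_zero {u : EuclideanSpace ℝ (Fin n)} (hu : ‖u‖ = 1) {t : ℝ} {x : Amb n}
    (hx : inner ℝ x (F.pt t u) = (0 : ℝ)) :
    x = inner ℝ x (F.dr t u) • F.dr t u + F.incl (F.tang u x) := by
  have h := F.eq_polar hu t x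
  rwa [hx, zero_smul, zero_add] at h

theorem norm_sq_polar {u : EuclideanSpace ℝ (Fin n)} (hu : ‖u‖ = 1) {t : ℝ} {x : Amb n}
    (hx : inner ℝ x (F.pt t u) = (0 : ℝ)) :
    ‖x‖ ^ 2 = inner ℝ x (F.dr t u) ^ 2 + ‖F.tang u x‖ ^ 2 := by
  conv_lhs => rw [F.eq_polar_of_inner_eq_zero hu hx]
  exact F.norm_smul_dr_add hu (F.inner_tang hu x) t _

/-- The derivative of the polar parametrisation over a graph. -/
theorem hasFDerivAt_pt {T : EuclideanSpace ℝ (Fin n) → ℝ} {g u : EuclideanSpace ℝ (Fin n)}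
    (hu : ‖u‖ = 1) (hT : HasGradientAt T g u) :
    HasFDerivAt (fun v => F.pt (T v) v)
      ((innerSL ℝ g).smulRight (F.dr (T u) u) + Real.sin (T u) •
        (F.incl.toContinuousLinearMap ∘L (ContinuousLinearMap.id ℝ (EuclideanSpace ℝ (Fin n)) -
          (innerSL ℝ u).smulRight u))) u := by
  have hT' : HasFDerivAt T (innerSL ℝ g) u := hT.hasFDerivAt
  have h1 := hT'.cos.smul_const (p : Amb n)
  have h2 : HasFDerivAt (fun v => F.incl.toContinuousLinearMap (‖v‖⁻¹ • v)) _ u :=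
    F.incl.toContinuousLinearMap.hasFDerivAt.comp u (hasFDerivAt_normalize hu)
  have h3 := h1.add (hT'.sin.smul h2)
  have he : (fun v => F.pt (T v) v) = fun v => Real.cos (T v) • (p : Amb n) + Real.sin (T v) •
      F.incl.toContinuousLinearMap (‖v‖⁻¹ • v) := by
    funext v
    rw [pt, expPt, map_smul]; rfl
  rw [he]
  refine h3.congr_fderiv ?_
  ext1 w
  simp [dr, hu]
  module

/-- The gradient of a function on the sphere, read over a graph in polar coordinates. -/
theorem hasGradientAt_comp_pt {f : Amb n → ℝ} {T : EuclideanSpace ℝ (Fin n) → ℝ}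
    {g u : EuclideanSpace ℝ (Fin n)} (hu : ‖u‖ = 1) (hT : HasGradientAt T g u)
    (hf : DifferentiableAt ℝ f (F.pt (T u) u)) :
    HasGradientAt (fun v => f (F.pt (T v) v))
      (inner ℝ (sphGrad f (F.pt (T u) u)) (F.dr (T u) u) • g
        + Real.sin (T u) • F.tang u (sphGrad f (F.pt (T u) u))) u := by
  have hu0 : u ≠ 0 := fun h => by simp [h] at hu
  have h : HasFDerivAt (fun v => homExt f (F.pt (T v) v)) _ u :=
    HasFDerivAt.comp (f := fun v => F.pt (T v) v) u
      (hasGradientAt_homExt_sphGrad (F.norm_pt hu0 _) hf).hasFDerivAt (F.hasFDerivAt_pt hu hT)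
  rw [hasGradientAt_iff_hasFDerivAt]
  refine HasFDerivAt.congr_of_eventuallyEq (h.congr_fderiv ?_) ?_
  · ext w
    simp only [ContinuousLinearMap.comp_apply, InnerProductSpace.toDual_apply_apply,
      add_apply, ContinuousLinearMap.smulRight_apply, innerSL_apply_apply,
      smul_apply, sub_apply, ContinuousLinearMap.id_apply,
      inner_add_right, inner_add_left, inner_smul_right, inner_smul_left, tang, inner_sub_left]
    change _ + _ * inner ℝ _ (F.incl (w - inner ℝ u w • u)) = _
    rw [← F.inner_proj, inner_sub_right, inner_smul_right, real_inner_comm u]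
    simp only [conj_trivial]
    ring
  · filter_upwards [eventually_ne_nhds hu0] with v hv
    simp [homExt, F.norm_pt hv]

end PolarFrame

namespace IsStarDomain

variable {Ω : Set (Sph n)} {p : Sph n} {α : ℝ}

theorem hasGradientAt_rad (h : IsStarDomain Ω p α) (F : PolarFrame p)
    {v : EuclideanSpace ℝ (Fin n)} (hv : v ≠ 0) :
    HasGradientAt (F.rad Ω) (gradient (F.rad Ω) v) v :=
  ((h.contDiffAt_rad F hv).differentiableAt (by simp)).hasGradientAt

theorem inner_gradient_rad (_h : IsStarDomain Ω p α) (F : PolarFrame p)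
    (v : EuclideanSpace ℝ (Fin n)) : inner ℝ v (gradient (F.rad Ω) v) = (0 : ℝ) := by
  rw [real_inner_comm]
  exact inner_gradient_self_of_homogeneous (fun r x hr => F.rad_smul Ω hr x) v

/-- The (non-normalised) outward conormal of the boundary in polar coordinates. -/
theorem sphGrad_eq_of_localDefining (h : IsStarDomain Ω p α) (F : PolarFrame p)
    {u : EuclideanSpace ℝ (Fin n)} (hu : ‖u‖ = 1) {q : Sph n} (hq : (q : Amb n) = F.pt (F.rad Ω u) u)
    {U : Set (Amb n)} {ρ : Amb n → ℝ} (hρ : IsLocalDefiningFunction Ω q U ρ) :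
    (0 < Real.cos α ∧ Real.cos α * ‖sphGrad ρ q‖ ≤ inner ℝ (sphGrad ρ q) (F.dr (F.rad Ω u) u)) ∧
    sphGrad ρ q = inner ℝ (sphGrad ρ q) (F.dr (F.rad Ω u) u) •
      (F.dr (F.rad Ω u) u - F.incl ((Real.sin (F.rad Ω u))⁻¹ • gradient (F.rad Ω) u)) := by
  have hu0 : u ≠ 0 := fun hh => by simp [hh] at hu
  have hut := F.incl_mem_unitTangent hu
  have hq' : q = expSph p hut (radius Ω p (F.incl u)) := by
    refine Subtype.ext ?_
    rw [hq, F.rad_of_norm_eq_one Ω hu, PolarFrame.pt, hu, inv_one, one_smul]; rfl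
  have hq2 : F.pt (F.rad Ω u) u = expPt p (F.incl u) (radius Ω p (F.incl u)) := by
    rw [← hq, hq']; rfl
  have hd : DifferentiableAt ℝ ρ (F.pt (F.rad Ω u) u) := by
    rw [hq2]
    exact h.differentiableAt hut (by rwa [← hq'])
  constructor
  · have := h.cos_mul_norm_le hut (by rwa [← hq'])
    rw [hq, hq2, PolarFrame.dr, F.rad_of_norm_eq_one Ω hu]
    exact this
  have hg := F.hasGradientAt_comp_pt hu (h.hasGradientAt_rad F hu0) hd
  -- The function ρ vanishes along the graph of R. Differentiating this in the direction variable
  -- determines the tangential part of ∇ρ from its radial part.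
  have hz : (fun v => ρ (F.pt (F.rad Ω v) v)) =ᶠ[𝓝 u] fun _ => 0 := by
    have hc : ContinuousAt (fun v => F.pt (F.rad Ω v) v) u :=
      (F.hasFDerivAt_pt hu (h.hasGradientAt_rad F hu0)).continuousAt
    have hU : F.pt (F.rad Ω u) u ∈ U := hq ▸ hρ.mem
    filter_upwards [hc.preimage_mem_nhds (hρ.isOpen.mem_nhds hU), eventually_ne_nhds hu0]
      with v hv hv0
    exact (hρ.zero_iff (expSph p (F.normalize_mem_unitTangent hv0) (F.rad Ω v)) hv).1
      (h.mem_frontier (F.normalize_mem_unitTangent hv0))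
  have h0 : HasGradientAt (fun v => ρ (F.pt (F.rad Ω v) v)) 0 u := by
    have h1 : HasGradientAt (fun _ : EuclideanSpace ℝ (Fin n) => (0:ℝ)) 0 u :=
      hasGradientAt_const u 0
    rw [hasGradientAt_iff_hasFDerivAt] at h1 ⊢
    exact h1.congr_of_eventuallyEq hz
  have hzero := hg.unique h0
  have hs := h.sin_rad_pos F hu0
  rw [hq]
  have hGp := inner_sphGrad_self (F.norm_pt hu0 _) hd
  set G := sphGrad ρ (F.pt (F.rad Ω u) u)
  have htau : F.tang u G = -((inner ℝ G (F.dr (F.rad Ω u) u) * (Real.sin (F.rad Ω u))⁻¹) •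
      gradient (F.rad Ω) u) := by
    have h2 : Real.sin (F.rad Ω u) • F.tang u G
        = -(inner ℝ G (F.dr (F.rad Ω u) u) • gradient (F.rad Ω) u) := by
      rw [eq_neg_iff_add_eq_zero, add_comm]; exact hzero
    calc F.tang u G = (Real.sin (F.rad Ω u))⁻¹ • Real.sin (F.rad Ω u) • F.tang u G := by
          rw [smul_smul, inv_mul_cancel₀ hs.ne', one_smul]
      _ = _ := by rw [h2]; module
  refine (F.eq_polar_of_inner_eq_zero hu hGp).trans ?_
  rw [htau, map_neg, map_smul, map_smul]
  module

/-- The slope factor of the boundary in polar coordinates. -/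
def _root_.Steklov.PolarFrame.secant (F : PolarFrame p) (Ω : Set (Sph n))
    (u : EuclideanSpace ℝ (Fin n)) : ℝ :=
  Real.sqrt (1 + ‖gradient (F.rad Ω) u‖ ^ 2 / Real.sin (F.rad Ω u) ^ 2)

theorem _root_.Steklov.PolarFrame.one_le_secant (F : PolarFrame p) (Ω : Set (Sph n))
    (u : EuclideanSpace ℝ (Fin n)) : 1 ≤ F.secant Ω u := by
  rw [PolarFrame.secant, Real.one_le_sqrt]
  have : 0 ≤ ‖gradient (F.rad Ω) u‖ ^ 2 / Real.sin (F.rad Ω u) ^ 2 := by positivity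
  linarith

theorem norm_conormal (h : IsStarDomain Ω p α) (F : PolarFrame p)
    {u : EuclideanSpace ℝ (Fin n)} (hu : ‖u‖ = 1) :
    ‖F.dr (F.rad Ω u) u - F.incl ((Real.sin (F.rad Ω u))⁻¹ • gradient (F.rad Ω) u)‖
      = F.secant Ω u := by
  have h1 := F.norm_smul_dr_add hu (w := -((Real.sin (F.rad Ω u))⁻¹ • gradient (F.rad Ω) u)) (by
    rw [inner_neg_right, inner_smul_right, h.inner_gradient_rad F u]; simp) (F.rad Ω u) 1
  rw [one_smul, map_neg, ← sub_eq_add_neg] at h1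
  rw [PolarFrame.secant, eq_comm, Real.sqrt_eq_iff_mul_self_eq (by positivity) (norm_nonneg _),
    ← sq, h1, norm_neg, norm_smul, mul_pow, norm_inv, Real.norm_eq_abs, inv_pow, sq_abs]
  ring

/-- Every outward unit normal in polar coordinates. -/
theorem outwardNormal_eq (h : IsStarDomain Ω p α) (F : PolarFrame p)
    {u : EuclideanSpace ℝ (Fin n)} (hu : ‖u‖ = 1) {q : Sph n} (hq : (q : Amb n) = F.pt (F.rad Ω u) u)
    {ν : Amb n} (hν : IsOutwardNormal Ω q ν) :
    F.secant Ω u • ν = F.dr (F.rad Ω u) u -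
      F.incl ((Real.sin (F.rad Ω u))⁻¹ • gradient (F.rad Ω) u) := by
  obtain ⟨U, ρ, hρ, rfl⟩ := hν
  obtain ⟨⟨hc, h1⟩, h2⟩ := h.sphGrad_eq_of_localDefining F hu hq hρ
  have hG : 0 < ‖sphGrad ρ q‖ := norm_pos_iff.2 hρ.grad_ne
  have hc0 : 0 < inner ℝ (sphGrad ρ q) (F.dr (F.rad Ω u) u) := lt_of_lt_of_le (mul_pos hc hG) h1
  have hS := F.one_le_secant Ω u
  set c := inner ℝ (sphGrad ρ q) (F.dr (F.rad Ω u) u)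
  have hn : ‖sphGrad ρ q‖ = c * F.secant Ω u := by
    rw [h2, norm_smul, h.norm_conormal F hu, Real.norm_of_nonneg hc0.le]
  rw [hn, smul_smul]
  conv_lhs => rw [h2]
  rw [smul_smul, show F.secant Ω u * (c * F.secant Ω u)⁻¹ * c = 1 by field_simp, one_smul]

theorem exists_localDefining (h : IsStarDomain Ω p α) (F : PolarFrame p)
    {u : EuclideanSpace ℝ (Fin n)} (hu : ‖u‖ = 1) :
    ∃ q ∈ frontier Ω, (q : Amb n) = F.pt (F.rad Ω u) u := by
  refine ⟨_, h.mem_frontier (F.incl_mem_unitTangent hu), ?_⟩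
  rw [F.rad_of_norm_eq_one Ω hu, PolarFrame.pt, hu, inv_one, one_smul]; rfl

/-- The conormal ∂_r − ∇R / sin R has radial component 1 and length `secant`, so `secant` is sec θ,
and the bound on θ applies. -/
theorem cos_pos_and_secant_le (h : IsStarDomain Ω p α) (F : PolarFrame p)
    {u : EuclideanSpace ℝ (Fin n)} (hu : ‖u‖ = 1) :
    0 < Real.cos α ∧ F.secant Ω u ≤ (Real.cos α)⁻¹ := by
  obtain ⟨q, hqf, hq⟩ := h.exists_localDefining F hu
  obtain ⟨U, ρ, hρ⟩ := h.smooth q hqf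
  obtain ⟨⟨hc, h1⟩, h2⟩ := h.sphGrad_eq_of_localDefining F hu hq hρ
  have hG : 0 < ‖sphGrad ρ q‖ := norm_pos_iff.2 hρ.grad_ne
  have hc0 : 0 < inner ℝ (sphGrad ρ q) (F.dr (F.rad Ω u) u) := lt_of_lt_of_le (mul_pos hc hG) h1
  set c := inner ℝ (sphGrad ρ q) (F.dr (F.rad Ω u) u)
  have hn : ‖sphGrad ρ q‖ = c * F.secant Ω u := by
    rw [h2, norm_smul, h.norm_conormal F hu, Real.norm_of_nonneg hc0.le]
  refine ⟨hc, ?_⟩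
  rw [hn] at h1
  rw [← one_div, le_div_iff₀ hc]
  have : c * (F.secant Ω u * Real.cos α) ≤ c * 1 := by linarith
  exact le_of_mul_le_mul_left this hc0

/-- The extension used in `radiusGrad` is `rad` composed with the projection to T_p, whose adjoint
is the inclusion. -/
theorem radiusGrad_eq (h : IsStarDomain Ω p α) (F : PolarFrame p)
    {u : EuclideanSpace ℝ (Fin n)} (hu : ‖u‖ = 1) :
    radiusGrad Ω p (F.incl u) = F.incl (gradient (F.rad Ω) u) := by
  have hu0 : u ≠ 0 := fun hh => by simp [hh] at hu
  have he : (fun v => radius Ω p (‖tangentProj p v‖⁻¹ • tangentProj p v))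
      = fun v => F.rad Ω (F.proj v) := by
    funext v
    rw [← F.incl_proj, PolarFrame.rad, F.incl.norm_map]
  rw [radiusGrad, he]
  refine HasGradientAt.gradient ?_
  rw [hasGradientAt_iff_hasFDerivAt]
  have h1 : HasFDerivAt (F.rad Ω) (innerSL ℝ (gradient (F.rad Ω) u)) (F.proj (F.incl u)) := by
    rw [F.proj_incl]; exact (h.hasGradientAt_rad F hu0).hasFDerivAt
  refine (h1.comp (F.incl u) F.proj.hasFDerivAt).congr_fderiv ?_
  ext w
  simp only [ContinuousLinearMap.comp_apply, innerSL_apply_apply,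
    InnerProductSpace.toDual_apply_apply]
  rw [real_inner_comm, F.inner_proj, real_inner_comm]

end IsStarDomain

end Steklov

end

noncomputable section

namespace Steklov

open MeasureTheory Set Filter Topology
open scoped ENNReal

/-! ### Integration in polar coordinates -/

theorem lintegral_polar {E : Type*} [NormedAddCommGroup E] [InnerProductSpace ℝ E]
    [FiniteDimensional ℝ E] [MeasurableSpace E] [BorelSpace E] {g : E → ℝ≥0∞}
    (hg : Measurable g) [Nontrivial E] :
    ∫⁻ x, g x = ∫⁻ u : Metric.sphere (0 : E) 1, (∫⁻ r in Ioi (0:ℝ),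
      ENNReal.ofReal (r ^ (Module.finrank ℝ E - 1)) * g (r • (u : E)))
        ∂(volume : Measure E).toSphere := by
  have hmp := (volume : Measure E).measurePreserving_homeomorphUnitSphereProd
  have hm : Measurable fun z : Metric.sphere (0 : E) 1 × Ioi (0 : ℝ) =>
      g ((z.2 : ℝ) • (z.1 : E)) := hg.comp (by fun_prop)
  calc ∫⁻ x, g x = ∫⁻ x in ({0}ᶜ : Set E), g x := by rw [restrict_compl_singleton]
    _ = ∫⁻ x : ({0}ᶜ : Set E), g x ∂((volume : Measure E).comap (↑)) := by
        rw [lintegral_subtype_comap (measurableSet_singleton _).compl]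
    _ = ∫⁻ x : ({0}ᶜ : Set E), (fun z : Metric.sphere (0 : E) 1 × Ioi (0 : ℝ) =>
          g ((z.2 : ℝ) • (z.1 : E))) (homeomorphUnitSphereProd E x)
          ∂((volume : Measure E).comap (↑)) := by
        refine lintegral_congr fun x => ?_
        have hx : ‖(x : E)‖ ≠ 0 := norm_ne_zero_iff.2 x.2
        simp [smul_smul, hx]
    _ = _ := by
        rw [hmp.lintegral_comp hm, lintegral_prod _ hm.aemeasurable]
        refine lintegral_congr fun u => ?_
        have hmr : Measurable fun r : Ioi (0 : ℝ) =>
            ENNReal.ofReal ((r : ℝ) ^ (Module.finrank ℝ E - 1)) := by fun_prop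
        rw [Measure.volumeIoiPow, lintegral_withDensity_eq_lintegral_mul _ hmr
          (g := fun r : Ioi (0 : ℝ) => g ((r : ℝ) • (u : E))) (hg.comp (by fun_prop))]
        exact lintegral_subtype_comap measurableSet_Ioi fun r : ℝ =>
          ENNReal.ofReal (r ^ (Module.finrank ℝ E - 1)) * g (r • (u : E))

/-- Plane polar coordinates a = r cos t, ρ = r sin t on the half plane ρ > 0. The weight ρ^d and the
Jacobian r combine to r^{d+1} sin^d t. -/
theorem lintegral_half_plane {d : ℕ} {k : ℝ → ℝ → ℝ≥0∞} {w gS : ℝ → ℝ≥0∞}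
    (hk : Measurable (Function.uncurry k)) (hw : Measurable w) (hgS : Measurable gS)
    (h : ∀ r t : ℝ, 0 < r → k (r * Real.cos t) (r * Real.sin t) = w r * gS t) :
    ∫⁻ a : ℝ, (∫⁻ ρ in Ioi (0:ℝ), ENNReal.ofReal (ρ ^ d) * k a ρ) =
      (∫⁻ r in Ioi (0:ℝ), ENNReal.ofReal (r ^ (d + 1)) * w r) *
        ∫⁻ t in Ioo 0 Real.pi, ENNReal.ofReal (Real.sin t ^ d) * gS t := by
  set H : ℝ × ℝ → ℝ≥0∞ := fun z => (Ioi (0:ℝ)).indicator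
    (fun ρ => ENNReal.ofReal (ρ ^ d) * k z.1 ρ) z.2 with hH
  have hHm : Measurable H := by
    have h1 : Measurable fun z : ℝ × ℝ => ENNReal.ofReal (z.2 ^ d) * k z.1 z.2 :=
      (by fun_prop : Measurable fun z : ℝ × ℝ => ENNReal.ofReal (z.2 ^ d)).mul hk
    have h2 : H = (Prod.snd ⁻¹' (Ioi (0:ℝ)) : Set (ℝ × ℝ)).indicator
        fun z : ℝ × ℝ => ENNReal.ofReal (z.2 ^ d) * k z.1 z.2 := by
      ext z
      simp only [hH, indicator, mem_preimage]
    rw [h2]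
    exact h1.indicator (measurable_snd measurableSet_Ioi)
  have h1 : ∫⁻ a : ℝ, (∫⁻ ρ in Ioi (0:ℝ), ENNReal.ofReal (ρ ^ d) * k a ρ) = ∫⁻ z : ℝ × ℝ, H z := by
    rw [Measure.volume_eq_prod, lintegral_prod _ hHm.aemeasurable]
    refine lintegral_congr fun a => ?_
    rw [← lintegral_indicator measurableSet_Ioi]
  rw [h1, ← lintegral_comp_polarCoord_symm, polarCoord_target]
  have hval : ∀ r ∈ Ioi (0:ℝ), ∀ t ∈ Ioo (-Real.pi) Real.pi,
      ENNReal.ofReal r • H (polarCoord.symm (r, t)) =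
        (ENNReal.ofReal (r ^ (d + 1)) * w r) *
        (Ioo 0 Real.pi).indicator (fun t => ENNReal.ofReal (Real.sin t ^ d) * gS t) t := by
    intro r hr t ht
    have hr' : (0:ℝ) < r := hr
    rw [polarCoord_symm_apply]
    simp only [hH]
    by_cases h0 : 0 < t
    · have hs : 0 < Real.sin t := Real.sin_pos_of_pos_of_lt_pi h0 ht.2
      rw [indicator_of_mem (show r * Real.sin t ∈ Ioi (0:ℝ) from
        mul_pos hr' hs), indicator_of_mem (show t ∈ Ioo 0 Real.pi from ⟨h0, ht.2⟩)]
      simp only [h r t hr', smul_eq_mul]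
      rw [mul_pow, pow_succ, ENNReal.ofReal_mul (by positivity), ENNReal.ofReal_mul (by positivity)]
      ring
    · have hs : Real.sin t ≤ 0 := Real.sin_nonpos_of_nonpos_of_neg_pi_le (not_lt.1 h0) ht.1.le
      rw [indicator_of_notMem (fun hh => h0 (mem_Ioo.1 hh).1), indicator_of_notMem
        (fun hh : r * Real.sin t ∈ Ioi (0:ℝ) =>
          absurd hh (not_lt.2 (mul_nonpos_of_nonneg_of_nonpos hr'.le hs)))]
      simp
  have hmeas : Measurable fun z : ℝ × ℝ => ENNReal.ofReal z.1 • H (polarCoord.symm z) :=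
    (by fun_prop : Measurable fun z : ℝ × ℝ => ENNReal.ofReal z.1).mul
      (hHm.comp continuous_polarCoord_symm.measurable)
  rw [Measure.volume_eq_prod, ← Measure.prod_restrict, lintegral_prod _ hmeas.aemeasurable]
  have hmi : Measurable fun t : ℝ => ENNReal.ofReal (Real.sin t ^ d) * gS t :=
    (by fun_prop : Measurable fun t : ℝ => ENNReal.ofReal (Real.sin t ^ d)).mul hgS
  have hmr : Measurable fun r : ℝ => ENNReal.ofReal (r ^ (d + 1)) * w r :=
    (by fun_prop : Measurable fun t : ℝ => ENNReal.ofReal (t ^ (d + 1))).mul hw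
  rw [← lintegral_mul_const _ hmr]
  refine setLIntegral_congr_fun measurableSet_Ioi fun r hr => ?_
  change (∫⁻ t in Ioo (-Real.pi) Real.pi, ENNReal.ofReal r • H (polarCoord.symm (r, t))) = _
  rw [setLIntegral_congr_fun measurableSet_Ioo (hval r hr),
    lintegral_const_mul _ (hmi.indicator measurableSet_Ioo),
    lintegral_indicator measurableSet_Ioo, Measure.restrict_restrict measurableSet_Ioo,
    inter_eq_left.2 (Ioo_subset_Ioo_left (by linarith [Real.pi_pos]))]

namespace PolarFrame

variable {n : ℕ} {p : Sph n} (F : PolarFrame p)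

theorem measurePreserving :
    MeasurePreserving (fun z : ℝ × EuclideanSpace ℝ (Fin n) => z.1 • (p : Amb n) + F.incl z.2) := by
  have h1 : MeasurePreserving
      (fun z : ℝ × EuclideanSpace ℝ (Fin n) => F.toEquiv (WithLp.toLp 2 z)) :=
    F.toEquiv.measurePreserving.comp (WithLp.volume_preserving_toLp _ _)
  convert h1 using 1
  ext1 z
  exact (F.toEquiv_toLp z.1 z.2).symm

theorem continuous_pt_sphere : Continuous
    fun z : ℝ × Metric.sphere (0 : EuclideanSpace ℝ (Fin n)) 1 => F.pt z.1 z.2 := by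
  have : (fun z : ℝ × Metric.sphere (0 : EuclideanSpace ℝ (Fin n)) 1 => F.pt z.1 z.2)
      = fun z => Real.cos z.1 • (p : Amb n) + Real.sin z.1 • F.incl z.2 := by
    ext1 z
    rw [F.pt_of_norm_eq_one (norm_eq_of_mem_sphere z.2)]
  rw [this]
  have := F.incl.continuous
  fun_prop

theorem lintegral_frame (hn : 1 ≤ n) {G : Amb n → ℝ≥0∞} (hG : Measurable G) :
    ∫⁻ y, G y = ∫⁻ u : Metric.sphere (0 : EuclideanSpace ℝ (Fin n)) 1, (∫⁻ a : ℝ,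
      (∫⁻ ρ in Ioi (0:ℝ), ENNReal.ofReal (ρ ^ (n - 1)) *
        G (a • (p : Amb n) + ρ • F.incl (u : EuclideanSpace ℝ (Fin n)))))
          ∂(volume : Measure (EuclideanSpace ℝ (Fin n))).toSphere := by
  have : Nontrivial (EuclideanSpace ℝ (Fin n)) :=
    Module.nontrivial_of_finrank_pos (R := ℝ) (by rw [finrank_euclideanSpace_fin]; omega)
  have hcont : Continuous F.incl := F.incl.continuous
  have hGz : Measurable fun z : ℝ × EuclideanSpace ℝ (Fin n) =>
      G (z.1 • (p : Amb n) + F.incl z.2) := hG.comp (by fun_prop)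
  rw [← F.measurePreserving.lintegral_comp hG, Measure.volume_eq_prod,
    lintegral_prod _ hGz.aemeasurable]
  have h1 : ∀ a : ℝ, (∫⁻ v : EuclideanSpace ℝ (Fin n), G (a • (p : Amb n) + F.incl v)) =
      ∫⁻ u : Metric.sphere (0 : EuclideanSpace ℝ (Fin n)) 1, (∫⁻ ρ in Ioi (0:ℝ),
        ENNReal.ofReal (ρ ^ (n - 1)) *
          G (a • (p : Amb n) + ρ • F.incl (u : EuclideanSpace ℝ (Fin n))))
        ∂(volume : Measure (EuclideanSpace ℝ (Fin n))).toSphere := by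
    intro a
    rw [lintegral_polar (show Measurable fun v => G (a • (p : Amb n) + F.incl v) from
      hGz.comp measurable_prodMk_left), finrank_euclideanSpace_fin]
    simp only [map_smul]
  have hc3 : Continuous fun z : (ℝ × Metric.sphere (0 : EuclideanSpace ℝ (Fin n)) 1) × ℝ =>
      z.1.1 • (p : Amb n) + z.2 • F.incl (z.1.2 : EuclideanSpace ℝ (Fin n)) :=
    ((continuous_fst.comp continuous_fst).smul continuous_const).add
      (continuous_snd.smul (hcont.comp (continuous_subtype_val.comp
        (continuous_snd.comp continuous_fst))))
  have hw3 : Measurable fun z : (ℝ × Metric.sphere (0 : EuclideanSpace ℝ (Fin n)) 1) × ℝ =>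
      ENNReal.ofReal (z.2 ^ (n - 1)) := (measurable_snd.pow_const _).ennreal_ofReal
  have hm3 := Measurable.lintegral_prod_right' (ν := (volume : Measure ℝ).restrict (Ioi 0))
    (hw3.mul (hG.comp hc3.measurable))
  rw [lintegral_congr h1]
  exact lintegral_lintegral_swap hm3.aemeasurable

/-- The surface measure of the sphere in geodesic polar coordinates. -/
theorem lintegral_toSphere (hn : 1 ≤ n) {g : Amb n → ℝ≥0∞} (hg : Measurable g) :
    ∫⁻ x : Sph n, g x ∂(volume : Measure (Amb n)).toSphere =
      ∫⁻ u : Metric.sphere (0 : EuclideanSpace ℝ (Fin n)) 1, (∫⁻ t in Ioo 0 Real.pi,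
        ENNReal.ofReal (Real.sin t ^ (n - 1)) * g (F.pt t u))
          ∂(volume : Measure (EuclideanSpace ℝ (Fin n))).toSphere := by
  have : Nontrivial (EuclideanSpace ℝ (Fin n)) :=
    Module.nontrivial_of_finrank_pos (R := ℝ) (by rw [finrank_euclideanSpace_fin]; omega)
  set w : ℝ → ℝ≥0∞ := fun r => ENNReal.ofReal (Real.exp (-r ^ 2 / 2)) with hw
  have hwm : Measurable w := by fun_prop
  -- The function e^{−‖y‖²/2} g(y/‖y‖) is integrated over ℝⁿ⁺¹ in two ways: in polar coordinates
  -- about the origin, and after splitting off ℝp, in polar coordinates on T_p and then on each half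
  -- plane. Both produce the same finite nonzero radial moment, which cancels.
  set G : Amb n → ℝ≥0∞ := fun y => w ‖y‖ * g (‖y‖⁻¹ • y) with hG
  have hGm : Measurable G := (hwm.comp measurable_norm).mul
    (hg.comp (measurable_norm.inv.smul measurable_id))
  have hc : ∫⁻ r in Ioi (0:ℝ), ENNReal.ofReal (r ^ n) * w r = ENNReal.ofReal (halfMoment n) := by
    rw [halfMoment, ofReal_integral_eq_lintegral_ofReal (integrableOn_halfMoment n) (by
      filter_upwards [ae_restrict_mem measurableSet_Ioi] with r hr
      have : (0:ℝ) < r := hr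
      positivity)]
    refine setLIntegral_congr_fun measurableSet_Ioi fun r hr => ?_
    have : (0:ℝ) < r := hr
    simp only [hw]
    rw [ENNReal.ofReal_mul (by positivity)]
  have hc0 : ENNReal.ofReal (halfMoment n) ≠ 0 := by
    simpa using halfMoment_pos n
  have hGr : ∀ (r : ℝ) (y : Amb n), 0 < r → ‖y‖ = 1 → G (r • y) = w r * g y := by
    intro r y hr hy
    simp only [hG]
    rw [norm_smul, hy, Real.norm_of_nonneg hr.le, mul_one, smul_smul, inv_mul_cancel₀ hr.ne',
      one_smul]
  have hL : ∫⁻ y, G y = ENNReal.ofReal (halfMoment n) *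
      ∫⁻ x : Sph n, g x ∂(volume : Measure (Amb n)).toSphere := by
    rw [lintegral_polar hGm, ← lintegral_const_mul _
      (show Measurable fun x : Sph n => g x from hg.comp measurable_subtype_coe), ← hc]
    refine lintegral_congr fun x => ?_
    rw [finrank_euclideanSpace_fin, Nat.add_sub_cancel, ← lintegral_mul_const _ (by fun_prop)]
    refine setLIntegral_congr_fun measurableSet_Ioi fun r hr => ?_
    change _ * G (r • (x : Amb n)) = _
    rw [hGr r x hr (norm_coe_sph x), mul_assoc]
  have hR : ∫⁻ y, G y = ENNReal.ofReal (halfMoment n) *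
      ∫⁻ u : Metric.sphere (0 : EuclideanSpace ℝ (Fin n)) 1, (∫⁻ t in Ioo 0 Real.pi,
        ENNReal.ofReal (Real.sin t ^ (n - 1)) * g (F.pt t u))
          ∂(volume : Measure (EuclideanSpace ℝ (Fin n))).toSphere := by
    rw [F.lintegral_frame hn hGm, ← lintegral_const_mul]
    · refine lintegral_congr fun u => ?_
      have hu := norm_eq_of_mem_sphere u
      have h2 := lintegral_half_plane (d := n - 1)
        (k := fun a ρ => G (a • (p : Amb n) + ρ • F.incl (u : EuclideanSpace ℝ (Fin n))))
        (w := w) (gS := fun t => g (F.pt t u))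
        (hGm.comp (Continuous.measurable (f := fun z : ℝ × ℝ => z.1 • (p : Amb n) +
          z.2 • F.incl (u : EuclideanSpace ℝ (Fin n))) (by fun_prop))) hwm
        (hg.comp (F.continuous_pt_sphere.comp (Continuous.prodMk_left u)).measurable) (by
          intro r t hr
          rw [← hGr r _ hr (F.norm_pt (by intro h; simp [h] at hu) t), F.pt_of_norm_eq_one hu]
          congr 1
          module)
      rw [h2, ← hc, Nat.sub_add_cancel hn]
    · refine Measurable.lintegral_prod_right' (f := fun z :
        Metric.sphere (0 : EuclideanSpace ℝ (Fin n)) 1 × ℝ =>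
          ENNReal.ofReal (Real.sin z.2 ^ (n - 1)) * g (F.pt z.2 z.1)) ?_
      exact (by fun_prop : Measurable fun z : Metric.sphere (0 : EuclideanSpace ℝ (Fin n)) 1 × ℝ =>
        ENNReal.ofReal (Real.sin z.2 ^ (n - 1))).mul
        (hg.comp (F.continuous_pt_sphere.comp continuous_swap).measurable)
  exact (ENNReal.mul_right_inj hc0 ENNReal.ofReal_ne_top).1 (hL.symm.trans hR)

end PolarFrame

end Steklov

end

/-! ### The surface measure as an image of the polar product measure -/

noncomputable section

namespace Steklov

open MeasureTheory Set Filter Topology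
open scoped ENNReal

namespace PolarFrame

variable {n : ℕ} {p : Sph n} (F : PolarFrame p)

/-- The geodesic polar parametrisation with values in the sphere. -/
def sph (z : Metric.sphere (0 : EuclideanSpace ℝ (Fin n)) 1 × ℝ) : Sph n :=
  ⟨F.pt z.2 z.1, by
    rw [mem_sphere_zero_iff_norm]
    exact F.norm_pt (ne_zero_of_mem_unit_sphere z.1) z.2⟩

theorem continuous_sph : Continuous F.sph :=
  Continuous.subtype_mk (F.continuous_pt_sphere.comp continuous_swap) _

/-- The density of the surface measure in the radial variable. -/
def radialMeasure (n : ℕ) : Measure ℝ :=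
  (volume.restrict (Ioo 0 Real.pi)).withDensity fun t => ENNReal.ofReal (Real.sin t ^ (n - 1))

/-- Equality of all nonnegative integrals identifies the two measures, and so carries the polar
formula over to integrals of signed functions. -/
theorem map_sph (hn : 1 ≤ n) :
    Measure.map F.sph ((volume : Measure (EuclideanSpace ℝ (Fin n))).toSphere.prod
      (radialMeasure n)) = (volume : Measure (Amb n)).toSphere := by
  have hd : Measurable fun t => ENNReal.ofReal (Real.sin t ^ (n - 1)) := by fun_prop
  refine Measure.ext_of_lintegral _ fun f hf => ?_
  have hemb : MeasurableEmbedding ((↑) : Sph n → Amb n) :=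
    MeasurableEmbedding.subtype_coe Metric.isClosed_sphere.measurableSet
  obtain ⟨g, hg, hgf⟩ := hemb.exists_measurable_extend hf fun _ => inferInstance
  have hfg : ∀ x, f x = g (x : Amb n) := fun x => (congrFun hgf x).symm
  have : SFinite (radialMeasure n) := by unfold radialMeasure; infer_instance
  rw [lintegral_map hf F.continuous_sph.measurable,
    lintegral_prod (fun a => f (F.sph a)) (hf.comp F.continuous_sph.measurable).aemeasurable]
  simp only [hfg]
  rw [F.lintegral_toSphere hn hg]
  refine lintegral_congr fun u => ?_
  rw [radialMeasure, lintegral_withDensity_eq_lintegral_mul _ hd]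
  · rfl
  · exact hg.comp ((F.continuous_pt_sphere.comp (Continuous.prodMk_left u)).measurable)

theorem integral_toSphere (hn : 1 ≤ n) {b : Sph n → ℝ} (hb : Continuous b) :
    ∫ x, b x ∂(volume : Measure (Amb n)).toSphere =
      ∫ u : Metric.sphere (0 : EuclideanSpace ℝ (Fin n)) 1, (∫ t in Ioo 0 Real.pi,
        Real.sin t ^ (n - 1) * b (F.sph (u, t)))
          ∂(volume : Measure (EuclideanSpace ℝ (Fin n))).toSphere := by
  have hd : Measurable fun t => ENNReal.ofReal (Real.sin t ^ (n - 1)) := by fun_prop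
  have : SFinite (radialMeasure n) := by unfold radialMeasure; infer_instance
  have hint := integrable_toSphere (E := Amb n) hb
  rw [← F.map_sph hn] at hint ⊢
  have hint' := (integrable_map_measure hint.aestronglyMeasurable
    F.continuous_sph.measurable.aemeasurable).1 hint
  rw [integral_map F.continuous_sph.measurable.aemeasurable hint.aestronglyMeasurable,
    integral_prod (fun a => b (F.sph a)) hint']
  refine integral_congr_ae (ae_of_all _ fun u => ?_)
  change ∫ t, b (F.sph (u, t)) ∂radialMeasure n = _
  rw [radialMeasure, integral_withDensity_eq_integral_toReal_smul₀ hd.aemeasurable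
    (ae_of_all _ fun _ => ENNReal.ofReal_lt_top)]
  refine setIntegral_congr_fun measurableSet_Ioo fun t ht => ?_
  have hs := Real.sin_pos_of_mem_Ioo ht
  simp only [smul_eq_mul]
  rw [ENNReal.toReal_ofReal (by positivity)]

end PolarFrame

/-! ### Weak form of harmonicity on the sphere -/

theorem integral_fderiv_eq_zero {E : Type*} [NormedAddCommGroup E] [InnerProductSpace ℝ E]
    [FiniteDimensional ℝ E] [MeasurableSpace E] [BorelSpace E] {G : E → ℝ}
    (hG : ContDiff ℝ 1 G) (hc : HasCompactSupport G) (e : E) :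
    Integrable (fun x => fderiv ℝ G x e) ∧ ∫ x, fderiv ℝ G x e = 0 := by
  have hcont : Continuous fun x => fderiv ℝ G x e :=
    (hG.continuous_fderiv one_ne_zero).clm_apply continuous_const
  have hint : Integrable fun x => fderiv ℝ G x e :=
    hcont.integrable_of_hasCompactSupport (hc.fderiv_apply ℝ e)
  refine ⟨hint, ?_⟩
  have h := integral_mul_fderiv_eq_neg_fderiv_mul_of_integrable (f := fun _ : E => (1:ℝ)) (g := G)
    (v := e) (μ := (volume : Measure E)) (by simp) (by simpa using hint)
    (by simpa using hG.continuous.integrable_of_hasCompactSupport hc)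
    (fun x _ => differentiableAt_const _) (fun x _ => hG.differentiable one_ne_zero x)
  simpa using h

/-- The Laplacian as a divergence of the gradient. -/
theorem laplacian_eq_sum_fderiv {E : Type*} [NormedAddCommGroup E] [InnerProductSpace ℝ E]
    [FiniteDimensional ℝ E] {f : E → ℝ} {x : E} (hf : ContDiffAt ℝ 2 f x) {ι : Type*} [Fintype ι]
    (e : OrthonormalBasis ι ℝ E) :
    Laplacian.laplacian f x = ∑ i, fderiv ℝ (fun y => fderiv ℝ f y (e i)) x (e i) := by
  rw [InnerProductSpace.laplacian_eq_iteratedFDeriv_orthonormalBasis f e]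
  refine Finset.sum_congr rfl fun i _ => ?_
  rw [iteratedFDeriv_two_apply]
  have hd : DifferentiableAt ℝ (fderiv ℝ f) x :=
    (hf.fderiv_right (m := 1) (by norm_num)).differentiableAt one_ne_zero
  have := (hd.hasFDerivAt.clm_apply (hasFDerivAt_const (e i) x)).fderiv
  rw [this]
  simp

/-- The Laplacian of a function that is constant along rays scales quadratically. -/
theorem laplacian_smul_of_homogeneous {E : Type*} [NormedAddCommGroup E] [InnerProductSpace ℝ E]
    [FiniteDimensional ℝ E] {k : E → ℝ} (hk : ∀ (r : ℝ) (x : E), 0 < r → k (r • x) = k x)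
    {r : ℝ} (hr : 0 < r) {x : E} (hx : ContDiffAt ℝ 2 k x) (hrx : ContDiffAt ℝ 2 k (r • x)) :
    Laplacian.laplacian k (r • x) = (r⁻¹) ^ 2 * Laplacian.laplacian k x := by
  have e := stdOrthonormalBasis ℝ E
  rw [laplacian_eq_sum_fderiv hx e, laplacian_eq_sum_fderiv hrx e, Finset.mul_sum]
  refine Finset.sum_congr rfl fun i _ => ?_
  have h1 : ∀ y, fderiv ℝ k y = r • fderiv ℝ k (r • y) := by
    intro y
    have h2 : fderiv ℝ (fun y => k (r • y)) y = r • fderiv ℝ k (r • y) := fderiv_comp_smul ..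
    rwa [show (fun y => k (r • y)) = k from funext fun y => hk r y hr] at h2
  have h3 : fderiv ℝ (fun y => fderiv ℝ k y (e i)) x
      = r • r • fderiv ℝ (fun y => fderiv ℝ k y (e i)) (r • x) := by
    have h4 : (fun y => fderiv ℝ k y (e i)) = fun y => r • (fun z => fderiv ℝ k z (e i)) (r • y) := by
      funext y
      conv_lhs => rw [h1 y]
      simp
    conv_lhs => rw [h4]
    have hd : DifferentiableAt ℝ (fun y => (fun z => fderiv ℝ k z (e i)) (r • y)) x := by
      have hd0 : DifferentiableAt ℝ (fderiv ℝ k) (r • x) :=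
        (hrx.fderiv_right (m := 1) (by norm_num)).differentiableAt one_ne_zero
      exact DifferentiableAt.comp x (f := fun y => r • y)
        (g := fun z => fderiv ℝ k z (e i)) (hd0.clm_apply (differentiableAt_const _)) (by fun_prop)
    rw [fderiv_fun_const_smul hd]
    congr 1
    exact fderiv_comp_smul (f := fun z => fderiv ℝ k z (e i)) ..
  rw [h3]
  simp
  field_simp

/-- Weak harmonicity: a `0`-homogeneous function which is harmonic on an open cone, tested against
a `0`-homogeneous function supported in the cone. -/
theorem integral_inner_gradient_eq_zero {E : Type*} [NormedAddCommGroup E] [InnerProductSpace ℝ E]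
    [FiniteDimensional ℝ E] [MeasurableSpace E] [BorelSpace E] [Nontrivial E] {O : Set E}
    {k χ : E → ℝ} (hOs : ∀ (r : ℝ) (x : E), 0 < r → x ∈ O → r • x ∈ O)
    (hk : ∀ (r : ℝ) (x : E), 0 < r → k (r • x) = k x)
    (hkO : ∀ x ∈ O, ContDiffAt ℝ 2 k x) (hlap : ∀ x ∈ O, ‖x‖ = 1 → Laplacian.laplacian k x = 0)
    (hχ : IsHomogeneousC1 χ) (hχO : ∀ x, x ≠ 0 → x ∉ O → χ =ᶠ[𝓝 x] 0) :
    Continuous (fun x : Metric.sphere (0 : E) 1 => inner ℝ (gradient χ x) (gradient k x)) ∧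
    ∫ x : Metric.sphere (0 : E) 1, inner ℝ (gradient χ x) (gradient k x)
      ∂(volume : Measure E).toSphere = 0 := by
  have hgrad0 : ∀ x, x ≠ 0 → x ∉ O → gradient χ =ᶠ[𝓝 x] 0 := by
    intro x hx hxO
    have h1 := (hχO x hx hxO).eventuallyEq_nhds
    filter_upwards [h1] with y hy
    rw [gradient, hy.fderiv_eq]
    simp
  have hgk : ∀ x ∈ O, ContinuousAt (gradient k) x := by
    intro x hx
    have : ContinuousAt (fderiv ℝ k) x :=
      ((hkO x hx).fderiv_right (m := 1) (by norm_num)).continuousAt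
    exact (InnerProductSpace.toDual ℝ E).symm.continuous.continuousAt.comp this
  have hcont : ∀ x, x ≠ 0 → ContinuousAt (fun y => inner ℝ (gradient χ y) (gradient k y)) x := by
    intro x hx
    by_cases hxO : x ∈ O
    · exact (hχ.continuousAt_gradient hx).inner (hgk x hxO)
    · refine (continuousAt_const (y := (0:ℝ))).congr ?_
      filter_upwards [hgrad0 x hx hxO] with y hy
      rw [hy]; simp
  have hcs : Continuous (fun x : Metric.sphere (0 : E) 1 =>
      inner ℝ (gradient χ x) (gradient k x)) := by
    rw [continuous_iff_continuousAt]
    intro x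
    exact (hcont x (ne_zero_of_mem_unit_sphere x)).comp continuous_subtype_val.continuousAt
  refine ⟨hcs, ?_⟩
  -- A radial weight supported in the shell 1 ≤ ‖y‖ ≤ 2, away from the origin, where functions
  -- constant along rays are singular.
  let ψ : ContDiffBump (3 / 2 : ℝ) := ⟨1 / 4, 1 / 2, by norm_num, by norm_num⟩
  have hψ0 : ∀ r : ℝ, r ≤ 1 → ψ r = 0 := fun r hr => ψ.zero_of_le_dist (by
    rw [Real.dist_eq, abs_of_nonpos (by linarith)]
    change (1/2 : ℝ) ≤ _
    linarith)
  have hψ2 : ∀ r : ℝ, 2 ≤ r → ψ r = 0 := fun r hr => ψ.zero_of_le_dist (by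
    rw [Real.dist_eq, abs_of_nonneg (by linarith)]
    change (1/2 : ℝ) ≤ _
    linarith)
  have hlapO : ∀ x ∈ O, x ≠ 0 → Laplacian.laplacian k x = 0 := by
    intro x hx hx0
    have hn : 0 < ‖x‖ := norm_pos_iff.2 hx0
    have hx1 : ‖x‖⁻¹ • x ∈ O := hOs _ _ (inv_pos.2 hn) hx
    have hx2 : x = ‖x‖ • ‖x‖⁻¹ • x := by rw [smul_smul, mul_inv_cancel₀ hn.ne', one_smul]
    have := laplacian_smul_of_homogeneous hk hn (hkO _ hx1) (by rw [← hx2]; exact hkO x hx)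
    rw [← hx2, hlap _ hx1 (by rw [norm_smul, norm_inv, norm_norm, inv_mul_cancel₀ hn.ne'])] at this
    simpa using this
  have e := stdOrthonormalBasis ℝ E
  -- The components of ψ χ ∇k. The divergence of this field is ψ ⟨∇χ, ∇k⟩: the term with Δk vanishes
  -- by harmonicity, and the one with ∇ψ because ψ is radial while ∇k is orthogonal to y.
  set G : Fin (Module.finrank ℝ E) → E → ℝ :=
    fun i y => ψ ‖y‖ * χ y * fderiv ℝ k y (e i) with hGdef
  have hψn : ∀ y : E, ContDiffAt ℝ 1 (fun y : E => ψ ‖y‖) y := by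
    intro y
    by_cases hy : y = 0
    · subst hy
      refine (contDiffAt_const (c := (0:ℝ))).congr_of_eventuallyEq ?_
      filter_upwards [Metric.ball_mem_nhds (0 : E) one_pos] with z hz
      exact hψ0 _ (mem_ball_zero_iff.1 hz).le
    · exact (ψ.contDiff (n := 1)).contDiffAt.comp y (contDiffAt_norm ℝ hy)
  have hfk : ∀ i, ∀ y ∈ O, ContDiffAt ℝ 1 (fun y => fderiv ℝ k y (e i)) y := fun i y hy =>
    ((hkO y hy).fderiv_right (m := 1) (by norm_num)).clm_apply contDiffAt_const
  have hGz : ∀ i y, (y = 0 ∨ y ∉ O) → G i =ᶠ[𝓝 y] 0 := by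
    intro i y hy
    by_cases hy0 : y = 0
    · subst hy0
      filter_upwards [Metric.ball_mem_nhds (0 : E) one_pos] with z hz
      simp [hGdef, hψ0 _ (mem_ball_zero_iff.1 hz).le]
    · filter_upwards [hχO y hy0 (hy.resolve_left hy0)] with z hz
      simp [hGdef, hz]
  have hG1 : ∀ i, ContDiff ℝ 1 (G i) := by
    intro i
    rw [contDiff_iff_contDiffAt]
    intro y
    by_cases hy : y = 0 ∨ y ∉ O
    · exact (contDiffAt_const (c := (0:ℝ))).congr_of_eventuallyEq (hGz i y hy)
    · push Not at hy
      exact ((hψn y).mul (hχ.contDiffAt y hy.1)).mul (hfk i y hy.2)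
  have hGc : ∀ i, HasCompactSupport (G i) := by
    intro i
    refine HasCompactSupport.intro (isCompact_closedBall (0 : E) 2) fun y hy => ?_
    rw [mem_closedBall_zero_iff, not_le] at hy
    simp [hGdef, hψ2 _ hy.le]
  have hsum : ∀ y, ∑ i, fderiv ℝ (G i) y (e i)
      = ψ ‖y‖ * inner ℝ (gradient χ y) (gradient k y) := by
    intro y
    by_cases hy : y = 0 ∨ y ∉ O
    · have h1 : ∀ i, fderiv ℝ (G i) y (e i) = 0 := by
        intro i
        rw [(hGz i y hy).fderiv_eq]
        simp
      rw [Finset.sum_eq_zero fun i _ => h1 i]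
      by_cases hy0 : y = 0
      · subst hy0; simp [hψ0 0 (by norm_num)]
      · rw [(hgrad0 y hy0 (hy.resolve_left hy0)).self_of_nhds]; simp
    · push Not at hy
      have hχd := (hχ.contDiffAt y hy.1).differentiableAt one_ne_zero
      have hψd := (hψn y).differentiableAt one_ne_zero
      have h1 : ∀ i, fderiv ℝ (G i) y (e i) =
          ψ ‖y‖ * (inner ℝ (gradient χ y) (e i) * inner ℝ (e i) (gradient k y)) +
          χ y * (fderiv ℝ (fun y : E => ψ ‖y‖) y (e i) * fderiv ℝ k y (e i)) +
          ψ ‖y‖ * χ y * fderiv ℝ (fun y => fderiv ℝ k y (e i)) y (e i) := by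
        intro i
        have hfd := (hfk i y hy.2).differentiableAt one_ne_zero
        have := ((hψd.hasFDerivAt.mul hχd.hasFDerivAt).mul hfd.hasFDerivAt).fderiv
        have hGi : G i = (((fun y : E => ψ ‖y‖) * χ) * fun y => fderiv ℝ k y (e i)) := rfl
        rw [hGi, this, real_inner_comm (gradient k y)]
        simp only [gradient, InnerProductSpace.toDual_symm_apply]
        simp
        ring
      simp only [h1]
      rw [Finset.sum_add_distrib, Finset.sum_add_distrib, ← Finset.mul_sum, ← Finset.mul_sum,
        ← Finset.mul_sum, e.sum_inner_mul_inner, ← laplacian_eq_sum_fderiv (hkO y hy.2) e,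
        hlapO y hy.2 hy.1]
      have h2 : ∑ i, fderiv ℝ (fun y : E => ψ ‖y‖) y (e i) * fderiv ℝ k y (e i) = 0 := by
        have h3 : ∀ i, fderiv ℝ (fun y : E => ψ ‖y‖) y (e i) * fderiv ℝ k y (e i) =
            deriv ψ ‖y‖ * ‖y‖⁻¹ * (inner ℝ y (e i) * inner ℝ (e i) (gradient k y)) := by
          intro i
          have h4 : HasFDerivAt (fun y : E => ψ ‖y‖)
              (deriv ψ ‖y‖ • fderiv ℝ (fun y : E => ‖y‖) y) y :=
            HasDerivAt.comp_hasFDerivAt (h₂ := fun r => ψ r) (f := fun y : E => ‖y‖) y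
              ((ψ.contDiff (n := 1)).differentiable one_ne_zero _).hasDerivAt
              ((contDiffAt_norm ℝ hy.1 (n := 1)).differentiableAt one_ne_zero).hasFDerivAt
          have h5 : fderiv ℝ (fun y : E => ‖y‖) y (e i) = ‖y‖⁻¹ * inner ℝ y (e i) := by
            have := (hasStrictFDerivAt_norm_sq y).hasFDerivAt.sqrt
              (pow_ne_zero 2 (norm_ne_zero_iff.2 hy.1))
            simp only [Real.sqrt_sq (norm_nonneg _)] at this
            rw [this.fderiv]
            simp
            field_simp
          rw [h4.fderiv, real_inner_comm (gradient k y)]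
          simp only [gradient, InnerProductSpace.toDual_symm_apply,
            smul_apply, h5, smul_eq_mul]
          ring
        simp only [h3]
        rw [← Finset.mul_sum, e.sum_inner_mul_inner, real_inner_comm,
          inner_gradient_self_of_homogeneous hk, mul_zero]
      rw [h2]
      simp
  have hint0 : ∫ y, ψ ‖y‖ * inner ℝ (gradient χ y) (gradient k y) = 0 := by
    simp only [← hsum]
    rw [integral_finsetSum _ fun i _ => (integral_fderiv_eq_zero (hG1 i) (hGc i) (e i)).1]
    exact Finset.sum_eq_zero fun i _ => (integral_fderiv_eq_zero (hG1 i) (hGc i) (e i)).2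
  have haint : Integrable fun r : ℝ => r ^ (Module.finrank ℝ E - 1) * (ψ r * (r⁻¹) ^ 2) := by
    have hc : Continuous fun r : ℝ => r ^ (Module.finrank ℝ E - 1) * (ψ r * (r⁻¹) ^ 2) := by
      rw [continuous_iff_continuousAt]
      intro r
      by_cases hr : r = 0
      · refine (continuousAt_const (y := (0:ℝ))).congr ?_
        filter_upwards [eventually_lt_nhds (show r < 1 by rw [hr]; norm_num)] with s hs
        rw [hψ0 s hs.le]; simp
      · exact (continuousAt_id.pow _).mul (ψ.continuous.continuousAt.mul
          ((continuousAt_inv₀ hr).pow 2))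
    refine hc.integrable_of_hasCompactSupport (HasCompactSupport.intro
      (isCompact_Icc (a := (1:ℝ)) (b := 2)) fun r hr => ?_)
    rcases not_and_or.1 hr with h | h
    · rw [hψ0 r (not_le.1 h).le]; simp
    · rw [hψ2 r (not_le.1 h).le]; simp
  -- Both gradients are homogeneous of degree −1, hence the weight r⁻². The vanishing integral is
  -- now the spherical one times a positive radial factor.
  have hpolar := (integral_polar (E := E)
    (Φ := fun y => ψ ‖y‖ * inner ℝ (gradient χ y) (gradient k y))
    (a := fun r => ψ r * (r⁻¹) ^ 2)
    (b := fun x : Metric.sphere (0 : E) 1 => inner ℝ (gradient χ x) (gradient k x)) (by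
      intro r hr u
      rw [gradient_smul_of_homogeneous hχ.smul_eq hr, gradient_smul_of_homogeneous hk hr,
        norm_smul, norm_eq_of_mem_sphere, Real.norm_of_nonneg hr.le, inner_smul_left,
        inner_smul_right]
      simp
      ring) haint.integrableOn (integrable_toSphere hcs)).2
  rw [hint0] at hpolar
  have hpos : 0 < ∫ r in Ioi (0:ℝ), r ^ (Module.finrank ℝ E - 1) * (ψ r * (r⁻¹) ^ 2) := by
    rw [setIntegral_pos_iff_support_of_nonneg_ae _ haint.integrableOn]
    · have hsub : Ioo (5/4 : ℝ) (7/4) ⊆ (Function.support fun r : ℝ =>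
          r ^ (Module.finrank ℝ E - 1) * (ψ r * (r⁻¹) ^ 2)) ∩ Ioi 0 := by
        intro r hr
        have hr0 : 0 < r := by linarith [hr.1]
        refine ⟨?_, hr0⟩
        have : ψ r = 1 := ψ.one_of_mem_closedBall (by
          rw [Metric.mem_closedBall, Real.dist_eq, abs_le]
          change -(1/4 : ℝ) ≤ _ ∧ _ ≤ (1/4 : ℝ)
          constructor <;> linarith [hr.1, hr.2])
        rw [Function.mem_support, this]
        positivity
      exact lt_of_lt_of_le (by rw [Real.volume_Ioo]; norm_num) (measure_mono hsub)
    · filter_upwards [ae_restrict_mem measurableSet_Ioi] with r hr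
      have hr0 : (0:ℝ) < r := hr
      have := ψ.nonneg (x := r)
      change 0 ≤ r ^ _ * (ψ r * _)
      positivity
  rcases mul_eq_zero.1 hpolar.symm with h | h
  · exact absurd h hpos.ne'
  · exact h

end Steklov

end

/-! ### From interior cutoffs to the boundary flux -/

noncomputable section

namespace Steklov

open MeasureTheory Set Filter Topology

/-- Concentrating a cutoff at the end of the interval in a weak flux identity. -/
theorem integral_eq_of_forall_cutoff {A B : ℝ → ℝ} (hA : ContinuousOn A (Icc (1 / 2) 1))
    (hB : ContinuousOn B (Icc 0 1))
    (h : ∀ η η' : ℝ → ℝ, (∀ s, HasDerivAt η (η' s) s) → Continuous η' →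
      (∃ c, ∀ s ≤ 1 / 2, η s = c) → (∃ δ > 0, ∀ s, 1 - δ ≤ s → η s = 0) →
      ∫ s in Icc (0:ℝ) 1, (η s * B s + η' s * A s) = 0) :
    ∫ s in Icc (0:ℝ) 1, B s = A 1 := by
  have hBi : IntervalIntegrable B volume 0 1 := hB.intervalIntegrable_of_Icc zero_le_one
  set Bi : ℝ → ℝ := fun s => ∫ x in (0:ℝ)..s, B x with hBidef
  have hBid : ∀ s ∈ Ioo (0:ℝ) 1, HasDerivAt Bi (B s) s := fun s hs =>
    intervalIntegral.integral_hasDerivAt_right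
      (hBi.mono_set (by
        rw [uIcc_of_le hs.1.le, uIcc_of_le zero_le_one]; exact Icc_subset_Icc_right hs.2.le))
      (hB.stronglyMeasurableAtFilter_nhdsWithin measurableSet_Icc s |>.filter_mono (by
        rw [nhdsWithin_eq_nhds.2 (Icc_mem_nhds hs.1 hs.2)]))
      (hB.continuousAt (Icc_mem_nhds hs.1 hs.2))
  have hBic : ContinuousOn Bi (Icc 0 1) := by
    have := intervalIntegral.continuousOn_primitive_interval
      (μ := volume) (f := B) (a := 0) (b := 1) (by
        rw [uIcc_of_le zero_le_one]; exact hB.integrableOn_Icc)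
    rwa [uIcc_of_le zero_le_one] at this
  set C : ℝ → ℝ := fun s => Bi s - A s with hC
  have hCc : ContinuousOn C (Icc (1 / 2) 1) :=
    (hBic.mono (Icc_subset_Icc_left (by norm_num))).sub hA
  -- Fundamental lemma of the calculus of variations: every test function ψ on (1/2, 1) is, up to
  -- sign, the derivative of an admissible cutoff, and integration by parts turns the hypothesis
  -- into ∫ ψ C = 0.
  have hmain : ∀ᵐ x, x ∈ Ioo (1 / 2 : ℝ) 1 → C x = 0 := by
    refine isOpen_Ioo.ae_eq_zero_of_integral_contDiff_smul_eq_zero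
      ((hCc.mono Ioo_subset_Icc_self).locallyIntegrableOn measurableSet_Ioo) ?_
    intro ψ hψ hψc hψs
    have hψ0 : ∀ s, s ∉ Ioo (1 / 2 : ℝ) 1 → ψ s = 0 := fun s hs =>
      image_eq_zero_of_notMem_tsupport fun h' => hs (hψs h')
    have hψi : ∀ a b, IntervalIntegrable ψ volume a b :=
      fun a b => hψ.continuous.intervalIntegrable a b
    -- The primitive of −ψ that vanishes at 1. It vanishes near 1 and is constant below 1/2, because
    -- ψ has compact support in (1/2, 1).
    set η : ℝ → ℝ := fun s => -∫ x in (1:ℝ)..s, ψ x with hη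
    have hηd : ∀ s, HasDerivAt η (-ψ s) s := fun s =>
      (intervalIntegral.integral_hasDerivAt_right (hψi 1 s)
        (hψ.continuous.stronglyMeasurableAtFilter _ _) hψ.continuous.continuousAt).neg
    have hη1 : ∃ δ > 0, ∀ s, 1 - δ ≤ s → η s = 0 := by
      obtain ⟨δ, hδ, hδ'⟩ : ∃ δ > 0, ∀ s, 1 - δ ≤ s → ψ s = 0 := by
        have hev : ∀ᶠ s in 𝓝 (1:ℝ), s ∉ tsupport ψ :=
          (isClosed_tsupport ψ).isOpen_compl.mem_nhds fun h' => (hψs h').2.false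
        obtain ⟨ε, hε, hb⟩ := Metric.eventually_nhds_iff.1 hev
        refine ⟨ε / 2, by positivity, fun s hs => ?_⟩
        by_cases h1 : 1 ≤ s
        · exact hψ0 s fun h' => h'.2.not_ge h1
        · refine image_eq_zero_of_notMem_tsupport (hb ?_)
          rw [Real.dist_eq, abs_lt]
          constructor <;> linarith
      refine ⟨δ, hδ, fun s hs => ?_⟩
      simp only [hη, neg_eq_zero]
      refine intervalIntegral.integral_zero_ae (ae_of_all _ fun x hx => hδ' x ?_)
      rcases (mem_uIoc.1 hx) with h' | h'
      · linarith [h'.1]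
      · linarith [h'.1]
    have hη0 : ∃ c, ∀ s ≤ 1 / 2, η s = c := by
      refine ⟨η (1 / 2), fun s hs => ?_⟩
      simp only [hη, neg_inj]
      rw [← intervalIntegral.integral_add_adjacent_intervals (hψi 1 (1 / 2)) (hψi (1 / 2) s),
        add_eq_left]
      refine intervalIntegral.integral_zero_ae (ae_of_all _ fun x hx => hψ0 x fun h' => ?_)
      rw [uIoc_of_ge hs] at hx
      exact h'.1.not_ge hx.2
    have key := h η (fun s => -ψ s) hηd hψ.continuous.neg hη0 hη1
    have hηc : Continuous η := continuous_iff_continuousAt.2 fun s => (hηd s).continuousAt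
    have hψA : Continuous fun s => ψ s * A s := by
      rw [continuous_iff_continuousAt]
      intro s
      by_cases hs : s ∈ tsupport ψ
      · exact hψ.continuous.continuousAt.mul
          (hA.continuousAt (Icc_mem_nhds (hψs hs).1 (hψs hs).2))
      · refine (continuousAt_const (y := (0:ℝ))).congr ?_
        filter_upwards [(isClosed_tsupport ψ).isOpen_compl.mem_nhds hs] with x hx
        rw [image_eq_zero_of_notMem_tsupport hx, zero_mul]
    have hη1' : η 1 = 0 := by simp [hη]
    have hBi0 : Bi 0 = 0 := by simp [hBidef]
    have ibp := intervalIntegral.integral_mul_deriv_eq_deriv_mul_of_hasDerivAt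
      (u := η) (v := Bi) (u' := fun s => -ψ s) (v' := B) (a := 0) (b := 1)
      hηc.continuousOn (by rwa [uIcc_of_le zero_le_one]) (fun x _ => hηd x)
      (fun x hx => hBid x (by simpa using hx)) (hψ.continuous.neg.intervalIntegrable _ _) hBi
    rw [hη1', hBi0] at ibp
    have hI1 : IntervalIntegrable (fun s => η s * B s) volume 0 1 :=
      hBi.continuousOn_mul hηc.continuousOn
    have hI2 : IntervalIntegrable (fun s => ψ s * Bi s) volume 0 1 :=
      (hψ.continuous.continuousOn.mul hBic).intervalIntegrable_of_Icc zero_le_one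
    have hI3 := hψA.intervalIntegrable (μ := volume) 0 1
    rw [integral_Icc_eq_integral_Ioc, ← intervalIntegral.integral_of_le zero_le_one] at key
    have e1 : (fun s => η s * B s + -ψ s * A s) = fun s => η s * B s - ψ s * A s := by
      funext s; ring
    rw [e1, intervalIntegral.integral_sub hI1 hI3, ibp] at key
    have e2 : ∫ s in (0:ℝ)..1, -ψ s * Bi s = -∫ s in (0:ℝ)..1, ψ s * Bi s := by
      rw [← intervalIntegral.integral_neg]; congr 1; funext s; ring
    rw [e2] at key
    have e3 : ∫ x, ψ x • C x = ∫ x in Ioc (0:ℝ) 1, ψ x • C x := by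
      rw [setIntegral_eq_integral_of_forall_compl_eq_zero]
      intro x hx
      rw [hψ0 x fun h' => hx ⟨by linarith [h'.1], h'.2.le⟩, zero_smul]
    rw [e3, ← intervalIntegral.integral_of_le zero_le_one]
    have e4 : (fun x => ψ x • C x) = fun x => ψ x * Bi x - ψ x * A x := by
      funext x; simp only [hC, smul_eq_mul]; ring
    rw [e4, intervalIntegral.integral_sub hI2 hI3]
    linarith
  have hEq : EqOn C 0 (Ioo (1 / 2) 1) := by
    refine Measure.eqOn_Ioo_of_ae_eq (μ := volume) ?_ (hCc.mono Ioo_subset_Icc_self)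
      continuousOn_const
    rw [EventuallyEq, ae_restrict_iff' measurableSet_Ioo]
    exact hmain
  -- Continuity carries the identity to s = 1, so no divergence theorem up to the boundary is
  -- required.
  have hEq' : EqOn C 0 (Icc (1 / 2) 1) :=
    hEq.of_subset_closure hCc continuousOn_const Ioo_subset_Icc_self
      (by rw [closure_Ioo (by norm_num)])
  have := hEq' (right_mem_Icc.2 (by norm_num))
  simp only [hC, hBidef, Pi.zero_apply, sub_eq_zero] at this
  rw [integral_Icc_eq_integral_Ioc, ← intervalIntegral.integral_of_le zero_le_one, this]

end Steklov

end

/-! ### Cones and cutoff test functions -/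

noncomputable section

namespace Steklov

open MeasureTheory Set Filter Topology

variable {n : ℕ}

/-- The open Euclidean cone over a subset of the sphere. -/
def cone (Ω : Set (Sph n)) : Set (Amb n) := {y | y ≠ 0 ∧ ‖y‖⁻¹ • y ∈ ((↑) '' Ω : Set (Amb n))}

theorem normalize_smul {r : ℝ} (hr : 0 < r) (y : Amb n) : ‖r • y‖⁻¹ • r • y = ‖y‖⁻¹ • y := by
  rw [norm_smul, Real.norm_of_nonneg hr.le, mul_inv, smul_smul, mul_right_comm,
    inv_mul_cancel₀ hr.ne', one_mul]

theorem smul_mem_cone_iff {Ω : Set (Sph n)} {r : ℝ} (hr : 0 < r) {y : Amb n} :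
    r • y ∈ cone Ω ↔ y ∈ cone Ω := by
  rw [cone, mem_ofPred_eq, mem_ofPred_eq, normalize_smul hr, smul_ne_zero_iff_right hr.ne']

theorem coe_mem_cone_iff {Ω : Set (Sph n)} {x : Sph n} : (x : Amb n) ∈ cone Ω ↔ x ∈ Ω := by
  rw [cone, mem_ofPred_eq, norm_coe_sph, inv_one, one_smul]
  exact ⟨fun h => by simpa using h.2, fun h => ⟨ne_zero_of_mem_unit_sphere x, x, h, rfl⟩⟩

theorem cone_mem_nhds {Ω : Set (Sph n)} (hΩ : IsOpen Ω) {y : Amb n} (hy : y ∈ cone Ω) :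
    cone Ω ∈ 𝓝 y := by
  obtain ⟨W, hW, hWΩ⟩ := isOpen_induced_iff.1 hΩ
  obtain ⟨hy0, x, hx, hxy⟩ := hy
  have hyW : ‖y‖⁻¹ • y ∈ W := by rw [← hxy]; rw [← hWΩ] at hx; exact hx
  filter_upwards [eventually_ne_nhds hy0,
    (contDiffAt_normalize hy0 (k := 0)).continuousAt.preimage_mem_nhds (hW.mem_nhds hyW)]
    with z hz hzW
  refine ⟨hz, ⟨‖z‖⁻¹ • z, ?_⟩, ?_, rfl⟩
  · rw [mem_sphere_zero_iff_norm, norm_smul, norm_inv, norm_norm,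
      inv_mul_cancel₀ (norm_ne_zero_iff.2 hz)]
  · rw [← hWΩ]; exact hzW

theorem inner_pos_of_mem_cone {Ω : Set (Sph n)} {p : Sph n}
    (hball : Ω ⊆ geodesicBall p (Real.pi / 2)) {y : Amb n} (hy : y ∈ cone Ω) :
    0 < inner ℝ (p : Amb n) y := by
  obtain ⟨hy0, x, hx, hxy⟩ := hy
  have h := (mem_geodesicBall_iff (by positivity) (by linarith [Real.pi_pos])).1 (hball hx)
  rw [Real.cos_pi_div_two, hxy, inner_smul_right] at h
  exact (mul_pos_iff_of_pos_left (inv_pos.2 (norm_pos_iff.2 hy0))).1 h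

theorem homExt_eq_of_homogeneous {χ : Amb n → ℝ}
    (hχ : ∀ (r : ℝ) (x : Amb n), 0 < r → χ (r • x) = χ x) : homExt χ = χ := by
  funext y
  by_cases hy : y = 0
  · simp [homExt, hy]
  · exact hχ _ _ (inv_pos.2 (norm_pos_iff.2 hy))

namespace PolarFrame

variable {p : Sph n} (F : PolarFrame p)

theorem inner_polar {u : EuclideanSpace ℝ (Fin n)} (hu : ‖u‖ = 1) {t : ℝ} {x y : Amb n}
    (hx : inner ℝ x (F.pt t u) = (0 : ℝ)) (hy : inner ℝ y (F.pt t u) = (0 : ℝ)) :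
    inner ℝ x y = inner ℝ x (F.dr t u) * inner ℝ y (F.dr t u)
      + inner ℝ (F.tang u x) (F.tang u y) := by
  conv_lhs => rw [F.eq_polar_of_inner_eq_zero hu hx, F.eq_polar_of_inner_eq_zero hu hy]
  rw [inner_add_left, inner_add_right, inner_add_right, inner_smul_left, inner_smul_right,
    inner_smul_left, inner_smul_right, F.inner_dr_incl (F.inner_tang hu y),
    real_inner_comm (F.dr t u) (F.incl _), F.inner_dr_incl (F.inner_tang hu x), F.inner_incl_incl,
    real_inner_self_eq_norm_sq, F.norm_dr hu]
  simp

theorem proj_pt (t : ℝ) (v : EuclideanSpace ℝ (Fin n)) :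
    F.proj (F.pt t v) = (Real.sin t * ‖v‖⁻¹) • v := by
  rw [pt, expPt, map_add, map_smul, map_smul, map_smul, proj_center, proj_incl, smul_zero,
    zero_add, smul_smul]

/-- The distance to the centre, as a fraction of the radial function. -/
def param (Ω : Set (Sph n)) (y : Amb n) : ℝ :=
  Real.arccos (inner ℝ (p : Amb n) (‖y‖⁻¹ • y)) / F.rad Ω (F.proj y)

theorem param_smul (Ω : Set (Sph n)) {r : ℝ} (hr : 0 < r) (y : Amb n) :
    F.param Ω (r • y) = F.param Ω y := by
  rw [param, param, normalize_smul hr, map_smul, F.rad_smul Ω hr]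

theorem param_pt (Ω : Set (Sph n)) {v : EuclideanSpace ℝ (Fin n)} (hv : v ≠ 0) {t : ℝ}
    (ht : t ∈ Ioo 0 Real.pi) : F.param Ω (F.pt t v) = t / F.rad Ω v := by
  have hs := Real.sin_pos_of_mem_Ioo ht
  have hn : 0 < ‖v‖ := norm_pos_iff.2 hv
  rw [param, F.norm_pt hv, inv_one, one_smul, pt,
    inner_expPt_left p (F.normalize_mem_unitTangent hv), Real.arccos_cos ht.1.le ht.2.le, ← pt,
    proj_pt, F.rad_smul Ω (by positivity)]

theorem exists_eq_pt {y : Amb n} (hy : ‖y‖ = 1) (hp : F.proj y ≠ 0) :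
    ∃ t ∈ Ioo 0 Real.pi, y = F.pt t (F.proj y) := by
  obtain ⟨a, v, rfl⟩ := F.exists_eq y
  rw [map_add, map_smul, F.proj_center, smul_zero, zero_add, F.proj_incl] at hp ⊢
  have hv : 0 < ‖v‖ := norm_pos_iff.2 hp
  have h1 : a ^ 2 + ‖v‖ ^ 2 = 1 := by
    have : ‖a • (p : Amb n) + F.incl v‖ ^ 2 = 1 := by rw [hy]; norm_num
    rw [norm_add_sq_real, norm_smul, norm_coe_sph, inner_smul_left, F.inner_incl, F.incl.norm_map,
      Real.norm_eq_abs, mul_one, sq_abs] at this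
    simpa using this
  have ha1 : a < 1 := by nlinarith
  have ha2 : -1 < a := by nlinarith
  refine ⟨Real.arccos a, ⟨Real.arccos_pos.2 ha1, ?_⟩, ?_⟩
  · refine lt_of_le_of_ne (Real.arccos_le_pi a) fun h => ?_
    rw [Real.arccos_eq_pi] at h
    linarith
  · rw [pt, expPt, Real.cos_arccos ha2.le ha1.le, Real.sin_arccos,
      show 1 - a ^ 2 = ‖v‖ ^ 2 by linarith, Real.sqrt_sq hv.le, smul_smul,
      mul_inv_cancel₀ hv.ne', one_smul]

end PolarFrame

namespace IsStarDomain

variable {Ω : Set (Sph n)} {p : Sph n} {α : ℝ}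

theorem pt_mem_cone_iff (h : IsStarDomain Ω p α) (F : PolarFrame p)
    {v : EuclideanSpace ℝ (Fin n)} (hv : v ≠ 0) {t : ℝ} (h0 : 0 ≤ t) (h1 : t < Real.pi) :
    F.pt t v ∈ cone Ω ↔ t < F.rad Ω v := by
  have hu := F.normalize_mem_unitTangent hv
  have := expSph_mem_iff_lt_radius h.isOpen h.star hu h0 h1
  rw [← coe_mem_cone_iff] at this
  exact this

theorem mem_cone_iff_param (h : IsStarDomain Ω p α) (F : PolarFrame p) {y : Amb n}
    (hp : F.proj y ≠ 0) : y ∈ cone Ω ↔ F.param Ω y < 1 := by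
  have hy0 : y ≠ 0 := fun hh => hp (by rw [hh, map_zero])
  have hn : 0 < ‖y‖ := norm_pos_iff.2 hy0
  have hpz : F.proj (‖y‖⁻¹ • y) ≠ 0 := by
    rw [map_smul]; exact smul_ne_zero (inv_pos.2 hn).ne' hp
  obtain ⟨t, ht, hz⟩ := F.exists_eq_pt (y := ‖y‖⁻¹ • y)
    (by rw [norm_smul, norm_inv, norm_norm, inv_mul_cancel₀ hn.ne']) hpz
  rw [← smul_mem_cone_iff (inv_pos.2 hn), ← F.param_smul Ω (inv_pos.2 hn), hz,
    h.pt_mem_cone_iff F hpz ht.1.le ht.2, F.param_pt Ω hpz ht, div_lt_one (h.rad_pos F hpz)]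

/-- R is continuous and positive on the compact unit sphere and constant along rays. The bound gives
a neighbourhood of the centre on which the cutoff is constant. -/
theorem exists_pos_le_rad (h : IsStarDomain Ω p α) (F : PolarFrame p) :
    ∃ ε > 0, ∀ v : EuclideanSpace ℝ (Fin n), v ≠ 0 → ε ≤ F.rad Ω v := by
  rcases isEmpty_or_nonempty (Metric.sphere (0 : EuclideanSpace ℝ (Fin n)) 1) with hE | hE
  · refine ⟨1, one_pos, fun v hv => (hE.false ⟨‖v‖⁻¹ • v, ?_⟩).elim⟩
    rw [mem_sphere_zero_iff_norm, norm_smul, norm_inv, norm_norm,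
      inv_mul_cancel₀ (norm_ne_zero_iff.2 hv)]
  · obtain ⟨u, -, hu⟩ := isCompact_univ.exists_isMinOn univ_nonempty
      (h.isHomogeneousC1_rad F).continuous_sphere.continuousOn
    refine ⟨F.rad Ω u, h.rad_pos F (ne_zero_of_mem_unit_sphere u), fun v hv => ?_⟩
    have hn : 0 < ‖v‖ := norm_pos_iff.2 hv
    obtain ⟨w, hw⟩ : ∃ w : Metric.sphere (0 : EuclideanSpace ℝ (Fin n)) 1,
        (w : EuclideanSpace ℝ (Fin n)) = ‖v‖⁻¹ • v := ⟨⟨‖v‖⁻¹ • v, by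
      rw [mem_sphere_zero_iff_norm, norm_smul, norm_inv, norm_norm, inv_mul_cancel₀ hn.ne']⟩, rfl⟩
    have := isMinOn_iff.1 hu w (mem_univ w)
    rwa [hw, F.rad_smul Ω (inv_pos.2 hn) v] at this

theorem contDiffAt_param (h : IsStarDomain Ω p α) (F : PolarFrame p) {y : Amb n}
    (hp : F.proj y ≠ 0) : ContDiffAt ℝ 1 (F.param Ω) y := by
  have hy0 : y ≠ 0 := fun hh => hp (by rw [hh, map_zero])
  have hn : 0 < ‖y‖ := norm_pos_iff.2 hy0
  have hpz : F.proj (‖y‖⁻¹ • y) ≠ 0 := by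
    rw [map_smul]; exact smul_ne_zero (inv_pos.2 hn).ne' hp
  obtain ⟨t, ht, hz⟩ := F.exists_eq_pt (y := ‖y‖⁻¹ • y)
    (by rw [norm_smul, norm_inv, norm_norm, inv_mul_cancel₀ hn.ne']) hpz
  have hin : inner ℝ (p : Amb n) (‖y‖⁻¹ • y) = Real.cos t := by
    rw [hz, PolarFrame.pt, inner_expPt_left p (F.normalize_mem_unitTangent hpz)]
  have hs := Real.sin_pos_of_mem_Ioo ht
  have hsc := Real.sin_sq_add_cos_sq t
  have h1 : ContDiffAt ℝ 1 (fun y : Amb n => inner ℝ (p : Amb n) (‖y‖⁻¹ • y)) y :=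
    contDiffAt_const.inner ℝ (contDiffAt_normalize hy0)
  have h2 : ContDiffAt ℝ 1 Real.arccos (inner ℝ (p : Amb n) (‖y‖⁻¹ • y)) := by
    rw [hin]
    refine Real.contDiffAt_arccos ?_ ?_ <;> intro hc <;> rw [hc] at hsc <;> nlinarith
  have h3 : ContDiffAt ℝ 1 (fun y => F.rad Ω (F.proj y)) y :=
    ((h.isHomogeneousC1_rad F).contDiffAt _ hp).comp y F.proj.contDiff.contDiffAt
  exact (h2.comp y h1).div h3 (h.rad_pos F hp).ne'

end IsStarDomain

/-- The test function `K · η(t / R_u)`, extended by zero. -/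
def testFn {p : Sph n} (F : PolarFrame p) (Ω : Set (Sph n)) (K : Amb n → ℝ) (η : ℝ → ℝ) :
    Amb n → ℝ :=
  (cone Ω).indicator fun y => homExt K y * η (F.param Ω y)

namespace IsStarDomain

variable {Ω : Set (Sph n)} {p : Sph n} {α : ℝ}

theorem testFn_smul (F : PolarFrame p) (K : Amb n → ℝ) (η : ℝ → ℝ) (r : ℝ) (y : Amb n)
    (hr : 0 < r) : testFn F Ω K η (r • y) = testFn F Ω K η y := by
  rw [testFn]
  by_cases hy : y ∈ cone Ω
  · rw [indicator_of_mem hy, indicator_of_mem ((smul_mem_cone_iff hr).2 hy), homExt_smul _ _ _ hr,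
      F.param_smul Ω hr]
  · rw [indicator_of_notMem hy, indicator_of_notMem (fun hh => hy ((smul_mem_cone_iff hr).1 hh))]

/-- Off the axis ℝp a point outside the cone has parameter at least 1, where the cutoff already
vanishes nearby. On the axis such a point is a negative multiple of p, near which the hemisphere
condition keeps the cone away. -/
theorem eventually_testFn_eq_zero (h : IsStarDomain Ω p α) (F : PolarFrame p) (K : Amb n → ℝ)
    {η : ℝ → ℝ} (hη1 : ∃ δ > 0, ∀ s, 1 - δ ≤ s → η s = 0) {y : Amb n} (hy : y ≠ 0)
    (hyO : y ∉ cone Ω) : testFn F Ω K η =ᶠ[𝓝 y] 0 := by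
  by_cases hp : F.proj y = 0
  · have hneg : inner ℝ (p : Amb n) y < 0 := by
      obtain ⟨a, v, rfl⟩ := F.exists_eq y
      rw [map_add, map_smul, F.proj_center, smul_zero, zero_add, F.proj_incl] at hp
      subst hp
      simp only [map_zero, add_zero] at *
      rw [inner_smul_right, inner_coe_sph, mul_one]
      by_contra ha
      have ha0 : 0 < a := lt_of_le_of_ne (not_lt.1 ha) fun hh => hy (by rw [← hh, zero_smul])
      exact hyO ((smul_mem_cone_iff ha0).2 (coe_mem_cone_iff.2 h.star.1))
    have hc : ContinuousAt (fun z : Amb n => inner ℝ (p : Amb n) z) y := by fun_prop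
    filter_upwards [hc.preimage_mem_nhds (Iio_mem_nhds hneg)] with z hz
    exact indicator_of_notMem (fun hh => lt_asymm hz (inner_pos_of_mem_cone h.subset_ball hh)) _
  · obtain ⟨δ, hδ, hδη⟩ := hη1
    have hpar : 1 - δ < F.param Ω y := by
      have := not_lt.1 fun hh => hyO ((h.mem_cone_iff_param F hp).2 hh)
      linarith
    filter_upwards [(h.contDiffAt_param F hp).continuousAt.preimage_mem_nhds (Ioi_mem_nhds hpar)]
      with z hz
    rw [testFn]
    by_cases hzO : z ∈ cone Ω
    · rw [indicator_of_mem hzO, hδη _ (le_of_lt hz), mul_zero]; rfl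
    · rw [indicator_of_notMem hzO]; rfl

/-- The parameter t / R_u is not differentiable on the ray through p, but η is constant there.
Across the boundary of the cone the function vanishes identically. -/
theorem isHomogeneousC1_testFn (h : IsStarDomain Ω p α) (F : PolarFrame p) {K : Amb n → ℝ}
    (hK : ∀ y ∈ cone Ω, ContDiffAt ℝ 1 (homExt K) y) {η : ℝ → ℝ} (hη : ContDiff ℝ 1 η)
    (hη0 : ∃ c, ∀ s ≤ 1 / 2, η s = c) (hη1 : ∃ δ > 0, ∀ s, 1 - δ ≤ s → η s = 0) :
    IsHomogeneousC1 (testFn F Ω K η) := by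
  refine ⟨fun y hy => ?_, fun r x hr => testFn_smul F K η r x hr⟩
  by_cases hyO : y ∈ cone Ω
  · have heq : testFn F Ω K η =ᶠ[𝓝 y] fun y => homExt K y * η (F.param Ω y) := by
      filter_upwards [cone_mem_nhds h.isOpen hyO] with z hz
      rw [testFn, indicator_of_mem hz]
    refine ContDiffAt.congr_of_eventuallyEq ?_ heq
    refine (hK y hyO).mul ?_
    by_cases hp : F.proj y = 0
    · obtain ⟨c, hc⟩ := hη0
      obtain ⟨ε, hε, hεR⟩ := h.exists_pos_le_rad F
      refine (contDiffAt_const (c := c)).congr_of_eventuallyEq ?_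
      have hcont : ContinuousAt (fun y : Amb n => Real.arccos (inner ℝ (p : Amb n) (‖y‖⁻¹ • y))) y :=
        Real.continuous_arccos.continuousAt.comp
          (continuousAt_const.inner (contDiffAt_normalize hy (k := 0)).continuousAt)
      have hval : Real.arccos (inner ℝ (p : Amb n) (‖y‖⁻¹ • y)) < ε / 2 := by
        have hpos := inner_pos_of_mem_cone h.subset_ball hyO
        obtain ⟨a, v, rfl⟩ := F.exists_eq y
        rw [map_add, map_smul, F.proj_center, smul_zero, zero_add, F.proj_incl] at hp
        subst hp
        simp only [map_zero, add_zero] at *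
        rw [inner_smul_right, inner_coe_sph, mul_one] at hpos
        rw [normalize_smul hpos, norm_coe_sph, inv_one, one_smul, inner_coe_sph, Real.arccos_one]
        positivity
      filter_upwards [hcont.preimage_mem_nhds (Iio_mem_nhds hval), cone_mem_nhds h.isOpen hyO]
        with z hz hzO
      refine hc _ ?_
      rw [PolarFrame.param]
      -- On the axis the numerator is arccos 1 = 0, so the quotient is 0 whatever the default value
      -- of `rad` at the zero vector.
      by_cases hpz : F.proj z = 0
      · have hpos := inner_pos_of_mem_cone h.subset_ball hzO
        obtain ⟨a, v, rfl⟩ := F.exists_eq z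
        rw [map_add, map_smul, F.proj_center, smul_zero, zero_add, F.proj_incl] at hpz
        subst hpz
        simp only [map_zero, add_zero] at *
        rw [inner_smul_right, inner_coe_sph, mul_one] at hpos
        rw [normalize_smul hpos, norm_coe_sph, inv_one, one_smul, inner_coe_sph, Real.arccos_one]
        simp
      · rw [div_le_iff₀ (h.rad_pos F hpz)]
        have h1 := hεR _ hpz
        have h2 : Real.arccos (inner ℝ (p : Amb n) (‖z‖⁻¹ • z)) < ε / 2 := hz
        linarith
    · exact hη.contDiffAt.comp y (h.contDiffAt_param F hp)
  · exact (contDiffAt_const (c := (0:ℝ))).congr_of_eventuallyEq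
      (h.eventually_testFn_eq_zero F K hη1 hy hyO)

end IsStarDomain

end Steklov

end

/-! ### Functions and gradients along rescaled rays -/

noncomputable section

namespace Steklov

open MeasureTheory Set Filter Topology

variable {n : ℕ}

namespace PolarFrame

variable {p : Sph n} (F : PolarFrame p)

/-- The point at the fraction `s` of the segment from the centre to the boundary. -/
def gpt (Ω : Set (Sph n)) (s : ℝ) (u : EuclideanSpace ℝ (Fin n)) : Amb n :=
  F.pt (s * F.rad Ω u) u

/-- The radial derivative. -/
def fr (Ω : Set (Sph n)) (f : Amb n → ℝ) (s : ℝ) (u : EuclideanSpace ℝ (Fin n)) : ℝ :=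
  inner ℝ (sphGrad f (F.gpt Ω s u)) (F.dr (s * F.rad Ω u) u)

/-- The tangential part of the gradient. -/
def ftan (Ω : Set (Sph n)) (f : Amb n → ℝ) (s : ℝ) (u : EuclideanSpace ℝ (Fin n)) :
    EuclideanSpace ℝ (Fin n) :=
  F.tang u (sphGrad f (F.gpt Ω s u))

theorem hasDerivAt_pt {u : EuclideanSpace ℝ (Fin n)} (hu : ‖u‖ = 1) (t : ℝ) :
    HasDerivAt (fun t => F.pt t u) (F.dr t u) t := by
  have h : (fun t => F.pt t u) = expPt p (F.incl u) := by
    funext t; rw [pt, hu, inv_one, one_smul]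
  rw [h]
  exact IsStarDomain.hasDerivAt_expPt _ _

theorem hasDerivAt_gpt (Ω : Set (Sph n)) {f : Amb n → ℝ} {u : EuclideanSpace ℝ (Fin n)}
    (hu : ‖u‖ = 1) {s : ℝ} (hf : DifferentiableAt ℝ f (F.gpt Ω s u)) :
    HasDerivAt (fun s => f (F.gpt Ω s u)) (F.rad Ω u * F.fr Ω f s u) s := by
  have hu0 : u ≠ 0 := fun h => by simp [h] at hu
  have h1 : HasDerivAt (fun s => F.gpt Ω s u) (F.rad Ω u • F.dr (s * F.rad Ω u) u) s := by
    have := HasDerivAt.scomp s (F.hasDerivAt_pt hu (s * F.rad Ω u))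
      ((hasDerivAt_id s).mul_const (F.rad Ω u))
    rw [one_mul] at this
    exact this
  have h2 := hasDerivAt_comp_curve h1 (Eventually.of_forall fun s => F.norm_pt hu0 _) hf
  rwa [inner_smul_right] at h2

end PolarFrame

namespace IsStarDomain

variable {Ω : Set (Sph n)} {p : Sph n} {α : ℝ}

theorem mul_rad_lt_pi (h : IsStarDomain Ω p α) (F : PolarFrame p) {u : EuclideanSpace ℝ (Fin n)}
    (hu : ‖u‖ = 1) {s : ℝ} (h0 : 0 ≤ s) (h1 : s ≤ 1) :
    0 ≤ s * F.rad Ω u ∧ s * F.rad Ω u < Real.pi := by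
  have hu0 : u ≠ 0 := fun hh => by simp [hh] at hu
  have hR := h.rad_pos F hu0
  have hR' := h.rad_le F hu0
  have hpi := Real.pi_pos
  exact ⟨by positivity, by nlinarith⟩

theorem gpt_mem_cone (h : IsStarDomain Ω p α) (F : PolarFrame p) {u : EuclideanSpace ℝ (Fin n)}
    (hu : ‖u‖ = 1) {s : ℝ} (h0 : 0 ≤ s) (h1 : s < 1) : F.gpt Ω s u ∈ cone Ω := by
  have hu0 : u ≠ 0 := fun hh => by simp [hh] at hu
  obtain ⟨h2, h3⟩ := h.mul_rad_lt_pi F hu h0 h1.le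
  exact (h.pt_mem_cone_iff F hu0 h2 h3).2 (by nlinarith [h.rad_pos F hu0])

theorem gpt_mem_closure (h : IsStarDomain Ω p α) (F : PolarFrame p)
    {u : EuclideanSpace ℝ (Fin n)} (hu : ‖u‖ = 1) {s : ℝ} (h0 : 0 ≤ s) (h1 : s ≤ 1) :
    ∃ x ∈ closure Ω, (x : Amb n) = F.gpt Ω s u := by
  rcases h1.lt_or_eq with h1 | rfl
  · have hm := h.gpt_mem_cone F hu h0 h1
    have hu0 : u ≠ 0 := fun hh => by simp [hh] at hu
    refine ⟨⟨F.gpt Ω s u, by rw [mem_sphere_zero_iff_norm]; exact F.norm_pt hu0 _⟩,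
      subset_closure (coe_mem_cone_iff.1 hm), rfl⟩
  · obtain ⟨q, hq, hq'⟩ := h.exists_localDefining F hu
    exact ⟨q, frontier_subset_closure hq, by rw [hq', PolarFrame.gpt, one_mul]⟩

theorem contDiffAt_gpt (h : IsStarDomain Ω p α) (F : PolarFrame p) {f : Amb n → ℝ}
    (hf : ∀ x ∈ closure Ω, ContDiffAt ℝ ∞ f (x : Amb n)) {u : EuclideanSpace ℝ (Fin n)}
    (hu : ‖u‖ = 1) {s : ℝ} (h0 : 0 ≤ s) (h1 : s ≤ 1) : ContDiffAt ℝ ∞ f (F.gpt Ω s u) := by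
  obtain ⟨x, hx, hx'⟩ := h.gpt_mem_closure F hu h0 h1
  rw [← hx']
  exact hf x hx

theorem contDiffAt_homExt_cone {f : Amb n → ℝ}
    (hf : ∀ x ∈ closure Ω, ContDiffAt ℝ ∞ f (x : Amb n)) {y : Amb n} (hy : y ∈ cone Ω) :
    ContDiffAt ℝ ∞ (homExt f) y := by
  obtain ⟨hy0, x, hx, hxy⟩ := hy
  exact contDiffAt_homExt hy0 (by rw [← hxy]; exact hf x (subset_closure hx))

theorem continuous_rad_sphere (h : IsStarDomain Ω p α) (F : PolarFrame p) :
    Continuous fun u : Metric.sphere (0 : EuclideanSpace ℝ (Fin n)) 1 => F.rad Ω u :=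
  (h.isHomogeneousC1_rad F).continuous_sphere

theorem continuous_gpt (h : IsStarDomain Ω p α) (F : PolarFrame p) : Continuous
    fun z : ℝ × Metric.sphere (0 : EuclideanSpace ℝ (Fin n)) 1 => F.gpt Ω z.1 z.2 := by
  have hR := h.continuous_rad_sphere F
  have h2 : Continuous fun z : ℝ × Metric.sphere (0 : EuclideanSpace ℝ (Fin n)) 1 =>
      (z.1 * F.rad Ω z.2, z.2) :=
    (continuous_fst.mul (hR.comp continuous_snd)).prodMk continuous_snd
  have h3 := F.continuous_pt_sphere.comp h2
  simp only [Function.comp_def] at h3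
  exact h3

theorem continuousOn_gpt (h : IsStarDomain Ω p α) (F : PolarFrame p) {f : Amb n → ℝ}
    (hf : ∀ x ∈ closure Ω, ContDiffAt ℝ ∞ f (x : Amb n)) :
    ContinuousOn (fun z : ℝ × Metric.sphere (0 : EuclideanSpace ℝ (Fin n)) 1 =>
      f (F.gpt Ω z.1 z.2)) (Icc 0 1 ×ˢ univ) := by
  rintro ⟨s, u⟩ ⟨hs, -⟩
  have hc := (h.contDiffAt_gpt F hf (norm_eq_of_mem_sphere u) hs.1 hs.2).continuousAt
  exact (ContinuousAt.comp (f := fun z : ℝ × Metric.sphere (0 : EuclideanSpace ℝ (Fin n)) 1 =>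
    F.gpt Ω z.1 z.2) (x := (s, u)) hc (h.continuous_gpt F).continuousAt).continuousWithinAt

theorem continuousOn_sphGrad_gpt (h : IsStarDomain Ω p α) (F : PolarFrame p) {f : Amb n → ℝ}
    (hf : ∀ x ∈ closure Ω, ContDiffAt ℝ ∞ f (x : Amb n)) :
    ContinuousOn (fun z : ℝ × Metric.sphere (0 : EuclideanSpace ℝ (Fin n)) 1 =>
      sphGrad f (F.gpt Ω z.1 z.2)) (Icc 0 1 ×ˢ univ) := by
  rintro ⟨s, u⟩ ⟨hs, -⟩
  have hu := norm_eq_of_mem_sphere u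
  have hn : ‖F.gpt Ω s u‖ = 1 := F.norm_pt (ne_zero_of_mem_unit_sphere u) _
  have h1 : ContDiffAt ℝ ∞ (homExt f) (F.gpt Ω s u) :=
    contDiffAt_homExt (fun hh => by rw [hh, norm_zero] at hn; exact zero_ne_one hn) (by
      rw [hn, inv_one, one_smul]; exact h.contDiffAt_gpt F hf hu hs.1 hs.2)
  have hc : ContinuousAt (sphGrad f) (F.gpt Ω s u) :=
    (InnerProductSpace.toDual ℝ (Amb n)).symm.continuous.continuousAt.comp
      (h1.fderiv_right (m := 0) (by norm_num)).continuousAt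
  exact (ContinuousAt.comp (f := fun z : ℝ × Metric.sphere (0 : EuclideanSpace ℝ (Fin n)) 1 =>
    F.gpt Ω z.1 z.2) (x := (s, u)) hc (h.continuous_gpt F).continuousAt).continuousWithinAt

theorem continuousOn_fr (h : IsStarDomain Ω p α) (F : PolarFrame p) {f : Amb n → ℝ}
    (hf : ∀ x ∈ closure Ω, ContDiffAt ℝ ∞ f (x : Amb n)) :
    ContinuousOn (fun z : ℝ × Metric.sphere (0 : EuclideanSpace ℝ (Fin n)) 1 =>
      F.fr Ω f z.1 z.2) (Icc 0 1 ×ˢ univ) := by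
  refine (h.continuousOn_sphGrad_gpt F hf).inner (Continuous.continuousOn ?_)
  have hR := h.continuous_rad_sphere F
  have hm : Continuous fun z : ℝ × Metric.sphere (0 : EuclideanSpace ℝ (Fin n)) 1 =>
      z.1 * F.rad Ω z.2 := continuous_fst.mul (hR.comp continuous_snd)
  have hi : Continuous fun z : ℝ × Metric.sphere (0 : EuclideanSpace ℝ (Fin n)) 1 =>
      F.incl z.2 := F.incl.continuous.comp (continuous_subtype_val.comp continuous_snd)
  exact ((Real.continuous_sin.comp hm).neg.smul continuous_const).add
    ((Real.continuous_cos.comp hm).smul hi)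

theorem continuousOn_ftan (h : IsStarDomain Ω p α) (F : PolarFrame p) {f : Amb n → ℝ}
    (hf : ∀ x ∈ closure Ω, ContDiffAt ℝ ∞ f (x : Amb n)) :
    ContinuousOn (fun z : ℝ × Metric.sphere (0 : EuclideanSpace ℝ (Fin n)) 1 =>
      F.ftan Ω f z.1 z.2) (Icc 0 1 ×ˢ univ) := by
  have h1 : ContinuousOn (fun z : ℝ × Metric.sphere (0 : EuclideanSpace ℝ (Fin n)) 1 =>
      F.proj (sphGrad f (F.gpt Ω z.1 z.2))) (Icc 0 1 ×ˢ univ) :=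
    F.proj.continuous.comp_continuousOn (h.continuousOn_sphGrad_gpt F hf)
  have h2 : ContinuousOn (fun z : ℝ × Metric.sphere (0 : EuclideanSpace ℝ (Fin n)) 1 =>
      (z.2 : EuclideanSpace ℝ (Fin n))) (Icc 0 1 ×ˢ univ) := by fun_prop
  exact h1.sub ((h2.inner (𝕜 := ℝ) h1).smul h2)

theorem inner_sphGrad_gpt (h : IsStarDomain Ω p α) (F : PolarFrame p) {f : Amb n → ℝ}
    (hf : ∀ x ∈ closure Ω, ContDiffAt ℝ ∞ f (x : Amb n)) {u : EuclideanSpace ℝ (Fin n)}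
    (hu : ‖u‖ = 1) {s : ℝ} (h0 : 0 ≤ s) (h1 : s ≤ 1) :
    inner ℝ (sphGrad f (F.gpt Ω s u)) (F.gpt Ω s u) = (0:ℝ) :=
  inner_sphGrad_self (F.norm_pt (fun hh => by simp [hh] at hu) _)
    ((h.contDiffAt_gpt F hf hu h0 h1).differentiableAt (by simp))

/-- The gradient along a geodesic sphere of the graph. -/
theorem hasGradientAt_gpt (h : IsStarDomain Ω p α) (F : PolarFrame p) {f : Amb n → ℝ}
    {u : EuclideanSpace ℝ (Fin n)} (hu : ‖u‖ = 1) {s : ℝ}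
    (hf : DifferentiableAt ℝ f (F.gpt Ω s u)) :
    HasGradientAt (fun v => f (F.gpt Ω s v))
      ((F.fr Ω f s u * s) • gradient (F.rad Ω) u + Real.sin (s * F.rad Ω u) • F.ftan Ω f s u) u := by
  have hu0 : u ≠ 0 := fun hh => by simp [hh] at hu
  have hT : HasGradientAt (fun v => s * F.rad Ω v) (s • gradient (F.rad Ω) u) u := by
    have := (h.hasGradientAt_rad F hu0)
    rw [hasGradientAt_iff_hasFDerivAt] at this ⊢
    refine (this.const_mul s).congr_fderiv ?_
    rw [map_smul]
  have := F.hasGradientAt_comp_pt hu hT hf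
  rw [smul_smul] at this
  exact this

/-- Product rule for K · η(s) with s = t / R_u, whose gradient is ∂_r / R − s ∇R / (R sin t). The
radial and tangential components are found by differentiating along rays and along the hypersurface
s = const. -/
theorem inner_gradient_testFn (h : IsStarDomain Ω p α) (F : PolarFrame p) {f K : Amb n → ℝ}
    (hf : ∀ x ∈ closure Ω, ContDiffAt ℝ ∞ f (x : Amb n))
    (hK : ∀ x ∈ closure Ω, ContDiffAt ℝ ∞ K (x : Amb n)) {η η' : ℝ → ℝ}
    (hη : ∀ s, HasDerivAt η (η' s) s) (hη' : Continuous η')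
    (hη0 : ∃ c, ∀ s ≤ 1 / 2, η s = c) (hη1 : ∃ δ > 0, ∀ s, 1 - δ ≤ s → η s = 0)
    {u : EuclideanSpace ℝ (Fin n)} (hu : ‖u‖ = 1) {s : ℝ} (hs : s ∈ Ioo (0:ℝ) 1) :
    inner ℝ (gradient (testFn F Ω K η) (F.gpt Ω s u)) (gradient (homExt f) (F.gpt Ω s u)) =
      η s * inner ℝ (sphGrad K (F.gpt Ω s u)) (sphGrad f (F.gpt Ω s u)) +
      η' s * (K (F.gpt Ω s u) / F.rad Ω u * (F.fr Ω f s u -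
        s * inner ℝ (gradient (F.rad Ω) u) (F.ftan Ω f s u) / Real.sin (s * F.rad Ω u))) := by
  have hu0 : u ≠ 0 := fun hh => by simp [hh] at hu
  have hR := h.rad_pos F hu0
  have hη1' : ContDiff ℝ 1 η := by
    rw [contDiff_one_iff_deriv]
    exact ⟨fun s => (hη s).differentiableAt, by
      rwa [show deriv η = η' from funext fun s => (hη s).deriv]⟩
  have hχ := h.isHomogeneousC1_testFn F
    (fun y hy => (contDiffAt_homExt_cone hK hy).of_le (by norm_cast)) hη1' hη0 hη1
  have hχe : homExt (testFn F Ω K η) = testFn F Ω K η := homExt_eq_of_homogeneous hχ.smul_eq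
  have hval : ∀ s ∈ Ioo (0:ℝ) 1, ∀ v : EuclideanSpace ℝ (Fin n), v ≠ 0 →
      testFn F Ω K η (F.gpt Ω s v) = K (F.gpt Ω s v) * η s := by
    intro s hs v hv
    have hRv := h.rad_pos F hv
    have hRv' := h.rad_le F hv
    have hpi := Real.pi_pos
    have ht : s * F.rad Ω v ∈ Ioo 0 Real.pi :=
      ⟨mul_pos hs.1 hRv, by nlinarith [hs.2, hs.1]⟩
    have hm : F.gpt Ω s v ∈ cone Ω :=
      (h.pt_mem_cone_iff F hv ht.1.le ht.2).2 (by nlinarith [hs.2])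
    rw [testFn, indicator_of_mem hm]
    congr 1
    · rw [homExt, PolarFrame.gpt, F.norm_pt hv, inv_one, one_smul]
    · rw [PolarFrame.gpt, F.param_pt Ω hv ht, mul_div_assoc, div_self hRv.ne', mul_one]
  set x := F.gpt Ω s u with hx
  have hxn : ‖x‖ = 1 := F.norm_pt hu0 _
  have hx0 : x ≠ 0 := fun hh => by rw [hh, norm_zero] at hxn; exact zero_ne_one hxn
  have hdχ : DifferentiableAt ℝ (testFn F Ω K η) x :=
    (hχ.contDiffAt x hx0).differentiableAt one_ne_zero
  have hdK : DifferentiableAt ℝ K x :=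
    (h.contDiffAt_gpt F hK hu hs.1.le hs.2.le).differentiableAt (by simp)
  have hdf : DifferentiableAt ℝ f x :=
    (h.contDiffAt_gpt F hf hu hs.1.le hs.2.le).differentiableAt (by simp)
  have hgχ : gradient (testFn F Ω K η) x = sphGrad (testFn F Ω K η) x := by
    rw [sphGrad, hχe]
  -- the radial derivative
  have hr : F.rad Ω u * F.fr Ω (testFn F Ω K η) s u
      = F.rad Ω u * F.fr Ω K s u * η s + K x * η' s := by
    have h1 := F.hasDerivAt_gpt Ω hu hdχ
    have h2 := (F.hasDerivAt_gpt Ω hu hdK).mul (hη s)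
    refine h1.unique (h2.congr_of_eventuallyEq ?_)
    filter_upwards [Ioo_mem_nhds hs.1 hs.2] with s' hs'
    exact hval s' hs' u hu0
  -- the tangential part
  have ht : (F.fr Ω (testFn F Ω K η) s u * s) • gradient (F.rad Ω) u +
      Real.sin (s * F.rad Ω u) • F.ftan Ω (testFn F Ω K η) s u =
      η s • ((F.fr Ω K s u * s) • gradient (F.rad Ω) u +
        Real.sin (s * F.rad Ω u) • F.ftan Ω K s u) := by
    have h1 := h.hasGradientAt_gpt F hu hdχ
    have h2 := h.hasGradientAt_gpt F hu hdK
    have h3 : HasGradientAt (fun v => K (F.gpt Ω s v) * η s) (η s • ((F.fr Ω K s u * s) •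
        gradient (F.rad Ω) u + Real.sin (s * F.rad Ω u) • F.ftan Ω K s u)) u := by
      rw [hasGradientAt_iff_hasFDerivAt] at h2 ⊢
      refine (h2.mul_const (η s)).congr_fderiv ?_
      conv_rhs => rw [map_smul]
    refine h1.unique ?_
    rw [hasGradientAt_iff_hasFDerivAt] at h3 ⊢
    refine h3.congr_of_eventuallyEq ?_
    filter_upwards [eventually_ne_nhds hu0] with v hv
    exact hval s hs v hv
  have hmul := h.mul_rad_lt_pi F hu hs.1.le hs.2.le
  have hsin : 0 < Real.sin (s * F.rad Ω u) :=
    Real.sin_pos_of_pos_of_lt_pi (mul_pos hs.1 hR) hmul.2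
  have e1 : F.fr Ω (testFn F Ω K η) s u = η s * F.fr Ω K s u + η' s * (K x / F.rad Ω u) := by
    field_simp
    linarith
  have e2 : F.ftan Ω (testFn F Ω K η) s u = η s • F.ftan Ω K s u -
      (η' s * (K x / F.rad Ω u) * s / Real.sin (s * F.rad Ω u)) • gradient (F.rad Ω) u := by
    have h4 : Real.sin (s * F.rad Ω u) • F.ftan Ω (testFn F Ω K η) s u =
        (η s * Real.sin (s * F.rad Ω u)) • F.ftan Ω K s u
          - (η' s * (K x / F.rad Ω u) * s) • gradient (F.rad Ω) u := by
      have h5 := eq_sub_of_add_eq' ht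
      rw [h5, e1]
      module
    calc F.ftan Ω (testFn F Ω K η) s u
        = (Real.sin (s * F.rad Ω u))⁻¹ • Real.sin (s * F.rad Ω u) •
          F.ftan Ω (testFn F Ω K η) s u := by rw [smul_smul, inv_mul_cancel₀ hsin.ne', one_smul]
      _ = _ := by
          rw [h4, smul_sub, smul_smul, smul_smul]
          congr 2 <;> field_simp
  have hf0 := h.inner_sphGrad_gpt F hf hu hs.1.le hs.2.le
  have hK0 := h.inner_sphGrad_gpt F hK hu hs.1.le hs.2.le
  have hχ0 : inner ℝ (sphGrad (testFn F Ω K η) x) x = (0:ℝ) := inner_sphGrad_self hxn hdχ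
  have i1 : inner ℝ (sphGrad (testFn F Ω K η) x) (sphGrad f x) =
      F.fr Ω (testFn F Ω K η) s u * F.fr Ω f s u +
      inner ℝ (F.ftan Ω (testFn F Ω K η) s u) (F.ftan Ω f s u) := F.inner_polar hu hχ0 hf0
  have i2 : inner ℝ (sphGrad K x) (sphGrad f x) = F.fr Ω K s u * F.fr Ω f s u +
      inner ℝ (F.ftan Ω K s u) (F.ftan Ω f s u) := F.inner_polar hu hK0 hf0
  rw [hgχ, show gradient (homExt f) x = sphGrad f x from rfl, i1, i2, e1, e2, inner_sub_left,
    inner_smul_left, inner_smul_left]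
  simp only [conj_trivial]
  ring

end IsStarDomain

end Steklov

end

/-! ### Green's identity in polar coordinates -/

noncomputable section

namespace Steklov

open MeasureTheory Set Filter Topology

theorem continuousOn_integral_of_compact {Z : Type*} [TopologicalSpace Z] [CompactSpace Z]
    [MeasurableSpace Z] [OpensMeasurableSpace Z] [SecondCountableTopology Z] {ν : Measure Z}
    [IsFiniteMeasure ν] {a b : ℝ} {g : ℝ × Z → ℝ} (hg : ContinuousOn g (Icc a b ×ˢ univ)) :
    ContinuousOn (fun s => ∫ z, g (s, z) ∂ν) (Icc a b) := by
  rw [continuousOn_iff_continuous_domRestrict]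
  have hc : Continuous (Function.uncurry fun (s : Icc a b) (z : Z) => g (s, z)) :=
    hg.comp_continuous (f := fun w : Icc a b × Z => ((w.1 : ℝ), w.2)) (by fun_prop)
      fun w => ⟨w.1.2, mem_univ _⟩
  have := continuous_parametric_integral_of_continuous (μ := ν) hc (isCompact_univ (X := Z))
  simp only [Measure.restrict_univ] at this
  exact this

theorem continuous_slice_of_continuousOn {Z : Type*} [TopologicalSpace Z] {a b : ℝ} {g : ℝ × Z → ℝ}
    (hg : ContinuousOn g (Icc a b ×ˢ univ)) {s : ℝ} (hs : s ∈ Icc a b) :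
    Continuous fun z => g (s, z) :=
  hg.comp_continuous (f := fun z : Z => (s, z)) (by fun_prop) fun z => ⟨hs, mem_univ _⟩

variable {n : ℕ}

namespace PolarFrame

variable {p : Sph n} (F : PolarFrame p)

/-- The Dirichlet pairing over the geodesic sphere at the fraction `s` of the graph. -/
def dirichletSlice (Ω : Set (Sph n)) (K f : Amb n → ℝ) (s : ℝ) : ℝ :=
  ∫ u : Metric.sphere (0 : EuclideanSpace ℝ (Fin n)) 1,
    Real.sin (s * F.rad Ω u) ^ (n - 1) * F.rad Ω u *
      inner ℝ (sphGrad K (F.gpt Ω s u)) (sphGrad f (F.gpt Ω s u))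
    ∂(volume : Measure (EuclideanSpace ℝ (Fin n))).toSphere

/-- The weighted flux through the geodesic sphere at the fraction `s` of the graph. -/
def fluxSlice (Ω : Set (Sph n)) (K f : Amb n → ℝ) (s : ℝ) : ℝ :=
  ∫ u : Metric.sphere (0 : EuclideanSpace ℝ (Fin n)) 1,
    Real.sin (s * F.rad Ω u) ^ (n - 1) * (K (F.gpt Ω s u) * (F.fr Ω f s u -
        s * inner ℝ (gradient (F.rad Ω) u) (F.ftan Ω f s u) / Real.sin (s * F.rad Ω u)))
    ∂(volume : Measure (EuclideanSpace ℝ (Fin n))).toSphere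

end PolarFrame

namespace IsStarDomain

variable {Ω : Set (Sph n)} {p : Sph n} {α : ℝ}

theorem continuousOn_dirichlet (h : IsStarDomain Ω p α) (F : PolarFrame p) {f K : Amb n → ℝ}
    (hf : ∀ x ∈ closure Ω, ContDiffAt ℝ ∞ f (x : Amb n))
    (hK : ∀ x ∈ closure Ω, ContDiffAt ℝ ∞ K (x : Amb n)) :
    ContinuousOn (fun z : ℝ × Metric.sphere (0 : EuclideanSpace ℝ (Fin n)) 1 =>
      Real.sin (z.1 * F.rad Ω z.2) ^ (n - 1) * F.rad Ω z.2 *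
        inner ℝ (sphGrad K (F.gpt Ω z.1 z.2)) (sphGrad f (F.gpt Ω z.1 z.2)))
      (Icc 0 1 ×ˢ univ) := by
  have hR := (h.continuous_rad_sphere F).comp
    (continuous_snd (X := ℝ) (Y := Metric.sphere (0 : EuclideanSpace ℝ (Fin n)) 1))
  exact (((Real.continuous_sin.comp (continuous_fst.mul hR)).pow _).mul hR).continuousOn.mul
    ((h.continuousOn_sphGrad_gpt F hK).inner (h.continuousOn_sphGrad_gpt F hf))

theorem continuousOn_flux (h : IsStarDomain Ω p α) (F : PolarFrame p) {f K : Amb n → ℝ}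
    (hf : ∀ x ∈ closure Ω, ContDiffAt ℝ ∞ f (x : Amb n))
    (hK : ∀ x ∈ closure Ω, ContDiffAt ℝ ∞ K (x : Amb n)) {ε : ℝ} (hε : 0 < ε) :
    ContinuousOn (fun z : ℝ × Metric.sphere (0 : EuclideanSpace ℝ (Fin n)) 1 =>
      Real.sin (z.1 * F.rad Ω z.2) ^ (n - 1) * (K (F.gpt Ω z.1 z.2) * (F.fr Ω f z.1 z.2 -
        z.1 * inner ℝ (gradient (F.rad Ω) z.2) (F.ftan Ω f z.1 z.2) /
          Real.sin (z.1 * F.rad Ω z.2)))) (Icc ε 1 ×ˢ univ) := by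
  have hsub : Icc ε 1 ×ˢ univ ⊆
      (Icc 0 1 ×ˢ univ : Set (ℝ × Metric.sphere (0 : EuclideanSpace ℝ (Fin n)) 1)) :=
    prod_mono (Icc_subset_Icc_left hε.le) Subset.rfl
  have hR := (h.continuous_rad_sphere F).comp
    (continuous_snd (X := ℝ) (Y := Metric.sphere (0 : EuclideanSpace ℝ (Fin n)) 1))
  have hG := (h.isHomogeneousC1_rad F).continuous_gradient_sphere.comp
    (continuous_snd (X := ℝ) (Y := Metric.sphere (0 : EuclideanSpace ℝ (Fin n)) 1))
  have hs := Real.continuous_sin.comp (continuous_fst.mul hR)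
  refine ((hs.pow _).continuousOn).mul ((((h.continuousOn_gpt F hK).mono hsub)).mul
    (((h.continuousOn_fr F hf).mono hsub).sub (ContinuousOn.div (continuous_fst.continuousOn.mul
      (hG.continuousOn.inner ((h.continuousOn_ftan F hf).mono hsub))) hs.continuousOn ?_)))
  rintro ⟨s, u⟩ ⟨hs', -⟩
  have hu0 := ne_zero_of_mem_unit_sphere u
  have h1 := h.mul_rad_lt_pi F (norm_eq_of_mem_sphere u) (hε.le.trans hs'.1) hs'.2
  exact (Real.sin_pos_of_pos_of_lt_pi (mul_pos (hε.trans_le hs'.1) (h.rad_pos F hu0)) h1.2).ne'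

/-- Weak harmonicity tested with K · η(s). The substitution t = s R_u on each ray brings in a factor
R_u, which cancels the 1/R_u of the gradient of s in the flux term. -/
theorem cutoff_flux (h : IsStarDomain Ω p α) (F : PolarFrame p) (hn : 1 ≤ n) {f K : Amb n → ℝ}
    (hf : ∀ x ∈ closure Ω, ContDiffAt ℝ ∞ f (x : Amb n))
    (hK : ∀ x ∈ closure Ω, ContDiffAt ℝ ∞ K (x : Amb n)) (hlap : ∀ x ∈ Ω, sphLaplacian f x = 0)
    {η η' : ℝ → ℝ} (hη : ∀ s, HasDerivAt η (η' s) s) (hη' : Continuous η')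
    (hη0 : ∃ c, ∀ s ≤ 1 / 2, η s = c) (hη1 : ∃ δ > 0, ∀ s, 1 - δ ≤ s → η s = 0) :
    ∫ s in Icc (0:ℝ) 1, (η s * F.dirichletSlice Ω K f s + η' s * F.fluxSlice Ω K f s) = 0 := by
  have hη1' : ContDiff ℝ 1 η := by
    rw [contDiff_one_iff_deriv]
    exact ⟨fun s => (hη s).differentiableAt, by
      rwa [show deriv η = η' from funext fun s => (hη s).deriv]⟩
  have hχ := h.isHomogeneousC1_testFn F
    (fun y hy => (contDiffAt_homExt_cone hK hy).of_le (by norm_cast)) hη1' hη0 hη1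
  obtain ⟨hbc, hb0⟩ := integral_inner_gradient_eq_zero (O := cone Ω) (k := homExt f)
    (χ := testFn F Ω K η) (fun r x hr hx => (smul_mem_cone_iff hr).2 hx)
    (fun r x hr => homExt_smul f r x hr)
    (fun x hx => (contDiffAt_homExt_cone hf hx).of_le (by norm_cast))
    (fun x hx hx1 => hlap ⟨x, by rwa [mem_sphere_zero_iff_norm]⟩ (coe_mem_cone_iff.1 hx)) hχ
    (fun x hx hxO => h.eventually_testFn_eq_zero F K hη1 hx hxO)
  set b : Sph n → ℝ := fun x => inner ℝ (gradient (testFn F Ω K η) x) (gradient (homExt f) x)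
    with hb
  have hbz : ∀ x : Sph n, x ∉ Ω → b x = 0 := by
    intro x hx
    have h1 := (h.eventually_testFn_eq_zero F K hη1 (ne_zero_of_mem_unit_sphere x)
      (fun hh => hx (coe_mem_cone_iff.1 hh))).fderiv_eq (𝕜 := ℝ)
    simp only [hb, gradient, h1]
    simp
  have hcS := hbc.comp F.continuous_sph
  rw [F.integral_toSphere hn hbc] at hb0
  have hRc := h.continuous_rad_sphere F
  have hinner : ∀ u : Metric.sphere (0 : EuclideanSpace ℝ (Fin n)) 1,
      ∫ t in Ioo 0 Real.pi, Real.sin t ^ (n - 1) * b (F.sph (u, t)) =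
      ∫ s in Icc (0:ℝ) 1, F.rad Ω u * (Real.sin (s * F.rad Ω u) ^ (n - 1) *
        b (F.sph (u, s * F.rad Ω u))) := by
    intro u
    have hu := norm_eq_of_mem_sphere u
    have hu0 := ne_zero_of_mem_unit_sphere u
    have hR := h.rad_pos F hu0
    have hR' := h.rad_le F hu0
    have hpi := Real.pi_pos
    have hgc : Continuous fun t => Real.sin t ^ (n - 1) * b (F.sph (u, t)) :=
      (Real.continuous_sin.pow _).mul (hcS.comp (Continuous.prodMk_right u))
    rw [← integral_Ioc_eq_integral_Ioo, ← intervalIntegral.integral_of_le hpi.le,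
      ← intervalIntegral.integral_add_adjacent_intervals
        (hgc.intervalIntegrable 0 (F.rad Ω u)) (hgc.intervalIntegrable (F.rad Ω u) Real.pi)]
    have hz : ∫ t in (F.rad Ω u)..Real.pi, Real.sin t ^ (n - 1) * b (F.sph (u, t)) = 0 := by
      refine intervalIntegral.integral_zero_ae (ae_of_all _ fun t ht => ?_)
      rw [uIoc_of_le (by linarith)] at ht
      rw [hbz, mul_zero]
      rw [← coe_mem_cone_iff]
      change F.pt t u ∉ cone Ω
      -- At t = π the point is −p, which is excluded by the hemisphere condition rather than by the
      -- radial function.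
      rcases ht.2.lt_or_eq with h1 | h1
      · rw [h.pt_mem_cone_iff F hu0 (hR.le.trans ht.1.le) h1, not_lt]
        exact ht.1.le
      · intro hh
        have := inner_pos_of_mem_cone h.subset_ball hh
        rw [PolarFrame.pt, inner_expPt_left p (F.normalize_mem_unitTangent hu0), h1,
          Real.cos_pi] at this
        linarith
    rw [hz, add_zero, integral_Icc_eq_integral_Ioc, ← intervalIntegral.integral_of_le zero_le_one,
      intervalIntegral.integral_const_mul, intervalIntegral.integral_comp_mul_right
        (fun t => Real.sin t ^ (n - 1) * b (F.sph (u, t))) hR.ne', zero_mul, one_mul, smul_eq_mul,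
      ← mul_assoc, mul_inv_cancel₀ hR.ne', one_mul]
  simp only [hinner] at hb0
  have hRs := hRc.comp
    (continuous_snd (X := ℝ) (Y := Metric.sphere (0 : EuclideanSpace ℝ (Fin n)) 1))
  have hmc : Continuous fun z : ℝ × Metric.sphere (0 : EuclideanSpace ℝ (Fin n)) 1 =>
    z.1 * F.rad Ω z.2 := continuous_fst.mul hRs
  have hQc : Continuous fun z : ℝ × Metric.sphere (0 : EuclideanSpace ℝ (Fin n)) 1 =>
      F.rad Ω z.2 * (Real.sin (z.1 * F.rad Ω z.2) ^ (n - 1) *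
        b (F.sph (z.2, z.1 * F.rad Ω z.2))) :=
    hRs.mul (((Real.continuous_sin.comp hmc).pow _).mul (hcS.comp (continuous_snd.prodMk hmc)))
  have hQi := integrable_prod_of_continuousOn (a := 0) (b := 1)
    (ν := (volume : Measure (EuclideanSpace ℝ (Fin n))).toSphere) hQc.continuousOn
  have hswap := integral_prod_symm _ hQi
  rw [integral_prod _ hQi] at hswap
  rw [hb0] at hswap
  refine Eq.trans ?_ hswap
  -- The end points are removed because the formula for the gradient of the test function holds only
  -- for 0 < s < 1.
  rw [integral_Icc_eq_integral_Ioo, integral_Icc_eq_integral_Ioo]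
  refine setIntegral_congr_fun measurableSet_Ioo fun s hs => ?_
  have hI1 := integrable_toSphere (continuous_slice_of_continuousOn
    (h.continuousOn_dirichlet F hf hK) ⟨hs.1.le, hs.2.le⟩)
  have hI2 := integrable_toSphere (continuous_slice_of_continuousOn
    (h.continuousOn_flux F hf hK hs.1) ⟨le_rfl, hs.2.le⟩)
  simp only [PolarFrame.dirichletSlice, PolarFrame.fluxSlice]
  rw [← integral_const_mul, ← integral_const_mul,
    ← integral_add (hI1.const_mul (η s)) (hI2.const_mul (η' s))]
  refine integral_congr_ae (ae_of_all _ fun u => ?_)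
  have hu := norm_eq_of_mem_sphere u
  have hR := h.rad_pos F (ne_zero_of_mem_unit_sphere u)
  have key := h.inner_gradient_testFn F hf hK hη hη' hη0 hη1 hu hs
  have hbv : b (F.sph (u, s * F.rad Ω u)) = inner ℝ (gradient (testFn F Ω K η) (F.gpt Ω s u))
    (gradient (homExt f) (F.gpt Ω s u)) := rfl
  simp only [hbv, key]
  field_simp

/-- The first Green identity in polar coordinates. -/
theorem integral_dirichletSlice_eq (h : IsStarDomain Ω p α) (F : PolarFrame p) (hn : 1 ≤ n)
    {f K : Amb n → ℝ} (hf : ∀ x ∈ closure Ω, ContDiffAt ℝ ∞ f (x : Amb n))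
    (hK : ∀ x ∈ closure Ω, ContDiffAt ℝ ∞ K (x : Amb n)) (hlap : ∀ x ∈ Ω, sphLaplacian f x = 0) :
    ∫ s in Icc (0:ℝ) 1, F.dirichletSlice Ω K f s = F.fluxSlice Ω K f 1 :=
  integral_eq_of_forall_cutoff
    (continuousOn_integral_of_compact (h.continuousOn_flux F hf hK (by norm_num)))
    (continuousOn_integral_of_compact (h.continuousOn_dirichlet F hf hK))
    fun _ _ hη hη' hη0 hη1 => h.cutoff_flux F hn hf hK hlap hη hη' hη0 hη1

end IsStarDomain

end Steklov

end

noncomputable section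

namespace Steklov

open MeasureTheory Set Filter Topology

/-! ### Comparison of Dirichlet integrands -/

/-- The factor lost when the angular derivative is taken along the graph. -/
def slopeFactor (a : ℝ) : ℝ := ((2 + a) - Real.sqrt (a ^ 2 + 4 * a)) / 2

theorem slopeFactor_pos {a : ℝ} (ha : 0 ≤ a) : 0 < slopeFactor a := by
  have h : Real.sqrt (a ^ 2 + 4 * a) < 2 + a := by
    rw [Real.sqrt_lt' (by linarith)]; nlinarith
  unfold slopeFactor
  linarith

/-- The factor is the smaller root of q² − (2 + a) q + 1 = 0. -/
theorem slopeFactor_sq {a : ℝ} (ha : 0 ≤ a) : (1 - slopeFactor a) ^ 2 = slopeFactor a * a := by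
  have h := Real.sq_sqrt (show 0 ≤ a ^ 2 + 4 * a by positivity)
  unfold slopeFactor
  nlinarith

theorem slopeFactor_le_one {a : ℝ} (ha : 0 ≤ a) : slopeFactor a ≤ 1 := by
  have h : a ≤ Real.sqrt (a ^ 2 + 4 * a) := Real.le_sqrt_of_sq_le (by linarith)
  unfold slopeFactor
  linarith

/-- The form y² + (√a y + z)² has trace 2 + a and determinant 1, so its eigenvalues are q and 1/q
with q = `slopeFactor a`, and it is at most (y² + z²) / q. The proof exhibits the difference as a
multiple of a square. -/
theorem slopeFactor_mul_le {a : ℝ} (ha : 0 ≤ a) (y z : ℝ) :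
    slopeFactor a * (y ^ 2 + (Real.sqrt a * y + z) ^ 2) ≤ y ^ 2 + z ^ 2 := by
  have hq := slopeFactor_pos ha
  have hq1 := slopeFactor_le_one ha
  have hsq := slopeFactor_sq ha
  set q := slopeFactor a
  have hqs := Real.sq_sqrt hq.le
  have has := Real.sq_sqrt ha
  have h1 : 1 - q = Real.sqrt q * Real.sqrt a := by
    have : (1 - q) ^ 2 = (Real.sqrt q * Real.sqrt a) ^ 2 := by rw [mul_pow, hqs, has, hsq]
    rwa [sq_eq_sq₀ (by linarith) (by positivity)] at this
  have h2 : y ^ 2 + z ^ 2 - q * (y ^ 2 + (Real.sqrt a * y + z) ^ 2)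
      = (1 - q) * (Real.sqrt q * y - z) ^ 2 := by
    have e1 : (1 - q) * Real.sqrt q = q * Real.sqrt a := by
      rw [h1]; linear_combination Real.sqrt a * hqs
    have e2 : (1 - q) * q = 1 - q - q * a := by linear_combination -hsq
    linear_combination (-q * y ^ 2) * has + 2 * y * z * e1 - y ^ 2 * e2 - (1 - q) * y ^ 2 * hqs
  have h3 : 0 ≤ (1 - q) * (Real.sqrt q * y - z) ^ 2 :=
    mul_nonneg (by linarith) (sq_nonneg _)
  linarith

/-- The sine is concave on [0, π] and vanishes at 0, so sin x / x decreases. -/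
theorem mul_sin_le_mul_sin {r t : ℝ} (h0 : 0 ≤ r) (hrt : r ≤ t) (ht0 : 0 < t) (ht : t ≤ Real.pi) :
    r * Real.sin t ≤ t * Real.sin r := by
  have hc := strictConcaveOn_sin_Icc.concaveOn.2 (show t ∈ Icc 0 Real.pi from ⟨ht0.le, ht⟩)
    (show (0:ℝ) ∈ Icc 0 Real.pi from ⟨le_rfl, Real.pi_pos.le⟩)
    (show 0 ≤ r / t by positivity) (show 0 ≤ 1 - r / t by
      rw [sub_nonneg, div_le_one ht0]; exact hrt) (by ring)
  simp only [smul_eq_mul, Real.sin_zero, mul_zero, add_zero, div_mul_cancel₀ _ ht0.ne'] at hc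
  rw [div_mul_eq_mul_div, div_le_iff₀ ht0] at hc
  linarith

/-- Here x and τ are the radial and tangential parts of ∇f, and g = ∇R. Transplantation multiplies
the radial derivative by R / R_m. The angular derivative becomes x s g + sin(sR) τ, which after
division by sin(sR_m) is at most (R / R_m)(√a |x| + |τ|), because sin x / x decreases. The binary
quadratic form inequality then costs the factor `slopeFactor a`. -/
theorem integrand_comparison {E : Type*} [NormedAddCommGroup E] [InnerProductSpace ℝ E] (m : ℕ)
    {a Rm R RM s x : ℝ} {g τ : E} (hRm : 0 < Rm) (hR : Rm ≤ R) (hRM : R ≤ RM)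
    (hpi : RM ≤ Real.pi / 2) (hs0 : 0 < s) (hs1 : s ≤ 1)
    (ha : ‖g‖ ^ 2 / Real.sin R ^ 2 ≤ a) :
    slopeFactor a * (Rm / RM) * (((R * x) ^ 2 / Rm ^ 2 +
      ‖(x * s) • g + Real.sin (s * R) • τ‖ ^ 2 / Real.sin (s * Rm) ^ 2) *
        (Real.sin (s * Rm) ^ m * Rm)) ≤
      (x ^ 2 + ‖τ‖ ^ 2) * (Real.sin (s * Rm) ^ m * (R ^ 2 / RM)) := by
  have hpi0 := Real.pi_pos
  have hR0 : 0 < R := by linarith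
  have hRM0 : 0 < RM := by linarith
  have ha0 : 0 ≤ a := le_trans (by positivity) ha
  have hsRm : 0 < s * Rm := by positivity
  have hsR : s * R ≤ R := by nlinarith
  have hsRR : s * Rm ≤ s * R := by nlinarith
  have hsin1 : 0 < Real.sin (s * Rm) := Real.sin_pos_of_pos_of_lt_pi hsRm (by linarith)
  have hsinR : 0 < Real.sin R := Real.sin_pos_of_pos_of_lt_pi hR0 (by linarith)
  have hsint : 0 ≤ Real.sin (s * R) :=
    Real.sin_nonneg_of_nonneg_of_le_pi (by positivity) (by linarith)
  have hg : ‖g‖ ≤ Real.sqrt a * Real.sin R := by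
    have h1 : ‖g‖ ^ 2 ≤ (Real.sqrt a * Real.sin R) ^ 2 := by
      rw [mul_pow, Real.sq_sqrt ha0]
      rwa [div_le_iff₀ (by positivity)] at ha
    exact (sq_le_sq₀ (norm_nonneg _) (by positivity)).1 h1
  -- the two comparison ratios
  have c1 : Rm * s * ‖g‖ ≤ Real.sqrt a * R * Real.sin (s * Rm) := by
    have h1 := mul_sin_le_mul_sin hsRm.le (hsRR.trans hsR) hR0 (by linarith)
    calc Rm * s * ‖g‖ ≤ Rm * s * (Real.sqrt a * Real.sin R) := by gcongr
      _ = Real.sqrt a * (s * Rm * Real.sin R) := by ring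
      _ ≤ Real.sqrt a * (R * Real.sin (s * Rm)) := by gcongr
      _ = _ := by ring
  have c2 : Rm * Real.sin (s * R) ≤ R * Real.sin (s * Rm) := by
    have h1 := mul_sin_le_mul_sin hsRm.le hsRR (by positivity) (by linarith)
    have h2 : s * (Rm * Real.sin (s * R)) ≤ s * (R * Real.sin (s * Rm)) := by linarith
    exact le_of_mul_le_mul_left h2 hs0
  have hnorm : Rm * ‖(x * s) • g + Real.sin (s * R) • τ‖ ≤
      R * Real.sin (s * Rm) * (Real.sqrt a * |x| + ‖τ‖) := by
    calc Rm * ‖(x * s) • g + Real.sin (s * R) • τ‖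
        ≤ Rm * (|x| * s * ‖g‖ + Real.sin (s * R) * ‖τ‖) := by
          refine mul_le_mul_of_nonneg_left ((norm_add_le _ _).trans ?_) hRm.le
          rw [norm_smul, norm_smul, Real.norm_eq_abs, Real.norm_eq_abs, abs_mul, abs_of_pos hs0,
            abs_of_nonneg hsint]
      _ = |x| * (Rm * s * ‖g‖) + ‖τ‖ * (Rm * Real.sin (s * R)) := by ring
      _ ≤ |x| * (Real.sqrt a * R * Real.sin (s * Rm)) + ‖τ‖ * (R * Real.sin (s * Rm)) := by
          gcongr
      _ = _ := by ring
  have hsq : (Rm * ‖(x * s) • g + Real.sin (s * R) • τ‖) ^ 2 / Real.sin (s * Rm) ^ 2 ≤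
      R ^ 2 * (Real.sqrt a * |x| + ‖τ‖) ^ 2 := by
    rw [div_le_iff₀ (by positivity)]
    calc _ ≤ (R * Real.sin (s * Rm) * (Real.sqrt a * |x| + ‖τ‖)) ^ 2 := by gcongr
      _ = _ := by ring
  have hquad := slopeFactor_mul_le ha0 |x| ‖τ‖
  have hq := slopeFactor_pos ha0
  have hA : 0 ≤ Real.sin (s * Rm) ^ m / RM := by positivity
  calc slopeFactor a * (Rm / RM) * (((R * x) ^ 2 / Rm ^ 2 +
      ‖(x * s) • g + Real.sin (s * R) • τ‖ ^ 2 / Real.sin (s * Rm) ^ 2) *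
        (Real.sin (s * Rm) ^ m * Rm))
      = Real.sin (s * Rm) ^ m / RM * (slopeFactor a * (R ^ 2 * |x| ^ 2 +
        (Rm * ‖(x * s) • g + Real.sin (s * R) • τ‖) ^ 2 / Real.sin (s * Rm) ^ 2)) := by
        rw [sq_abs]; field_simp
    _ ≤ Real.sin (s * Rm) ^ m / RM * (slopeFactor a * (R ^ 2 * |x| ^ 2 +
        R ^ 2 * (Real.sqrt a * |x| + ‖τ‖) ^ 2)) := by gcongr
    _ = Real.sin (s * Rm) ^ m / RM * (R ^ 2 * (slopeFactor a * (|x| ^ 2 +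
        (Real.sqrt a * |x| + ‖τ‖) ^ 2))) := by ring
    _ ≤ Real.sin (s * Rm) ^ m / RM * (R ^ 2 * (|x| ^ 2 + ‖τ‖ ^ 2)) := by gcongr
    _ = _ := by rw [sq_abs]; ring

/-! ### Extremal radii -/

namespace IsStarDomain

variable {n : ℕ} {Ω : Set (Sph n)} {p : Sph n} {α : ℝ}

theorem image_radius_eq (F : PolarFrame p) : radius Ω p '' unitTangent p =
    range fun u : Metric.sphere (0 : EuclideanSpace ℝ (Fin n)) 1 => F.rad Ω u := by
  ext r
  rw [F.unitTangent_eq]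
  constructor
  · rintro ⟨_, ⟨u, hu, rfl⟩, rfl⟩
    exact ⟨⟨u, hu⟩, F.rad_of_norm_eq_one Ω (by simpa using hu)⟩
  · rintro ⟨u, rfl⟩
    exact ⟨_, ⟨u, u.2, rfl⟩, (F.rad_of_norm_eq_one Ω (norm_eq_of_mem_sphere u)).symm⟩

theorem nonempty_sphere (hn : 1 ≤ n) :
    Nonempty (Metric.sphere (0 : EuclideanSpace ℝ (Fin n)) 1) := by
  have : Nontrivial (EuclideanSpace ℝ (Fin n)) :=
    Module.nontrivial_of_finrank_pos (R := ℝ) (by rw [finrank_euclideanSpace_fin]; omega)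
  exact (NormedSpace.sphere_nonempty.2 zero_le_one).to_subtype

theorem extremal_radii (h : IsStarDomain Ω p α) (F : PolarFrame p) (hn : 1 ≤ n) :
    0 < minRadius Ω p ∧ maxRadius Ω p ≤ Real.pi / 2 ∧
    (∀ u : Metric.sphere (0 : EuclideanSpace ℝ (Fin n)) 1,
      minRadius Ω p ≤ F.rad Ω u ∧ F.rad Ω u ≤ maxRadius Ω p) := by
  have := nonempty_sphere hn
  have hc := isCompact_range (h.continuous_rad_sphere F)
  have hne := range_nonempty
    (fun u : Metric.sphere (0 : EuclideanSpace ℝ (Fin n)) 1 => F.rad Ω u)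
  rw [minRadius, maxRadius, image_radius_eq F]
  refine ⟨?_, ?_, fun u => ⟨csInf_le hc.bddBelow (mem_range_self u),
    le_csSup hc.bddAbove (mem_range_self u)⟩⟩
  · obtain ⟨u, hu⟩ := hc.sInf_mem hne
    rw [← hu]
    exact h.rad_pos F (ne_zero_of_mem_unit_sphere u)
  · refine csSup_le hne ?_
    rintro _ ⟨u, rfl⟩
    exact h.rad_le F (ne_zero_of_mem_unit_sphere u)

/-- The quotient is continuous on a compact sphere, so the real supremum in `slope` is a genuine
upper bound and not the default value 0 of an unbounded set. -/
theorem le_slope (h : IsStarDomain Ω p α) (F : PolarFrame p) (hn : 1 ≤ n) :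
    0 ≤ slope Ω p ∧ ∀ u : Metric.sphere (0 : EuclideanSpace ℝ (Fin n)) 1,
      ‖gradient (F.rad Ω) u‖ ^ 2 / Real.sin (F.rad Ω u) ^ 2 ≤ slope Ω p := by
  obtain ⟨u0⟩ := nonempty_sphere hn
  have himg : (fun u => ‖radiusGrad Ω p u‖ ^ 2 / Real.sin (radius Ω p u) ^ 2) '' unitTangent p =
      range fun u : Metric.sphere (0 : EuclideanSpace ℝ (Fin n)) 1 =>
        ‖gradient (F.rad Ω) u‖ ^ 2 / Real.sin (F.rad Ω u) ^ 2 := by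
    have hval : ∀ u : EuclideanSpace ℝ (Fin n), ‖u‖ = 1 →
        ‖radiusGrad Ω p (F.incl u)‖ ^ 2 / Real.sin (radius Ω p (F.incl u)) ^ 2 =
        ‖gradient (F.rad Ω) u‖ ^ 2 / Real.sin (F.rad Ω u) ^ 2 := fun u hu => by
      rw [h.radiusGrad_eq F hu, F.incl.norm_map, F.rad_of_norm_eq_one Ω hu]
    ext r
    rw [F.unitTangent_eq]
    constructor
    · rintro ⟨_, ⟨u, hu, rfl⟩, rfl⟩
      exact ⟨⟨u, hu⟩, (hval u (by simpa using hu)).symm⟩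
    · rintro ⟨u, rfl⟩
      exact ⟨_, ⟨u, u.2, rfl⟩, hval u (norm_eq_of_mem_sphere u)⟩
  have hcont : Continuous fun u : Metric.sphere (0 : EuclideanSpace ℝ (Fin n)) 1 =>
      ‖gradient (F.rad Ω) u‖ ^ 2 / Real.sin (F.rad Ω u) ^ 2 :=
    ((h.isHomogeneousC1_rad F).continuous_gradient_sphere.norm.pow 2).div
      ((Real.continuous_sin.comp (h.continuous_rad_sphere F)).pow 2)
      fun u => (pow_pos (h.sin_rad_pos F (ne_zero_of_mem_unit_sphere u)) 2).ne'
  have hb := (isCompact_range hcont).bddAbove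
  have hle : ∀ u : Metric.sphere (0 : EuclideanSpace ℝ (Fin n)) 1,
      ‖gradient (F.rad Ω) u‖ ^ 2 / Real.sin (F.rad Ω u) ^ 2 ≤ slope Ω p := fun u => by
    rw [slope, himg]
    exact le_csSup hb (mem_range_self u)
  exact ⟨le_trans (by positivity) (hle u0), hle⟩

end IsStarDomain

end Steklov

end

/-! ### Comparison of the energy with that of the inscribed ball -/

noncomputable section

namespace Steklov

open MeasureTheory Set Filter Topology

variable {m : ℕ} {Ω : Set (Sph (m + 1))} {p : Sph (m + 1)} {α : ℝ}

namespace PolarFrame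

variable (F : PolarFrame p)

/-- The energy density in polar coordinates. -/
def energyDensity (Ω : Set (Sph (m + 1))) (f : Amb (m + 1) → ℝ) (s : ℝ)
    (u : EuclideanSpace ℝ (Fin (m + 1))) : ℝ :=
  Real.sin (s * F.rad Ω u) ^ m * F.rad Ω u *
    inner ℝ (sphGrad f (F.gpt Ω s u)) (sphGrad f (F.gpt Ω s u))

/-- The energy density, on the inscribed ball, of the function transplanted along rays. -/
def modelDensity (Ω : Set (Sph (m + 1))) (f : Amb (m + 1) → ℝ) (s : ℝ)
    (u : EuclideanSpace ℝ (Fin (m + 1))) : ℝ :=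
  ((F.rad Ω u * F.fr Ω f s u) ^ 2 / minRadius Ω p ^ 2 +
    ‖gradient (fun v => f (F.gpt Ω s v)) u‖ ^ 2 / Real.sin (s * minRadius Ω p) ^ 2) *
      (Real.sin (s * minRadius Ω p) ^ m * minRadius Ω p)

/-- The defect in the comparison of the two energy densities. -/
def defect (Ω : Set (Sph (m + 1))) (f : Amb (m + 1) → ℝ) (s : ℝ)
    (u : EuclideanSpace ℝ (Fin (m + 1))) : ℝ :=
  F.energyDensity Ω f s u -
    slopeFactor (slope Ω p) * (minRadius Ω p / maxRadius Ω p) * F.modelDensity Ω f s u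

end PolarFrame

namespace IsStarDomain

/-- The comparison only uses the weight sin(sR_m)^m R² / R_M out of the actual polar weight
sin(sR)^m R. The difference of the two, times |∇f|², stays as a lower bound of the defect. -/
theorem le_defect (h : IsStarDomain Ω p α) (F : PolarFrame p) {f : Amb (m + 1) → ℝ}
    (hf : ∀ x ∈ closure Ω, ContDiffAt ℝ ∞ f (x : Amb (m + 1)))
    (u : Metric.sphere (0 : EuclideanSpace ℝ (Fin (m + 1))) 1) {s : ℝ} (hs : s ∈ Ioc (0:ℝ) 1) :
    (F.fr Ω f s u ^ 2 + ‖F.ftan Ω f s u‖ ^ 2) * (F.rad Ω u * (Real.sin (s * F.rad Ω u) ^ m -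
      Real.sin (s * minRadius Ω p) ^ m * (F.rad Ω u / maxRadius Ω p))) ≤ F.defect Ω f s u := by
  have hu := norm_eq_of_mem_sphere u
  obtain ⟨hRm, hRM, hR⟩ := h.extremal_radii F (by omega)
  have hsl := (h.le_slope F (by omega)).2 u
  have hE : F.energyDensity Ω f s u = Real.sin (s * F.rad Ω u) ^ m * F.rad Ω u *
      (F.fr Ω f s u ^ 2 + ‖F.ftan Ω f s u‖ ^ 2) := by
    rw [PolarFrame.energyDensity, real_inner_self_eq_norm_sq,
      F.norm_sq_polar hu (h.inner_sphGrad_gpt F hf hu hs.1.le hs.2)]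
    rfl
  have hg := (h.hasGradientAt_gpt F hu
    ((h.contDiffAt_gpt F hf hu hs.1.le hs.2).differentiableAt (by simp))).gradient
  have hcmp := integrand_comparison m (x := F.fr Ω f s u) (τ := F.ftan Ω f s u) hRm (hR u).1
    (hR u).2 hRM hs.1 hs.2 hsl
  rw [PolarFrame.defect, hE, PolarFrame.modelDensity, hg]
  calc _ = Real.sin (s * F.rad Ω u) ^ m * F.rad Ω u *
        (F.fr Ω f s u ^ 2 + ‖F.ftan Ω f s u‖ ^ 2) - (F.fr Ω f s u ^ 2 + ‖F.ftan Ω f s u‖ ^ 2) *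
        (Real.sin (s * minRadius Ω p) ^ m * (F.rad Ω u ^ 2 / maxRadius Ω p)) := by ring
    _ ≤ _ := sub_le_sub_left hcmp _

/-- The coefficient in the lower bound of the defect. -/
theorem defect_coeff_nonneg (h : IsStarDomain Ω p α) (F : PolarFrame p)
    (u : Metric.sphere (0 : EuclideanSpace ℝ (Fin (m + 1))) 1) {s : ℝ} (hs : s ∈ Ioc (0:ℝ) 1) :
    0 ≤ Real.sin (s * F.rad Ω u) ^ m -
      Real.sin (s * minRadius Ω p) ^ m * (F.rad Ω u / maxRadius Ω p) := by
  obtain ⟨hRm, hRM, hR⟩ := h.extremal_radii F (by omega)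
  obtain ⟨h1, h2⟩ := hR u
  have hpi := Real.pi_pos
  have hs0 := hs.1
  have hs1 := hs.2
  have ha : s * minRadius Ω p ≤ s * F.rad Ω u := by gcongr
  have hb : s * F.rad Ω u ≤ Real.pi / 2 := by nlinarith
  have hsin : Real.sin (s * minRadius Ω p) ≤ Real.sin (s * F.rad Ω u) :=
    Real.sin_le_sin_of_le_of_le_pi_div_two (by nlinarith) hb ha
  have hsin0 : 0 ≤ Real.sin (s * minRadius Ω p) :=
    Real.sin_nonneg_of_nonneg_of_le_pi (by positivity) (by linarith)
  have hq : F.rad Ω u / maxRadius Ω p ≤ 1 := by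
    rw [div_le_one (by linarith)]; exact h2
  have hp := pow_le_pow_left₀ hsin0 hsin m
  have := mul_le_mul_of_nonneg_left hq (pow_nonneg hsin0 m)
  linarith

theorem defect_nonneg (h : IsStarDomain Ω p α) (F : PolarFrame p) {f : Amb (m + 1) → ℝ}
    (hf : ∀ x ∈ closure Ω, ContDiffAt ℝ ∞ f (x : Amb (m + 1)))
    (u : Metric.sphere (0 : EuclideanSpace ℝ (Fin (m + 1))) 1) {s : ℝ} (hs : s ∈ Ioc (0:ℝ) 1) :
    0 ≤ F.defect Ω f s u :=
  le_trans (mul_nonneg (by positivity) (mul_nonneg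
    (h.rad_pos F (ne_zero_of_mem_unit_sphere u)).le (h.defect_coeff_nonneg F u hs)))
    (h.le_defect F hf u hs)

theorem continuousOn_gradient_gpt (h : IsStarDomain Ω p α) (F : PolarFrame p)
    {f : Amb (m + 1) → ℝ} (hf : ∀ x ∈ closure Ω, ContDiffAt ℝ ∞ f (x : Amb (m + 1))) :
    ContinuousOn (fun z : ℝ × Metric.sphere (0 : EuclideanSpace ℝ (Fin (m + 1))) 1 =>
      gradient (fun v => f (F.gpt Ω z.1 v)) (z.2 : EuclideanSpace ℝ (Fin (m + 1))))
      (Icc 0 1 ×ˢ univ) := by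
  have hRs := (h.continuous_rad_sphere F).comp
    (continuous_snd (X := ℝ) (Y := Metric.sphere (0 : EuclideanSpace ℝ (Fin (m + 1))) 1))
  have hG := (h.isHomogeneousC1_rad F).continuous_gradient_sphere.comp
    (continuous_snd (X := ℝ) (Y := Metric.sphere (0 : EuclideanSpace ℝ (Fin (m + 1))) 1))
  have hs := Real.continuous_sin.comp (continuous_fst.mul hRs)
  have hc := (((h.continuousOn_fr F hf).mul continuous_fst.continuousOn).smul
    hG.continuousOn).add (hs.continuousOn.smul (h.continuousOn_ftan F hf))
  refine hc.congr ?_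
  rintro ⟨s, u⟩ ⟨hs', -⟩
  have hu := norm_eq_of_mem_sphere u
  exact (h.hasGradientAt_gpt F hu
    ((h.contDiffAt_gpt F hf hu hs'.1 hs'.2).differentiableAt (by simp))).gradient

theorem continuousOn_modelDensity (h : IsStarDomain Ω p α) (F : PolarFrame p)
    {f : Amb (m + 1) → ℝ} (hf : ∀ x ∈ closure Ω, ContDiffAt ℝ ∞ f (x : Amb (m + 1))) {ε : ℝ}
    (hε : 0 < ε) :
    ContinuousOn (fun z : ℝ × Metric.sphere (0 : EuclideanSpace ℝ (Fin (m + 1))) 1 =>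
      F.modelDensity Ω f z.1 z.2) (Icc ε 1 ×ˢ univ) := by
  obtain ⟨hRm, hRM, hR⟩ := h.extremal_radii F (by omega)
  have hsub : Icc ε 1 ×ˢ univ ⊆
      (Icc 0 1 ×ˢ univ : Set (ℝ × Metric.sphere (0 : EuclideanSpace ℝ (Fin (m + 1))) 1)) :=
    prod_mono (Icc_subset_Icc_left hε.le) Subset.rfl
  have hRs := (h.continuous_rad_sphere F).comp
    (continuous_snd (X := ℝ) (Y := Metric.sphere (0 : EuclideanSpace ℝ (Fin (m + 1))) 1))
  have hs : Continuous fun z : ℝ × Metric.sphere (0 : EuclideanSpace ℝ (Fin (m + 1))) 1 =>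
    Real.sin (z.1 * minRadius Ω p) := by fun_prop
  refine ContinuousOn.mul (ContinuousOn.add ?_ (ContinuousOn.div
    (((h.continuousOn_gradient_gpt F hf).mono hsub).norm.pow 2) (hs.pow 2).continuousOn ?_))
    ((hs.pow m).mul continuous_const).continuousOn
  · exact ((hRs.continuousOn.mul ((h.continuousOn_fr F hf).mono hsub)).pow 2).div_const _
  · rintro ⟨s, u⟩ ⟨hs', -⟩
    have h1 : 0 < s := hε.trans_le hs'.1
    have h2 := hR u
    have hpi := Real.pi_pos
    exact pow_ne_zero 2 (Real.sin_pos_of_pos_of_lt_pi (mul_pos h1 hRm)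
      (by nlinarith [hs'.2])).ne'

theorem continuousOn_energyDensity (h : IsStarDomain Ω p α) (F : PolarFrame p)
    {f : Amb (m + 1) → ℝ} (hf : ∀ x ∈ closure Ω, ContDiffAt ℝ ∞ f (x : Amb (m + 1))) :
    ContinuousOn (fun z : ℝ × Metric.sphere (0 : EuclideanSpace ℝ (Fin (m + 1))) 1 =>
      F.energyDensity Ω f z.1 z.2) (Icc 0 1 ×ˢ univ) :=
  h.continuousOn_dirichlet F hf hf

theorem continuousOn_defect (h : IsStarDomain Ω p α) (F : PolarFrame p)
    {f : Amb (m + 1) → ℝ} (hf : ∀ x ∈ closure Ω, ContDiffAt ℝ ∞ f (x : Amb (m + 1))) {ε : ℝ}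
    (hε : 0 < ε) :
    ContinuousOn (fun z : ℝ × Metric.sphere (0 : EuclideanSpace ℝ (Fin (m + 1))) 1 =>
      F.defect Ω f z.1 z.2) (Icc ε 1 ×ˢ univ) :=
  ((h.continuousOn_energyDensity F hf).mono
    (prod_mono (Icc_subset_Icc_left hε.le) Subset.rfl)).sub
    (continuousOn_const.mul (h.continuousOn_modelDensity F hf hε))

theorem isHomogeneousC1_gpt (h : IsStarDomain Ω p α) (F : PolarFrame p)
    {f : Amb (m + 1) → ℝ} (hf : ∀ x ∈ closure Ω, ContDiffAt ℝ ∞ f (x : Amb (m + 1))) {s : ℝ}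
    (hs : s ∈ Icc (0:ℝ) 1) : IsHomogeneousC1 fun v => f (F.gpt Ω s v) := by
  have hsm : ∀ (r : ℝ) (v : EuclideanSpace ℝ (Fin (m + 1))), 0 < r →
      F.gpt Ω s (r • v) = F.gpt Ω s v := by
    intro r v hr
    rw [PolarFrame.gpt, PolarFrame.gpt, F.rad_smul Ω hr, PolarFrame.pt, PolarFrame.pt, norm_smul,
      Real.norm_of_nonneg hr.le, map_smul, smul_smul, mul_inv_rev, mul_assoc,
      inv_mul_cancel₀ hr.ne', mul_one]
  refine ⟨fun v hv => ?_, fun r v hr => by rw [hsm r v hr]⟩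
  have hn : 0 < ‖v‖ := norm_pos_iff.2 hv
  have hfv : ContDiffAt ℝ 1 f (F.pt (s * F.rad Ω v) v) := by
    have := h.contDiffAt_gpt F hf (u := ‖v‖⁻¹ • v)
      (by rw [norm_smul, norm_inv, norm_norm, inv_mul_cancel₀ hn.ne']) hs.1 hs.2
    rw [hsm _ _ (inv_pos.2 hn)] at this
    exact this.of_le (by norm_cast)
  have hpt := F.contDiffAt_pt hv (s * F.rad Ω v) (k := 1)
  have hpair : ContDiffAt ℝ 1 (fun w : EuclideanSpace ℝ (Fin (m + 1)) => (w, s * F.rad Ω w)) v :=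
    contDiffAt_id.prodMk (contDiffAt_const.mul ((h.isHomogeneousC1_rad F).contDiffAt v hv))
  exact ContDiffAt.comp v (f := fun w => F.gpt Ω s w) hfv
    (ContDiffAt.comp v (f := fun w : EuclideanSpace ℝ (Fin (m + 1)) => (w, s * F.rad Ω w)) hpt
      hpair)

/-- Comparison of the Dirichlet energy with the spectral gap of the inscribed ball. -/
theorem spectral_gap_le_energy (h : IsStarDomain Ω p α) (F : PolarFrame p)
    {f : Amb (m + 1) → ℝ} (hf : ∀ x ∈ closure Ω, ContDiffAt ℝ ∞ f (x : Amb (m + 1))) {ε : ℝ}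
    (hε : ε ∈ Ioo (0:ℝ) 1) :
    slopeFactor (slope Ω p) * (minRadius Ω p / maxRadius Ω p) *
      (ballEigenvalue m (minRadius Ω p) * Real.sin (minRadius Ω p) ^ m *
        ((volume : Measure (EuclideanSpace ℝ (Fin (m + 1)))).toSphere.real univ *
          (∫ u : Metric.sphere (0 : EuclideanSpace ℝ (Fin (m + 1))) 1, f (F.gpt Ω 1 u) ^ 2
            ∂(volume : Measure (EuclideanSpace ℝ (Fin (m + 1)))).toSphere) -
        (∫ u : Metric.sphere (0 : EuclideanSpace ℝ (Fin (m + 1))) 1, f (F.gpt Ω 1 u)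
            ∂(volume : Measure (EuclideanSpace ℝ (Fin (m + 1)))).toSphere) ^ 2)) +
      (volume : Measure (EuclideanSpace ℝ (Fin (m + 1)))).toSphere.real univ *
        (∫ s in Icc ε 1, (∫ u : Metric.sphere (0 : EuclideanSpace ℝ (Fin (m + 1))) 1,
          F.defect Ω f s u ∂(volume : Measure (EuclideanSpace ℝ (Fin (m + 1)))).toSphere)) ≤
    (volume : Measure (EuclideanSpace ℝ (Fin (m + 1)))).toSphere.real univ *
      ∫ s in Icc (0:ℝ) 1, F.dirichletSlice Ω f f s := by
  obtain ⟨hRm, hRM, hR⟩ := h.extremal_radii F (by omega)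
  obtain ⟨u0⟩ := nonempty_sphere (n := m + 1) (by omega)
  have hsl := (h.le_slope F (by omega)).1
  have hc0 : 0 ≤ slopeFactor (slope Ω p) * (minRadius Ω p / maxRadius Ω p) :=
    mul_nonneg (slopeFactor_pos hsl).le (div_nonneg hRm.le (by linarith [hR u0]))
  set c := slopeFactor (slope Ω p) * (minRadius Ω p / maxRadius Ω p) with hc
  set σ := (volume : Measure (EuclideanSpace ℝ (Fin (m + 1)))).toSphere with hσ
  have hS0 : 0 ≤ σ.real univ := measureReal_nonneg
  -- The transplanted function is h(s, v) = f(exp_p(s R_v v)), regarded as a function on the ball of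
  -- radius R_m. Its boundary values are those of f on ∂Ω.
  obtain ⟨C, hC⟩ := ball_spectral_gap (E := EuclideanSpace ℝ (Fin (m + 1))) (m := m)
    (by rw [finrank_euclideanSpace_fin]) hRm (by linarith [hR u0])
    (h := fun s v => f (F.gpt Ω s v)) (h' := fun s u => F.rad Ω u * F.fr Ω f s u)
    (fun s hs => h.isHomogeneousC1_gpt F hf ⟨hs.1.le, hs.2⟩)
    (fun s hs u => F.hasDerivAt_gpt Ω (norm_eq_of_mem_sphere u)
      ((h.contDiffAt_gpt F hf (norm_eq_of_mem_sphere u) hs.1 hs.2).differentiableAt (by simp)))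
    (h.continuousOn_gpt F hf)
    (((h.continuous_rad_sphere F).comp continuous_snd).continuousOn.mul (h.continuousOn_fr F hf))
    ((h.continuousOn_gradient_gpt F hf).mono (prod_mono Ioc_subset_Icc_self Subset.rfl))
    (fun u v => by simp [PolarFrame.gpt, PolarFrame.pt, expPt])
  have hDc : ContinuousOn (F.dirichletSlice Ω f f) (Icc 0 1) :=
    continuousOn_integral_of_compact (h.continuousOn_dirichlet F hf hf)
  have hD0 : ∀ s ∈ Icc (0:ℝ) 1, 0 ≤ F.dirichletSlice Ω f f s := by
    intro s hs
    refine integral_nonneg fun u => ?_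
    have hu := norm_eq_of_mem_sphere u
    have h1 := h.mul_rad_lt_pi F hu hs.1 hs.2
    have h2 := Real.sin_nonneg_of_nonneg_of_le_pi h1.1 h1.2.le
    have h3 := h.rad_pos F (ne_zero_of_mem_unit_sphere u)
    exact mul_nonneg (mul_nonneg (pow_nonneg h2 _) h3.le) real_inner_self_nonneg
  have hQc : ∀ ε > 0, ContinuousOn (fun s => ∫ u : Metric.sphere
      (0 : EuclideanSpace ℝ (Fin (m + 1))) 1, F.modelDensity Ω f s u ∂σ) (Icc ε 1) :=
    fun ε hε => continuousOn_integral_of_compact (h.continuousOn_modelDensity F hf hε)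
  have hWc : ∀ ε > 0, ContinuousOn (fun s => ∫ u : Metric.sphere
      (0 : EuclideanSpace ℝ (Fin (m + 1))) 1, F.defect Ω f s u ∂σ) (Icc ε 1) :=
    fun ε hε => continuousOn_integral_of_compact (h.continuousOn_defect F hf hε)
  have hW0 : ∀ s ∈ Ioc (0:ℝ) 1, 0 ≤ ∫ u : Metric.sphere
      (0 : EuclideanSpace ℝ (Fin (m + 1))) 1, F.defect Ω f s u ∂σ :=
    fun s hs => integral_nonneg fun u => h.defect_nonneg F hf u hs
  have hsplit : ∀ s ∈ Ioc (0:ℝ) 1, (∫ u : Metric.sphere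
      (0 : EuclideanSpace ℝ (Fin (m + 1))) 1, F.defect Ω f s u ∂σ) = F.dirichletSlice Ω f f s -
      c * ∫ u : Metric.sphere (0 : EuclideanSpace ℝ (Fin (m + 1))) 1, F.modelDensity Ω f s u ∂σ := by
    intro s hs
    have i1 := integrable_toSphere (continuous_slice_of_continuousOn
      (h.continuousOn_energyDensity F hf) ⟨hs.1.le, hs.2⟩)
    have i2 := integrable_toSphere (continuous_slice_of_continuousOn
      (h.continuousOn_modelDensity F hf hs.1) ⟨le_rfl, hs.2⟩)
    simp only [PolarFrame.defect]
    rw [integral_sub i1 (i2.const_mul _), integral_const_mul]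
    rfl
  set A := ballEigenvalue m (minRadius Ω p) * Real.sin (minRadius Ω p) ^ m *
        (σ.real univ * (∫ u : Metric.sphere (0 : EuclideanSpace ℝ (Fin (m + 1))) 1,
          f (F.gpt Ω 1 u) ^ 2 ∂σ) -
        (∫ u : Metric.sphere (0 : EuclideanSpace ℝ (Fin (m + 1))) 1, f (F.gpt Ω 1 u) ∂σ) ^ 2)
    with hA
  set Δ := ∫ s in Icc ε 1, (∫ u : Metric.sphere (0 : EuclideanSpace ℝ (Fin (m + 1))) 1,
          F.defect Ω f s u ∂σ) with hΔ
  -- The inner radius e tends to zero while the defect is kept only over the fixed interval [ε, 1].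
  -- Its nonnegativity allows this, and the error C e disappears in the limit.
  have hmain : ∀ e ∈ Ioo (0:ℝ) ε, c * (A - C * e) + σ.real univ * Δ ≤
      σ.real univ * ∫ s in Icc (0:ℝ) 1, F.dirichletSlice Ω f f s := by
    intro e he
    have he1 : e ∈ Ioo (0:ℝ) 1 := ⟨he.1, he.2.trans hε.2⟩
    have h1 := mul_le_mul_of_nonneg_left (hC e he1) hc0
    have hsub : Icc e 1 ⊆ Icc (0:ℝ) 1 := Icc_subset_Icc_left he.1.le
    have hDi : IntegrableOn (F.dirichletSlice Ω f f) (Icc 0 1) := hDc.integrableOn_Icc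
    have h2 : ∫ s in Icc e 1, F.dirichletSlice Ω f f s ≤
        ∫ s in Icc (0:ℝ) 1, F.dirichletSlice Ω f f s :=
      setIntegral_mono_set hDi (by
        filter_upwards [ae_restrict_mem measurableSet_Icc] with s hs
        exact hD0 s hs) (LE.le.eventuallyLE hsub)
    have hWi : IntegrableOn (fun s => ∫ u : Metric.sphere
      (0 : EuclideanSpace ℝ (Fin (m + 1))) 1, F.defect Ω f s u ∂σ) (Icc e 1) :=
      (hWc e he.1).integrableOn_Icc
    have h3 : Δ ≤ ∫ s in Icc e 1, (∫ u : Metric.sphere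
        (0 : EuclideanSpace ℝ (Fin (m + 1))) 1, F.defect Ω f s u ∂σ) :=
      setIntegral_mono_set hWi (by
        filter_upwards [ae_restrict_mem measurableSet_Icc] with s hs
        exact hW0 s ⟨he.1.trans_le hs.1, hs.2⟩)
        (LE.le.eventuallyLE (Icc_subset_Icc_left he.2.le))
    have h4 : ∫ s in Icc e 1, (∫ u : Metric.sphere
        (0 : EuclideanSpace ℝ (Fin (m + 1))) 1, F.defect Ω f s u ∂σ) =
        (∫ s in Icc e 1, F.dirichletSlice Ω f f s) - c * ∫ s in Icc e 1, (∫ u : Metric.sphere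
          (0 : EuclideanSpace ℝ (Fin (m + 1))) 1, F.modelDensity Ω f s u ∂σ) := by
      rw [← integral_const_mul, ← integral_sub (hDi.mono_set hsub)
        ((hQc e he.1).integrableOn_Icc.const_mul c)]
      exact setIntegral_congr_fun measurableSet_Icc fun s hs =>
        hsplit s ⟨he.1.trans_le hs.1, hs.2⟩
    have h5 : c * (A - C * e) ≤ c * (σ.real univ * ∫ s in Icc e 1, (∫ u : Metric.sphere
          (0 : EuclideanSpace ℝ (Fin (m + 1))) 1, F.modelDensity Ω f s u ∂σ)) := h1
    have h6 := mul_le_mul_of_nonneg_left h3 hS0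
    have h7 := mul_le_mul_of_nonneg_left h2 hS0
    rw [h4] at h6
    linarith
  have hlim : Tendsto (fun e : ℝ => c * (A - C * e) + σ.real univ * Δ) (𝓝[>] 0)
      (𝓝 (c * (A - C * 0) + σ.real univ * Δ)) :=
    (Continuous.tendsto (by fun_prop) _).mono_left nhdsWithin_le_nhds
  rw [mul_zero, sub_zero] at hlim
  exact le_of_tendsto hlim (by
    filter_upwards [Ioo_mem_nhdsGT hε.1] with e he
    exact hmain e he)

end IsStarDomain

end Steklov

end

noncomputable section

namespace Steklov

open MeasureTheory Set Filter Topology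

/-! ### Rayleigh quotients of eigenfunctions -/

/-- `f` is a Steklov eigenfunction on `Ω` with eigenvalue `μ`. -/
structure IsSteklovEigenfunction {n : ℕ} (Ω : Set (Sph n)) (f : Amb n → ℝ) (μ : ℝ) : Prop where
  contDiffAt : ∀ x ∈ closure Ω, ContDiffAt ℝ ∞ f (x : Amb n)
  exists_ne : ∃ x ∈ Ω, f x ≠ 0
  harmonic : ∀ x ∈ Ω, sphLaplacian f x = 0
  normal : ∀ q ∈ frontier Ω, ∃ ν, IsOutwardNormal Ω q ν ∧ inner ℝ (sphGrad f q) ν = μ * f q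

theorem IsSteklovEigenvalue.exists_eigenfunction {n : ℕ} {Ω : Set (Sph n)} {μ : ℝ}
    (h : IsSteklovEigenvalue Ω μ) : ∃ f, IsSteklovEigenfunction Ω f μ := by
  obtain ⟨f, U, hU, hcl, hf, hne, hlap, hnor⟩ := h
  exact ⟨f, fun x hx => hf.contDiffAt (hU.mem_nhds (hcl x hx)), hne, hlap, hnor⟩

theorem eq_zero_of_integral_toSphere_nonpos {E : Type*} [NormedAddCommGroup E]
    [InnerProductSpace ℝ E] [FiniteDimensional ℝ E] [MeasurableSpace E] [BorelSpace E]
    {g : Metric.sphere (0 : E) 1 → ℝ} (hg : Continuous g) (h0 : ∀ u, 0 ≤ g u)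
    (hi : ∫ u, g u ∂(volume : Measure E).toSphere ≤ 0) (u : Metric.sphere (0 : E) 1) :
    g u = 0 := by
  have h1 := (integral_eq_zero_iff_of_nonneg h0 (integrable_toSphere hg)).1
    (le_antisymm hi (integral_nonneg h0))
  exact congrFun ((hg.ae_eq_iff_eq _ continuous_zero).1 h1) u

theorem eqOn_zero_of_setIntegral_Icc_nonpos {a b : ℝ} (hab : a ≠ b) {g : ℝ → ℝ}
    (hg : ContinuousOn g (Icc a b)) (h0 : ∀ s ∈ Icc a b, 0 ≤ g s)
    (hi : ∫ s in Icc a b, g s ≤ 0) : ∀ s ∈ Icc a b, g s = 0 := by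
  have h1 : 0 ≤ᵐ[volume.restrict (Icc a b)] g := by
    filter_upwards [ae_restrict_mem measurableSet_Icc] with s hs
    exact h0 s hs
  have h2 := (setIntegral_eq_zero_iff_of_nonneg_ae h1 hg.integrableOn_Icc).1
    (le_antisymm hi (integral_nonneg_of_ae h1))
  exact fun s hs => Measure.eqOn_Icc_of_ae_eq volume hab h2 hg continuousOn_const hs

variable {m : ℕ} {Ω : Set (Sph (m + 1))} {p : Sph (m + 1)} {α : ℝ}

/-- The area density of the boundary over the unit tangent sphere. -/
def PolarFrame.areaDensity (F : PolarFrame p) (Ω : Set (Sph (m + 1)))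
    (u : EuclideanSpace ℝ (Fin (m + 1))) : ℝ :=
  Real.sin (F.rad Ω u) ^ m * F.secant Ω u

namespace IsStarDomain

theorem areaDensity_pos (h : IsStarDomain Ω p α) (F : PolarFrame p)
    (u : Metric.sphere (0 : EuclideanSpace ℝ (Fin (m + 1))) 1) : 0 < F.areaDensity Ω u :=
  mul_pos (pow_pos (h.sin_rad_pos F (ne_zero_of_mem_unit_sphere u)) m)
    (zero_lt_one.trans_le (F.one_le_secant Ω u))

theorem areaDensity_le (h : IsStarDomain Ω p α) (F : PolarFrame p)
    (u : Metric.sphere (0 : EuclideanSpace ℝ (Fin (m + 1))) 1) :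
    F.areaDensity Ω u ≤ (Real.cos α)⁻¹ * Real.sin (maxRadius Ω p) ^ m := by
  obtain ⟨hRm, hRM, hR⟩ := h.extremal_radii F (by omega)
  have h1 := h.sin_rad_pos F (ne_zero_of_mem_unit_sphere u)
  have h2 : Real.sin (F.rad Ω u) ≤ Real.sin (maxRadius Ω p) :=
    Real.sin_le_sin_of_le_of_le_pi_div_two (by linarith [Real.pi_pos, hR u]) hRM (hR u).2
  obtain ⟨h3, h4⟩ := h.cos_pos_and_secant_le F (norm_eq_of_mem_sphere u)
  have h5 := F.one_le_secant Ω u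
  rw [mul_comm (Real.cos α)⁻¹]
  exact mul_le_mul (pow_le_pow_left₀ h1.le h2 m) h4 (by linarith) (pow_nonneg (h1.le.trans h2) m)

theorem continuous_areaDensity (h : IsStarDomain Ω p α) (F : PolarFrame p) :
    Continuous fun u : Metric.sphere (0 : EuclideanSpace ℝ (Fin (m + 1))) 1 =>
      F.areaDensity Ω u := by
  have hR := Real.continuous_sin.comp (h.continuous_rad_sphere F)
  have hG := (h.isHomogeneousC1_rad F).continuous_gradient_sphere
  exact (hR.pow m).mul (Real.continuous_sqrt.comp (continuous_const.add
    ((hG.norm.pow 2).div (hR.pow 2) fun u =>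
      pow_ne_zero 2 (h.sin_rad_pos F (ne_zero_of_mem_unit_sphere u)).ne')))

theorem continuous_boundaryValue (h : IsStarDomain Ω p α) (F : PolarFrame p)
    {f : Amb (m + 1) → ℝ} (hf : ∀ x ∈ closure Ω, ContDiffAt ℝ ∞ f (x : Amb (m + 1))) :
    Continuous fun u : Metric.sphere (0 : EuclideanSpace ℝ (Fin (m + 1))) 1 =>
      f (F.gpt Ω 1 u) :=
  continuous_slice_of_continuousOn (h.continuousOn_gpt F hf) (s := 1) ⟨zero_le_one, le_rfl⟩

/-- Pair ∇f with sec θ · ν = ∂_r − ∇R / sin R and insert the Steklov condition. -/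
theorem flux_eq (h : IsStarDomain Ω p α) (F : PolarFrame p) {f : Amb (m + 1) → ℝ} {μ : ℝ}
    (hf : IsSteklovEigenfunction Ω f μ)
    (u : Metric.sphere (0 : EuclideanSpace ℝ (Fin (m + 1))) 1) :
    F.fr Ω f 1 u - inner ℝ (gradient (F.rad Ω) u) (F.ftan Ω f 1 u) / Real.sin (F.rad Ω u) =
      F.secant Ω u * (μ * f (F.gpt Ω 1 u)) := by
  have hu := norm_eq_of_mem_sphere u
  obtain ⟨q, hqf, hq⟩ := h.exists_localDefining F hu
  obtain ⟨ν, hν, hν'⟩ := hf.normal q hqf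
  have hg : F.gpt Ω 1 u = q := by rw [PolarFrame.gpt, one_mul, hq]
  have h1 := congrArg (inner ℝ (sphGrad f q)) (h.outwardNormal_eq F hu hq hν)
  rw [inner_smul_right, hν', inner_sub_right, ← F.inner_proj, inner_smul_right] at h1
  rw [PolarFrame.fr, PolarFrame.ftan, one_mul, hg, h1, PolarFrame.tang, inner_sub_right,
    inner_smul_right, real_inner_comm (u : EuclideanSpace ℝ (Fin (m + 1))) (gradient _ _),
    h.inner_gradient_rad F, real_inner_comm (gradient (F.rad Ω) u)]
  ring

theorem fluxSlice_eq (h : IsStarDomain Ω p α) (F : PolarFrame p) {f : Amb (m + 1) → ℝ} {μ : ℝ}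
    (hf : IsSteklovEigenfunction Ω f μ) (K : Amb (m + 1) → ℝ) :
    F.fluxSlice Ω K f 1 = μ * ∫ u : Metric.sphere (0 : EuclideanSpace ℝ (Fin (m + 1))) 1,
      F.areaDensity Ω u * (K (F.gpt Ω 1 u) * f (F.gpt Ω 1 u))
        ∂(volume : Measure (EuclideanSpace ℝ (Fin (m + 1)))).toSphere := by
  rw [PolarFrame.fluxSlice, ← integral_const_mul]
  refine integral_congr_ae (Eventually.of_forall fun u => ?_)
  have := h.flux_eq F hf u
  simp only [one_mul, PolarFrame.areaDensity, add_tsub_cancel_right]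
  rw [this]
  ring

/-- Green's identity with the constant test function 1: the total flux vanishes, and μ ≠ 0. -/
theorem integral_areaDensity_mul (h : IsStarDomain Ω p α) (F : PolarFrame p)
    {f : Amb (m + 1) → ℝ} {μ : ℝ} (hμ : μ ≠ 0) (hf : IsSteklovEigenfunction Ω f μ) :
    ∫ u : Metric.sphere (0 : EuclideanSpace ℝ (Fin (m + 1))) 1,
      F.areaDensity Ω u * f (F.gpt Ω 1 u)
        ∂(volume : Measure (EuclideanSpace ℝ (Fin (m + 1)))).toSphere = 0 := by
  have h1 := h.integral_dirichletSlice_eq F (by omega) hf.contDiffAt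
    (K := fun _ => (1:ℝ)) (fun _ _ => contDiffAt_const) hf.harmonic
  have h2 : ∀ x, sphGrad (fun _ : Amb (m + 1) => (1:ℝ)) x = 0 := fun x =>
    gradient_fun_const x (1:ℝ)
  rw [h.fluxSlice_eq F hf] at h1
  simp only [PolarFrame.dirichletSlice, h2, inner_zero_left, mul_zero, integral_zero,
    one_mul] at h1
  exact (mul_eq_zero.1 h1.symm).resolve_left hμ

theorem energy_eq (h : IsStarDomain Ω p α) (F : PolarFrame p) {f : Amb (m + 1) → ℝ} {μ : ℝ}
    (hf : IsSteklovEigenfunction Ω f μ) :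
    ∫ s in Icc (0:ℝ) 1, F.dirichletSlice Ω f f s =
      μ * ∫ u : Metric.sphere (0 : EuclideanSpace ℝ (Fin (m + 1))) 1,
        F.areaDensity Ω u * f (F.gpt Ω 1 u) ^ 2
          ∂(volume : Measure (EuclideanSpace ℝ (Fin (m + 1)))).toSphere := by
  rw [h.integral_dirichletSlice_eq F (by omega) hf.contDiffAt hf.contDiffAt hf.harmonic,
    h.fluxSlice_eq F hf]
  simp only [sq]

theorem gpt_eq_of_fr_eq_zero (h : IsStarDomain Ω p α) (F : PolarFrame p)
    {f : Amb (m + 1) → ℝ} (hf : ∀ x ∈ closure Ω, ContDiffAt ℝ ∞ f (x : Amb (m + 1)))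
    (u : Metric.sphere (0 : EuclideanSpace ℝ (Fin (m + 1))) 1)
    (h0 : ∀ s ∈ Ioo (0:ℝ) 1, F.fr Ω f s u = 0) {s : ℝ} (hs : s ∈ Icc (0:ℝ) 1) :
    f (F.gpt Ω s u) = f (F.gpt Ω 1 u) := by
  have hu := norm_eq_of_mem_sphere u
  have hd : ∀ t ∈ Icc (0:ℝ) 1,
      HasDerivAt (fun s => f (F.gpt Ω s u)) (F.rad Ω u * F.fr Ω f t u) t := fun t ht =>
    F.hasDerivAt_gpt Ω hu ((h.contDiffAt_gpt F hf hu ht.1 ht.2).differentiableAt (by simp))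
  rcases hs.2.eq_or_lt with rfl | hlt
  · rfl
  obtain ⟨c, hc, hc'⟩ := exists_hasDerivAt_eq_slope (fun s => f (F.gpt Ω s u))
    (fun t => F.rad Ω u * F.fr Ω f t u) hlt
    (fun t ht => (hd t ⟨hs.1.trans ht.1, ht.2⟩).continuousAt.continuousWithinAt)
    (fun t ht => hd t ⟨hs.1.trans ht.1.le, ht.2.le⟩)
  rw [h0 c ⟨hs.1.trans_lt hc.1, hc.2⟩, mul_zero, eq_comm, div_eq_zero_iff] at hc'
  rcases hc' with hc' | hc' <;> linarith

theorem exists_eq_gpt (h : IsStarDomain Ω p α) (F : PolarFrame p) {x : Sph (m + 1)}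
    (hx : x ∈ Ω) : ∃ u : Metric.sphere (0 : EuclideanSpace ℝ (Fin (m + 1))) 1,
      ∃ s ∈ Ico (0:ℝ) 1, (x : Amb (m + 1)) = F.gpt Ω s u := by
  have hc : Real.cos (Real.arccos (inner ℝ (p : Amb (m + 1)) x)) = inner ℝ (p : Amb (m + 1)) x :=
    Real.cos_arccos (neg_le_of_abs_le (abs_inner_le_one p x)) (le_of_abs_le (abs_inner_le_one p x))
  have ht0 := Real.arccos_nonneg (inner ℝ (p : Amb (m + 1)) x)
  have htpi := Real.arccos_le_pi (inner ℝ (p : Amb (m + 1)) x)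
  set t := Real.arccos (inner ℝ (p : Amb (m + 1)) x)
  obtain ⟨w, hw, hxw⟩ := exists_eq_expPt (by omega) p x hc.symm ht0 htpi
  have hw' := hw
  rw [F.unitTangent_eq] at hw'
  obtain ⟨u, hu, rfl⟩ := hw'
  have hu1 : ‖u‖ = 1 := by simpa using hu
  have hx' : x = expSph p hw t := Subtype.ext hxw
  have htp : t < Real.pi := by
    have := (mem_geodesicBall_iff (by positivity) (by linarith [Real.pi_pos])).1
      (h.subset_ball hx)
    rw [Real.cos_pi_div_two, ← hc] at this
    refine lt_of_le_of_ne htpi fun he => ?_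
    rw [he, Real.cos_pi] at this
    linarith
  have hR := h.rad_pos F (v := u) (fun h0 => by simp [h0] at hu1)
  have hlt : t < F.rad Ω u := by
    rw [F.rad_of_norm_eq_one Ω hu1]
    refine (expSph_mem_iff_lt_radius h.isOpen h.star hw ht0 htp).1 ?_
    rw [← hx']; exact hx
  refine ⟨⟨u, hu⟩, t / F.rad Ω u, ⟨by positivity, by rwa [div_lt_one hR]⟩, ?_⟩
  rw [PolarFrame.gpt, div_mul_cancel₀ _ hR.ne', F.pt_of_norm_eq_one hu1, hxw, expPt]

/-- If f vanished on ∂Ω its energy would be zero, so f would be constant along each ray, equal to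
its boundary value 0, and therefore zero in Ω. -/
theorem exists_boundaryValue_ne (h : IsStarDomain Ω p α) (F : PolarFrame p)
    {f : Amb (m + 1) → ℝ} {μ : ℝ} (hf : IsSteklovEigenfunction Ω f μ) :
    ∃ u : Metric.sphere (0 : EuclideanSpace ℝ (Fin (m + 1))) 1, f (F.gpt Ω 1 u) ≠ 0 := by
  by_contra! h0
  have hE := h.energy_eq F hf
  simp only [h0, ne_eq, OfNat.ofNat_ne_zero, not_false_eq_true, zero_pow, mul_zero,
    integral_zero] at hE
  have hpos : ∀ s ∈ Icc (0:ℝ) 1, ∀ u : Metric.sphere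
      (0 : EuclideanSpace ℝ (Fin (m + 1))) 1, 0 ≤ F.energyDensity Ω f s u := by
    intro s hs u
    have hu := norm_eq_of_mem_sphere u
    have h1 := h.mul_rad_lt_pi F hu hs.1 hs.2
    have h2 := Real.sin_nonneg_of_nonneg_of_le_pi h1.1 h1.2.le
    have h3 := h.rad_pos F (ne_zero_of_mem_unit_sphere u)
    exact mul_nonneg (mul_nonneg (pow_nonneg h2 _) h3.le) real_inner_self_nonneg
  have hs0 := eqOn_zero_of_setIntegral_Icc_nonpos zero_ne_one
    (continuousOn_integral_of_compact (h.continuousOn_energyDensity F hf.contDiffAt))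
    (fun s hs => integral_nonneg (hpos s hs)) hE.le
  have hd : ∀ s ∈ Icc (0:ℝ) 1, ∀ u : Metric.sphere
      (0 : EuclideanSpace ℝ (Fin (m + 1))) 1, F.energyDensity Ω f s u = 0 := fun s hs u =>
    eq_zero_of_integral_toSphere_nonpos (continuous_slice_of_continuousOn
      (h.continuousOn_energyDensity F hf.contDiffAt) hs) (hpos s hs) (hs0 s hs).le u
  obtain ⟨x, hx, hne⟩ := hf.exists_ne
  obtain ⟨u, s, hs, hxu⟩ := h.exists_eq_gpt F hx
  refine hne ?_
  rw [hxu, h.gpt_eq_of_fr_eq_zero F hf.contDiffAt u ?_ ⟨hs.1, hs.2.le⟩, h0]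
  intro t ht
  have hR := h.rad_pos F (ne_zero_of_mem_unit_sphere u)
  have hR' := h.mul_rad_lt_pi F (norm_eq_of_mem_sphere u) ht.1.le ht.2.le
  have hsin := Real.sin_pos_of_pos_of_lt_pi (mul_pos ht.1 hR) hR'.2
  have h4 := hd t ⟨ht.1.le, ht.2.le⟩ u
  rw [PolarFrame.energyDensity, mul_eq_zero, or_iff_right
    (mul_pos (pow_pos hsin m) hR).ne', inner_self_eq_zero] at h4
  rw [PolarFrame.fr, h4, inner_zero_left]

/-- An eigenfunction with nonzero eigenvalue changes sign on the boundary. -/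
theorem not_forall_boundaryValue_nonneg (h : IsStarDomain Ω p α) (F : PolarFrame p)
    {f : Amb (m + 1) → ℝ} {μ : ℝ} (hμ : μ ≠ 0) (hf : IsSteklovEigenfunction Ω f μ) {c : ℝ}
    (hc : c ≠ 0) : ¬ ∀ u : Metric.sphere (0 : EuclideanSpace ℝ (Fin (m + 1))) 1,
      0 ≤ c * f (F.gpt Ω 1 u) := by
  intro h0
  obtain ⟨u, hu⟩ := h.exists_boundaryValue_ne F hf
  have hi : ∫ u : Metric.sphere (0 : EuclideanSpace ℝ (Fin (m + 1))) 1,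
      F.areaDensity Ω u * (c * f (F.gpt Ω 1 u))
        ∂(volume : Measure (EuclideanSpace ℝ (Fin (m + 1)))).toSphere = 0 := by
    rw [← mul_zero c, ← h.integral_areaDensity_mul F hμ hf, ← integral_const_mul]
    congr 1; funext u; ring
  have := eq_zero_of_integral_toSphere_nonpos ((h.continuous_areaDensity F).mul
    (continuous_const.mul (h.continuous_boundaryValue F hf.contDiffAt)))
    (fun u => mul_nonneg (h.areaDensity_pos F u).le (h0 u)) hi.le u
  exact mul_ne_zero (h.areaDensity_pos F u).ne' (mul_ne_zero hc hu) this

theorem integral_areaDensity_mul_sq_pos (h : IsStarDomain Ω p α) (F : PolarFrame p)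
    {f : Amb (m + 1) → ℝ} {μ : ℝ} (hf : IsSteklovEigenfunction Ω f μ) :
    0 < ∫ u : Metric.sphere (0 : EuclideanSpace ℝ (Fin (m + 1))) 1,
        F.areaDensity Ω u * f (F.gpt Ω 1 u) ^ 2
          ∂(volume : Measure (EuclideanSpace ℝ (Fin (m + 1)))).toSphere := by
  by_contra! h0
  obtain ⟨u, hu⟩ := h.exists_boundaryValue_ne F hf
  have := eq_zero_of_integral_toSphere_nonpos ((h.continuous_areaDensity F).mul
    ((h.continuous_boundaryValue F hf.contDiffAt).pow 2))
    (fun u => mul_nonneg (h.areaDensity_pos F u).le (sq_nonneg _)) h0 u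
  exact mul_ne_zero (h.areaDensity_pos F u).ne' (pow_ne_zero 2 hu) this

/-- The boundary values have mean zero for the weight J but not for the measure du. Subtracting
their du-mean B / T adds the nonnegative term (B / T)² ∫ J to the weighted integral. Afterwards J
may be replaced by its upper bound, and the variance appears. -/
theorem integral_areaDensity_mul_sq_le (h : IsStarDomain Ω p α) (F : PolarFrame p)
    {f : Amb (m + 1) → ℝ} {μ : ℝ} (hμ : μ ≠ 0) (hf : IsSteklovEigenfunction Ω f μ) :
    (volume : Measure (EuclideanSpace ℝ (Fin (m + 1)))).toSphere.real univ *
      (∫ u : Metric.sphere (0 : EuclideanSpace ℝ (Fin (m + 1))) 1,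
        F.areaDensity Ω u * f (F.gpt Ω 1 u) ^ 2
          ∂(volume : Measure (EuclideanSpace ℝ (Fin (m + 1)))).toSphere) ≤
    (Real.cos α)⁻¹ * Real.sin (maxRadius Ω p) ^ m *
      ((volume : Measure (EuclideanSpace ℝ (Fin (m + 1)))).toSphere.real univ *
          (∫ u : Metric.sphere (0 : EuclideanSpace ℝ (Fin (m + 1))) 1, f (F.gpt Ω 1 u) ^ 2
            ∂(volume : Measure (EuclideanSpace ℝ (Fin (m + 1)))).toSphere) -
        (∫ u : Metric.sphere (0 : EuclideanSpace ℝ (Fin (m + 1))) 1, f (F.gpt Ω 1 u)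
            ∂(volume : Measure (EuclideanSpace ℝ (Fin (m + 1)))).toSphere) ^ 2) := by
  obtain ⟨u0⟩ := nonempty_sphere (n := m + 1) (by omega)
  have hT : 0 < (volume : Measure (EuclideanSpace ℝ (Fin (m + 1)))).toSphere.real univ :=
    ENNReal.toReal_pos (isOpen_univ.measure_pos _ ⟨u0, mem_univ _⟩).ne' (measure_ne_top _ _)
  have hmul := h.integral_areaDensity_mul F hμ hf
  have hc1 := h.continuous_areaDensity F
  have hc2 := h.continuous_boundaryValue F hf.contDiffAt
  set σ := (volume : Measure (EuclideanSpace ℝ (Fin (m + 1)))).toSphere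
  set M := (Real.cos α)⁻¹ * Real.sin (maxRadius Ω p) ^ m with hM
  set T := σ.real univ
  set A := ∫ u : Metric.sphere (0 : EuclideanSpace ℝ (Fin (m + 1))) 1, f (F.gpt Ω 1 u) ^ 2 ∂σ
    with hA
  set B := ∫ u : Metric.sphere (0 : EuclideanSpace ℝ (Fin (m + 1))) 1, f (F.gpt Ω 1 u) ∂σ
    with hB
  set W := ∫ u : Metric.sphere (0 : EuclideanSpace ℝ (Fin (m + 1))) 1,
    F.areaDensity Ω u * f (F.gpt Ω 1 u) ^ 2 ∂σ with hW
  have i0 : Integrable (fun u : Metric.sphere (0 : EuclideanSpace ℝ (Fin (m + 1))) 1 => F.areaDensity Ω u) σ :=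
    integrable_toSphere hc1
  have i1 : Integrable (fun u : Metric.sphere (0 : EuclideanSpace ℝ (Fin (m + 1))) 1 =>
      F.areaDensity Ω u * f (F.gpt Ω 1 u)) σ := integrable_toSphere (hc1.mul hc2)
  have i2 : Integrable (fun u : Metric.sphere (0 : EuclideanSpace ℝ (Fin (m + 1))) 1 =>
      F.areaDensity Ω u * f (F.gpt Ω 1 u) ^ 2) σ := integrable_toSphere (hc1.mul (hc2.pow 2))
  have i3 : Integrable (fun u : Metric.sphere (0 : EuclideanSpace ℝ (Fin (m + 1))) 1 => f (F.gpt Ω 1 u)) σ :=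
    integrable_toSphere hc2
  have i4 : Integrable (fun u : Metric.sphere (0 : EuclideanSpace ℝ (Fin (m + 1))) 1 =>
      f (F.gpt Ω 1 u) ^ 2) σ := integrable_toSphere (hc2.pow 2)
  have i5 : Integrable (fun u : Metric.sphere (0 : EuclideanSpace ℝ (Fin (m + 1))) 1 =>
      F.areaDensity Ω u * f (F.gpt Ω 1 u) ^ 2 -
        2 * (B / T) * (F.areaDensity Ω u * f (F.gpt Ω 1 u))) σ := i2.sub (i1.const_mul _)
  have i6 : Integrable (fun u : Metric.sphere (0 : EuclideanSpace ℝ (Fin (m + 1))) 1 =>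
      f (F.gpt Ω 1 u) ^ 2 - 2 * (B / T) * f (F.gpt Ω 1 u)) σ := i4.sub (i3.const_mul _)
  have hJ : 0 ≤ ∫ u : Metric.sphere (0 : EuclideanSpace ℝ (Fin (m + 1))) 1,
      F.areaDensity Ω u ∂σ := integral_nonneg fun u => (h.areaDensity_pos F u).le
  have e1 : ∫ u : Metric.sphere (0 : EuclideanSpace ℝ (Fin (m + 1))) 1,
      F.areaDensity Ω u * (f (F.gpt Ω 1 u) - B / T) ^ 2 ∂σ =
      W + (B / T) ^ 2 * ∫ u : Metric.sphere (0 : EuclideanSpace ℝ (Fin (m + 1))) 1,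
        F.areaDensity Ω u ∂σ := by
    have : ∀ u : Metric.sphere (0 : EuclideanSpace ℝ (Fin (m + 1))) 1,
        F.areaDensity Ω u * (f (F.gpt Ω 1 u) - B / T) ^ 2 =
        F.areaDensity Ω u * f (F.gpt Ω 1 u) ^ 2 -
          2 * (B / T) * (F.areaDensity Ω u * f (F.gpt Ω 1 u)) +
          (B / T) ^ 2 * F.areaDensity Ω u := fun u => by ring
    simp only [this]
    rw [integral_add i5 (i0.const_mul _), integral_sub i2 (i1.const_mul _),
      integral_const_mul, integral_const_mul, hmul]
    ring
  have e2 : ∫ u : Metric.sphere (0 : EuclideanSpace ℝ (Fin (m + 1))) 1,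
      M * (f (F.gpt Ω 1 u) - B / T) ^ 2 ∂σ = M * (A - B ^ 2 / T) := by
    have : ∀ u : Metric.sphere (0 : EuclideanSpace ℝ (Fin (m + 1))) 1,
        (f (F.gpt Ω 1 u) - B / T) ^ 2 =
        f (F.gpt Ω 1 u) ^ 2 - 2 * (B / T) * f (F.gpt Ω 1 u) + (B / T) ^ 2 := fun u => by ring
    simp only [this]
    rw [integral_const_mul, integral_add i6 (integrable_const _),
      integral_sub i4 (i3.const_mul _), integral_const_mul, integral_const, smul_eq_mul,
      ← hA, ← hB]
    congr 1
    field_simp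
    ring
  have e3 : ∫ u : Metric.sphere (0 : EuclideanSpace ℝ (Fin (m + 1))) 1,
      F.areaDensity Ω u * (f (F.gpt Ω 1 u) - B / T) ^ 2 ∂σ ≤
      ∫ u : Metric.sphere (0 : EuclideanSpace ℝ (Fin (m + 1))) 1,
        M * (f (F.gpt Ω 1 u) - B / T) ^ 2 ∂σ :=
    integral_mono (integrable_toSphere (hc1.mul ((hc2.sub continuous_const).pow 2)))
      (integrable_toSphere (continuous_const.mul ((hc2.sub continuous_const).pow 2)))
      fun u => mul_le_mul_of_nonneg_right (h.areaDensity_le F u) (sq_nonneg _)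
  rw [e1, e2] at e3
  have e4 : W ≤ M * (A - B ^ 2 / T) := by nlinarith [mul_nonneg (sq_nonneg (B / T)) hJ]
  calc T * W ≤ T * (M * (A - B ^ 2 / T)) := by gcongr
    _ = M * (T * A - B ^ 2) := by field_simp

/-- The estimate, with the first eigenvalue of the inscribed ball in closed form and with the
defect as remainder term. -/
theorem lowerBound_mul_add_le (h : IsStarDomain Ω p α) (F : PolarFrame p)
    {f : Amb (m + 1) → ℝ} {μ : ℝ} (hμ : μ ≠ 0) (hf : IsSteklovEigenfunction Ω f μ) {ε : ℝ}
    (hε : ε ∈ Ioo (0:ℝ) 1) :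
    lowerBound (m + 1) (minRadius Ω p) (maxRadius Ω p) (slope Ω p) α
        (ballEigenvalue m (minRadius Ω p)) *
      (∫ u : Metric.sphere (0 : EuclideanSpace ℝ (Fin (m + 1))) 1,
        F.areaDensity Ω u * f (F.gpt Ω 1 u) ^ 2
          ∂(volume : Measure (EuclideanSpace ℝ (Fin (m + 1)))).toSphere) +
      (∫ s in Icc ε 1, (∫ u : Metric.sphere (0 : EuclideanSpace ℝ (Fin (m + 1))) 1,
          F.defect Ω f s u ∂(volume : Measure (EuclideanSpace ℝ (Fin (m + 1)))).toSphere)) ≤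
    μ * (∫ u : Metric.sphere (0 : EuclideanSpace ℝ (Fin (m + 1))) 1,
        F.areaDensity Ω u * f (F.gpt Ω 1 u) ^ 2
          ∂(volume : Measure (EuclideanSpace ℝ (Fin (m + 1)))).toSphere) := by
  obtain ⟨u0⟩ := nonempty_sphere (n := m + 1) (by omega)
  obtain ⟨hRm, hRM, hR⟩ := h.extremal_radii F (by omega)
  have hle : minRadius Ω p ≤ maxRadius Ω p := (hR u0).1.trans (hR u0).2
  have hsl := slopeFactor_pos (h.le_slope F (by omega)).1
  have hT : 0 < (volume : Measure (EuclideanSpace ℝ (Fin (m + 1)))).toSphere.real univ :=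
    ENNReal.toReal_pos (isOpen_univ.measure_pos _ ⟨u0, mem_univ _⟩).ne' (measure_ne_top _ _)
  have h1 := h.spectral_gap_le_energy F hf.contDiffAt hε
  rw [h.energy_eq F hf] at h1
  have h2 := h.integral_areaDensity_mul_sq_le F hμ hf
  have hκ := ballEigenvalue_pos m hRm (hle.trans hRM)
  have hsm := sin_pos_of_le_pi_div_two hRm (hle.trans hRM)
  have hsM := sin_pos_of_le_pi_div_two (hRm.trans_le hle) hRM
  have hcos := (h.cos_pos_and_secant_le F (norm_eq_of_mem_sphere u0)).1
  have hq : lowerBound (m + 1) (minRadius Ω p) (maxRadius Ω p) (slope Ω p) α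
      (ballEigenvalue m (minRadius Ω p)) = minRadius Ω p / maxRadius Ω p *
        slopeFactor (slope Ω p) * (Real.sin (minRadius Ω p) ^ m /
          ((Real.cos α)⁻¹ * Real.sin (maxRadius Ω p) ^ m)) *
        ballEigenvalue m (minRadius Ω p) := rfl
  have hM : 0 < (Real.cos α)⁻¹ * Real.sin (maxRadius Ω p) ^ m :=
    mul_pos (inv_pos.2 hcos) (pow_pos hsM m)
  rw [hq]
  generalize (∫ u : Metric.sphere (0 : EuclideanSpace ℝ (Fin (m + 1))) 1,
        F.areaDensity Ω u * f (F.gpt Ω 1 u) ^ 2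
          ∂(volume : Measure (EuclideanSpace ℝ (Fin (m + 1)))).toSphere) = W at *
  generalize (∫ s in Icc ε 1, (∫ u : Metric.sphere (0 : EuclideanSpace ℝ (Fin (m + 1))) 1,
          F.defect Ω f s u ∂(volume : Measure (EuclideanSpace ℝ (Fin (m + 1)))).toSphere)) = D at *
  generalize (volume : Measure (EuclideanSpace ℝ (Fin (m + 1)))).toSphere.real univ *
          (∫ u : Metric.sphere (0 : EuclideanSpace ℝ (Fin (m + 1))) 1, f (F.gpt Ω 1 u) ^ 2
            ∂(volume : Measure (EuclideanSpace ℝ (Fin (m + 1)))).toSphere) -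
        (∫ u : Metric.sphere (0 : EuclideanSpace ℝ (Fin (m + 1))) 1, f (F.gpt Ω 1 u)
            ∂(volume : Measure (EuclideanSpace ℝ (Fin (m + 1)))).toSphere) ^ 2 = G at *
  generalize (volume : Measure (EuclideanSpace ℝ (Fin (m + 1)))).toSphere.real univ = T at *
  generalize (Real.cos α)⁻¹ * Real.sin (maxRadius Ω p) ^ m = M at *
  have hρ : 0 < minRadius Ω p / maxRadius Ω p := div_pos hRm (hRm.trans_le hle)
  generalize minRadius Ω p / maxRadius Ω p = ρ at *
  have hsp := pow_pos hsm m
  generalize Real.sin (minRadius Ω p) ^ m = S at *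
  generalize slopeFactor (slope Ω p) = q at *
  generalize ballEigenvalue m (minRadius Ω p) = κ at *
  -- The weighted boundary integral, divided by the bound M of the area density, is at most the
  -- variance that enters the spectral gap.
  have h3 : q * ρ * (κ * S * (T * W / M)) ≤ q * ρ * (κ * S * G) := by
    have : T * W / M ≤ G := by rw [div_le_iff₀ hM]; linarith
    gcongr
  have h4 : T * (ρ * q * (S / M) * κ * W + D) ≤ T * (μ * W) := by
    calc _ = q * ρ * (κ * S * (T * W / M)) + T * D := by ring
      _ ≤ _ := by linarith
  exact le_of_mul_le_mul_left h4 hT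

end IsStarDomain

end Steklov

end

noncomputable section

namespace Steklov

open MeasureTheory Set Filter Topology

/-! ### The equality case -/

theorem eq_or_eq_neg_of_norm_eq_one {u v : EuclideanSpace ℝ (Fin 1)} (hu : ‖u‖ = 1)
    (hv : ‖v‖ = 1) : u = v ∨ u = -v := by
  rw [EuclideanSpace.norm_eq, Fin.sum_univ_one, Real.sqrt_sq (norm_nonneg _),
    Real.norm_eq_abs] at hu hv
  rcases abs_eq_abs.1 (hu.trans hv.symm) with h | h
  · left; ext i; fin_cases i; exact h
  · right; ext i; fin_cases i; exact h

variable {m : ℕ} {Ω : Set (Sph (m + 1))} {p : Sph (m + 1)} {α : ℝ}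

namespace IsStarDomain

theorem exists_boundaryValue_mul_neg (h : IsStarDomain Ω p α) (F : PolarFrame p)
    {f : Amb (m + 1) → ℝ} {μ : ℝ} (hμ : μ ≠ 0) (hf : IsSteklovEigenfunction Ω f μ) :
    ∃ u v : Metric.sphere (0 : EuclideanSpace ℝ (Fin (m + 1))) 1,
      f (F.gpt Ω 1 u) * f (F.gpt Ω 1 v) < 0 := by
  obtain ⟨u, hu⟩ := h.exists_boundaryValue_ne F hf
  have := h.not_forall_boundaryValue_nonneg F hμ hf hu
  push Not at this
  exact ⟨u, this⟩

theorem defect_eq_zero (h : IsStarDomain Ω p α) (F : PolarFrame p) {f : Amb (m + 1) → ℝ}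
    (hf : ∀ x ∈ closure Ω, ContDiffAt ℝ ∞ f (x : Amb (m + 1)))
    (hD : ∀ ε ∈ Ioo (0:ℝ) 1, ∫ s in Icc ε 1,
      (∫ u : Metric.sphere (0 : EuclideanSpace ℝ (Fin (m + 1))) 1,
        F.defect Ω f s u ∂(volume : Measure (EuclideanSpace ℝ (Fin (m + 1)))).toSphere) ≤ 0)
    {s : ℝ} (hs : s ∈ Ioc (0:ℝ) 1)
    (u : Metric.sphere (0 : EuclideanSpace ℝ (Fin (m + 1))) 1) : F.defect Ω f s u = 0 := by
  have hε : s / 2 ∈ Ioo (0:ℝ) 1 := ⟨by linarith [hs.1], by linarith [hs.2]⟩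
  have hsε : s ∈ Icc (s / 2) 1 := ⟨by linarith [hs.1], hs.2⟩
  have hc := h.continuousOn_defect F hf hε.1
  have hnn : ∀ t ∈ Icc (s / 2) 1, ∀ u : Metric.sphere (0 : EuclideanSpace ℝ (Fin (m + 1))) 1,
      0 ≤ F.defect Ω f t u := fun t ht u =>
    h.defect_nonneg F hf u ⟨hε.1.trans_le ht.1, ht.2⟩
  have h0 := eqOn_zero_of_setIntegral_Icc_nonpos hε.2.ne (continuousOn_integral_of_compact hc)
    (fun t ht => integral_nonneg (hnn t ht)) (hD _ hε) s hsε
  exact eq_zero_of_integral_toSphere_nonpos (continuous_slice_of_continuousOn hc hsε)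
    (hnn s hsε) h0.le u

/-- Where the coefficient in the lower bound of the defect is positive, a function of vanishing
defect is constant along rays. -/
theorem fr_eq_zero_and_ftan_eq_zero (h : IsStarDomain Ω p α) (F : PolarFrame p)
    {f : Amb (m + 1) → ℝ} (hf : ∀ x ∈ closure Ω, ContDiffAt ℝ ∞ f (x : Amb (m + 1)))
    {s : ℝ} (hs : s ∈ Ioc (0:ℝ) 1)
    {u : Metric.sphere (0 : EuclideanSpace ℝ (Fin (m + 1))) 1} (hD : F.defect Ω f s u = 0)
    (hpos : 0 < Real.sin (s * F.rad Ω u) ^ m -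
      Real.sin (s * minRadius Ω p) ^ m * (F.rad Ω u / maxRadius Ω p)) :
    F.fr Ω f s u = 0 ∧ F.ftan Ω f s u = 0 := by
  have h1 := h.le_defect F hf u hs
  rw [hD] at h1
  have h2 := mul_pos (h.rad_pos F (ne_zero_of_mem_unit_sphere u)) hpos
  have h3 : F.fr Ω f s u ^ 2 + ‖F.ftan Ω f s u‖ ^ 2 ≤ 0 := by
    by_contra! h4
    exact absurd (mul_pos h4 h2) (not_lt.2 h1)
  have h5 : F.fr Ω f s u ^ 2 = 0 := by nlinarith [sq_nonneg (F.fr Ω f s u), sq_nonneg ‖F.ftan Ω f s u‖]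
  have h6 : ‖F.ftan Ω f s u‖ ^ 2 = 0 := by nlinarith [sq_nonneg ‖F.ftan Ω f s u‖]
  exact ⟨by simpa using h5, by simpa using h6⟩

/-- Where the coefficient in the lower bound of the defect is positive, the vanishing defect kills
∇f. If R_m < R_M this happens so often that f could not take boundary values of both signs. -/
theorem minRadius_eq_maxRadius (h : IsStarDomain Ω p α) (F : PolarFrame p)
    {f : Amb (m + 1) → ℝ} {μ : ℝ} (hμ : μ ≠ 0) (hf : IsSteklovEigenfunction Ω f μ)
    (hD : ∀ ε ∈ Ioo (0:ℝ) 1, ∫ s in Icc ε 1,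
      (∫ u : Metric.sphere (0 : EuclideanSpace ℝ (Fin (m + 1))) 1,
        F.defect Ω f s u ∂(volume : Measure (EuclideanSpace ℝ (Fin (m + 1)))).toSphere) ≤ 0) :
    minRadius Ω p = maxRadius Ω p := by
  obtain ⟨hRm, hRM, hR⟩ := h.extremal_radii F (by omega)
  obtain ⟨u1, u2, hneg⟩ := h.exists_boundaryValue_mul_neg F hμ hf
  have hpi := Real.pi_pos
  by_contra hne
  have hlt : minRadius Ω p < maxRadius Ω p := lt_of_le_of_ne ((hR u1).1.trans (hR u1).2) hne
  have hM0 := hRm.trans hlt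
  have hconst : ∀ u : Metric.sphere (0 : EuclideanSpace ℝ (Fin (m + 1))) 1,
      (∀ s ∈ Ioc (0:ℝ) 1, F.fr Ω f s u = 0) → f (F.gpt Ω 1 u) = f p := fun u hu => by
    rw [← h.gpt_eq_of_fr_eq_zero F hf.contDiffAt u (fun s hs => hu s ⟨hs.1, hs.2.le⟩)
      (s := 0) ⟨le_rfl, zero_le_one⟩]
    simp [PolarFrame.gpt, PolarFrame.pt, expPt]
  -- For m = 0 the powers of the sine are 1 and the coefficient is 1 − R / R_M, which is positive
  -- only in the direction with R < R_M. There ∇f = 0 at the boundary point, so f = 0 there by the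
  -- Steklov condition. The unit sphere of ℝ¹ has a single other point, which leaves no room for a
  -- change of sign.
  rcases Nat.eq_zero_or_pos m with rfl | hm
  · obtain ⟨u0, hu0⟩ : ∃ u : Metric.sphere (0 : EuclideanSpace ℝ (Fin (0 + 1))) 1,
        F.rad Ω u < maxRadius Ω p := by
      by_contra! hge
      refine hlt.not_ge ?_
      rw [minRadius, image_radius_eq F]
      refine le_csInf ⟨_, mem_range_self u1⟩ ?_
      rintro _ ⟨u, rfl⟩
      exact hge u
    have hpos : 0 < Real.sin (1 * F.rad Ω u0) ^ 0 -
        Real.sin (1 * minRadius Ω p) ^ 0 * (F.rad Ω u0 / maxRadius Ω p) := by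
      rw [pow_zero, pow_zero, one_mul, sub_pos, div_lt_one hM0]
      exact hu0
    have hs1 : (1:ℝ) ∈ Ioc (0:ℝ) 1 := ⟨zero_lt_one, le_rfl⟩
    obtain ⟨h1, h2⟩ := h.fr_eq_zero_and_ftan_eq_zero F hf.contDiffAt hs1
      (h.defect_eq_zero F hf.contDiffAt hD hs1 u0) hpos
    have h3 := h.flux_eq F hf u0
    rw [h1, h2, inner_zero_right, zero_div, sub_zero, eq_comm, mul_eq_zero,
      or_iff_right (by linarith [F.one_le_secant Ω u0]), mul_eq_zero, or_iff_right hμ] at h3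
    have hopp : ∀ u : Metric.sphere (0 : EuclideanSpace ℝ (Fin (0 + 1))) 1,
        f (F.gpt Ω 1 u) ≠ 0 → (u : EuclideanSpace ℝ (Fin (0 + 1))) = -u0 := fun u hu =>
      (eq_or_eq_neg_of_norm_eq_one (norm_eq_of_mem_sphere u)
        (norm_eq_of_mem_sphere u0)).resolve_left fun he => hu (by rw [he, h3])
    rw [hopp u1 (left_ne_zero_of_mul hneg.ne), hopp u2 (right_ne_zero_of_mul hneg.ne)] at hneg
    exact hneg.not_ge (mul_self_nonneg _)
  · have hfr : ∀ u : Metric.sphere (0 : EuclideanSpace ℝ (Fin (m + 1))) 1,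
        f (F.gpt Ω 1 u) = f p := fun u => hconst u fun s hs => by
      refine (h.fr_eq_zero_and_ftan_eq_zero F hf.contDiffAt hs
        (h.defect_eq_zero F hf.contDiffAt hD hs u) ?_).1
      obtain ⟨h1, h2⟩ := hR u
      have hs0 := hs.1
      have hs1 := hs.2
      have hb : s * F.rad Ω u ≤ Real.pi / 2 := by nlinarith
      have hsin0 : 0 < Real.sin (s * minRadius Ω p) :=
        Real.sin_pos_of_pos_of_lt_pi (by positivity) (by nlinarith)
      have hab : s * minRadius Ω p ≤ s * F.rad Ω u := by gcongr
      have hsin : Real.sin (s * minRadius Ω p) ≤ Real.sin (s * F.rad Ω u) :=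
        Real.sin_le_sin_of_le_of_le_pi_div_two (by nlinarith) hb hab
      have hp := pow_pos hsin0 m
      -- For m ≥ 1 the coefficient is positive in every direction: either R / R_M < 1, or R = R_M >
      -- R_m and the power of the sine is strictly larger. Hence f is constant along all rays and
      -- equals f(p) on ∂Ω.
      rcases h2.lt_or_eq with h2 | h2
      · have hq : F.rad Ω u / maxRadius Ω p < 1 := by rwa [div_lt_one hM0]
        have := pow_le_pow_left₀ hsin0.le hsin m
        nlinarith
      · have : Real.sin (s * minRadius Ω p) < Real.sin (s * F.rad Ω u) :=
          Real.sin_lt_sin_of_lt_of_le_pi_div_two (by nlinarith) hb (by rw [h2]; gcongr)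
        have := pow_lt_pow_left₀ this hsin0.le hm.ne'
        rw [h2, div_self hM0.ne', mul_one, sub_pos, ← h2]
        exact this
    rw [hfr, hfr] at hneg
    exact hneg.not_ge (mul_self_nonneg _)

theorem eq_geodesicBall (h : IsStarDomain Ω p α) (F : PolarFrame p)
    (he : minRadius Ω p = maxRadius Ω p) : Ω = geodesicBall p (minRadius Ω p) := by
  obtain ⟨hRm, hRM, hR⟩ := h.extremal_radii F (by omega)
  have hrad : ∀ u : Metric.sphere (0 : EuclideanSpace ℝ (Fin (m + 1))) 1,
      F.rad Ω u = minRadius Ω p := fun u => le_antisymm (he ▸ (hR u).2) (hR u).1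
  have hpi := Real.pi_pos
  rw [he] at hrad
  rw [he] at hRm ⊢
  ext x
  constructor
  · intro hx
    obtain ⟨u, s, hs, hxu⟩ := h.exists_eq_gpt F hx
    have hu := norm_eq_of_mem_sphere u
    have : x = expSph p (F.incl_mem_unitTangent hu) (s * maxRadius Ω p) := by
      apply Subtype.ext
      rw [hxu, PolarFrame.gpt, F.pt_of_norm_eq_one hu, hrad]
      rfl
    rw [this]
    exact expSph_mem_geodesicBall _ (mul_nonneg hs.1 hRm.le) (by nlinarith [hs.2])
      (by linarith)
  · intro hx
    have hx' : Real.arccos (inner ℝ (p : Amb (m + 1)) x) < maxRadius Ω p := by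
      rw [← angle_eq_arccos]; exact hx
    have ht0 := Real.arccos_nonneg (inner ℝ (p : Amb (m + 1)) x)
    have hc := Real.cos_arccos (neg_le_of_abs_le (abs_inner_le_one p x))
      (le_of_abs_le (abs_inner_le_one p x))
    obtain ⟨w, hw, hxw⟩ := exists_eq_expPt (by omega) p x hc.symm ht0 (Real.arccos_le_pi _)
    have : x = expSph p hw (Real.arccos (inner ℝ (p : Amb (m + 1)) x)) := Subtype.ext hxw
    rw [this]
    refine (expSph_mem_iff_lt_radius h.isOpen h.star hw ht0 (by linarith)).2 ?_
    have hw' := hw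
    rw [F.unitTangent_eq] at hw'
    obtain ⟨u, hu, rfl⟩ := hw'
    rw [← F.rad_of_norm_eq_one Ω (by simpa using hu), hrad ⟨u, hu⟩]
    exact hx'

theorem rad_eq_of_eq_geodesicBall (h : IsStarDomain Ω p α) (F : PolarFrame p) {r : ℝ}
    (hr : Ω = geodesicBall p r) {v : EuclideanSpace ℝ (Fin (m + 1))} (hv : v ≠ 0) :
    F.rad Ω v = r := by
  have hpi := Real.pi_pos
  have hn : 0 < ‖v‖ := norm_pos_iff.2 hv
  have hu : ‖‖v‖⁻¹ • v‖ = 1 := by rw [norm_smul, norm_inv, norm_norm, inv_mul_cancel₀ hn.ne']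
  have hw := F.incl_mem_unitTangent hu
  have hiff : ∀ t, 0 ≤ t → t < Real.pi → (t < r ↔ t < F.rad Ω v) := by
    intro t h0 h1
    rw [← F.rad_smul Ω (inv_pos.2 hn), F.rad_of_norm_eq_one Ω hu,
      ← expSph_mem_iff_lt_radius h.isOpen h.star hw h0 h1, hr]
    change _ ↔ InnerProductGeometry.angle _ _ < r
    rw [angle_eq_arccos]
    change _ ↔ Real.arccos (inner ℝ (p : Amb (m + 1)) (expPt p _ t)) < r
    rw [inner_expPt_left p hw, Real.arccos_cos h0 h1.le]
  have hR := h.rad_pos F hv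
  have hR' := h.rad_le F hv
  apply le_antisymm
  · by_contra! hlt
    -- The maximum with 0 covers a negative r, for which the ball would be empty.
    have h0 := (hiff (max r 0) (le_max_right _ _) (max_lt (by linarith) hpi)).2 (max_lt hlt hR)
    exact absurd h0 (not_lt.2 (le_max_left _ _))
  · by_contra! hlt
    exact lt_irrefl _ ((hiff _ hR.le (by linarith)).1 hlt)

theorem gradient_rad_eq_zero_of_eq_geodesicBall (h : IsStarDomain Ω p α) (F : PolarFrame p)
    {r : ℝ} (hr : Ω = geodesicBall p r) {v : EuclideanSpace ℝ (Fin (m + 1))} (hv : v ≠ 0) :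
    gradient (F.rad Ω) v = 0 := by
  have he : F.rad Ω =ᶠ[𝓝 v] fun _ => r := by
    filter_upwards [isOpen_ne.mem_nhds hv] with w hw
    exact h.rad_eq_of_eq_geodesicBall F hr hw
  have := (hasGradientAt_const v r).congr_of_eventuallyEq he
  exact this.gradient

theorem radii_eq_of_eq_geodesicBall (h : IsStarDomain Ω p α) (F : PolarFrame p) {r : ℝ}
    (hr : Ω = geodesicBall p r) : minRadius Ω p = r ∧ maxRadius Ω p = r := by
  have := nonempty_sphere (n := m + 1) (by omega)
  have himg : radius Ω p '' unitTangent p = {r} := by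
    rw [image_radius_eq F]
    simp only [h.rad_eq_of_eq_geodesicBall F hr (ne_zero_of_mem_unit_sphere _), range_const]
  rw [minRadius, maxRadius, himg, csInf_singleton, csSup_singleton]
  exact ⟨rfl, rfl⟩

theorem slope_eq_zero_of_eq_geodesicBall (h : IsStarDomain Ω p α) (F : PolarFrame p) {r : ℝ}
    (hr : Ω = geodesicBall p r) : slope Ω p = 0 := by
  refine le_antisymm (Real.sSup_nonpos ?_) (h.le_slope F (by omega)).1
  rintro _ ⟨w, hw, rfl⟩
  rw [F.unitTangent_eq] at hw
  obtain ⟨u, hu, rfl⟩ := hw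
  have hu0 := ne_zero_of_mem_unit_sphere
    (⟨u, hu⟩ : Metric.sphere (0 : EuclideanSpace ℝ (Fin (m + 1))) 1)
  beta_reduce
  rw [h.radiusGrad_eq F (by simpa using hu), h.gradient_rad_eq_zero_of_eq_geodesicBall F hr hu0]
  simp

theorem eq_zero_of_mem_normalAngles (h : IsStarDomain Ω p α) (F : PolarFrame p) {r : ℝ}
    (hr : Ω = geodesicBall p r) {θ : ℝ} (hθ : θ ∈ normalAngles Ω p) : θ = 0 := by
  obtain ⟨q, hq, ν, hν, rfl⟩ := hθ
  obtain ⟨hRm, hRM, hR⟩ := h.extremal_radii F (by omega)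
  obtain ⟨h1, h2⟩ := h.radii_eq_of_eq_geodesicBall F hr
  rw [h1] at hRm
  rw [h2] at hRM
  have hpi := Real.pi_pos
  have hq' : inner ℝ (p : Amb (m + 1)) q = Real.cos r := by
    rw [hr] at hq
    exact (mem_frontier_geodesicBall_iff (by omega) hRm hRM).1 hq
  obtain ⟨w, hw, hqw⟩ := exists_eq_expPt (by omega) p q hq' hRm.le (by linarith)
  have hw' := hw
  rw [F.unitTangent_eq] at hw'
  obtain ⟨u, hu, rfl⟩ := hw'
  have hu1 : ‖u‖ = 1 := by simpa using hu
  have hu0 : u ≠ 0 := fun h0 => by simp [h0] at hu1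
  have hrad := h.rad_eq_of_eq_geodesicBall F hr hu0
  have hgrad := h.gradient_rad_eq_zero_of_eq_geodesicBall F hr hu0
  have h3 := h.outwardNormal_eq F hu1 (q := q)
    (by rw [hqw, hrad, F.pt_of_norm_eq_one hu1, expPt]) hν
  rw [PolarFrame.secant, hgrad, smul_zero, map_zero, sub_zero, norm_zero, hrad] at h3
  norm_num at h3
  rw [hqw, radialField_expPt p hw hRm (by linarith), h3]
  refine InnerProductGeometry.angle_self fun h0 => ?_
  have := F.norm_dr hu1 r
  rw [h0, norm_zero] at this
  exact zero_ne_one this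

end IsStarDomain

theorem lowerBound_self {n : ℕ} {r : ℝ} (h0 : 0 < r) (h1 : r ≤ Real.pi / 2) (μ : ℝ) :
    lowerBound n r r 0 0 μ = μ := by
  have hs := (pow_pos (sin_pos_of_le_pi_div_two h0 h1) (n - 1)).ne'
  rw [lowerBound, Real.cos_zero, inv_one, one_mul, div_self hs, div_self h0.ne']
  norm_num

/-- All factors in front of the eigenvalue are nonnegative, so the eigenvalue of the inscribed ball
may be replaced by any larger number. -/
theorem lowerBound_le_lowerBound {n : ℕ} {r R a α μ κ : ℝ} (hr : 0 < r) (hrR : r ≤ R)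
    (hR : R ≤ Real.pi / 2) (ha : 0 ≤ a) (hα : 0 < Real.cos α) (hμ : μ ≤ κ) :
    lowerBound n r R a α μ ≤ lowerBound n r R a α κ := by
  have h1 := sin_pos_of_le_pi_div_two hr (hrR.trans hR)
  have h2 := sin_pos_of_le_pi_div_two (hr.trans_le hrR) hR
  have h3 := hr.trans_le hrR
  refine mul_le_mul_of_nonneg_left hμ (mul_nonneg (mul_nonneg (by positivity)
    (slopeFactor_pos ha).le) (by positivity))

end Steklov

end

/-! ### The estimate and its equality case -/

theorem theorem3p1 (n : ℕ) (hn : 1 ≤ n)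
    (Ω : Set (Steklov.Sph n)) (p : Steklov.Sph n)
    (hopen : IsOpen Ω) (hconn : IsConnected Ω)
    (hsmooth : Steklov.HasSmoothBoundary Ω)
    (hstar : Steklov.StarShapedAt Ω p)
    (hball : Ω ⊆ Steklov.geodesicBall p (Real.pi / 2))
    (α : ℝ) (hα : α < Real.pi / 2) (hθ : ∀ θ ∈ Steklov.normalAngles Ω p, θ ≤ α)
    (μΩ μB : ℝ) (hμΩ : Steklov.IsFirstSteklovEigenvalue Ω μΩ)
    (hμB : Steklov.IsFirstSteklovEigenvalue
      (Steklov.geodesicBall p (Steklov.minRadius Ω p)) μB) :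
    Steklov.lowerBound n (Steklov.minRadius Ω p) (Steklov.maxRadius Ω p)
        (Steklov.slope Ω p) α μB ≤ μΩ ∧
      (IsGreatest (Steklov.normalAngles Ω p) α →
        (μΩ = Steklov.lowerBound n (Steklov.minRadius Ω p) (Steklov.maxRadius Ω p)
            (Steklov.slope Ω p) α μB ↔
          ∃ r : ℝ, Ω = Steklov.geodesicBall p r)) := by
  obtain ⟨m, rfl⟩ : ∃ m, n = m + 1 := ⟨n - 1, by omega⟩
  obtain ⟨F⟩ := Steklov.exists_polarFrame p
  have h : Steklov.IsStarDomain Ω p α := ⟨hopen, hsmooth, hstar, hball, hα, hθ⟩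
  obtain ⟨u0⟩ := Steklov.IsStarDomain.nonempty_sphere (n := m + 1) hn
  obtain ⟨hRm, hRM, hR⟩ := h.extremal_radii F hn
  have hle : Steklov.minRadius Ω p ≤ Steklov.maxRadius Ω p := (hR u0).1.trans (hR u0).2
  have hcos := (h.cos_pos_and_secant_le F (norm_eq_of_mem_sphere u0)).1
  -- Since μB ≤ κ(R_m), it suffices to prove the bound with κ(R_m).
  have hκ := Steklov.lowerBound_le_lowerBound (n := m + 1) hRm hle hRM (h.le_slope F hn).1 hcos
    (Steklov.firstEigenvalue_geodesicBall_le hRm (hle.trans hRM) hμB)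
  have hμ0 : μΩ ≠ 0 := hμΩ.1.1
  obtain ⟨f, hf⟩ := hμΩ.1.2.exists_eigenfunction
  have hW := h.integral_areaDensity_mul_sq_pos F hf
  have hmain := fun (ε : ℝ) hε => h.lowerBound_mul_add_le F hμ0 hf (ε := ε) hε
  refine ⟨hκ.trans (le_of_mul_le_mul_right ?_ hW), fun hα' => ⟨fun heq => ?_, ?_⟩⟩
  · have h1 := hmain (1 / 2) ⟨by norm_num, by norm_num⟩
    refine le_trans (le_add_of_nonneg_right ?_) h1
    exact MeasureTheory.setIntegral_nonneg measurableSet_Icc fun s hs =>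
      MeasureTheory.integral_nonneg fun u =>
        h.defect_nonneg F hf.contDiffAt u ⟨lt_of_lt_of_le (by norm_num) hs.1, hs.2⟩
  · refine ⟨_, h.eq_geodesicBall F (h.minRadius_eq_maxRadius F hμ0 hf fun ε hε => ?_)⟩
    have h1 := hmain ε hε
    -- Equality puts μΩ below the bound with κ(R_m), so the remainder over every [ε, 1] is at most
    -- zero.
    have h2 := mul_le_mul_of_nonneg_right (heq.le.trans hκ) hW.le
    linarith
  · rintro ⟨r, hr⟩
    obtain ⟨h1, h2⟩ := h.radii_eq_of_eq_geodesicBall F hr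
    -- The inscribed ball is now Ω itself, so μB and μΩ are least elements of the same set. Since α
    -- is an attained angle, it is 0, and with a = 0 and equal radii every factor of the bound is 1.
    rw [h1, ← hr] at hμB
    rw [h1] at hRm
    rw [h2] at hRM
    rw [h1, h2, h.slope_eq_zero_of_eq_geodesicBall F hr,
      h.eq_zero_of_mem_normalAngles F hr hα'.1, Steklov.lowerBound_self hRm hRM]
    exact hμΩ.unique hμB
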